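/- Let $\mathbb T=\mathbb R/2\pi\mathbb Z$, $e_2=(0,1)$, and let $\gamma_0:\mathbb T\to\mathbb R$ be real analytic. Put $\rho_0(x)=+1$ for $x_2>\gamma_0(x_1)$ and $\rho_0(x)=-1$ for $x_2<\gamma_0(x_1)$. Consider macroscopic IPM on $\mathbb T\times\mathbb R$, $$\partial_t\rho+\operatorname{div}(\rho v+\rho^2e_2)=0,\qquad \operatorname{div}v=0,\qquad v=-\nabla p-\rho e_2,\qquad \rho|_{t=0}=\rho_0 .$$ A weak solution on $[0,T)$ is a pair $\rho\in L^\infty((0,T)\times\mathbb T\times\mathbb R)$, $v\in L^\infty(0,T;L^2(\mathbb T\times\mathbb R;\mathbb R^2))$ such that for all $\varphi\in C_c^\infty([0,T)\times\mathbb T\times\mathbb R)$ $$\int_0^T\!\!\int_{\mathbb T\times\mathbb R}\rho\,\partial_t\varphi+(\rho v+\rho^2e_2)\cdot\nabla\varphi\,dx\,dt+\int_{\mathbb T\times\mathbb R}\rho_0\varphi(0,\cdot)\,dx=0,$$ $$\int_0^T\!\!\int_{\mathbb T\times\mathbb R}v\cdot\nabla\varphi\,dx\,dt=0,\qquad \int_0^T\!\!\int_{\mathbb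 T\times\mathbb R}(v+\rho e_2)\cdot\nabla^\perp\varphi\,dx\,dt=0,$$ where $\nabla^\perp\varphi=(-\partial_2\varphi,\partial_1\varphi)$. Then there are $T>0$, a constant $C_0>0$ (both depending on $\gamma_0$) and a weak solution $(\rho,v)$ on $[0,T)$ with the following properties. (i) $\rho$ and $v$ are continuous on $[0,T)\times\mathbb T\times\mathbb R\setminus\{(0,x_1,\gamma_0(x_1)):x_1\in\mathbb T\}$. (ii) For $t\in(0,T)$ the function $\rho(t,\cdot)$ is Lipschitz continuous with $\|\nabla\rho(t,\cdot)\|_{L^\infty}\le C_0t^{-1}$, and $v(t,\cdot)$ is log-Lipschitz continuous with $$|v(t,x)-v(t,x')|\le C_0t^{-1}|x-x'|\bigl(1+\bigl|\log|x-x'|\bigr|\bigr)\quad\text{whenever }|x-x'|\le 1 .$$ (iii) There is a function $\gamma:[0,T)\times\mathbb T\times[-1,1]\to\mathbb R$, $(t,x_1,h)\mapsto\gamma_t(x_1,h)$, of class $C^1([0,T);C^1(\mathbb T\times[-1,1]))$, with $\gamma_t(\cdot,h)=\gamma_0$ at $t=0$ for every $h$, such that for every $t\in(0,T)$: each $\gamma_t(\cdot,h)$,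 $h\in[-1,1]$, is real analytic; $\rho(t,x)=1$ if $x_2\ge\gamma_t(x_1,1)$; $\rho(t,x)=-1$ if $x_2\le\gamma_t(x_1,-1)$; $\rho(t,x)\in(-1,1)$ for all other $x$; and for $h\in(-1,1)$ the level set $\{\rho(t,\cdot)=h\}$ is the graph $\{x_2=\gamma_t(x_1,h)\}$. Moreover there is a real analytic $s_0:\mathbb T\to\mathbb R$ with $$\gamma_t(x_1,h)=\gamma_0(x_1)+t\,(2h+s_0(x_1))+o(t)\quad\text{in }C^1(\mathbb T\times[-1,1])\text{ as }t\downarrow0,$$ and $s_0$ is the (not normalized) normal component of the initial velocity at the interface: $s_0(x_1)$ is the limit of $v(0,y)\cdot(-\gamma_0'(x_1),1)$ as $y\to(x_1,\gamma_0(x_1))$ off the interface, and $$s_0(x_1)=\mathrm{p.v.}\!\int_{\mathbb T}K\bigl(x_1-z_1,\gamma_0(x_1)-\gamma_0(z_1)\bigr)\,2\gamma_0'(z_1)\,dz_1\cdot\begin{pmatrix}-\gamma_0'(x_1)\\1\end{pmatrix},\qquad K(z)=\frac1{4\pi}\frac{(-\sinh z_2,\ \sin z_1)}{\cosh z_2-\cos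 z_1}.$$ (iv) For every Lipschitz continuous $\eta:\mathbb R\to\mathbb R$, with $Q(u)=\int_0^u2\eta'(s)s\,ds$, one has $\partial_t\eta(\rho)+\operatorname{div}(\eta(\rho)v+Q(\rho)e_2)=0$ with initial datum $\eta(\rho_0)$ in the sense of distributions, i.e. for all $\varphi\in C_c^\infty([0,T)\times\mathbb T\times\mathbb R)$ $$\int_0^T\!\!\int_{\mathbb T\times\mathbb R}\eta(\rho)\partial_t\varphi+(\eta(\rho)v+Q(\rho)e_2)\cdot\nabla\varphi\,dx\,dt+\int_{\mathbb T\times\mathbb R}\eta(\rho_0)\varphi(0,\cdot)\,dx=0 .$$ In particular $(\rho,v)$ is an entropy solution: for every convex $\eta:\mathbb R\to\mathbb R$ and every such $\varphi\ge0$ the left-hand side is $\ge0$. -/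

import Mathlib

open Real Set Filter Topology MeasureTheory
open scoped ContDiff ENNReal NNReal

noncomputable section

namespace MacroIPM

/- The flat torus of length `2π` is handled through its universal cover: a function on `𝕋` is a
`2π`-periodic function on `ℝ`, and a function on `𝕋 × ℝ` is a function on `ℝ × ℝ` that is
`2π`-periodic in the first variable.  Integrals over `𝕋 × ℝ` are taken over one period. -/

/-- `2π`-periodicity in the first variable. -/
def PeriodicFst {α : Type*} (f : ℝ × ℝ → α) : Prop :=
  ∀ x : ℝ × ℝ, f (x.1 + 2 * π, x.2) = f x

/-- One period of `𝕋 × ℝ`. -/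
def strip : Set (ℝ × ℝ) := Ioc (-π) π ×ˢ univ

/-- The Euclidean length of a vector of the plane (the built-in norm of `ℝ × ℝ` is the
maximum norm). -/
def euclLen (x : ℝ × ℝ) : ℝ := √(x.1 ^ 2 + x.2 ^ 2)

/-- The partial derivative in the first space variable. -/
def dx1 (f : ℝ × ℝ → ℝ) (x : ℝ × ℝ) : ℝ := deriv (fun s => f (s, x.2)) x.1

/-- The partial derivative in the second space variable. -/
def dx2 (f : ℝ × ℝ → ℝ) (x : ℝ × ℝ) : ℝ := deriv (fun s => f (x.1, s)) x.2

/-- The partial derivative in time. -/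
def dt (φ : ℝ → ℝ × ℝ → ℝ) (t : ℝ) (x : ℝ × ℝ) : ℝ := deriv (fun s => φ s x) t

/-- The two-phase initial density: `+1` above the interface and `-1` below it (the value on the
interface itself, a null set, plays no role). -/
def twoPhase (γ₀ : ℝ → ℝ) (x : ℝ × ℝ) : ℝ := if γ₀ x.1 < x.2 then 1 else -1

/-- Test functions `φ ∈ C_c^∞([0,T) × 𝕋 × ℝ)`, as restrictions to `t ≥ 0` of smooth functions. -/
structure IsTest (T : ℝ) (φ : ℝ → ℝ × ℝ → ℝ) : Prop where
  smooth : ContDiff ℝ ∞ (fun p : ℝ × ℝ × ℝ => φ p.1 p.2)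
  periodic : ∀ t, PeriodicFst (φ t)
  compactSupport : ∃ S < T, ∃ R : ℝ, ∀ t x, 0 ≤ t → φ t x ≠ 0 → t ≤ S ∧ |x.2| ≤ R

/-- Weak solutions on `[0,T)` of macroscopic IPM
`∂ₜρ + div (ρ v + ρ² e₂) = 0`, `div v = 0`, `v = -∇p - ρ e₂` on `𝕋 × ℝ` with initial density `ρ₀`.
The last equation, which eliminates the pressure, tests `v + ρ e₂` with
`∇^⊥ φ = (-∂₂φ, ∂₁φ)`. -/
structure IsWeakSolution (T : ℝ) (ρ₀ : ℝ × ℝ → ℝ) (ρ : ℝ → ℝ × ℝ → ℝ) (v : ℝ → ℝ × ℝ → ℝ × ℝ) :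
    Prop where
  periodic_density : ∀ t ∈ Ico 0 T, PeriodicFst (ρ t)
  periodic_velocity : ∀ t ∈ Ico 0 T, PeriodicFst (v t)
  density_mem : MemLp (fun p : ℝ × ℝ × ℝ => ρ p.1 p.2) ∞
    ((volume.restrict (Ioo 0 T)).prod (volume.restrict strip))
  velocity_measurable : AEStronglyMeasurable (fun p : ℝ × ℝ × ℝ => v p.1 p.2)
    ((volume.restrict (Ioo 0 T)).prod (volume.restrict strip))
  velocity_bound : ∃ M : ℝ≥0, ∀ᵐ t ∂(volume.restrict (Ioo 0 T)),
    eLpNorm (v t) 2 (volume.restrict strip) ≤ M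
  mass : ∀ φ, IsTest T φ →
    (∫ t in Ioo 0 T, ∫ x in strip,
      (ρ t x * dt φ t x + ρ t x * (v t x).1 * dx1 (φ t) x
        + (ρ t x * (v t x).2 + ρ t x ^ 2) * dx2 (φ t) x))
      + ∫ x in strip, ρ₀ x * φ 0 x = 0
  incompressible : ∀ φ, IsTest T φ →
    ∫ t in Ioo 0 T, ∫ x in strip, ((v t x).1 * dx1 (φ t) x + (v t x).2 * dx2 (φ t) x) = 0
  darcy : ∀ φ, IsTest T φ →
    ∫ t in Ioo 0 T, ∫ x in strip,
      ((v t x).1 * (-dx2 (φ t) x) + ((v t x).2 + ρ t x) * dx1 (φ t) x) = 0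

/-- The entropy flux `Q(u) = ∫₀ᵘ 2 η'(s) s ds` induced by `η`. -/
def entropyFlux (η : ℝ → ℝ) (u : ℝ) : ℝ := ∫ s in (0 : ℝ)..u, 2 * deriv η s * s

/-- The distribution `-(∂ₜ η(ρ) + div (η(ρ) v + Q(ρ) e₂))` with initial datum `η(ρ₀)`, evaluated
at a test function. -/
def entropyForm (T : ℝ) (ρ₀ : ℝ × ℝ → ℝ) (ρ : ℝ → ℝ × ℝ → ℝ) (v : ℝ → ℝ × ℝ → ℝ × ℝ)
    (η : ℝ → ℝ) (φ : ℝ → ℝ × ℝ → ℝ) : ℝ :=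
  (∫ t in Ioo 0 T, ∫ x in strip,
    (η (ρ t x) * dt φ t x + η (ρ t x) * (v t x).1 * dx1 (φ t) x
      + (η (ρ t x) * (v t x).2 + entropyFlux η (ρ t x)) * dx2 (φ t) x))
    + ∫ x in strip, η (ρ₀ x) * φ 0 x

/-- Entropy solutions: weak solutions with the entropy inequality for every convex entropy. -/
def IsEntropySolution (T : ℝ) (ρ₀ : ℝ × ℝ → ℝ) (ρ : ℝ → ℝ × ℝ → ℝ) (v : ℝ → ℝ × ℝ → ℝ × ℝ) :
    Prop :=
  IsWeakSolution T ρ₀ ρ v ∧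
    ∀ η : ℝ → ℝ, ConvexOn ℝ univ η → ∀ φ, IsTest T φ → (∀ t ∈ Ico 0 T, ∀ x, 0 ≤ φ t x) →
      0 ≤ entropyForm T ρ₀ ρ v η φ

/-- The universal cover of `𝕋 × [-1,1]`. -/
def slab : Set (ℝ × ℝ) := univ ×ˢ Icc (-1) 1

/-- Membership in `C¹(𝕋 × [-1,1])`. -/
def MemC1 (f : ℝ × ℝ → ℝ) : Prop :=
  ContDiffOn ℝ 1 f slab ∧ ∀ x ∈ slab, f (x.1 + 2 * π, x.2) = f x

/-- The norm of `C¹(𝕋 × [-1,1])`, as an extended nonnegative number. -/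
def c1Norm (f : ℝ × ℝ → ℝ) : ℝ≥0∞ := ⨆ x ∈ slab, ‖f x‖ₑ + ‖fderivWithin ℝ f slab x‖ₑ

/-- Membership in `C¹([0,T); C¹(𝕋 × [-1,1]))`: the curve `t ↦ γ t` has a continuous derivative
`t ↦ γ' t` on `[0,T)` (one-sided at `0`) with respect to the norm of `C¹(𝕋 × [-1,1])`. -/
def MemC1C1 (T : ℝ) (γ : ℝ → ℝ × ℝ → ℝ) : Prop :=
  ∃ γ' : ℝ → ℝ × ℝ → ℝ,
    (∀ t ∈ Ico 0 T, MemC1 (γ t) ∧ MemC1 (γ' t)) ∧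
    (∀ t ∈ Ico 0 T, Tendsto
      (fun s => c1Norm (fun x => (s - t)⁻¹ * (γ s x - γ t x) - γ' t x))
      (𝓝[Ico 0 T \ {t}] t) (𝓝 0)) ∧
    (∀ t ∈ Ico 0 T, Tendsto (fun s => c1Norm (fun x => γ' s x - γ' t x))
      (𝓝[Ico 0 T] t) (𝓝 0))

/-- The Biot-Savart kernel of `𝕋 × ℝ`. -/
def biotSavart (z : ℝ × ℝ) : ℝ × ℝ :=
  (-sinh z.2 / (4 * π * (cosh z.2 - cos z.1)), sin z.1 / (4 * π * (cosh z.2 - cos z.1)))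

/-- The vector `(-γ₀'(x₁), 1)` normal to the interface, paired with `w`. -/
def normalPart (γ₀ : ℝ → ℝ) (x₁ : ℝ) (w : ℝ × ℝ) : ℝ := -deriv γ₀ x₁ * w.1 + w.2

/-- The truncated Biot-Savart integral at the point `(x₁, γ₀(x₁))` of the interface for the vortex
sheet carried by the interface; its limit as `ε ↓ 0` is the principal value. -/
def truncatedSheetVelocity (γ₀ : ℝ → ℝ) (x₁ ε : ℝ) : ℝ × ℝ :=
  ∫ z in {z : ℝ | ε < |x₁ - z| ∧ |x₁ - z| < π},
    (2 * deriv γ₀ z) • biotSavart (x₁ - z, γ₀ x₁ - γ₀ z)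

end MacroIPM

end

open MacroIPM

open Real Set Filter Topology MeasureTheory Metric
open scoped ContDiff ENNReal NNReal

noncomputable section

namespace MacroIPM

/-- A function `g` of `(q, z, h)`, holomorphic in `z` and differentiable in `h`, with partial
derivatives `gz` and `gh`, all three jointly continuous on `U`. -/
structure Reg (U : Set (ℝ × ℂ × ℝ)) (g gz gh : ℝ → ℂ → ℝ → ℂ) : Prop where
  cont : ContinuousOn (fun p : ℝ × ℂ × ℝ => g p.1 p.2.1 p.2.2) U
  cont_z : ContinuousOn (fun p : ℝ × ℂ × ℝ => gz p.1 p.2.1 p.2.2) U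
  cont_h : ContinuousOn (fun p : ℝ × ℂ × ℝ => gh p.1 p.2.1 p.2.2) U
  dz : ∀ q z h, (q, z, h) ∈ U → HasDerivAt (fun w => g q w h) (gz q z h) z
  dh : ∀ q z h, (q, z, h) ∈ U → HasDerivAt (fun w => g q z w) (gh q z h) h

namespace Reg

variable {U : Set (ℝ × ℂ × ℝ)} {g gz gh f fz fh : ℝ → ℂ → ℝ → ℂ}

theorem add (hg : Reg U g gz gh) (hf : Reg U f fz fh) :
    Reg U (fun q z h => g q z h + f q z h) (fun q z h => gz q z h + fz q z h)
      (fun q z h => gh q z h + fh q z h) :=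
  ⟨hg.cont.add hf.cont, hg.cont_z.add hf.cont_z, hg.cont_h.add hf.cont_h,
    fun q z h hp => (hg.dz q z h hp).add (hf.dz q z h hp),
    fun q z h hp => (hg.dh q z h hp).add (hf.dh q z h hp)⟩

theorem sub (hg : Reg U g gz gh) (hf : Reg U f fz fh) :
    Reg U (fun q z h => g q z h - f q z h) (fun q z h => gz q z h - fz q z h)
      (fun q z h => gh q z h - fh q z h) :=
  ⟨hg.cont.sub hf.cont, hg.cont_z.sub hf.cont_z, hg.cont_h.sub hf.cont_h,
    fun q z h hp => (hg.dz q z h hp).sub (hf.dz q z h hp),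
    fun q z h hp => (hg.dh q z h hp).sub (hf.dh q z h hp)⟩

theorem mul (hg : Reg U g gz gh) (hf : Reg U f fz fh) :
    Reg U (fun q z h => g q z h * f q z h)
      (fun q z h => gz q z h * f q z h + g q z h * fz q z h)
      (fun q z h => gh q z h * f q z h + g q z h * fh q z h) :=
  ⟨hg.cont.mul hf.cont, (hg.cont_z.mul hf.cont).add (hg.cont.mul hf.cont_z),
    (hg.cont_h.mul hf.cont).add (hg.cont.mul hf.cont_h),
    fun q z h hp => (hg.dz q z h hp).mul (hf.dz q z h hp),
    fun q z h hp => (hg.dh q z h hp).mul (hf.dh q z h hp)⟩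

theorem smul_time (hg : Reg U g gz gh) {c : ℝ → ℂ} (hc : Continuous c) :
    Reg U (fun q z h => c q * g q z h) (fun q z h => c q * gz q z h)
      (fun q z h => c q * gh q z h) :=
  ⟨(hc.comp continuous_fst).continuousOn.mul hg.cont,
    (hc.comp continuous_fst).continuousOn.mul hg.cont_z,
    (hc.comp continuous_fst).continuousOn.mul hg.cont_h,
    fun q z h hp => (hg.dz q z h hp).const_mul _, fun q z h hp => (hg.dh q z h hp).const_mul _⟩

theorem comp (hg : Reg U g gz gh) {φ φ' : ℂ → ℂ} {O : Set ℂ}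
    (hφ : ∀ a ∈ O, HasDerivAt φ (φ' a) a) (hφ' : ContinuousOn φ' O)
    (hO : ∀ q z h, (q, z, h) ∈ U → g q z h ∈ O) :
    Reg U (fun q z h => φ (g q z h)) (fun q z h => φ' (g q z h) * gz q z h)
      (fun q z h => φ' (g q z h) * gh q z h) := by
  have hmaps : MapsTo (fun p : ℝ × ℂ × ℝ => g p.1 p.2.1 p.2.2) U O := fun p hp => hO _ _ _ hp
  have h1 : ContinuousOn φ O := fun a ha => (hφ a ha).continuousAt.continuousWithinAt
  refine ⟨h1.comp hg.cont hmaps, (hφ'.comp hg.cont hmaps).mul hg.cont_z,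
    (hφ'.comp hg.cont hmaps).mul hg.cont_h,
      fun q z h hp => ((hφ _ (hO _ _ _ hp)).comp z (hg.dz q z h hp)), fun q z h hp => ?_⟩
  · simpa [mul_comm, Function.comp_def] using (hφ _ (hO _ _ _ hp)).scomp h (hg.dh q z h hp)

/-- Freezing the last variable and translating the complex one. -/
theorem shift (hg : Reg U g gz gh) (y h' : ℝ)
    (hU : ∀ q z h, (q, z, h) ∈ U → (q, z - y, h') ∈ U) :
    Reg U (fun q z _ => g q (z - y) h') (fun q z _ => gz q (z - y) h') (fun _ _ _ => 0) := by
  have hmaps : MapsTo (fun p : ℝ × ℂ × ℝ => (p.1, p.2.1 - (y : ℂ), h')) U U :=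
    fun p hp => hU _ _ _ hp
  have hc : ContinuousOn (fun p => (p.1, p.2.1 - (y : ℂ), h')) U := by fun_prop
  refine ⟨hg.cont.comp hc hmaps, hg.cont_z.comp hc hmaps, continuousOn_const,
    fun q z h hp => ?_, fun q z h hp => hasDerivAt_const _ _⟩
  simpa [Function.comp_def] using (hg.dz q (z - y) h' (hU _ _ _ hp)).comp z
    ((hasDerivAt_id z).sub_const (y : ℂ))

theorem congr_derivs (hg : Reg U g gz gh) {gz' gh' : ℝ → ℂ → ℝ → ℂ}
    (h1 : ∀ q z h, gz q z h = gz' q z h) (h2 : ∀ q z h, gh q z h = gh' q z h) :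
    Reg U g gz' gh' := by
  have e1 : gz = gz' := by ext q z h; exact h1 q z h
  have e2 : gh = gh' := by ext q z h; exact h2 q z h
  rwa [← e1, ← e2]

theorem integral {α : Type*} [MeasurableSpace α] {μ : Measure α}
    {g gz gh : α → ℝ → ℂ → ℝ → ℂ} (hU : IsOpen U)
    (hreg : ∀ᵐ a ∂μ, Reg U (g a) (gz a) (gh a))
    (hm : ∀ p ∈ U, AEStronglyMeasurable (fun a => g a p.1 p.2.1 p.2.2) μ)
    (hmz : ∀ p ∈ U, AEStronglyMeasurable (fun a => gz a p.1 p.2.1 p.2.2) μ)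
    (hmh : ∀ p ∈ U, AEStronglyMeasurable (fun a => gh a p.1 p.2.1 p.2.2) μ)
    (hdom : ∀ p ∈ U, ∃ V ∈ 𝓝 p, ∃ B : α → ℝ, Integrable B μ ∧ ∀ᵐ a ∂μ, ∀ p' ∈ V,
      ‖g a p'.1 p'.2.1 p'.2.2‖ ≤ B a ∧ ‖gz a p'.1 p'.2.1 p'.2.2‖ ≤ B a ∧
      ‖gh a p'.1 p'.2.1 p'.2.2‖ ≤ B a) :
    Reg U (fun q z h => ∫ a, g a q z h ∂μ) (fun q z h => ∫ a, gz a q z h ∂μ)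
      (fun q z h => ∫ a, gh a q z h ∂μ) := by
  have hcont : ∀ k : α → ℝ → ℂ → ℝ → ℂ,
      (∀ p ∈ U, AEStronglyMeasurable (fun a => k a p.1 p.2.1 p.2.2) μ) →
      (∀ᵐ a ∂μ, ContinuousOn (fun p => k a p.1 p.2.1 p.2.2) U) →
      (∀ p ∈ U, ∃ V ∈ 𝓝 p, ∃ B : α → ℝ, Integrable B μ ∧ ∀ᵐ a ∂μ, ∀ p' ∈ V,
        ‖k a p'.1 p'.2.1 p'.2.2‖ ≤ B a) →
      ContinuousOn (fun p => ∫ a, k a p.1 p.2.1 p.2.2 ∂μ) U := by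
    intro k h1 h2 h3 p hp
    obtain ⟨V, hV, B, hB, hb⟩ := h3 p hp
    refine continuousWithinAt_of_dominated ?_ ?_ hB ?_
    · filter_upwards [self_mem_nhdsWithin] with p' hp' using h1 p' hp'
    · filter_upwards [mem_nhdsWithin_of_mem_nhds hV] with p' hp'
      filter_upwards [hb] with a ha using ha p' hp'
    · filter_upwards [h2] with a ha using ha p hp
  refine ⟨hcont g hm (hreg.mono fun a ha => ha.cont) ?_,
    hcont gz hmz (hreg.mono fun a ha => ha.cont_z) ?_,
    hcont gh hmh (hreg.mono fun a ha => ha.cont_h) ?_, ?_, ?_⟩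
  · intro p hp
    obtain ⟨V, hV, B, hB, hb⟩ := hdom p hp
    exact ⟨V, hV, B, hB, hb.mono fun a ha p' hp' => (ha p' hp').1⟩
  · intro p hp
    obtain ⟨V, hV, B, hB, hb⟩ := hdom p hp
    exact ⟨V, hV, B, hB, hb.mono fun a ha p' hp' => (ha p' hp').2.1⟩
  · intro p hp
    obtain ⟨V, hV, B, hB, hb⟩ := hdom p hp
    exact ⟨V, hV, B, hB, hb.mono fun a ha p' hp' => (ha p' hp').2.2⟩
  · intro q z h hp
    obtain ⟨V, hV, B, hB, hb⟩ := hdom _ hp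
    have hc : ContinuousAt (fun w => (q, w, h)) z := by fun_prop
    have hs :=
      hc.preimage_mem_nhds (inter_mem hV (hU.mem_nhds hp))
    refine (hasDerivAt_integral_of_dominated_loc_of_deriv_le
      (F' := fun w a => gz a q w h) hs ?_ ?_ (hmz _ hp) ?_ hB ?_).2
    · filter_upwards [hs] with w hw using hm _ hw.2
    · refine hB.mono' (hm _ hp) ?_
      filter_upwards [hb] with a ha using (ha _ (mem_of_mem_nhds hV)).1
    · filter_upwards [hb] with a ha w hw using (ha _ hw.1).2.1
    · filter_upwards [hreg] with a ha w hw using ha.dz _ _ _ hw.2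
  · intro q z h hp
    obtain ⟨V, hV, B, hB, hb⟩ := hdom _ hp
    have hc : ContinuousAt (fun w => (q, z, w)) h := by fun_prop
    have hs :=
      hc.preimage_mem_nhds (inter_mem hV (hU.mem_nhds hp))
    refine (hasDerivAt_integral_of_dominated_loc_of_deriv_le
      (F' := fun w a => gh a q z w) hs ?_ ?_ (hmh _ hp) ?_ hB ?_).2
    · filter_upwards [hs] with w hw using hm _ hw.2
    · refine hB.mono' (hm _ hp) ?_
      filter_upwards [hb] with a ha using (ha _ (mem_of_mem_nhds hV)).1
    · filter_upwards [hb] with a ha w hw using (ha _ hw.1).2.2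
    · filter_upwards [hreg] with a ha w hw using ha.dh _ _ _ hw.2

end Reg

theorem exists_box_subset {U : Set (ℝ × ℂ × ℝ)} (hU : IsOpen U) {q : ℝ} {z : ℂ} {h : ℝ}
    (hp : (q, z, h) ∈ U) : ∃ r > 0, ∀ q' z' h', |q' - q| ≤ r → ‖z' - z‖ ≤ r → |h' - h| ≤ r →
      (q', z', h') ∈ U := by
  obtain ⟨r, hr, hb⟩ := nhds_basis_closedBall.mem_iff.1 (hU.mem_nhds hp)
  refine ⟨r, hr, fun q' z' h' h1 h2 h3 => hb ?_⟩
  rw [mem_closedBall, Prod.dist_eq, Prod.dist_eq, dist_eq_norm z']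
  exact max_le h1 (max_le h2 h3)

theorem tendstoLocallyUniformlyOn_of_box {U : Set (ℝ × ℂ × ℝ)} {f : ℝ → ℂ → ℝ → ℂ}
    (hc : ContinuousOn (fun p : ℝ × ℂ × ℝ => f p.1 p.2.1 p.2.2) U) {q : ℝ} {z : ℂ} {h r : ℝ}
    (hr : 0 < r)
    (hbox : ∀ q' z' h', |q' - q| ≤ r → ‖z' - z‖ ≤ r → |h' - h| ≤ r → (q', z', h') ∈ U) :
    TendstoLocallyUniformlyOn (fun (m : ℝ × ℝ) w => f m.1 w m.2) (fun w => f q w h)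
      (𝓝 (q, h)) (Metric.ball z r) := by
  refine TendstoUniformlyOn.tendstoLocallyUniformlyOn ?_
  intro u hu
  have hk := isCompact_closedBall z r
  have hcc : ContinuousOn (Function.uncurry fun m w => f m.1 w m.2)
      (closedBall (q, h) r ×ˢ closedBall z r) := by
    have : ContinuousOn (fun p => (p.1.1, p.2, p.1.2))
      (closedBall (q, h) r ×ˢ closedBall z r) := by fun_prop
    refine hc.comp this ?_
    rintro ⟨⟨q', h'⟩, w⟩ ⟨h1, h2⟩
    simp only [mem_closedBall, Prod.dist_eq, dist_eq, max_le_iff] at h1 h2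
    rw [dist_eq_norm] at h2
    exact hbox _ _ _ h1.1 h2 h1.2
  obtain ⟨v, hv, hvu⟩ := hk.mem_uniformity_of_prod hcc (mem_closedBall_self hr.le)
    (symm_le_uniformity hu)
  rw [nhdsWithin_eq_nhds.2 (closedBall_mem_nhds _ hr)] at hv
  filter_upwards [hv] with m hm w hw using hvu m hm w (ball_subset_closedBall hw)

/-- The `z`-derivative of a jointly continuous function that is holomorphic in `z` is jointly
continuous. -/
theorem continuousOn_deriv_of_holomorphic {U : Set (ℝ × ℂ × ℝ)} (hU : IsOpen U)
    {f : ℝ → ℂ → ℝ → ℂ} (hc : ContinuousOn (fun p : ℝ × ℂ × ℝ => f p.1 p.2.1 p.2.2) U)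
    (hd : ∀ q z h, (q, z, h) ∈ U → DifferentiableAt ℂ (fun w => f q w h) z) :
    ContinuousOn (fun p : ℝ × ℂ × ℝ => deriv (fun w => f p.1 w p.2.2) p.2.1) U := by
  rintro ⟨q, z, h⟩ hp
  obtain ⟨r, hr, hbox⟩ := exists_box_subset hU hp
  refine ContinuousAt.continuousWithinAt ?_
  have hder := (tendstoLocallyUniformlyOn_of_box hc hr hbox).deriv (by
    filter_upwards [closedBall_mem_nhds (q, h) hr] with m hm w hw
    simp only [mem_closedBall, Prod.dist_eq, dist_eq, max_le_iff] at hm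
    exact (hd _ _ _
      (hbox _ _ _ hm.1 (by simpa [dist_eq_norm] using (mem_ball.1 hw).le)
      hm.2)).differentiableWithinAt)
    isOpen_ball
  have hdz : ContinuousWithinAt (deriv fun w => f q w h) (ball z r) z := by
    have hdo : DifferentiableOn ℂ (fun w => f q w h) (Metric.ball z r) := fun w hw =>
      (hd _ _ _
        (hbox _ _ _ (by simpa using hr.le) (by simpa [dist_eq_norm] using (mem_ball.1 hw).le)
        (by simpa using hr.le))).differentiableWithinAt
    exact (hdo.deriv isOpen_ball).continuousOn z (mem_ball_self hr)
  have key : Tendsto (fun p => deriv (fun w => f p.1 w p.2.2) p.2.1) (𝓝 (q, z, h))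
      (𝓝 (deriv (fun w => f q w h) z)) := by
    have := tendsto_comp_of_locally_uniform_limit_within (p := 𝓝 (q, z, h))
      (F := fun (p : ℝ × ℂ × ℝ) w => deriv (fun w => f p.1 w p.2.2) w) (g := fun p => p.2.1)
      hdz ?_ ?_
    · exact this
    · rw [nhdsWithin_eq_nhds.2 (ball_mem_nhds _ hr)]
      exact (continuous_fst.comp continuous_snd).tendsto (q, z, h)
    · intro u hu
      obtain ⟨t, ht, h2⟩ := hder u hu z (mem_ball_self hr)
      refine ⟨t, ht, ?_⟩
      have hT : Tendsto (fun p => (p.1, p.2.2)) (𝓝 (q, z, h)) (𝓝 (q, h)) := by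
        have : Continuous (fun p : ℝ × ℂ × ℝ => (p.1, p.2.2)) := by fun_prop
        exact this.tendsto _
      exact hT.eventually h2
  exact key

/-- The difference quotients in `h` converge locally uniformly in `z`. -/
theorem Reg.tendstoLocallyUniformlyOn_slope {U : Set (ℝ × ℂ × ℝ)}
    {g gz gh : ℝ → ℂ → ℝ → ℂ} (hg : Reg U g gz gh) {q : ℝ} {z : ℂ} {h r : ℝ} (hr : 0 < r)
    (hbox : ∀ q' z' h', |q' - q| ≤ r → ‖z' - z‖ ≤ r → |h' - h| ≤ r → (q', z', h') ∈ U) :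
    TendstoLocallyUniformlyOn (fun (ε : ℝ) w => ε⁻¹ • (g q w (h + ε) - g q w h))
      (fun w => gh q w h) (𝓝[≠] 0) (Metric.ball z r) := by
  refine TendstoUniformlyOn.tendstoLocallyUniformlyOn ?_
  rw [tendstoUniformlyOn_iff]
  intro ε hε
  have hcc : ContinuousOn (Function.uncurry fun m w => gh q w m)
      (closedBall h r ×ˢ closedBall z r) := by
    have : ContinuousOn (fun p => (q, p.2, p.1))
      (closedBall h r ×ˢ closedBall z r) := by fun_prop
    refine hg.cont_h.comp this ?_
    rintro ⟨h', w⟩ ⟨h1, h2⟩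
    simp only [mem_closedBall, dist_eq_norm] at h1 h2
    exact hbox _ _ _ (by simpa using hr.le) h2 h1
  obtain ⟨v, hv, hvu⟩ := (isCompact_closedBall z r).mem_uniformity_of_prod hcc
    (mem_closedBall_self hr.le) (dist_mem_uniformity (half_pos hε))
  rw [nhdsWithin_eq_nhds.2 (closedBall_mem_nhds _ hr)] at hv
  obtain ⟨d, hd, hdv⟩ := Metric.mem_nhds_iff.1 hv
  have hmem : Metric.ball (0 : ℝ) (min d r) ∈ 𝓝[≠] (0 : ℝ) :=
    mem_nhdsWithin_of_mem_nhds (ball_mem_nhds _ (lt_min hd hr))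
  filter_upwards [hmem, self_mem_nhdsWithin] with x hx hx0 w hw
  have hxa : |x| < min d r := by simpa using hx
  have hxne := hx0
  have hwr : ‖w - z‖ ≤ r := by simpa [dist_eq_norm] using (mem_ball.1 hw).le
  have hmv := (convex_uIcc h (h + x)).norm_image_sub_le_of_norm_hasDerivWithin_le
    (f := fun m => g q w m - m • gh q w h) (f' := fun m => gh q w m - gh q w h)
    (C := ε / 2) ?_ ?_ left_mem_uIcc right_mem_uIcc
  · rw [dist_comm, dist_eq_norm]
    have hx' : ‖(x : ℝ)‖ ≠ 0 := by simpa using hxne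
    have e1 : x⁻¹ • (g q w (h + x) - g q w h) - gh q w h
        = x⁻¹ • (g q w (h + x) - (h + x) • gh q w h - (g q w h - h • gh q w h)) := by
      have : g q w (h + x) - (h + x) • gh q w h - (g q w h - h • gh q w h)
        = (g q w (h + x) - g q w h) - x • gh q w h := by
        rw [add_smul]; abel
      rw [this, smul_sub _ (_ - _), smul_smul, inv_mul_cancel₀ hxne, one_smul]
    rw [e1, norm_smul, norm_inv]
    have : ‖(x : ℝ)‖⁻¹ * ‖g q w (h + x) - (h + x) • gh q w h - (g q w h - h • gh q w h)‖
        ≤ ‖(x : ℝ)‖⁻¹ * (ε / 2 * ‖h + x - h‖) := by gcongr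
    refine lt_of_le_of_lt this ?_
    rw [add_sub_cancel_left]
    field_simp
    linarith
  · intro m hm
    have hma : |m - h| ≤ |x| := by
      simpa using abs_sub_left_of_mem_uIcc hm
    have := hg.dh q w m (hbox _ _ _ (by simpa using hr.le) hwr
      (hma.trans (hxa.le.trans (min_le_right _ _))))
    exact (this.sub (by simpa using ((hasDerivAt_id m).smul_const (gh q w h)))).hasDerivWithinAt
  · intro m hm
    have hma : |m - h| ≤ |x| := by
      simpa using abs_sub_left_of_mem_uIcc hm
    have := hvu m (hdv (by simpa [dist_eq] using hma.trans_lt (hxa.trans_le (min_le_left _ _)))) w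
      (by simpa [dist_eq_norm] using hwr)
    rw [← dist_eq_norm]
    exact (le_of_lt this)

theorem Reg.differentiableAt_dh {U : Set (ℝ × ℂ × ℝ)} (hU : IsOpen U)
    {g gz gh : ℝ → ℂ → ℝ → ℂ} (hg : Reg U g gz gh) {q : ℝ} {z : ℂ} {h : ℝ}
    (hp : (q, z, h) ∈ U) : DifferentiableAt ℂ (fun w => gh q w h) z ∧
      HasDerivAt (fun m => gz q z m) (deriv (fun w => gh q w h) z) h := by
  obtain ⟨r, hr, hbox⟩ := exists_box_subset hU hp
  have hloc := hg.tendstoLocallyUniformlyOn_slope hr hbox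
  have hev : ∀ᶠ ε : ℝ in 𝓝[≠] 0, |ε| ≤ r := by
    refine mem_nhdsWithin_of_mem_nhds ?_
    filter_upwards [closedBall_mem_nhds 0 hr] with ε hε using by simpa using hε
  have hdq : ∀ᶠ ε : ℝ in 𝓝[≠] 0, ∀ w ∈ ball z r,
      HasDerivAt (fun w => ε⁻¹ • (g q w (h + ε) - g q w h))
        (ε⁻¹ • (gz q w (h + ε) - gz q w h)) w := by
    filter_upwards [hev] with ε hε w hw
    have hwr : ‖w - z‖ ≤ r := by simpa [dist_eq_norm] using (mem_ball.1 hw).le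
    exact HasDerivAt.fun_const_smul _
      ((hg.dz q w (h + ε) (hbox _ _ _ (by simpa using hr.le) hwr (by simpa using hε))).sub
      (hg.dz q w h (hbox _ _ _ (by simpa using hr.le) hwr (by simpa using hr.le))))
  have hdo : ∀ᶠ ε : ℝ in 𝓝[≠] 0, DifferentiableOn ℂ
      (fun w => ε⁻¹ • (g q w (h + ε) - g q w h)) (Metric.ball z r) :=
    hdq.mono fun ε hε w hw => (hε w hw).differentiableAt.differentiableWithinAt
  refine ⟨(hloc.differentiableOn hdo isOpen_ball).differentiableAt
    (ball_mem_nhds z hr), ?_⟩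
  rw [hasDerivAt_iff_tendsto_slope_zero]
  have := (hloc.deriv hdo isOpen_ball).tendsto_at (mem_ball_self hr)
  refine this.congr' ?_
  filter_upwards [hdq] with ε hε using (hε z (mem_ball_self hr)).deriv

/-- The `z`-derivative of a regular function is regular. -/
theorem Reg.deriv_z {U : Set (ℝ × ℂ × ℝ)} (hU : IsOpen U)
    {g gz gh : ℝ → ℂ → ℝ → ℂ} (hg : Reg U g gz gh) :
    Reg U gz (fun q z h => deriv (fun w => gz q w h) z)
      (fun q z h => deriv (fun w => gh q w h) z) := by
  have hdd : ∀ q z h, (q, z, h) ∈ U → DifferentiableAt ℂ (fun w => gz q w h) z := by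
    intro q z h hp
    obtain ⟨r, hr, hbox⟩ := exists_box_subset hU hp
    have hin : ∀ w ∈ Metric.ball z r, (q, w, h) ∈ U := fun w hw =>
      hbox _ _ _ (by simpa using hr.le) (by simpa [dist_eq_norm] using (mem_ball.1 hw).le)
        (by simpa using hr.le)
    have hdo : DifferentiableOn ℂ (fun w => g q w h) (Metric.ball z r) := fun w hw =>
      (hg.dz q w h (hin w hw)).differentiableAt.differentiableWithinAt
    have h1 := (hdo.deriv isOpen_ball).differentiableAt (ball_mem_nhds z hr)
    refine h1.congr_of_eventuallyEq ?_
    filter_upwards [ball_mem_nhds z hr] with w hw using (hg.dz q w h (hin w hw)).deriv.symm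
  refine ⟨hg.cont_z, continuousOn_deriv_of_holomorphic hU hg.cont_z hdd,
    continuousOn_deriv_of_holomorphic hU hg.cont_h fun q z h hp =>
      (hg.differentiableAt_dh hU hp).1, fun q z h hp => (hdd q z h hp).hasDerivAt,
    fun q z h hp => (hg.differentiableAt_dh hU hp).2⟩

/-- The denominator `cosh a - cos y` of the kernel, for complex `a`. -/
def kerDen (y : ℝ) (a : ℂ) : ℂ := Complex.cosh a - Complex.cos y

/-- The first component of `∇G`, where `G` is the Green function of `𝕋 × ℝ`. -/
def ker (y : ℝ) (a : ℂ) : ℂ := (((4 * π)⁻¹ : ℝ) : ℂ) * (Complex.sin y * (kerDen y a)⁻¹)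

/-- The derivative of `ker y`. -/
def kerD (y : ℝ) (a : ℂ) : ℂ :=
  (((4 * π)⁻¹ : ℝ) : ℂ) * (Complex.sin y * (-(Complex.sinh a) * (kerDen y a)⁻¹ ^ 2))

theorem hasDerivAt_kerDen (y : ℝ) (a : ℂ) : HasDerivAt (kerDen y) (Complex.sinh a) a :=
  (Complex.hasDerivAt_cosh a).sub_const _

theorem hasDerivAt_ker {y : ℝ} {a : ℂ} (ha : kerDen y a ≠ 0) :
    HasDerivAt (ker y) (kerD y a) a := by
  refine HasDerivAt.congr_deriv
    ((((hasDerivAt_kerDen y a).inv ha).const_mul (Complex.sin y)).const_mul (((4 * π)⁻¹ : ℝ) : ℂ))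
    ?_
  rw [kerD, inv_pow, ← div_eq_mul_inv]

theorem continuous_kerDen : Continuous fun p : ℝ × ℂ => kerDen p.1 p.2 := by
  unfold kerDen; fun_prop

theorem continuousOn_ker :
    ContinuousOn (fun p : ℝ × ℂ => ker p.1 p.2) {p | kerDen p.1 p.2 ≠ 0} := by
  refine continuousOn_const.mul
    (ContinuousOn.mul ?_
    ((continuous_kerDen.continuousOn (s := {p : ℝ × ℂ | kerDen p.1 p.2 ≠ 0})).inv₀ fun p hp => hp))
  fun_prop

theorem continuousOn_kerD :
    ContinuousOn (fun p : ℝ × ℂ => kerD p.1 p.2) {p | kerDen p.1 p.2 ≠ 0} := by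
  refine continuousOn_const.mul (ContinuousOn.mul ?_ (ContinuousOn.mul ?_
    (((continuous_kerDen.continuousOn (s := {p : ℝ × ℂ | kerDen p.1 p.2 ≠ 0})).inv₀ fun p hp =>
      hp).pow 2)))
  · fun_prop
  · fun_prop

theorem one_add_sq_div_two_le_cosh (x : ℝ) : 1 + x ^ 2 / 2 ≤ Real.cosh x := by
  have h1 : cosh x = 1 + 2 * sinh (x / 2) ^ 2 := by
    have := cosh_two_mul (x / 2)
    rw [mul_div_cancel₀ x two_ne_zero, cosh_sq] at this
    linarith
  have h2 : (x / 2) ^ 2 ≤ sinh (x / 2) ^ 2 := by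
    rw [sq_le_sq]
    rcases le_total 0 (x / 2) with h | h
    · rw [abs_of_nonneg h, abs_of_nonneg (sinh_nonneg_iff.2 h)]
      exact self_le_sinh_iff.2 h
    · rw [abs_of_nonpos h, abs_of_nonpos (sinh_nonpos_iff.2 h)]
      have := sinh_le_self_iff.2 h
      linarith
  rw [h1]; nlinarith

theorem cos_le_one_sub_sq_div_five {y : ℝ} (hy : |y| ≤ π) : Real.cos y ≤ 1 - y ^ 2 / 5 := by
  have h := cos_le_one_sub_mul_cos_sq hy
  have hpi : 1 / 5 ≤ 2 / π ^ 2 := by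
    rw [div_le_div_iff₀ (by norm_num) (by positivity)]
    nlinarith [pi_lt_d2, pi_pos]
  nlinarith

theorem kerDen_re_ge {y : ℝ} (hy : |y| ≤ π) {a : ℂ} (ha : |a.im| ≤ 1) :
    a.re ^ 2 / 4 + y ^ 2 / 5 - a.im ^ 2 / 2 ≤ (kerDen y a).re := by
  have hre : (kerDen y a).re = cosh a.re * cos a.im - cos y := by
    rw [kerDen, Complex.sub_re]
    congr 1
    · conv_lhs => rw [← Complex.re_add_im a]
      rw [Complex.cosh_add, Complex.cosh_mul_I, Complex.sinh_mul_I, ← Complex.ofReal_cosh,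
        ← Complex.ofReal_cos, ← Complex.ofReal_sinh, ← Complex.ofReal_sin]
      simp only [Complex.add_re, Complex.mul_re, Complex.ofReal_re, Complex.I_im]
      simp
  rw [hre]
  have h1 := one_add_sq_div_two_le_cosh a.re
  have h2 := @one_sub_sq_div_two_le_cos a.im
  have h3 := cos_le_one_sub_sq_div_five hy
  have h4 : a.im ^ 2 ≤ 1 := by
    rw [← sq_abs]; nlinarith [abs_nonneg a.im]
  nlinarith

theorem norm_sinh_le (a : ℂ) : ‖Complex.sinh a‖ ≤ Real.exp ‖a‖ * ‖a‖ := by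
  have h : ∀ x ∈ closedBall (0 : ℂ) ‖a‖, ‖Complex.cosh x‖ ≤ exp ‖a‖ := by
    intro x hx
    have hx' : ‖x‖ ≤ ‖a‖ := by simpa using hx
    have h1 : ‖Complex.exp x‖ ≤ exp ‖a‖ := by
      rw [Complex.norm_exp]; exact exp_le_exp.2 ((Complex.re_le_norm x).trans hx')
    have h2 : ‖Complex.exp (-x)‖ ≤ exp ‖a‖ := by
      rw [Complex.norm_exp]
      exact exp_le_exp.2 ((Complex.re_le_norm (-x)).trans (by simpa using hx'))
    rw [Complex.cosh, norm_div]
    have h3 := norm_add_le (Complex.exp x) (Complex.exp (-x))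
    have : ‖(2 : ℂ)‖ = 2 := by simp
    rw [this]; linarith
  have := (convex_closedBall (0 : ℂ) ‖a‖).norm_image_sub_le_of_norm_hasDerivWithin_le

    (fun x _ => (Complex.hasDerivAt_sinh x).hasDerivWithinAt) h
    (x := 0) (y := a) (by simp) (by simp)
  simpa using this

theorem norm_cosh_sub_le {a b : ℂ} {r : ℝ} (ha : ‖a‖ ≤ r) (hb : ‖b‖ ≤ r) :
    ‖Complex.cosh a - Complex.cosh b‖ ≤ Real.exp r * r * ‖a - b‖ := by
  refine (convex_closedBall (0 : ℂ) r).norm_image_sub_le_of_norm_hasDerivWithin_le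

    (fun x _ => (Complex.hasDerivAt_cosh x).hasDerivWithinAt) ?_
    (by simpa using hb) (by simpa using ha)
  intro x hx
  have hx' : ‖x‖ ≤ r := by simpa using hx
  refine (norm_sinh_le x).trans ?_
  gcongr

theorem norm_sinh_sub_le {a b : ℂ} {r : ℝ} (ha : ‖a‖ ≤ r) (hb : ‖b‖ ≤ r) :
    ‖Complex.sinh a - Complex.sinh b‖ ≤ Real.exp r * ‖a - b‖ := by
  refine (convex_closedBall (0 : ℂ) r).norm_image_sub_le_of_norm_hasDerivWithin_le

    (fun x _ => (Complex.hasDerivAt_sinh x).hasDerivWithinAt) ?_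
    (by simpa using hb) (by simpa using ha)
  intro x hx
  have hx' : ‖x‖ ≤ r := by simpa using hx
  have h1 : ‖Complex.exp x‖ ≤ exp r := by
    rw [Complex.norm_exp]; exact exp_le_exp.2 ((Complex.re_le_norm x).trans hx')
  have h2 : ‖Complex.exp (-x)‖ ≤ exp r := by
    rw [Complex.norm_exp]
    exact exp_le_exp.2 ((Complex.re_le_norm (-x)).trans (by simpa using hx'))
  rw [Complex.cosh, norm_div]
  have h3 := norm_add_le (Complex.exp x) (Complex.exp (-x))
  have : ‖(2 : ℂ)‖ = 2 := by simp
  rw [this]; linarith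

theorem norm_sin_ofReal_le (y : ℝ) : ‖Complex.sin y‖ ≤ |y| := by
  rw [← Complex.ofReal_sin, Complex.norm_real, norm_eq_abs]
  exact abs_sin_le_abs

theorem norm_inv_four_pi_le : ‖(((4 * π)⁻¹ : ℝ) : ℂ)‖ ≤ 1 := by
  rw [Complex.norm_real, norm_of_nonneg (by positivity)]
  exact inv_le_one_of_one_le₀ (by nlinarith [pi_gt_three])

/-- Size and Lipschitz bounds of the kernel and its derivative in terms of a length `D` that is
comparable to the distance from the singularity. -/
theorem exists_ker_bounds {c A R : ℝ} (hc : 0 < c) (hA : 0 ≤ A) :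
    ∃ K : ℝ, 0 < K ∧ ∀ (y D : ℝ) (a b : ℂ), |y| ≤ D → 0 < D → D ≤ R → ‖a‖ ≤ A * D → ‖b‖ ≤ A * D →
      c * D ^ 2 ≤ ‖kerDen y a‖ → c * D ^ 2 ≤ ‖kerDen y b‖ →
      ‖ker y a‖ ≤ K / D ∧ ‖kerD y a‖ ≤ K / D ^ 2 ∧ ‖ker y a - ker y b‖ ≤ K * ‖a - b‖ / D ^ 2 ∧
      ‖kerD y a - kerD y b‖ ≤ K * ‖a - b‖ / D ^ 3 := by
  set X := exp (A * R) with hX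
  refine ⟨c⁻¹ + c⁻¹ ^ 2 * (X * A) + c⁻¹ ^ 2 * X + 2 * c⁻¹ ^ 3 * (X * A) ^ 2, by positivity,
    fun y D a b hy hD hDR ha hb hEa hEb => ?_⟩
  have hcD : 0 < c * D ^ 2 := by positivity
  have hEa0 := norm_pos_iff.1 (hcD.trans_le hEa)
  have hEb0 := norm_pos_iff.1 (hcD.trans_le hEb)
  have hia : ‖(kerDen y a)⁻¹‖ ≤ c⁻¹ / D ^ 2 := by
    rw [norm_inv]
    calc _ ≤ (c * D ^ 2)⁻¹ := inv_anti₀ hcD hEa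
      _ = _ := by field_simp
  have hib : ‖(kerDen y b)⁻¹‖ ≤ c⁻¹ / D ^ 2 := by
    rw [norm_inv]
    calc _ ≤ (c * D ^ 2)⁻¹ := inv_anti₀ hcD hEb
      _ = _ := by field_simp
  have hexp : exp (A * D) ≤ X := exp_le_exp.2 (by gcongr)
  have hsinh : ∀ w : ℂ, ‖w‖ ≤ A * D → ‖Complex.sinh w‖ ≤ X * A * D := by
    intro w hw
    calc _ ≤ exp ‖w‖ * ‖w‖ := norm_sinh_le w
      _ ≤ exp (A * D) * (A * D) := by gcongr
      _ ≤ X * (A * D) := by gcongr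
      _ = _ := by ring
  have hcosh : ‖Complex.cosh a - Complex.cosh b‖ ≤ X * A * D * ‖a - b‖ := by
    calc _ ≤ exp (A * D) * (A * D) * ‖a - b‖ := norm_cosh_sub_le ha hb
      _ ≤ X * (A * D) * ‖a - b‖ := by gcongr
      _ = _ := by ring
  have hsd : ‖Complex.sinh a - Complex.sinh b‖ ≤ X * ‖a - b‖ := by
    calc _ ≤ exp (A * D) * ‖a - b‖ := norm_sinh_sub_le ha hb
      _ ≤ X * ‖a - b‖ := by gcongr
  have hid : ‖(kerDen y a)⁻¹ - (kerDen y b)⁻¹‖ ≤ c⁻¹ ^ 2 * (X * A) * ‖a - b‖ / D ^ 3 := by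
    have e : (kerDen y a)⁻¹ - (kerDen y b)⁻¹
        = -(Complex.cosh a - Complex.cosh b) * ((kerDen y a)⁻¹ * (kerDen y b)⁻¹) := by
      have : Complex.cosh a - Complex.cosh b = kerDen y a - kerDen y b := by simp [kerDen]
      rw [this]; field_simp; ring
    rw [e, norm_mul, norm_mul, norm_neg]
    calc _ ≤ X * A * D * ‖a - b‖ * (c⁻¹ / D ^ 2 * (c⁻¹ / D ^ 2)) := by gcongr
      _ = _ := by field_simp
  have hsy := (norm_sin_ofReal_le y).trans hy
  have hpi := norm_inv_four_pi_le
  have hred : ∀ w : ℂ, ‖(((4 * π)⁻¹ : ℝ) : ℂ) * (Complex.sin y * w)‖ ≤ D * ‖w‖ := by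
    intro w
    rw [norm_mul, norm_mul]
    calc _ ≤ 1 * (D * ‖w‖) := by gcongr
      _ = _ := one_mul _
  refine ⟨?_, ?_, ?_, ?_⟩
  · calc ‖ker y a‖ ≤ D * ‖(kerDen y a)⁻¹‖ := hred _
      _ ≤ D * (c⁻¹ / D ^ 2) := by gcongr
      _ = c⁻¹ / D := by field_simp
      _ ≤ _ := by
        gcongr
        have : 0 ≤ c⁻¹ ^ 2 * (X * A) + c⁻¹ ^ 2 * X + 2 * c⁻¹ ^ 3 * (X * A) ^ 2 := by positivity
        linarith
  · calc ‖kerD y a‖ ≤ D * ‖-(Complex.sinh a) * (kerDen y a)⁻¹ ^ 2‖ := hred _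
      _ = D * (‖Complex.sinh a‖ * ‖(kerDen y a)⁻¹‖ ^ 2) := by rw [norm_mul, norm_neg, norm_pow]
      _ ≤ D * (X * A * D * (c⁻¹ / D ^ 2) ^ 2) := by gcongr; exact hsinh a ha
      _ = c⁻¹ ^ 2 * (X * A) / D ^ 2 := by field_simp
      _ ≤ _ := by
        gcongr
        have : 0 ≤ c⁻¹ + c⁻¹ ^ 2 * X + 2 * c⁻¹ ^ 3 * (X * A) ^ 2 := by positivity
        linarith
  · have e : ker y a - ker y b
        = (((4 * π)⁻¹ : ℝ) : ℂ) * (Complex.sin y * ((kerDen y a)⁻¹ - (kerDen y b)⁻¹)) := by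
      simp only [ker]; ring
    rw [e]
    calc _ ≤ D * ‖(kerDen y a)⁻¹ - (kerDen y b)⁻¹‖ := hred _
      _ ≤ D * (c⁻¹ ^ 2 * (X * A) * ‖a - b‖ / D ^ 3) := by gcongr
      _ = c⁻¹ ^ 2 * (X * A) * ‖a - b‖ / D ^ 2 := by field_simp
      _ ≤ _ := by
        gcongr
        have : 0 ≤ c⁻¹ + c⁻¹ ^ 2 * X + 2 * c⁻¹ ^ 3 * (X * A) ^ 2 := by positivity
        linarith
  · have e : kerD y a - kerD y b = (((4 * π)⁻¹ : ℝ) : ℂ) * (Complex.sin y *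
        (-((Complex.sinh a - Complex.sinh b) * (kerDen y a)⁻¹ ^ 2 + Complex.sinh b *
          (((kerDen y a)⁻¹ - (kerDen y b)⁻¹) * ((kerDen y a)⁻¹ + (kerDen y b)⁻¹))))) := by
      simp only [kerD]; ring
    rw [e]
    calc _ ≤ D * ‖-((Complex.sinh a - Complex.sinh b) * (kerDen y a)⁻¹ ^ 2 + Complex.sinh b *
          (((kerDen y a)⁻¹ - (kerDen y b)⁻¹) * ((kerDen y a)⁻¹ + (kerDen y b)⁻¹)))‖ := hred _
      _ ≤ D * (‖Complex.sinh a - Complex.sinh b‖ * ‖(kerDen y a)⁻¹‖ ^ 2 + ‖Complex.sinh b‖ *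
          (‖(kerDen y a)⁻¹ - (kerDen y b)⁻¹‖ * (‖(kerDen y a)⁻¹‖ + ‖(kerDen y b)⁻¹‖))) := by
        rw [norm_neg]
        refine mul_le_mul_of_nonneg_left ((norm_add_le _ _).trans ?_) hD.le
        rw [norm_mul, norm_mul, norm_mul, norm_pow]
        gcongr
        exact norm_add_le _ _
      _ ≤ D * (X * ‖a - b‖ * (c⁻¹ / D ^ 2) ^ 2 + X * A * D *
          (c⁻¹ ^ 2 * (X * A) * ‖a - b‖ / D ^ 3 * (c⁻¹ / D ^ 2 + c⁻¹ / D ^ 2))) := by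
        gcongr; exact hsinh b hb
      _ = (c⁻¹ ^ 2 * X + 2 * c⁻¹ ^ 3 * (X * A) ^ 2) * ‖a - b‖ / D ^ 3 := by field_simp; ring
      _ ≤ _ := by
        gcongr
        have : 0 ≤ c⁻¹ + c⁻¹ ^ 2 * (X * A) := by positivity
        linarith

/-- The linearised integrand, in the form in which it occurs for both partial derivatives. -/
theorem norm_linearized_sub_le {k κ k' κ' a₁ α₁ b β b₁ β₁ : ℂ} {D m Λ ν K B d : ℝ} (hD : 0 < D)
    (hm : 0 ≤ m) (hν : 0 ≤ ν) (hK : 0 ≤ K) (hB : 0 ≤ B) (hd : d ≤ B * D * ν)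
    (hk : ‖k‖ ≤ K / D) (hκ' : ‖κ'‖ ≤ K / D ^ 2)
    (hkd : ‖k - κ‖ ≤ K * d / D ^ 2) (hkd₁ : ‖k' - κ'‖ ≤ K * d / D ^ 3)
    (ha₁ : ‖a₁‖ ≤ B * m) (hα₁ : ‖α₁‖ ≤ B * m) (hb : ‖b‖ ≤ B * D * Λ) (hβ₁ : ‖β₁‖ ≤ B * m * Λ)
    (hda : ‖a₁ - α₁‖ ≤ B * m * ν) (hdb : ‖b - β‖ ≤ B * D * Λ * ν)
    (hdb₁ : ‖b₁ - β₁‖ ≤ B * m * Λ * ν) :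
    ‖(k' * a₁ * b + k * b₁) - (κ' * α₁ * β + κ * β₁)‖
      ≤ (K * B + 3 * K * B ^ 2 + K * B ^ 3) * (m * Λ * ν / D) := by
  have e : (k' * a₁ * b + k * b₁) - (κ' * α₁ * β + κ * β₁)
      = k * (b₁ - β₁) + (k - κ) * β₁ + (k' - κ') * a₁ * b + κ' * (a₁ - α₁) * b
        + κ' * α₁ * (b - β) := by ring
  have hkd' : ‖k - κ‖ ≤ K * (B * D * ν) / D ^ 2 := hkd.trans (by gcongr)
  have hkd₂ : ‖k' - κ'‖ ≤ K * (B * D * ν) / D ^ 3 := hkd₁.trans (by gcongr)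
  rw [e]
  calc _ ≤ ‖k * (b₁ - β₁)‖ + ‖(k - κ) * β₁‖ + ‖(k' - κ') * a₁ * b‖ + ‖κ' * (a₁ - α₁) * b‖
        + ‖κ' * α₁ * (b - β)‖ := by
        exact (norm_add_le _ _).trans
          (add_le_add_left ((norm_add_le _ _).trans (add_le_add_left norm_add₃_le _)) _)
    _ ≤ K / D * (B * m * Λ * ν) + K * (B * D * ν) / D ^ 2 * (B * m * Λ)
        + K * (B * D * ν) / D ^ 3 * (B * m) * (B * D * Λ) + K / D ^ 2 * (B * m * ν) * (B * D * Λ)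
        + K / D ^ 2 * (B * m) * (B * D * Λ * ν) := by
        simp
        gcongr
    _ = _ := by field_simp; ring

theorem norm_linearized_le {k k' a₁ b b₁ : ℂ} {D m Λ K B : ℝ} (hD : 0 < D)
    (hm : 0 ≤ m) (hK : 0 ≤ K) (hB : 0 ≤ B)
    (hk : ‖k‖ ≤ K / D) (hk' : ‖k'‖ ≤ K / D ^ 2)
    (ha₁ : ‖a₁‖ ≤ B * m) (hb : ‖b‖ ≤ B * D * Λ) (hb₁ : ‖b₁‖ ≤ B * m * Λ) :
    ‖k' * a₁ * b + k * b₁‖ ≤ (K * B + K * B ^ 2) * (m * Λ / D) := by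
  calc _ ≤ ‖k' * a₁ * b‖ + ‖k * b₁‖ := norm_add_le _ _
    _ ≤ K / D ^ 2 * (B * m) * (B * D * Λ) + K / D * (B * m * Λ) := by
        simp; gcongr
    _ = _ := by field_simp; ring

/-- The denominator stays away from zero when `a` is close to a real affine expression. -/
theorem kerDen_ge_of_near {M y δ θ : ℝ} (hM : 0 ≤ M) (hy : |y| ≤ π) (hδ : |δ| ≤ 3) (hθ : |θ| ≤ M)
    {a : ℂ} (ha : ‖a - ((θ * y + 2 * δ : ℝ) : ℂ)‖ ≤ (8 * (1 + M))⁻¹ * (|y| + |δ|)) :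
    (32 * (1 + M) ^ 2)⁻¹ * (|y| + |δ|) ^ 2 ≤ ‖kerDen y a‖ ∧ ‖a‖ ≤ (M + 3) * (|y| + |δ|) := by
  set r := θ * y + 2 * δ with hr
  set D := |y| + |δ| with hD
  have hθy : |θ * y| ≤ M * |y| := by rw [abs_mul]; gcongr
  have hε : (8 * (1 + M))⁻¹ ≤ 1 / 8 := by
    rw [← one_div]; apply one_div_le_one_div_of_le <;> linarith
  have hD7 : D ≤ 7 := by linarith [pi_lt_d2]
  have hn : ‖a - (r : ℂ)‖ ≤ 1 / 8 * D := ha.trans (by gcongr)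
  have hre : |a.re - r| ≤ ‖a - (r : ℂ)‖ := by
    simpa using Complex.abs_re_le_norm (a - (r : ℂ))
  have him : |a.im| ≤ ‖a - (r : ℂ)‖ := by
    simpa using Complex.abs_im_le_norm (a - (r : ℂ))
  have hDr : D ≤ (1 + M) * (|y| + |r|) := by
    have : |2 * δ| ≤ |r| + |θ * y| := by
      have : 2 * δ = r - θ * y := by rw [hr]; ring
      rw [this]; exact abs_sub _ _
    rw [abs_mul, abs_two] at this
    nlinarith [abs_nonneg y, abs_nonneg r]
  constructor
  · have h1 := kerDen_re_ge hy (by linarith)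
    have h2 : (kerDen y a).re ≤ ‖kerDen y a‖ := Complex.re_le_norm _
    have hsq : D ^ 2 ≤ 2 * (1 + M) ^ 2 * (y ^ 2 + r ^ 2) := by
      calc D ^ 2 ≤ ((1 + M) * (|y| + |r|)) ^ 2 := by gcongr
        _ = (1 + M) ^ 2 * (|y| + |r|) ^ 2 := by ring
        _ ≤ (1 + M) ^ 2 * (2 * (|y| ^ 2 + |r| ^ 2)) := by
          gcongr; nlinarith [sq_nonneg (|y| - |r|)]
        _ = _ := by rw [sq_abs, sq_abs]; ring
    have e1 : ‖a - (r : ℂ)‖ ^ 2 ≤ ((8 * (1 + M))⁻¹ * D) ^ 2 := by gcongr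
    have e2 : a.im ^ 2 ≤ ‖a - (r : ℂ)‖ ^ 2 := by rw [← sq_abs]; gcongr
    have e3 : (a.re - r) ^ 2 ≤ ‖a - (r : ℂ)‖ ^ 2 := by rw [← sq_abs]; gcongr
    have e5 : ((8 * (1 + M))⁻¹ * D) ^ 2 = D ^ 2 / (1 + M) ^ 2 / 64 := by field_simp; ring
    have e6 : (32 * (1 + M) ^ 2)⁻¹ * D ^ 2 = D ^ 2 / (1 + M) ^ 2 / 32 := by field_simp
    have e7 : D ^ 2 / (1 + M) ^ 2 ≤ 2 * (y ^ 2 + r ^ 2) := by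
      rw [div_le_iff₀ (by positivity)]; linarith
    rw [e6]; rw [e5] at e1
    nlinarith
  · calc ‖a‖ ≤ ‖a - (r : ℂ)‖ + ‖(r : ℂ)‖ := by simpa using norm_add_le (a - (r : ℂ)) r
      _ ≤ 1 / 8 * D + |r| := by rw [Complex.norm_real, norm_eq_abs]; gcongr
      _ ≤ 1 / 8 * D + (M * |y| + 2 * |δ|) := by
        gcongr
        refine (abs_add_le _ _).trans ?_
        rw [abs_mul 2 δ, abs_two]; gcongr
      _ ≤ _ := by rw [hD]; nlinarith [abs_nonneg y, abs_nonneg δ]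

/-- The shrinking strips on which the evolution is solved; `q` is the square root of time. -/
def dom (σ η : ℝ) : Set (ℝ × ℂ × ℝ) := {p | 0 < p.1 ∧ |p.2.1.im| + p.1 / η < σ ∧ |p.2.2| < 2}

/-- The distance that is left to the boundary of the shrinking strip. -/
def wid (σ η q : ℝ) (z : ℂ) : ℝ := σ - |z.im| - q / η

theorem isOpen_dom (σ η : ℝ) : IsOpen (dom σ η) := by
  have h2 : IsOpen {p : ℝ × ℂ × ℝ | |p.2.1.im| + p.1 / η < σ} := by
    refine isOpen_lt ?_ continuous_const
    have : Continuous fun p : ℝ × ℂ × ℝ => p.2.1.im := by fun_prop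
    exact this.abs.add (continuous_fst.div_const _)
  have h3 : IsOpen {p : ℝ × ℂ × ℝ | |p.2.2| < 2} := isOpen_lt (by fun_prop) continuous_const
  exact (isOpen_lt continuous_const continuous_fst).inter (h2.inter h3)

theorem wid_pos {σ η q : ℝ} {z : ℂ} {h : ℝ} (hp : (q, z, h) ∈ dom σ η) : 0 < wid σ η q z := by
  have := hp.2.1; simp only [wid] at *; linarith

theorem wid_le_one {σ η q : ℝ} {z : ℂ} {h : ℝ} (hσ : σ ≤ 1) (hη : 0 < η)
    (hp : (q, z, h) ∈ dom σ η) : wid σ η q z ≤ 1 := by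
  have h1 := div_nonneg hp.1.le hη.le
  simp only [wid]; linarith [abs_nonneg z.im]

theorem dom_scale {σ η q : ℝ} {z : ℂ} {h l : ℝ} (hη : 0 < η) (hp : (q, z, h) ∈ dom σ η)
    (hl : l ∈ Ioo (0 : ℝ) 1) : (q * l, z, h) ∈ dom σ η ∧ wid σ η q z ≤ wid σ η (q * l) z := by
  have hq := hp.1
  have : q * l / η ≤ q / η := by gcongr; nlinarith [hl.2]
  refine ⟨⟨mul_pos hq hl.1, ?_, hp.2.2⟩, ?_⟩
  · have := hp.2.1; simp only at *; linarith
  · simp only [wid]; linarith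

theorem dom_le_one {σ η q : ℝ} {z : ℂ} {h : ℝ} (hσ : σ ≤ 1) (hη : 0 < η) (hη1 : η ≤ 1)
    (hp : (q, z, h) ∈ dom σ η) : q ≤ η ∧ q ≤ 1 := by
  have h1 := hp.2.1
  have h2 : q / η < 1 := by linarith [abs_nonneg z.im]
  rw [div_lt_one hη] at h2
  exact ⟨h2.le, h2.le.trans hη1⟩

theorem wid_shift {σ η q : ℝ} {z : ℂ} (y : ℝ) : wid σ η q (z - y) = wid σ η q z := by
  simp [wid]

theorem dom_shift {σ η q : ℝ} {z : ℂ} {h h' : ℝ} (y : ℝ) (hh' : |h'| < 2)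
    (hp : (q, z, h) ∈ dom σ η) : (q, z - y, h') ∈ dom σ η :=
  ⟨hp.1, by simpa using hp.2.1, hh'⟩

/-- A candidate for the velocity of the level sets, together with its derivatives. -/
structure Jet where
  val : ℝ → ℂ → ℝ → ℂ
  dz : ℝ → ℂ → ℝ → ℂ
  dh : ℝ → ℂ → ℝ → ℂ

/-- Closeness of jets in the weighted norm. -/
def JetClose (σ η ν : ℝ) (e e' : Jet) : Prop :=
  ∀ q z h, (q, z, h) ∈ dom σ η → ‖e.val q z h - e'.val q z h‖ ≤ ν ∧
    ‖e.dz q z h - e'.dz q z h‖ ≤ ν / √(wid σ η q z) ∧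
    ‖e.dh q z h - e'.dh q z h‖ ≤ ν * q ^ 2 / √(wid σ η q z)

/-- The jet of the leading part `4 q h` of the velocity. -/
def baseJet : Jet := ⟨fun q _ h => 4 * q * h, fun _ _ _ => 0, fun q _ _ => 4 * q⟩

theorem reg_baseJet (U : Set (ℝ × ℂ × ℝ)) : Reg U baseJet.val baseJet.dz baseJet.dh := by
  refine ⟨?_, ?_, ?_, fun q z h _ => hasDerivAt_const _ _, fun q z h _ => ?_⟩
  · simp only [baseJet]; fun_prop
  · simp only [baseJet]; fun_prop
  · simp only [baseJet]; fun_prop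
  · simpa [baseJet] using Complex.ofRealCLM.hasDerivAt.const_mul (4 * q : ℂ)

theorem JetClose.mono {σ η ν ν' : ℝ} {e e' : Jet} (h : JetClose σ η ν e e') (hν : ν ≤ ν') :
    JetClose σ η ν' e e' := by
  intro q z h' hp
  obtain ⟨h1, h2, h3⟩ := h q z h' hp
  exact ⟨h1.trans hν, h2.trans (by gcongr), h3.trans (by gcongr)⟩

theorem JetClose.trans {σ η ν ν' : ℝ} {e e' e'' : Jet} (h : JetClose σ η ν e e')
    (h' : JetClose σ η ν' e' e'') : JetClose σ η (ν + ν') e e'' := by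
  intro q z m hp
  obtain ⟨h1, h2, h3⟩ := h q z m hp
  obtain ⟨k1, k2, k3⟩ := h' q z m hp
  refine ⟨(norm_sub_le_norm_sub_add_norm_sub _ _ _).trans (add_le_add h1 k1), ?_, ?_⟩
  · rw [add_div]; exact (norm_sub_le_norm_sub_add_norm_sub _ _ _).trans (add_le_add h2 k2)
  · rw [add_mul, add_div]
    exact (norm_sub_le_norm_sub_add_norm_sub _ _ _).trans (add_le_add h3 k3)

theorem norm_deriv_le_of_weighted {σ η q h c : ℝ} {z : ℂ} (hp : (q, z, h) ∈ dom σ η)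
    (hc : 0 ≤ c) {f : ℂ → ℂ}
    (hf : ∀ w, (q, w, h) ∈ dom σ η → DifferentiableAt ℂ f w ∧ ‖f w‖ ≤ c / √(wid σ η q w)) :
    ‖deriv f z‖ ≤ 3 * c / (wid σ η q z * √(wid σ η q z)) := by
  set s := wid σ η q z with hs
  have hs0 := wid_pos hp
  have hin : ∀ w, ‖w - z‖ ≤ s / 2 → (q, w, h) ∈ dom σ η ∧ s / 2 ≤ wid σ η q w := by
    intro w hw
    have h1 : |w.im| ≤ |z.im| + s / 2 := by
      have := (Complex.abs_im_le_norm (w - z)).trans hw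
      rw [Complex.sub_im] at this
      have h2 := abs_sub_abs_le_abs_sub w.im z.im
      linarith
    have h2 : s / 2 ≤ wid σ η q w := by simp only [wid] at *; linarith
    refine ⟨⟨hp.1, ?_, hp.2.2⟩, h2⟩
    simp only [wid] at *; linarith
  have hmem : ∀ w ∈ Metric.closedBall z (s / 2), ‖w - z‖ ≤ s / 2 := fun w hw => by
    simpa [dist_eq_norm] using hw
  have hdc : DiffContOnCl ℂ f (ball z (s / 2)) := by
    refine DifferentiableOn.diffContOnCl fun w hw => ?_
    rw [closure_ball _ (by positivity)] at hw
    exact (hf w (hin w (hmem w hw)).1).1.differentiableWithinAt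
  have := Complex.norm_deriv_le_of_forall_mem_sphere_norm_le (C := c / √(s / 2))
    (by positivity : 0 < s / 2) hdc
    (fun w hw => by
      have h1 := hin w (hmem w (sphere_subset_closedBall hw))
      refine (hf w h1.1).2.trans ?_
      gcongr
      exact h1.2)
  refine this.trans ?_
  have h2 := sqrt_div hs0.le 2
  have h3 : √2 ≤ 3 / 2 := by rw [sqrt_le_left (by norm_num)]; norm_num
  have h4 := sqrt_pos.2 hs0
  have e1 : c / (√s / √2) / (s / 2) = √2 * (2 * c) / (s * √s) := by field_simp
  rw [h2, e1]
  exact div_le_div_of_nonneg_right (by nlinarith) (by positivity)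

/-- The average over the past of a function of time. -/
def avg (g : ℝ → ℂ → ℝ → ℂ) (q : ℝ) (z : ℂ) (h : ℝ) : ℂ := ∫ l in Ioo (0 : ℝ) 1, g (q * l) z h

theorem aestronglyMeasurable_avg {σ η : ℝ} (hη : 0 < η) {g : ℝ → ℂ → ℝ → ℂ}
    (hg : ContinuousOn (fun p : ℝ × ℂ × ℝ => g p.1 p.2.1 p.2.2) (dom σ η))
    {q h : ℝ} {z : ℂ} (hp : (q, z, h) ∈ dom σ η) :
    AEStronglyMeasurable (fun l => g (q * l) z h) (volume.restrict (Ioo (0 : ℝ) 1)) := by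
  refine ContinuousOn.aestronglyMeasurable ?_ measurableSet_Ioo
  have hc : ContinuousOn (fun l => (q * l, z, h)) (Ioo 0 1) := by fun_prop
  exact hg.comp hc fun l hl => (dom_scale hη hp hl).1

theorem integrable_avg {σ η C : ℝ} (hη : 0 < η) {g : ℝ → ℂ → ℝ → ℂ}
    (hg : ContinuousOn (fun p : ℝ × ℂ × ℝ => g p.1 p.2.1 p.2.2) (dom σ η))
    (hC : ∀ q z h, (q, z, h) ∈ dom σ η → ‖g q z h‖ ≤ C / wid σ η q z ^ 2)
    {q h : ℝ} {z : ℂ} (hp : (q, z, h) ∈ dom σ η) :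
    Integrable (fun l => g (q * l) z h) (volume.restrict (Ioo (0 : ℝ) 1)) := by
  have hs := wid_pos hp
  have hC0 : 0 ≤ C := by
    have := (norm_nonneg _).trans (hC q z h hp)
    rwa [le_div_iff₀ (by positivity), zero_mul] at this
  refine (integrable_const (C / wid σ η q z ^ 2)).mono' (aestronglyMeasurable_avg hη hg hp) ?_
  rw [ae_restrict_iff' measurableSet_Ioo]
  refine ae_of_all _ fun l hl => ?_
  have h1 := dom_scale hη hp hl
  refine (hC _ _ _ h1.1).trans ?_
  gcongr
  exact h1.2

theorem Reg.avg {σ η C : ℝ} (hη : 0 < η) {g gz gh : ℝ → ℂ → ℝ → ℂ}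
    (hg : Reg (dom σ η) g gz gh)
    (hC : ∀ q z h, (q, z, h) ∈ dom σ η → ‖g q z h‖ ≤ C / wid σ η q z ^ 2)
    (hCz : ∀ q z h, (q, z, h) ∈ dom σ η → ‖gz q z h‖ ≤ C / wid σ η q z ^ 2)
    (hCh : ∀ q z h, (q, z, h) ∈ dom σ η → ‖gh q z h‖ ≤ C / wid σ η q z ^ 2) :
    Reg (dom σ η) (avg g) (avg gz) (avg gh) := by
  have hsc : ∀ l ∈ Ioo (0 : ℝ) 1, MapsTo (fun p : ℝ × ℂ × ℝ => (p.1 * l, p.2.1, p.2.2))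
      (dom σ η) (dom σ η) := fun l hl p hp => (dom_scale hη hp hl).1
  have hcs : ∀ l : ℝ, ContinuousOn (fun p : ℝ × ℂ × ℝ => (p.1 * l, p.2.1, p.2.2)) (dom σ η) :=
    fun l => by fun_prop
  refine Reg.integral
    (isOpen_dom σ η) ?_
    (fun p hp => aestronglyMeasurable_avg hη hg.cont hp)
    (fun p hp => aestronglyMeasurable_avg hη hg.cont_z hp)
    (fun p hp => aestronglyMeasurable_avg hη hg.cont_h hp) ?_
  · rw [ae_restrict_iff' measurableSet_Ioo]
    refine ae_of_all _ fun l hl => ⟨hg.cont.comp (hcs l) (hsc l hl),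
      hg.cont_z.comp (hcs l) (hsc l hl), hg.cont_h.comp (hcs l) (hsc l hl),
        (fun q z h hp => hg.dz _ _ _ (dom_scale hη hp hl).1),
        (fun q z h hp => hg.dh _ _ _ (dom_scale hη hp hl).1)⟩
  · rintro ⟨q, z, h⟩ hp
    have hs := wid_pos hp
    have hC0 : 0 ≤ C := by
      have := (norm_nonneg _).trans (hC q z h hp)
      rwa [le_div_iff₀ (by positivity), zero_mul] at this
    have hcw : Continuous fun p : ℝ × ℂ × ℝ => wid σ η p.1 p.2.1 := by
      have : Continuous fun p : ℝ × ℂ × ℝ => p.2.1.im := by fun_prop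
      exact (continuous_const.sub this.abs).sub (continuous_fst.div_const _)
    have hV : {p : ℝ × ℂ × ℝ | wid σ η q z / 2 < wid σ η p.1 p.2.1} ∈ 𝓝 (q, z, h) :=
      (isOpen_lt continuous_const hcw).mem_nhds (by simpa using hs)
    refine ⟨_, inter_mem hV ((isOpen_dom σ η).mem_nhds hp), fun _ => C / (wid σ η q z / 2) ^ 2,
      integrable_const _, ?_⟩
    rw [ae_restrict_iff' measurableSet_Ioo]
    refine ae_of_all _ fun l hl p hp => ?_
    have h1 := dom_scale hη hp.2 hl
    have h2 := (le_of_lt hp.1).trans h1.2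
    have h3 : C / wid σ η (p.1 * l) p.2.1 ^ 2 ≤ C / (wid σ η q z / 2) ^ 2 := by gcongr
    exact ⟨(hC _ _ _ h1.1).trans h3, (hCz _ _ _ h1.1).trans h3, (hCh _ _ _ h1.1).trans h3⟩

theorem integral_inv_sqrt_le {d q η : ℝ} (hη : 0 < η) (hq : 0 < q) (hd : 0 < d - q / η)
    (hd1 : d ≤ 1) :
    IntegrableOn (fun l => q * (1 / √(d - q * l / η))) (Ioo (0 : ℝ) 1) ∧
      ∫ l in Ioo (0 : ℝ) 1, q * (1 / √(d - q * l / η)) ≤ 2 * η := by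
  have hpos : ∀ l ∈ Icc 0 1, 0 < d - q * l / η := by
    intro l hl
    have : q * l / η ≤ q / η := by gcongr; nlinarith [hl.2]
    linarith
  have hcont : ContinuousOn (fun l => q * (1 / √(d - q * l / η))) (Icc 0 1) := by
    refine continuousOn_const.mul (continuousOn_const.div (by fun_prop) fun l hl => ?_)
    exact (sqrt_pos.2 (hpos l hl)).ne'
  have hder : ∀ l ∈ uIcc 0 1, HasDerivAt (fun l => -(2 * η) * √(d - q * l / η))
      (q * (1 / √(d - q * l / η))) l := by
    intro l hl
    rw [uIcc_of_le zero_le_one] at hl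
    have h1 : HasDerivAt (fun l => d - q * l / η) (-(q / η)) l := by
      simpa using (((hasDerivAt_id l).const_mul q).div_const η).const_sub d
    refine ((h1.sqrt (hpos l hl).ne').const_mul (-(2 * η))).congr_deriv ?_
    have := (sqrt_pos.2 (hpos l hl)).ne'
    field_simp
  refine ⟨(hcont.integrableOn_Icc).mono_set Ioo_subset_Icc_self, ?_⟩
  rw [← integral_Ioc_eq_integral_Ioo, ← intervalIntegral.integral_of_le zero_le_one,
    intervalIntegral.integral_eq_sub_of_hasDerivAt hder
      (ContinuousOn.intervalIntegrable (by rwa [uIcc_of_le zero_le_one]))]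
  have h3 : √(d - q * 0 / η) ≤ 1 := by
    rw [sqrt_le_one]; simpa using hd1
  have h4 := sqrt_nonneg (d - q * 1 / η)
  nlinarith

theorem integral_inv_sqrt_cube_le {d q η : ℝ} (hη : 0 < η) (hq : 0 < q) (hd : 0 < d - q / η) :
    IntegrableOn (fun l => q * (1 / ((d - q * l / η) * √(d - q * l / η)))) (Ioo (0 : ℝ) 1) ∧
      ∫ l in Ioo (0 : ℝ) 1, q * (1 / ((d - q * l / η) * √(d - q * l / η)))
        ≤ 2 * η / √(d - q / η) := by
  have hpos : ∀ l ∈ Icc 0 1, 0 < d - q * l / η := by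
    intro l hl
    have : q * l / η ≤ q / η := by gcongr; nlinarith [hl.2]
    linarith
  have hcont : ContinuousOn (fun l => q * (1 / ((d - q * l / η) * √(d - q * l / η))))
      (Icc 0 1) := by
    refine continuousOn_const.mul (continuousOn_const.div (by fun_prop) fun l hl => ?_)
    exact (mul_pos (hpos l hl) (sqrt_pos.2 (hpos l hl))).ne'
  have hder : ∀ l ∈ uIcc 0 1, HasDerivAt (fun l => (2 * η) * (√(d - q * l / η))⁻¹)
      (q * (1 / ((d - q * l / η) * √(d - q * l / η)))) l := by
    intro l hl
    rw [uIcc_of_le zero_le_one] at hl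
    have h1 : HasDerivAt (fun l => d - q * l / η) (-(q / η)) l := by
      simpa using (((hasDerivAt_id l).const_mul q).div_const η).const_sub d
    have h0 := (sqrt_pos.2 (hpos l hl)).ne'
    refine (((h1.sqrt (hpos l hl).ne').inv h0).const_mul (2 * η)).congr_deriv ?_
    rw [sq_sqrt (hpos l hl).le]
    field_simp
  refine ⟨(hcont.integrableOn_Icc).mono_set Ioo_subset_Icc_self, ?_⟩
  rw [← integral_Ioc_eq_integral_Ioo, ← intervalIntegral.integral_of_le zero_le_one,
    intervalIntegral.integral_eq_sub_of_hasDerivAt hder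
      (ContinuousOn.intervalIntegrable (by rwa [uIcc_of_le zero_le_one]))]
  have h5 : 0 ≤ 2 * η * (√(d - q * 0 / η))⁻¹ := by positivity
  rw [mul_one, div_eq_mul_inv (2 * η)]
  linarith

theorem norm_avg_le_of_sqrt {σ η c q h : ℝ} {z : ℂ} (hσ : σ ≤ 1) (hη : 0 < η) (hc : 0 ≤ c)
    (hp : (q, z, h) ∈ dom σ η) {g : ℝ → ℂ → ℝ → ℂ}
    (hg : ∀ l ∈ Ioo (0 : ℝ) 1, ‖g (q * l) z h‖ ≤ c / √(wid σ η (q * l) z)) :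
    ‖(q : ℂ) * avg g q z h‖ ≤ 2 * η * c := by
  have hI := integral_inv_sqrt_le hη hp.1 (wid_pos hp)
    (by linarith [abs_nonneg z.im])
  have e : (q : ℂ) * avg g q z h = ∫ l in Ioo (0 : ℝ) 1, (q : ℂ) * g (q * l) z h :=
    (integral_const_mul _ _).symm
  rw [e]
  calc _ ≤ ∫ l in Ioo 0 1, c * (q * (1 / √(σ - |z.im| - q * l / η))) := by
        refine norm_integral_le_of_norm_le (hI.1.const_mul c) ?_
        rw [ae_restrict_iff' measurableSet_Ioo]
        refine ae_of_all _ fun l hl => ?_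
        rw [norm_mul, Complex.norm_real, norm_of_nonneg hp.1.le]
        have hq := hp.1
        calc q * ‖g (q * l) z h‖ ≤ q * (c / √(wid σ η (q * l) z)) := by gcongr; exact hg l hl
          _ = _ := by simp only [wid]; ring
    _ = c * ∫ l in Ioo 0 1, (q * (1 / √(σ - |z.im| - q * l / η))) := integral_const_mul _ _
    _ ≤ c * (2 * η) := by gcongr; exact hI.2
    _ = _ := by ring

theorem norm_avg_le_of_sqrt_cube {σ η c q h : ℝ} {z : ℂ} (hη : 0 < η) (hc : 0 ≤ c)
    (hp : (q, z, h) ∈ dom σ η) {g : ℝ → ℂ → ℝ → ℂ}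
    (hg : ∀ l ∈ Ioo (0 : ℝ) 1, ‖g (q * l) z h‖
      ≤ c / (wid σ η (q * l) z * √(wid σ η (q * l) z))) :
    ‖(q : ℂ) * avg g q z h‖ ≤ 2 * η * c / √(wid σ η q z) := by
  have hI := integral_inv_sqrt_cube_le hη hp.1 (wid_pos hp)
  have e : (q : ℂ) * avg g q z h = ∫ l in Ioo (0 : ℝ) 1, (q : ℂ) * g (q * l) z h :=
    (integral_const_mul _ _).symm
  rw [e]
  calc _ ≤ ∫ l in Ioo 0 1,
          c * (q * (1 / ((σ - |z.im| - q * l / η) * √(σ - |z.im| - q * l / η)))) := by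
        refine norm_integral_le_of_norm_le (hI.1.const_mul c) ?_
        rw [ae_restrict_iff' measurableSet_Ioo]
        refine ae_of_all _ fun l hl => ?_
        rw [norm_mul, Complex.norm_real, norm_of_nonneg hp.1.le]
        have hq := hp.1
        calc q * ‖g (q * l) z h‖ ≤ q * (c / (wid σ η (q * l) z * √(wid σ η (q * l) z))) := by
              gcongr; exact hg l hl
          _ = _ := by simp only [wid]; ring
    _ = c * ∫ l in Ioo 0 1,
          (q * (1 / ((σ - |z.im| - q * l / η) * √(σ - |z.im| - q * l / η)))) :=
        integral_const_mul _ _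
    _ ≤ c * (2 * η / √(wid σ η q z)) := by gcongr; exact hI.2
    _ = _ := by ring

/-- The level set function `g` together with its derivatives `u = g_z`, `ux = g_zz`, `gh = g_h`,
`uh = g_zh`. -/
structure Curve where
  g : ℝ → ℂ → ℝ → ℂ
  u : ℝ → ℂ → ℝ → ℂ
  ux : ℝ → ℂ → ℝ → ℂ
  gh : ℝ → ℂ → ℝ → ℂ
  uh : ℝ → ℂ → ℝ → ℂ

/-- Regularity of a level set function on the shrinking strips. -/
structure CurveReg (σ η : ℝ) (c : Curve) : Prop where
  reg : Reg (dom σ η) c.g c.u c.gh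
  reg_u : Reg (dom σ η) c.u c.ux c.uh

/-- Closeness of level set functions. -/
def CurveClose (σ η ν : ℝ) (c c' : Curve) : Prop :=
  ∀ q z h, (q, z, h) ∈ dom σ η → ‖c.u q z h - c'.u q z h‖ ≤ ν ∧
    ‖c.ux q z h - c'.ux q z h‖ ≤ ν / √(wid σ η q z) ∧
    ‖c.gh q z h - c'.gh q z h‖ ≤ ν * q ^ 2 ∧
    ‖c.uh q z h - c'.uh q z h‖ ≤ ν * q ^ 2 / √(wid σ η q z)

/-- The level set function with initial value `Γ` and velocity `e`. -/
def curveOf (Γ : ℂ → ℂ) (e : Jet) : Curve where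
  g q z h := Γ z + q * avg e.val q z h
  u q z h := deriv Γ z + q * avg e.dz q z h
  ux q z h := deriv (deriv Γ) z + q * avg (fun q z h => deriv (fun w => e.dz q w h) z) q z h
  gh q z h := q * avg e.dh q z h
  uh q z h := q * avg (fun q z h => deriv (fun w => e.dh q w h) z) q z h

/-- Bounds on the holomorphic extension of the initial interface. -/
structure ExtBounds (σ M : ℝ) (Γ : ℂ → ℂ) : Prop where
  nonneg : 0 ≤ M
  diff : DifferentiableOn ℂ Γ {z | |z.im| < σ}
  deriv_le : ∀ z : ℂ, |z.im| < σ → ‖deriv Γ z‖ ≤ M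
  deriv2_le : ∀ z : ℂ, |z.im| < σ → ‖deriv (deriv Γ) z‖ ≤ M
  im_le : ∀ z : ℂ, |z.im| < σ → |(deriv Γ z).im| ≤ (16 * (1 + M))⁻¹

theorem isOpen_strip_im (σ : ℝ) : IsOpen {z : ℂ | |z.im| < σ} :=
  isOpen_lt Complex.continuous_im.abs continuous_const

theorem dom_im_lt {σ η q h : ℝ} {z : ℂ} (hη : 0 < η) (hp : (q, z, h) ∈ dom σ η) : |z.im| < σ := by
  have h1 := hp.2.1
  have h2 := div_nonneg hp.1.le hη.le
  simp only at h1; linarith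

theorem reg_of_holomorphic {σ η : ℝ} (hη : 0 < η) {Γ : ℂ → ℂ}
    (hΓ : DifferentiableOn ℂ Γ {z | |z.im| < σ}) :
    Reg (dom σ η) (fun _ z _ => Γ z) (fun _ z _ => deriv Γ z) (fun _ _ _ => 0) := by
  have hm : MapsTo (fun p : ℝ × ℂ × ℝ => p.2.1) (dom σ η) {z : ℂ | |z.im| < σ} :=
    fun p hp => dom_im_lt hη hp
  have hc : ContinuousOn (fun p => p.2.1) (dom σ η) := by fun_prop
  exact ⟨hΓ.continuousOn.comp hc hm,
    (hΓ.deriv (isOpen_strip_im σ)).continuousOn.comp hc hm, continuousOn_const,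
    fun q z h hp =>
      ((hΓ.differentiableAt ((isOpen_strip_im σ).mem_nhds (dom_im_lt hη hp))).hasDerivAt),
      fun q z h hp => hasDerivAt_const _ _⟩

theorem JetClose.deriv_le {σ η ν : ℝ} {e e' : Jet} (hν : 0 ≤ ν)
    (he : Reg (dom σ η) e.val e.dz e.dh) (he' : Reg (dom σ η) e'.val e'.dz e'.dh)
    (h : JetClose σ η ν e e') {q m : ℝ} {z : ℂ} (hp : (q, z, m) ∈ dom σ η) :
    ‖deriv (fun w => e.dz q w m) z - deriv (fun w => e'.dz q w m) z‖
      ≤ 3 * ν / (wid σ η q z * √(wid σ η q z)) ∧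
    ‖deriv (fun w => e.dh q w m) z - deriv (fun w => e'.dh q w m) z‖
      ≤ 3 * (ν * q ^ 2) / (wid σ η q z * √(wid σ η q z)) := by
  have hU := isOpen_dom σ η
  have d1 :=
    fun w hw => ((he.deriv_z hU).dz q w m hw).differentiableAt
  have d2 :=
    fun w hw => ((he'.deriv_z hU).dz q w m hw).differentiableAt
  have d3 : ∀ w, (q, w, m) ∈ dom σ η → DifferentiableAt ℂ (fun w => e.dh q w m) w :=
    fun w hw => (he.differentiableAt_dh hU hw).1
  have d4 : ∀ w, (q, w, m) ∈ dom σ η → DifferentiableAt ℂ (fun w => e'.dh q w m) w :=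
    fun w hw => (he'.differentiableAt_dh hU hw).1
  constructor
  · rw [← deriv_fun_sub (d1 z hp) (d2 z hp)]
    exact norm_deriv_le_of_weighted hp hν fun w hw => ⟨(d1 w hw).sub (d2 w hw), (h q w m hw).2.1⟩
  · rw [← deriv_fun_sub (d3 z hp) (d4 z hp)]
    exact norm_deriv_le_of_weighted hp (by positivity)
      fun w hw => ⟨(d3 w hw).sub (d4 w hw), (h q w m hw).2.2⟩

theorem one_div_sqrt_le {s : ℝ} (hs : 0 < s) (hs1 : s ≤ 1) :
    1 ≤ 1 / √s ∧ 1 / √s ≤ 1 / s ^ 2 ∧ 1 / (s * √s) ≤ 1 / s ^ 2 ∧ 1 ≤ 1 / s ^ 2 := by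
  have h0 := sqrt_pos.2 hs
  have h1 := sqrt_le_one.2 hs1
  have h2 : s ≤ √s := by
    rw [le_sqrt' hs]; nlinarith
  refine ⟨?_, ?_, ?_, ?_⟩
  · rw [le_div_iff₀ h0]; linarith
  · apply one_div_le_one_div_of_le (by positivity); nlinarith
  · apply one_div_le_one_div_of_le (by positivity); nlinarith
  · rw [le_div_iff₀ (by positivity)]; nlinarith

/-- Crude bounds for a jet that is close to the base jet. -/
theorem JetClose.crude {σ η N : ℝ} {e : Jet} (hσ : σ ≤ 1) (hη : 0 < η) (hη1 : η ≤ 1) (hN : 0 ≤ N)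
    (he : Reg (dom σ η) e.val e.dz e.dh) (h : JetClose σ η N e baseJet) (q : ℝ) (z : ℂ) (m : ℝ)
    (hp : (q, z, m) ∈ dom σ η) :
    ‖e.val q z m‖ ≤ (3 * N + 8) / wid σ η q z ^ 2 ∧ ‖e.dz q z m‖ ≤ (3 * N + 8) / wid σ η q z ^ 2 ∧
    ‖e.dh q z m‖ ≤ (3 * N + 8) / wid σ η q z ^ 2 ∧
    ‖deriv (fun w => e.dz q w m) z‖ ≤ (3 * N + 8) / wid σ η q z ^ 2 ∧
    ‖deriv (fun w => e.dh q w m) z‖ ≤ (3 * N + 8) / wid σ η q z ^ 2 := by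
  obtain ⟨h1, h2, h3⟩ := h q z m hp
  obtain ⟨h4, h5⟩ := h.deriv_le hN he (reg_baseJet _) hp
  have hs := wid_pos hp
  obtain ⟨s1, s2, s3, s4⟩ := one_div_sqrt_le hs (wid_le_one hσ hη hp)
  have hq := (dom_le_one hσ hη hη1 hp).2
  have hq0 := hp.1
  have hm := hp.2.2
  set s := wid σ η q z
  have hq2 : q ^ 2 ≤ 1 := by nlinarith
  have b1 : ‖baseJet.val q z m‖ ≤ 8 := by
    simp only [baseJet, norm_mul, Complex.norm_real, norm_eq_abs]
    rw [abs_of_pos hq0]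
    have : ‖(4 : ℂ)‖ = 4 := by simp
    rw [this]; nlinarith
  have b2 : ‖baseJet.dh q z m‖ ≤ 4 := by
    simp only [baseJet, norm_mul, Complex.norm_real, norm_eq_abs]
    rw [abs_of_pos hq0]
    have : ‖(4 : ℂ)‖ = 4 := by simp
    rw [this]; nlinarith
  have e1 : (3 * N + 8) / s ^ 2 = 3 * N * (1 / s ^ 2) + 8 * (1 / s ^ 2) := by ring
  have e2 : N / √s = N * (1 / √s) := by ring
  have e3 : N * q ^ 2 / √s ≤ N * (1 / √s) := by
    rw [mul_one_div]; gcongr; nlinarith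
  have e4 : 3 * N / (s * √s) = 3 * N * (1 / (s * √s)) := by ring
  have e5 : 3 * (N * q ^ 2) / (s * √s) ≤ 3 * N * (1 / (s * √s)) := by
    rw [mul_one_div]; gcongr; nlinarith
  have n1 := norm_le_norm_add_norm_sub' (e.val q z m) (baseJet.val q z m)
  have n3 := norm_le_norm_add_norm_sub' (e.dh q z m) (baseJet.dh q z m)
  have m1 : N * (1 / √s) ≤ N * (1 / s ^ 2) := by gcongr
  have m2 : 3 * N * (1 / (s * √s)) ≤ 3 * N * (1 / s ^ 2) := by gcongr
  have m3 := le_mul_of_one_le_right hN s4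
  have z1 : deriv (fun w => baseJet.dz q w m) z = 0 := by simp [baseJet]
  have z2 : deriv (fun w => baseJet.dh q w m) z = 0 := by simp [baseJet]
  rw [z1, sub_zero] at h4
  rw [z2, sub_zero] at h5
  have h2' : ‖e.dz q z m‖ ≤ N / √s := by simpa [baseJet] using h2
  rw [e1]
  refine ⟨?_, ?_, ?_, ?_, ?_⟩ <;> linarith

theorem curveReg_curveOf {σ η N : ℝ} {Γ : ℂ → ℂ} {e : Jet} (hσ : σ ≤ 1) (hη : 0 < η)
    (hη1 : η ≤ 1) (hN : 0 ≤ N) (hΓ : DifferentiableOn ℂ Γ {z | |z.im| < σ})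
    (he : Reg (dom σ η) e.val e.dz e.dh) (h : JetClose σ η N e baseJet) :
    CurveReg σ η (curveOf Γ e) := by
  have hcr := h.crude hσ hη hη1 hN he
  have hq := Complex.continuous_ofReal
  constructor
  · have h1 :=
      (Reg.avg hη he (fun q z m hp => (hcr q z m hp).1) (fun q z m hp => (hcr q z m hp).2.1)
      (fun q z m hp => (hcr q z m hp).2.2.1)).smul_time hq
    exact ((reg_of_holomorphic hη hΓ).add h1).congr_derivs (fun _ _ _ => rfl)
      (fun _ _ _ => zero_add _)
  · exact ((reg_of_holomorphic hη (hΓ.deriv (isOpen_strip_im σ))).add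
      ((Reg.avg hη (he.deriv_z (isOpen_dom σ η)) (fun q z m hp => (hcr q z m hp).2.1)
      (fun q z m hp => (hcr q z m hp).2.2.2.1) (fun q z m hp => (hcr q z m hp).2.2.2.2)).smul_time
      hq)).congr_derivs
      (fun _ _ _ => rfl) (fun _ _ _ => zero_add _)

theorem mul_avg_sub {σ η C : ℝ} (hη : 0 < η) {g g' : ℝ → ℂ → ℝ → ℂ}
    (hg : ContinuousOn (fun p : ℝ × ℂ × ℝ => g p.1 p.2.1 p.2.2) (dom σ η))
    (hg' : ContinuousOn (fun p : ℝ × ℂ × ℝ => g' p.1 p.2.1 p.2.2) (dom σ η))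
    (hC : ∀ q z h, (q, z, h) ∈ dom σ η → ‖g q z h‖ ≤ C / wid σ η q z ^ 2)
    (hC' : ∀ q z h, (q, z, h) ∈ dom σ η → ‖g' q z h‖ ≤ C / wid σ η q z ^ 2)
    {q h : ℝ} {z : ℂ} (hp : (q, z, h) ∈ dom σ η) :
    (q : ℂ) * avg g q z h - q * avg g' q z h
      = q * avg (fun q z h => g q z h - g' q z h) q z h := by
  rw [← mul_sub]
  congr 1
  exact (integral_sub (integrable_avg hη hg hC hp) (integrable_avg hη hg' hC' hp)).symm

theorem curveClose_curveOf {σ η N ν : ℝ} {Γ : ℂ → ℂ} {e e' : Jet} (hσ : σ ≤ 1) (hη : 0 < η)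
    (hη1 : η ≤ 1) (hN : 0 ≤ N) (hν : 0 ≤ ν)
    (he : Reg (dom σ η) e.val e.dz e.dh) (h : JetClose σ η N e baseJet)
    (he' : Reg (dom σ η) e'.val e'.dz e'.dh) (h' : JetClose σ η N e' baseJet)
    (hc : JetClose σ η ν e e') :
    CurveClose σ η (6 * η * ν) (curveOf Γ e) (curveOf Γ e') := by
  have hcr := h.crude hσ hη hη1 hN he
  have hcr' := h'.crude hσ hη hη1 hN he'
  have hU := isOpen_dom σ η
  intro q z m hp
  have hq0 := hp.1
  have hql : ∀ l ∈ Ioo 0 1, (q * l) ^ 2 ≤ q ^ 2 := by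
    intro l hl
    have : q * l ≤ q := by nlinarith [hl.2]
    have := mul_nonneg hq0.le hl.1.le
    gcongr
  have h6 : 0 ≤ η * ν := by positivity
  simp only [curveOf, add_sub_add_left_eq_sub]
  refine ⟨?_, ?_, ?_, ?_⟩
  · rw [mul_avg_sub hη he.cont_z he'.cont_z (fun q z m hp => (hcr q z m hp).2.1)
      (fun q z m hp => (hcr' q z m hp).2.1) hp]
    refine (norm_avg_le_of_sqrt hσ hη hν hp fun l hl =>
      (hc _ _ _ (dom_scale hη hp hl).1).2.1).trans ?_
    linarith
  · rw [mul_avg_sub hη (he.deriv_z hU).cont_z (he'.deriv_z hU).cont_z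
      (fun q z m hp => (hcr q z m hp).2.2.2.1) (fun q z m hp => (hcr' q z m hp).2.2.2.1) hp]
    refine (norm_avg_le_of_sqrt_cube hη (by positivity : 0 ≤ 3 * ν) hp fun l hl =>
      (hc.deriv_le hν he he' (dom_scale hη hp hl).1).1).trans (le_of_eq ?_)
    ring
  · rw [mul_avg_sub hη he.cont_h he'.cont_h (fun q z m hp => (hcr q z m hp).2.2.1)
      (fun q z m hp => (hcr' q z m hp).2.2.1) hp]
    refine (norm_avg_le_of_sqrt hσ hη (by positivity : 0 ≤ ν * q ^ 2) hp fun l hl =>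
      (hc _ _ _ (dom_scale hη hp hl).1).2.2.trans ?_).trans ?_
    · have := hql l hl
      gcongr ν * ?_ / _
    · nlinarith
  · rw [mul_avg_sub hη (he.deriv_z hU).cont_h (he'.deriv_z hU).cont_h
      (fun q z m hp => (hcr q z m hp).2.2.2.2) (fun q z m hp => (hcr' q z m hp).2.2.2.2) hp]
    refine (norm_avg_le_of_sqrt_cube hη (by positivity : 0 ≤ 3 * (ν * q ^ 2)) hp fun l hl =>
      (hc.deriv_le hν he he' (dom_scale hη hp hl).1).2.trans ?_).trans (le_of_eq ?_)
    · have := (fun l hl => wid_pos (dom_scale hη hp hl).1) l hl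
      have := hql l hl
      gcongr 3 * (ν * ?_) / _
    · ring

theorem integral_id_Ioo : ∫ l in Ioo (0 : ℝ) 1, (l : ℂ) = 1 / 2 := by
  rw [integral_complex_ofReal, ← integral_Ioc_eq_integral_Ioo,
    ← intervalIntegral.integral_of_le zero_le_one, integral_id]
  norm_num

theorem curveOf_baseJet (Γ : ℂ → ℂ) (q : ℝ) (z : ℂ) (h : ℝ) :
    (curveOf Γ baseJet).g q z h = Γ z + 2 * q ^ 2 * h ∧ (curveOf Γ baseJet).u q z h = deriv Γ z ∧
    (curveOf Γ baseJet).ux q z h = deriv (deriv Γ) z ∧ (curveOf Γ baseJet).gh q z h = 2 * q ^ 2 ∧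
    (curveOf Γ baseJet).uh q z h = 0 := by
  refine ⟨?_, ?_, ?_, ?_, ?_⟩
  · have : avg baseJet.val q z h = 4 * q * h * (1 / 2) := by
      rw [← integral_id_Ioo, ← integral_const_mul]
      simp only [avg, baseJet]
      congr 1; ext l; push_cast; ring
    simp only [curveOf, this]; ring
  · simp [curveOf, avg, baseJet]
  · simp [curveOf, avg, baseJet]
  · have : avg baseJet.dh q z h = 4 * q * (1 / 2) := by
      rw [← integral_id_Ioo, ← integral_const_mul]
      simp only [avg, baseJet]
      congr 1; ext l; push_cast; ring
    simp only [curveOf, this]; ring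
  · simp [curveOf, avg, baseJet]

theorem convex_horizontal (z : ℂ) : Convex ℝ {w : ℂ | w.im = z.im} := by
  intro a ha b hb s t _ _ hst
  simp at *
  rw [ha, hb, ← add_mul, hst, one_mul]

theorem Reg.norm_sub_shift_le {σ η A B : ℝ} {f fz fh : ℝ → ℂ → ℝ → ℂ}
    (hf : Reg (dom σ η) f fz fh) {q h h' y : ℝ} {z : ℂ} (hp : (q, z, h) ∈ dom σ η) (hh' : |h'| < 2)
    (hA : ∀ w m, w.im = z.im → (q, w, m) ∈ dom σ η → ‖fz q w m‖ ≤ A)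
    (hB : ∀ w m, w.im = z.im → (q, w, m) ∈ dom σ η → ‖fh q w m‖ ≤ B) :
    ‖f q z h - f q (z - y) h'‖ ≤ A * |y| + B * |h - h'| := by
  have h1 : ‖f q z h - f q (z - y) h‖ ≤ A * |y| := by
    have hcv := convex_horizontal z
    have hin : ∀ w ∈ {w : ℂ | w.im = z.im}, (q, w, h) ∈ dom σ η := by
      intro w hw
      have hw' : w.im = z.im := hw
      exact ⟨hp.1, by simp only [hw']; exact hp.2.1, hp.2.2⟩
    have := hcv.norm_image_sub_le_of_norm_hasDerivWithin_le
      (x := z - y) (y := z)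
      (fun w hw => (hf.dz q w h (hin w hw)).hasDerivWithinAt)
      (fun w hw => hA w h hw (hin w hw)) (by simp) (by simp)
    simpa using this
  have h2 : ‖f q (z - y) h - f q (z - y) h'‖ ≤ B * |h - h'| := by
    have hin : ∀ m ∈ {m : ℝ | |m| < 2}, (q, z - y, m) ∈ dom σ η := fun m hm => dom_shift y hm hp
    have hcv : Convex ℝ {m : ℝ | |m| < 2} := by
      have : {m : ℝ | |m| < 2} = ball 0 2 := by ext m; simp
      rw [this]; exact convex_ball _ _
    have := hcv.norm_image_sub_le_of_norm_hasDerivWithin_le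

      (fun m hm => (hf.dh q (z - y) m (hin m hm)).hasDerivWithinAt)
      (fun m hm => hB _ m (by simp) (hin m hm)) hh' hp.2.2
    simpa using this
  calc _ ≤ _ := norm_sub_le_norm_sub_add_norm_sub _ (f q (z - y) h) _
    _ ≤ _ := add_le_add h1 h2

/-- Difference of the level set function between two points. -/
def Curve.a (c : Curve) (y h' q : ℝ) (z : ℂ) (h : ℝ) : ℂ := c.g q z h - c.g q (z - y) h'

/-- Difference of the slope between two points. -/
def Curve.b (c : Curve) (y h' q : ℝ) (z : ℂ) (h : ℝ) : ℂ := c.u q z h - c.u q (z - y) h'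

/-- Difference of the second derivative between two points. -/
def Curve.bx (c : Curve) (y h' q : ℝ) (z : ℂ) (h : ℝ) : ℂ := c.ux q z h - c.ux q (z - y) h'

/-- The integrand of the velocity of the level sets. -/
def Curve.J (c : Curve) (y h' q : ℝ) (z : ℂ) (h : ℝ) : ℂ :=
  ker y (c.a y h' q z h) * c.b y h' q z h

/-- The `z`-derivative of the integrand. -/
def Curve.Jz (c : Curve) (y h' q : ℝ) (z : ℂ) (h : ℝ) : ℂ :=
  kerD y (c.a y h' q z h) * c.b y h' q z h * c.b y h' q z h +
    ker y (c.a y h' q z h) * c.bx y h' q z h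

/-- The `h`-derivative of the integrand. -/
def Curve.Jh (c : Curve) (y h' q : ℝ) (z : ℂ) (h : ℝ) : ℂ :=
  kerD y (c.a y h' q z h) * c.gh q z h * c.b y h' q z h +
    ker y (c.a y h' q z h) * c.uh q z h

section Pointwise

variable {σ η M ν : ℝ} {Γ : ℂ → ℂ} {c c' : Curve}

theorem wid_of_im_eq {q : ℝ} {w z : ℂ} (h : w.im = z.im) : wid σ η q w = wid σ η q z := by
  simp [wid, h]

theorem CurveClose.a_le (hc : CurveReg σ η c) (hc' : CurveReg σ η c') (h : CurveClose σ η ν c c')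
    {q m m' : ℝ} (y : ℝ) {z : ℂ} (hp : (q, z, m) ∈ dom σ η) (hm' : |m'| < 2) :
    ‖c.a y m' q z m - c'.a y m' q z m‖ ≤ ν * (|y| + q ^ 2 * |m - m'|) := by
  have e : c.a y m' q z m - c'.a y m' q z m = c.g q z m - c'.g q z m
    - (c.g q (z - y) m' - c'.g q (z - y) m') := by simp only [Curve.a]; ring
  rw [e]
  refine ((hc.reg.sub hc'.reg).norm_sub_shift_le (y := y) hp hm' (fun w k _ hw => (h q w k hw).1)
    (fun w k _ hw => (h q w k hw).2.2.1)).trans (le_of_eq ?_)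
  ring

theorem CurveClose.b_le (hc : CurveReg σ η c) (hc' : CurveReg σ η c') (h : CurveClose σ η ν c c')
    {q m m' : ℝ} (y : ℝ) {z : ℂ} (hp : (q, z, m) ∈ dom σ η) (hm' : |m'| < 2) :
    ‖c.b y m' q z m - c'.b y m' q z m‖ ≤ ν * (|y| + q ^ 2 * |m - m'|) * (1 / √(wid σ η q z)) ∧
    ‖c.b y m' q z m - c'.b y m' q z m‖ ≤ 2 * ν ∧
    ‖c.bx y m' q z m - c'.bx y m' q z m‖ ≤ 2 * ν * (1 / √(wid σ η q z)) := by
  have h1 := (hc.reg_u.sub hc'.reg_u).norm_sub_shift_le (y := y)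
    (A := ν / √(wid σ η q z)) (B := ν * q ^ 2 / √(wid σ η q z)) hp hm'
    (fun w k hw' hw => by rw [← wid_of_im_eq hw']; exact (h q w k hw).2.1)
    (fun w k hw' hw => by rw [← wid_of_im_eq hw']; exact (h q w k hw).2.2.2)
  have e : c.b y m' q z m - c'.b y m' q z m = c.u q z m - c'.u q z m
    - (c.u q (z - y) m' - c'.u q (z - y) m') := by simp only [Curve.b]; ring
  have e' : c.bx y m' q z m - c'.bx y m' q z m = c.ux q z m - c'.ux q z m
    - (c.ux q (z - y) m' - c'.ux q (z - y) m') := by simp only [Curve.bx]; ring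
  have hp' := dom_shift y hm' hp
  refine ⟨?_, ?_, ?_⟩
  · rw [e]
    refine h1.trans (le_of_eq ?_)
    ring
  · rw [e]
    refine (norm_sub_le _ _).trans ?_
    linarith [(h q z m hp).1, (h q (z - y) m' hp').1]
  · rw [e']
    refine (norm_sub_le _ _).trans ?_
    have h2 := (h q z m hp).2.1
    have h3 := (h q (z - y) m' hp').2.1
    rw [wid_shift] at h3
    rw [mul_one_div, mul_div_assoc]
    linarith

/-- Properties of the difference `a` for curves that are close to the base curve. -/
theorem near_bounds (hη : 0 < η) (hη1 : η ≤ 1) (hσ : σ ≤ 1) (hΓ : ExtBounds σ M Γ)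
    (hν : ν ≤ (16 * (1 + M))⁻¹) (hc : CurveReg σ η c) (hb : CurveReg σ η (curveOf Γ baseJet))
    (h : CurveClose σ η ν c (curveOf Γ baseJet)) {q m m' y : ℝ} {z : ℂ}
    (hp : (q, z, m) ∈ dom σ η) (hm' : |m'| ≤ 1) (hy : |y| ≤ π) :
    (32 * (1 + M) ^ 2)⁻¹ * (|y| + q ^ 2 * |m - m'|) ^ 2 ≤ ‖kerDen y (c.a y m' q z m)‖ ∧
    ‖c.a y m' q z m‖ ≤ (M + 3) * (|y| + q ^ 2 * |m - m'|) ∧ |y| + q ^ 2 * |m - m'| ≤ 7 := by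
  have hM := hΓ.nonneg
  have hq := (dom_le_one hσ hη hη1 hp).2
  have hq0 := hp.1
  have hmm := hp.2.2
  have hmd : |m - m'| ≤ 3 := (abs_sub _ _).trans (by linarith)
  have hδ : |q ^ 2 * (m - m')| = q ^ 2 * |m - m'| := by rw [abs_mul, abs_of_nonneg (sq_nonneg q)]
  have hδ3 : |q ^ 2 * (m - m')| ≤ 3 := by
    rw [hδ]; nlinarith
  have hm2 : |m'| < 2 := by linarith
  set d := Γ z - Γ (z - y) with hd
  have hzσ := dom_im_lt hη hp
  have hder : ∀ w : ℂ, w.im = z.im → HasDerivAt Γ (deriv Γ w) w := fun w hw =>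
    (hΓ.diff.differentiableAt ((isOpen_strip_im σ).mem_nhds (by
      simp only [mem_ofPred_eq, hw]; exact hzσ))).hasDerivAt
  have hdn : ‖d‖ ≤ M * |y| := by
    have := (convex_horizontal z).norm_image_sub_le_of_norm_hasDerivWithin_le
      (fun w hw => (hder w hw).hasDerivWithinAt)
      (fun w hw => hΓ.deriv_le w (by rw [show w.im = z.im from hw]; exact hzσ))
      (show (z - (y : ℂ)).im = z.im by simp) (show z.im = z.im from rfl)
    simpa using this
  have hdi : |d.im| ≤ (16 * (1 + M))⁻¹ * |y| := by
    have hd2 : ∀ s : ℝ, HasDerivAt (fun s : ℝ => (Γ (z - s)).im) (-(deriv Γ (z - s)).im) s := by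
      intro s
      have h1 : HasDerivAt (fun s : ℝ => z - (s : ℂ)) (-1) s := by
        simpa using (Complex.ofRealCLM.hasDerivAt).const_sub z
      have h2 := (hder (z - s) (by simp)).comp_of_eq s h1 rfl
      simpa [Function.comp_def] using Complex.imCLM.hasFDerivAt.comp_hasDerivAt s h2
    have := (convex_univ).norm_image_sub_le_of_norm_hasDerivWithin_le
      (x := y) (y := 0)
      (fun s _ => (hd2 s).hasDerivWithinAt)
      (fun s _ => by
        rw [norm_neg, norm_eq_abs]; exact hΓ.im_le _ (by simpa using hzσ))
      (mem_univ _) (mem_univ _)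
    simpa [hd] using this
  obtain ⟨θ, hθ, hθy⟩ : ∃ θ : ℝ, |θ| ≤ M ∧ θ * y = d.re := by
    rcases eq_or_ne y 0 with rfl | hy0
    · exact ⟨0, by simpa using hM, by simp [hd]⟩
    · refine ⟨d.re / y, ?_, by field_simp⟩
      rw [abs_div, div_le_iff₀ (abs_pos.2 hy0)]
      exact (Complex.abs_re_le_norm d).trans hdn
  have ha := h.a_le hc hb y hp hm2
  have hab : (curveOf Γ baseJet).a y m' q z m = d + 2 * (q ^ 2 * (m - m') : ℝ) := by
    simp only [Curve.a, (curveOf_baseJet Γ _ _ _).1]; push_cast; ring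
  have hfin : ‖c.a y m' q z m - ((θ * y + 2 * (q ^ 2 * (m - m')) : ℝ) : ℂ)‖
      ≤ (8 * (1 + M))⁻¹ * (|y| + |q ^ 2 * (m - m')|) := by
    have e1 : c.a y m' q z m - ((θ * y + 2 * (q ^ 2 * (m - m')) : ℝ) : ℂ)
        = (c.a y m' q z m - (curveOf Γ baseJet).a y m' q z m) + d.im * Complex.I := by
      rw [hab, hθy]
      push_cast
      linear_combination -(Complex.re_add_im d)
    rw [e1, hδ]
    have e2 : (8 * (1 + M))⁻¹ = (16 * (1 + M))⁻¹ + (16 * (1 + M))⁻¹ := by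
      field_simp; norm_num
    calc _ ≤ ‖c.a y m' q z m - (curveOf Γ baseJet).a y m' q z m‖ + ‖(d.im : ℂ) * Complex.I‖ :=
          norm_add_le _ _
      _ ≤ ν * (|y| + q ^ 2 * |m - m'|) + (16 * (1 + M))⁻¹ * |y| := by
          gcongr
          rw [norm_mul, Complex.norm_I, mul_one, Complex.norm_real]; exact hdi
      _ ≤ (16 * (1 + M))⁻¹ * (|y| + q ^ 2 * |m - m'|)
          + (16 * (1 + M))⁻¹ * (|y| + q ^ 2 * |m - m'|) := by
          gcongr
          exact le_add_of_nonneg_right (by positivity)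
      _ = _ := by rw [e2, add_mul]
  obtain ⟨r1, r2⟩ := kerDen_ge_of_near hM hy hδ3 hθ hfin
  rw [hδ] at r1 r2 hδ3
  exact ⟨r1, r2, by linarith [pi_lt_d2]⟩

/-- Bounds on the slope of a curve that is close to the base curve. -/
theorem near_slope_bounds (hη : 0 < η) (hσ : σ ≤ 1) (hΓ : ExtBounds σ M Γ)
    (hν : ν ≤ 1) (hc : CurveReg σ η c)
    (h : CurveClose σ η ν c (curveOf Γ baseJet)) {q m m' : ℝ} (y : ℝ) {z : ℂ}
    (hp : (q, z, m) ∈ dom σ η) (hm' : |m'| ≤ 1) :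
    ‖c.b y m' q z m‖ ≤ (2 * M + 4) * (|y| + q ^ 2 * |m - m'|) * (1 / √(wid σ η q z)) ∧
    ‖c.b y m' q z m‖ ≤ 2 * M + 4 ∧ ‖c.bx y m' q z m‖ ≤ (2 * M + 4) * (1 / √(wid σ η q z)) ∧
    ‖c.gh q z m‖ ≤ (2 * M + 4) * q ^ 2 ∧
    ‖c.uh q z m‖ ≤ (2 * M + 4) * q ^ 2 * (1 / √(wid σ η q z)) := by
  have hM := hΓ.nonneg
  have hm2 : |m'| < 2 := by linarith
  have key : ∀ w k, (q, w, k) ∈ dom σ η → ‖c.u q w k‖ ≤ M + 1 ∧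
      ‖c.ux q w k‖ ≤ (M + 1) * (1 / √(wid σ η q w)) ∧ ‖c.gh q w k‖ ≤ 3 * q ^ 2 ∧
      ‖c.uh q w k‖ ≤ q ^ 2 * (1 / √(wid σ η q w)) := by
    intro w k hw
    obtain ⟨b1, b2, b3, b4, b5⟩ := curveOf_baseJet Γ q w k
    obtain ⟨h1, h2, h3, h4⟩ := h q w k hw
    have hs1 := (one_div_sqrt_le (wid_pos hw) (wid_le_one hσ hη hw)).1
    have hwσ := dom_im_lt hη hw
    set S := 1 / √(wid σ η q w)
    have hS0 : 0 ≤ S := by linarith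
    rw [b2] at h1; rw [b3, div_eq_mul_one_div] at h2; rw [b4] at h3
    rw [b5, sub_zero, div_eq_mul_one_div] at h4
    have n1 := norm_le_norm_add_norm_sub' (c.u q w k) (deriv Γ w)
    have n2 := norm_le_norm_add_norm_sub' (c.ux q w k) (deriv (deriv Γ) w)
    have n3 := norm_le_norm_add_norm_sub' (c.gh q w k) (2 * (q : ℂ) ^ 2)
    have n4 : ‖(2 * (q : ℂ) ^ 2)‖ = 2 * q ^ 2 := by
      rw [norm_mul, norm_pow, Complex.norm_real, norm_eq_abs, sq_abs]; simp
    have d1 := hΓ.deriv_le w hwσ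
    have d2 := hΓ.deriv2_le w hwσ
    refine ⟨by linarith, ?_, ?_, ?_⟩
    · calc _ ≤ M + ν * S := by linarith
        _ ≤ M * S + 1 * S := by gcongr; exact le_mul_of_one_le_right hM hs1
        _ = _ := by ring
    · nlinarith
    · refine h4.trans ?_
      have : ν * q ^ 2 ≤ q ^ 2 := by nlinarith
      gcongr
  obtain ⟨k1, k2, k3, k4⟩ := key z m hp
  obtain ⟨l1, l2, l3, l4⟩ := key (z - y) m' (dom_shift y hm2 hp)
  rw [wid_shift] at l2
  have hS0 : 0 ≤ 1 / √(wid σ η q z) := by positivity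
  refine ⟨?_, ((norm_sub_le _ _).trans (by linarith)), ?_, ?_, ?_⟩
  · have := hc.reg_u.norm_sub_shift_le (y := y)
      (A := (M + 1) * (1 / √(wid σ η q z))) (B := q ^ 2 * (1 / √(wid σ η q z))) hp hm2
      (fun w k hw' hw => by rw [← wid_of_im_eq hw']; exact (key w k hw).2.1)
      (fun w k hw' hw => by rw [← wid_of_im_eq hw']; exact (key w k hw).2.2.2)
    refine this.trans ?_
    have e1 : 0 ≤ (1 / √(wid σ η q z)) * |y| := by positivity
    have e2 : 0 ≤ q ^ 2 * (1 / √(wid σ η q z)) * |m - m'| := by positivity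
    nlinarith
  · refine (norm_sub_le _ _).trans ?_
    nlinarith
  · nlinarith
  · have e2 : 0 ≤ q ^ 2 * (1 / √(wid σ η q z)) := by positivity
    nlinarith

end Pointwise

theorem integrable_abs_rpow {r : ℝ} (hr : -1 < r) (R : ℝ) :
    IntervalIntegrable (fun v : ℝ => |v| ^ r) volume (-R) R := by
  have h1 : ∀ T : ℝ, 0 ≤ T → IntervalIntegrable (fun v => |v| ^ r) volume 0 T := by
    refine fun T hT => (intervalIntegral.intervalIntegrable_rpow' hr).congr ?_
    intro v hv
    rw [uIoc_of_le hT] at hv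
    simp only [abs_of_pos hv.1]
  have h3 : ∀ T : ℝ, IntervalIntegrable (fun v => |v| ^ r) volume 0 T := by
    intro T
    rcases le_total 0 T with hT | hT
    · exact h1 T hT
    · simpa using (h1 (-T) (by linarith)).comp_sub_left 0
  exact (h3 (-R)).symm.trans (h3 R)

theorem integral_abs_rpow {r : ℝ} (hr : -1 < r) {R : ℝ} (hR : 0 ≤ R) :
    ∫ v in (-R)..R, |v| ^ r = 2 * (R ^ (r + 1) / (r + 1)) := by
  have h0 : ∫ v in 0..R, |v| ^ r = R ^ (r + 1) / (r + 1) := by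
    have : ∫ v in 0..R, |v| ^ r = ∫ v in 0..R, v ^ r := by
      refine intervalIntegral.integral_congr_ae (ae_of_all _ fun v hv => ?_)
      rw [uIoc_of_le hR] at hv
      rw [abs_of_pos hv.1]
    rw [this, integral_rpow (Or.inl hr), zero_rpow (by linarith), sub_zero]
  have hsub : ∀ a b : ℝ, a ∈ Icc (-R) R → b ∈ Icc (-R) R →
      IntervalIntegrable (fun v : ℝ => |v| ^ r) volume a b := fun a b ha hb =>
    (integrable_abs_rpow hr R).mono_set (by
      rw [uIcc_of_le (by linarith : -R ≤ R)]
      exact uIcc_subset_Icc ha hb)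
  have h1 : ∫ v in (-R)..0, |v| ^ r = R ^ (r + 1) / (r + 1) := by
    have := intervalIntegral.integral_comp_neg (a := 0) (b := R) (fun v => |v| ^ r)
    rw [neg_zero] at this
    rw [← this, ← h0]
    simp
  rw [← intervalIntegral.integral_add_adjacent_intervals (hsub (-R) 0 (by simp [hR]) (by simp [hR]))
    (hsub 0 R (by simp [hR]) (by simp [hR])), h0, h1]
  ring

theorem integral_abs_sub_rpow_le {r : ℝ} (hr : -1 < r) {R m : ℝ} (hm : |m| ≤ R) :
    IntervalIntegrable (fun v : ℝ => |m - v| ^ r) volume (-1) 1 ∧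
      ∫ v in (-1 : ℝ)..1, |m - v| ^ r ≤ 2 * ((R + 1) ^ (r + 1) / (r + 1)) := by
  have hm' := abs_le.1 hm
  have hI := integrable_abs_rpow hr (R + 1)
  have hs : IntervalIntegrable (fun v : ℝ => |v| ^ r) volume (m - 1) (m - -1) :=
    hI.mono_set (by
      rw [uIcc_of_le (by linarith), uIcc_of_le (by linarith)]
      exact Icc_subset_Icc (by linarith) (by linarith))
  constructor
  · simpa using (hs.comp_sub_left m).symm
  · rw [intervalIntegral.integral_comp_sub_left (fun v => |v| ^ r) m,
      ← integral_abs_rpow hr (by linarith)]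
    refine intervalIntegral.integral_mono_interval (by linarith) (by linarith) (by linarith)
      (ae_of_all _ fun v => by positivity) hI

/-- The punctured period. -/
def punct : Set ℝ := Ioo (-π) π \ {0}

theorem measurableSet_punct : MeasurableSet punct := measurableSet_Ioo.diff
    (measurableSet_singleton 0)

theorem punct_abs {y : ℝ} (hy : y ∈ punct) : 0 < |y| ∧ |y| ≤ π :=
  ⟨abs_pos.2 hy.2, (abs_lt.2 hy.1).le⟩

theorem integrableOn_punct_rpow {r : ℝ} (hr : -1 < r) :
    IntegrableOn (fun v : ℝ => |v| ^ r) punct := by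
  have h := integrable_abs_rpow hr π
  rw [intervalIntegrable_iff_integrableOn_Ioc_of_le (by linarith [pi_pos])] at h
  exact h.mono_set (sdiff_subset.trans Ioo_subset_Ioc_self)

theorem integral_punct_rpow_le {r : ℝ} (hr : -1 < r) :
    ∫ v in punct, |v| ^ r ≤ 2 * (π ^ (r + 1) / (r + 1)) := by
  have hpi := pi_pos
  rw [← integral_abs_rpow hr hpi.le, intervalIntegral.integral_of_le (by linarith)]
  have h := integrable_abs_rpow hr π
  rw [intervalIntegrable_iff_integrableOn_Ioc_of_le (by linarith)] at h
  exact setIntegral_mono_set h (ae_of_all _ fun v => by positivity)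
    (sdiff_subset.trans Ioo_subset_Ioc_self).eventuallyLE

theorem one_div_add_le_rpow {A B : ℝ} (hA : 0 < A) (hB : 0 < B) :
    1 / (A + B) ≤ 1 / 2 * (A ^ (-(1 / 2) : ℝ) * B ^ (-(1 / 2) : ℝ)) := by
  rw [rpow_neg hA.le, rpow_neg hB.le, ← sqrt_eq_rpow, ← sqrt_eq_rpow]
  have h1 := sqrt_pos.2 hA
  have h2 := sqrt_pos.2 hB
  rw [← mul_inv, ← one_div, ← one_div_mul_one_div_rev, one_div_mul_one_div_rev, div_mul_div_comm,
    one_mul]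
  refine one_div_le_one_div_of_le (by positivity) ?_
  nlinarith [sq_sqrt hA.le, sq_sqrt hB.le, sq_nonneg (√A - √B)]

/-- The basic integral bound over the values of the level sets. -/
theorem norm_integral_le_of_inv {E : Type*} [NormedAddCommGroup E] [NormedSpace ℝ E] {f : ℝ → E}
    {C q m y : ℝ} (hq : 0 < q) (hy : 0 < |y|)
    (hm : |m| ≤ 2) (hC : 0 ≤ C)
    (hf : ∀ m' ∈ Icc (-1 : ℝ) 1, ‖f m'‖ ≤ C / (|y| + q ^ 2 * |m - m'|)) :
    ‖∫ m' in Icc (-1 : ℝ) 1, f m'‖ ≤ C / q * (4 * |y| ^ (-(1 / 2) : ℝ)) := by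
  obtain ⟨hI, hle⟩ := integral_abs_sub_rpow_le (r := -(1 / 2)) (by norm_num) hm
  rw [intervalIntegrable_iff_integrableOn_Ioc_of_le (by norm_num)] at hI
  have hI' : IntegrableOn (fun v => |m - v| ^ (-(1 / 2) : ℝ)) (Icc (-1) 1) := by
    rwa [integrableOn_Icc_iff_integrableOn_Ioc]
  have h3 : 2 * ((2 + 1 : ℝ) ^ (-(1 / 2) + 1 : ℝ) / (-(1 / 2) + 1)) ≤ 7 := by
    have : (2 + 1 : ℝ) ^ (-(1 / 2) + 1 : ℝ) = √3 := by
      rw [sqrt_eq_rpow]; norm_num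
    rw [this]
    have : √3 ≤ 7 / 4 := by rw [sqrt_le_left (by norm_num)]; norm_num
    norm_num; linarith
  set c := C * (1 / 2 * (|y| ^ (-(1 / 2) : ℝ) * q⁻¹)) with hc
  calc _ ≤ ∫ m' in Icc (-1) 1, c * |m - m'| ^ (-(1 / 2) : ℝ) := by
        refine norm_integral_le_of_norm_le (hI'.const_mul c) ?_
        have hne : ∀ᵐ m' : ℝ ∂(volume.restrict (Icc (-1 : ℝ) 1)), m' ≠ m :=
          ae_restrict_of_ae (by simp [ae_iff])
        filter_upwards [ae_restrict_mem measurableSet_Icc, hne] with m' hm' hmm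
        refine (hf m' hm').trans ?_
        have hpos := abs_pos.2 (sub_ne_zero.2 hmm.symm)
        have := one_div_add_le_rpow hy (B := q ^ 2 * |m - m'|) (by positivity)
        rw [mul_rpow (by positivity) hpos.le] at this
        have e : (q ^ 2) ^ (-(1 / 2) : ℝ) = q⁻¹ := by
          rw [rpow_neg (by positivity), ← sqrt_eq_rpow, sqrt_sq hq.le]
        rw [e] at this
        calc C / (|y| + q ^ 2 * |m - m'|) = C * (1 / (|y| + q ^ 2 * |m - m'|)) := by ring
          _ ≤ C * (1 / 2 * (|y| ^ (-(1 / 2) : ℝ) * (q⁻¹ * |m - m'| ^ (-(1 / 2) : ℝ)))) := by gcongr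
          _ = _ := by rw [hc]; ring
    _ = c * ∫ m' in (-1)..1, |m - m'| ^ (-(1 / 2) : ℝ) := by
        rw [integral_const_mul, intervalIntegral.integral_of_le (by norm_num),
          integral_Icc_eq_integral_Ioc]
    _ ≤ c * 7 := by gcongr; exact hle.trans h3
    _ ≤ _ := by
        calc c * 7 = 7 / 2 * (C * q⁻¹ * |y| ^ (-(1 / 2) : ℝ)) := by rw [hc]; ring
          _ ≤ 4 * (C * q⁻¹ * |y| ^ (-(1 / 2) : ℝ)) := by gcongr; norm_num
          _ = _ := by ring

theorem norm_integral_integral_le {f : ℝ → ℝ → ℂ} {C q m : ℝ} (hq : 0 < q)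
    (hm : |m| ≤ 2) (hC : 0 ≤ C)
    (hf : ∀ y ∈ punct, ∀ m' ∈ Icc (-1 : ℝ) 1, ‖f y m'‖ ≤ C / (|y| + q ^ 2 * |m - m'|)) :
    ‖∫ y in punct, ∫ m' in Icc (-1 : ℝ) 1, f y m'‖ ≤ C / q * 32 := by
  have h3 : 2 * (π ^ (-(1 / 2) + 1 : ℝ) / (-(1 / 2) + 1)) ≤ 8 := by
    have : π ^ (-(1 / 2) + 1 : ℝ) = √π := by
      rw [sqrt_eq_rpow]; norm_num
    rw [this]
    have : √π ≤ 2 := by rw [sqrt_le_left (by norm_num)]; linarith [pi_lt_d2]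
    norm_num; linarith
  have hCq := div_nonneg hC hq.le
  calc _ ≤ ∫ y in punct, (C / q * 4) * |y| ^ (-(1 / 2) : ℝ) := by
        refine norm_integral_le_of_norm_le
          ((integrableOn_punct_rpow (r := -(1 / 2)) (by norm_num)).const_mul _) ?_
        filter_upwards [ae_restrict_mem measurableSet_punct] with y hy
        refine (norm_integral_le_of_inv hq (punct_abs hy).1 hm hC (hf y hy)).trans (le_of_eq ?_)
        ring
    _ = (C / q * 4) * ∫ y in punct, |y| ^ (-(1 / 2) : ℝ) := integral_const_mul _ _
    _ ≤ (C / q * 4) *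
      8 := by gcongr; exact (integral_punct_rpow_le (r := -(1 / 2)) (by norm_num)).trans h3
    _ = _ := by ring

/-- A curve that is regular and close to the base curve. -/
structure NearBase (σ η M : ℝ) (Γ : ℂ → ℂ) (c : Curve) : Prop where
  reg : CurveReg σ η c
  close : CurveClose σ η (16 * (1 + M))⁻¹ c (curveOf Γ baseJet)

/-- Standing assumptions on the parameters. -/
structure Params (σ η M : ℝ) (Γ : ℂ → ℂ) : Prop where
  ext : ExtBounds σ M Γ
  σ_le : σ ≤ 1
  η_pos : 0 < η
  η_le : η ≤ 1

theorem Params.base_reg {σ η M : ℝ} {Γ : ℂ → ℂ} (P : Params σ η M Γ) :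
    CurveReg σ η (curveOf Γ baseJet) :=
  curveReg_curveOf P.σ_le P.η_pos P.η_le le_rfl P.ext.diff (reg_baseJet _)
    (fun q z h _ => by simp)

theorem Params.radius_bounds {σ η M : ℝ} {Γ : ℂ → ℂ} (P : Params σ η M Γ) :
    0 < (16 * (1 + M))⁻¹ ∧ (16 * (1 + M))⁻¹ ≤ 1 := by
  have := P.ext.nonneg
  exact ⟨by positivity, inv_le_one_of_one_le₀ (by linarith)⟩

set_option maxHeartbeats 800000 in
theorem exists_integrand_bounds (M : ℝ) (hM : 0 ≤ M) : ∃ K : ℝ, 0 < K ∧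
    ∀ (σ η : ℝ) (Γ : ℂ → ℂ) (c : Curve), Params σ η M Γ → NearBase σ η M Γ c →
    ∀ (q m m' y : ℝ) (z : ℂ), (q, z, m) ∈ dom σ η → m' ∈ Icc (-1 : ℝ) 1 → y ∈ punct →
      kerDen y (c.a y m' q z m) ≠ 0 ∧
      (‖c.J y m' q z m‖ ≤ K / (|y| + q ^ 2 * |m - m'|) ∧
      ‖c.Jz y m' q z m‖ ≤ K * (1 / √(wid σ η q z)) / (|y| + q ^ 2 * |m - m'|) ∧
      ‖c.Jh y m' q z m‖ ≤ K * q ^ 2 * (1 / √(wid σ η q z)) / (|y| + q ^ 2 * |m - m'|)) ∧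
      ∀ (c' : Curve) (ν : ℝ), NearBase σ η M Γ c' → 0 ≤ ν → CurveClose σ η ν c c' →
      ‖c.J y m' q z m - c'.J y m' q z m‖ ≤ K * ν / (|y| + q ^ 2 * |m - m'|) ∧
      ‖c.Jz y m' q z m - c'.Jz y m' q z m‖
        ≤ K * ν * (1 / √(wid σ η q z)) / (|y| + q ^ 2 * |m - m'|) ∧
      ‖c.Jh y m' q z m - c'.Jh y m' q z m‖
        ≤ K * ν * q ^ 2 * (1 / √(wid σ η q z)) / (|y| + q ^ 2 * |m - m'|) := by
  obtain ⟨k, hk, hker⟩ := exists_ker_bounds (c := (32 * (1 + M) ^ 2)⁻¹) (A := M + 3)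
    (by positivity) (by linarith)
  set B := 2 * M + 4 with hB
  have hB0 : 0 ≤ B := by linarith
  refine ⟨k * B + 3 * k * B ^ 2 + k * B ^ 3, by positivity, ?_⟩
  set K := k * B + 3 * k * B ^ 2 + k * B ^ 3 with hK
  have hK2 : k * B + k * B ^ 2 ≤ K := by
    have : 0 ≤ 2 * k * B ^ 2 + k * B ^ 3 := by positivity
    linarith
  intro σ η Γ c P hc q m m' y z hp hm' hy
  have hm1 := abs_le.2 hm'
  have hm2 : |m'| < 2 := by linarith
  obtain ⟨hy0, hyπ⟩ := punct_abs hy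
  obtain ⟨r0, r1⟩ := P.radius_bounds
  set D := |y| + q ^ 2 * |m - m'| with hD
  have hD0 : 0 < D := by positivity
  have hyD : |y| ≤ D := le_add_of_nonneg_right (by positivity)
  have hden : ∀ c : Curve, NearBase σ η M Γ c → _ := fun c hc =>
    near_bounds P.η_pos P.η_le P.σ_le P.ext le_rfl hc.reg P.base_reg hc.close hp hm1 hyπ
  have hslope : ∀ c : Curve, NearBase σ η M Γ c → _ := fun c hc =>
    near_slope_bounds P.η_pos P.σ_le P.ext r1 hc.reg hc.close y hp hm1
  set S := 1 / √(wid σ η q z) with hS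
  obtain ⟨d1, d2, d3⟩ := hden c hc
  obtain ⟨s1, s2, s3, s4, s5⟩ := hslope c hc
  obtain ⟨k1, k2, -, -⟩ := hker y D _ _ hyD hD0 d3 d2 d2 d1 d1
  have hq2 := sq_nonneg q
  have hJ : ∀ c : Curve, c.J y m' q z m = kerD y (c.a y m' q z m) * 0 * 0 +
    ker y (c.a y m' q z m) * c.b y m' q z m := fun c => by simp [Curve.J]
  refine ⟨?_, ⟨?_, ?_, ?_⟩, ?_⟩
  · refine norm_pos_iff.1 (lt_of_lt_of_le ?_ d1)
    positivity
  · rw [hJ]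
    refine (norm_linearized_le (Λ := 1) hD0 zero_le_one hk.le hB0 k1 k2 (by simpa using hB0)
      (by rw [norm_zero]; positivity) (by simpa using s2)).trans ?_
    rw [mul_one, mul_one_div]; gcongr
  · refine (norm_linearized_le hD0 zero_le_one hk.le hB0 k1 k2 (by simpa using s2)
      s1 (by simpa using s3)).trans ?_
    rw [one_mul, ← mul_div_assoc]; gcongr
  · refine (norm_linearized_le hD0 hq2 hk.le hB0 k1 k2 s4 s1 s5).trans ?_
    rw [← mul_div_assoc, ← mul_assoc]; gcongr
  intro c' ν hc' hν hcl
  obtain ⟨d1', d2', d3'⟩ := hden c' hc'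
  obtain ⟨s1', s2', s3', s4', s5'⟩ := hslope c' hc'
  obtain ⟨-, -, k3, k4⟩ := hker y D _ _ hyD hD0 d3 d2 d2' d1 d1'
  obtain ⟨-, k2', -, -⟩ := hker y D _ _ hyD hD0 d3 d2' d2' d1' d1'
  obtain ⟨b1, b2, b3⟩ := hcl.b_le hc.reg hc'.reg y hp hm2
  obtain ⟨-, -, g3, g4⟩ := hcl q z m hp
  have hB2 : ∀ x : ℝ, 0 ≤ x → 2 * x ≤ B * x := fun x hx =>
    mul_le_mul_of_nonneg_right (by linarith) hx
  have hB1 : ∀ x : ℝ, 0 ≤ x → x ≤ B * x := fun x hx => le_mul_of_one_le_left hx (by linarith)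
  have ha' : ‖c.a y m' q z m - c'.a y m' q z m‖ ≤ B * D * ν :=
    ((hcl.a_le hc.reg hc'.reg y hp hm2).trans (hB1 _ (by positivity))).trans (le_of_eq (by ring))
  have b1' : ‖c.b y m' q z m - c'.b y m' q z m‖ ≤ B * D * S * ν :=
    (b1.trans (hB1 _ (by positivity))).trans (le_of_eq (by ring))
  have b2' : ‖c.b y m' q z m - c'.b y m' q z m‖ ≤ B * 1 * ν :=
    (b2.trans (hB2 _ hν)).trans (le_of_eq (by ring))
  have g4' : ‖c.uh q z m - c'.uh q z m‖ ≤ B * q ^ 2 * S * ν := by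
    rw [div_eq_mul_one_div] at g4
    exact (g4.trans (hB1 _ (by positivity))).trans (le_of_eq (by ring))
  refine ⟨?_, ?_, ?_⟩
  · rw [hJ, hJ]
    refine (norm_linearized_sub_le (Λ := 1) hD0 zero_le_one hν hk.le hB0 ha' k1 k2'
      k3 k4 (by simpa using hB0) (by simpa using hB0) (by rw [norm_zero]; positivity)
      (by simpa using s2') (by rw [sub_zero, norm_zero]; positivity)
      (by rw [sub_zero, norm_zero]; positivity) (by simpa using b2')).trans (le_of_eq ?_)
    ring
  · refine (norm_linearized_sub_le hD0 zero_le_one hν hk.le hB0 ha' k1 k2'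
      k3 k4 (by simpa using s2) (by simpa using s2') s1 (by simpa using s3') b2' b1'
        ((b3.trans ((le_of_eq (by ring)).trans (hB2 (ν * S) (by positivity)))).trans
        (le_of_eq (by ring)))).trans
      (le_of_eq ?_)
    ring
  · refine (norm_linearized_sub_le hD0 hq2 hν hk.le hB0 ha' k1 k2'
      k3 k4 s4 s4' s1 s5' ((g3.trans (hB1 _ (by positivity))).trans (le_of_eq (by ring))) b1'
        g4').trans (le_of_eq ?_)
    ring

theorem integrable_of_inv_bound {f : ℝ → ℝ → ℂ} {C q m : ℝ} (hq : 0 < q) (hm : |m| ≤ 2) (hC : 0 ≤ C)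
    (hc : ContinuousOn (fun r : ℝ × ℝ => f r.1 r.2) (punct ×ˢ Icc (-1) 1))
    (hf : ∀ y ∈ punct, ∀ m' ∈ Icc (-1 : ℝ) 1, ‖f y m'‖ ≤ C / (|y| + q ^ 2 * |m - m'|)) :
    (∀ y ∈ punct, IntegrableOn (f y) (Icc (-1) 1)) ∧
      IntegrableOn (fun y => ∫ m' in Icc (-1 : ℝ) 1, f y m') punct := by
  constructor
  · refine fun y hy => ContinuousOn.integrableOn_Icc ?_
    have h1 : ContinuousOn (fun m' : ℝ => (y, m')) (Icc (-1) 1) := by fun_prop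
    exact hc.comp h1 fun m' hm' => ⟨hy, hm'⟩
  · have hms : AEStronglyMeasurable (fun r => f r.1 r.2)
        ((volume.restrict punct).prod (volume.restrict (Icc (-1) 1))) := by
      rw [Measure.prod_restrict]
      exact hc.aestronglyMeasurable (measurableSet_punct.prod measurableSet_Icc)
    refine Integrable.mono'
      ((integrableOn_punct_rpow (r := -(1 / 2)) (by norm_num)).const_mul (C / q * 4))
      hms.integral_prod_right' ?_
    filter_upwards [ae_restrict_mem measurableSet_punct] with y hy
    refine (norm_integral_le_of_inv hq (punct_abs hy).1 hm hC (hf y hy)).trans (le_of_eq ?_)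
    ring

theorem norm_double_integral_sub_le {f g : ℝ → ℝ → ℂ} {C C' q m : ℝ} (hq : 0 < q) (hm : |m| ≤ 2)
    (hC : 0 ≤ C) (hC' : 0 ≤ C')
    (hfc : ContinuousOn (fun r : ℝ × ℝ => f r.1 r.2) (punct ×ˢ Icc (-1) 1))
    (hgc : ContinuousOn (fun r : ℝ × ℝ => g r.1 r.2) (punct ×ˢ Icc (-1) 1))
    (hf : ∀ y ∈ punct, ∀ m' ∈ Icc (-1 : ℝ) 1, ‖f y m'‖ ≤ C / (|y| + q ^ 2 * |m - m'|))
    (hg : ∀ y ∈ punct, ∀ m' ∈ Icc (-1 : ℝ) 1, ‖g y m'‖ ≤ C / (|y| + q ^ 2 * |m - m'|))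
    (hfg : ∀ y ∈ punct, ∀ m' ∈ Icc (-1 : ℝ) 1,
      ‖f y m' - g y m'‖ ≤ C' / (|y| + q ^ 2 * |m - m'|)) :
    ‖(∫ y in punct, ∫ m' in Icc (-1 : ℝ) 1, f y m') - ∫ y in punct, ∫ m' in Icc (-1 : ℝ) 1, g y m'‖
      ≤ C' / q * 32 := by
  obtain ⟨f1, f2⟩ := integrable_of_inv_bound hq hm hC hfc hf
  obtain ⟨g1, g2⟩ := integrable_of_inv_bound hq hm hC hgc hg
  have e : (∫ y in punct, ∫ m' in Icc (-1) 1, f y m')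
      - ∫ y in punct, ∫ m' in Icc (-1) 1, g y m'
      = ∫ y in punct, ∫ m' in Icc (-1) 1, (f y m' - g y m') := by
    rw [← integral_sub f2 g2]
    exact setIntegral_congr_fun measurableSet_punct fun y hy =>
      ((integral_sub (f1 y hy) (g1 y hy)).symm)
  rw [e]
  exact norm_integral_integral_le hq hm hC' hfg

/-- The velocity of the level sets of a curve. -/
def stepJet (c : Curve) : Jet where
  val q z h := 4 * q * h - 2 * q * ∫ y in punct, ∫ m in Icc (-1 : ℝ) 1, c.J y m q z h
  dz q z h := -(2 * q * ∫ y in punct, ∫ m in Icc (-1 : ℝ) 1, c.Jz y m q z h)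
  dh q z h := 4 * q - 2 * q * ∫ y in punct, ∫ m in Icc (-1 : ℝ) 1, c.Jh y m q z h

section Step

variable {σ η M : ℝ} {Γ : ℂ → ℂ} {c c' : Curve}

theorem continuousOn_integrands (hc : CurveReg σ η c) {q h : ℝ} {z : ℂ} (hp : (q, z, h) ∈ dom σ η)
    (hden : ∀ y ∈ punct, ∀ m ∈ Icc (-1 : ℝ) 1, kerDen y (c.a y m q z h) ≠ 0) :
    ContinuousOn (fun r : ℝ × ℝ => c.J r.1 r.2 q z h) (punct ×ˢ Icc (-1) 1) ∧
    ContinuousOn (fun r : ℝ × ℝ => c.Jz r.1 r.2 q z h) (punct ×ˢ Icc (-1) 1) ∧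
    ContinuousOn (fun r : ℝ × ℝ => c.Jh r.1 r.2 q z h) (punct ×ˢ Icc (-1) 1) := by
  have hm : ContinuousOn (fun r : ℝ × ℝ => (q, z - (r.1 : ℂ), r.2)) (punct ×ˢ Icc (-1) 1) := by
    fun_prop
  have hmaps : MapsTo (fun r : ℝ × ℝ => (q, z - (r.1 : ℂ), r.2)) (punct ×ˢ Icc (-1) 1)
      (dom σ η) := fun r hr => dom_shift r.1 (lt_of_le_of_lt (abs_le.2 hr.2) (by norm_num)) hp
  have ca : ContinuousOn (fun r : ℝ × ℝ => c.a r.1 r.2 q z h) (punct ×ˢ Icc (-1) 1) :=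
    continuousOn_const.sub (hc.reg.cont.comp hm hmaps)
  have cb : ContinuousOn (fun r : ℝ × ℝ => c.b r.1 r.2 q z h) (punct ×ˢ Icc (-1) 1) :=
    continuousOn_const.sub (hc.reg_u.cont.comp hm hmaps)
  have cp :=
    continuousOn_fst.prodMk ca
  have hmp : MapsTo (fun r : ℝ × ℝ => (r.1, c.a r.1 r.2 q z h)) (punct ×ˢ Icc (-1) 1)
      {p | kerDen p.1 p.2 ≠ 0} := fun r hr => hden r.1 hr.1 r.2 hr.2
  have ck := continuousOn_ker.comp cp hmp
  have ck' := continuousOn_kerD.comp cp hmp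
  exact ⟨ck.mul cb,
    ((ck'.mul cb).mul cb).add (ck.mul (continuousOn_const.sub (hc.reg_u.cont_z.comp hm hmaps))),
    ((ck'.mul continuousOn_const).mul cb).add (ck.mul continuousOn_const)⟩

theorem reg_integrand (hc : CurveReg σ η c) {y m : ℝ} (hm : |m| < 2)
    (hden : ∀ q z h, (q, z, h) ∈ dom σ η → kerDen y (c.a y m q z h) ≠ 0) :
    Reg (dom σ η) (c.J y m) (c.Jz y m) (c.Jh y m) := by
  have ra :=
    (hc.reg.sub (hc.reg.shift y m fun q z h hp => dom_shift y hm hp)).congr_derivs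
      (fun _ _ _ => rfl) (fun _ _ _ => sub_zero _)
  have rb :=
    (hc.reg_u.sub (hc.reg_u.shift y m fun q z h hp => dom_shift y hm hp)).congr_derivs
      (fun _ _ _ => rfl) (fun _ _ _ => sub_zero _)
  have hO : ContinuousOn (kerD y) {a | kerDen y a ≠ 0} := by
    have h1 : ContinuousOn (fun a => (y, a)) {a | kerDen y a ≠ 0} := by fun_prop
    have h3 := continuousOn_kerD.comp h1 (fun a ha => ha)
    exact h3
  have rk := ra.comp
    (fun a ha => hasDerivAt_ker ha) hO hden
  exact (rk.mul rb).congr_derivs (fun _ _ _ => rfl) (fun _ _ _ => rfl)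

theorem exists_nhds_weight (P : Params σ η M Γ) {q h : ℝ} {z : ℂ} (hp : (q, z, h) ∈ dom σ η) :
    ∃ V ∈ 𝓝 (q, z, h), V ⊆ dom σ η ∧ ∃ S : ℝ, 1 ≤ S ∧ ∀ p ∈ V, 1 / √(wid σ η p.1 p.2.1) ≤ S ∧
      q / 2 ≤ p.1 := by
  have hs := wid_pos hp
  have hcw : Continuous fun p : ℝ × ℂ × ℝ => wid σ η p.1 p.2.1 := by
    have : Continuous fun p : ℝ × ℂ × ℝ => p.2.1.im := by fun_prop
    exact (continuous_const.sub this.abs).sub (continuous_fst.div_const _)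
  have hV : {p : ℝ × ℂ × ℝ | wid σ η q z / 2 < wid σ η p.1 p.2.1} ∈ 𝓝 (q, z, h) :=
    (isOpen_lt continuous_const hcw).mem_nhds (by simpa using hs)
  have hV' : {p : ℝ × ℂ × ℝ | q / 2 < p.1} ∈ 𝓝 (q, z, h) :=
    (isOpen_lt continuous_const continuous_fst).mem_nhds (by
      have := hp.1
      simpa using this)
  refine ⟨_, inter_mem (inter_mem hV hV') ((isOpen_dom σ η).mem_nhds hp), inter_subset_right,
    1 / √(wid σ η q z / 2), ?_, fun p hp' => ⟨?_, le_of_lt hp'.1.2⟩⟩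
  · exact (one_div_sqrt_le (by positivity) (by
      linarith [wid_le_one P.σ_le P.η_pos hp])).1
  · have : wid σ η q z / 2 < wid σ η p.1 p.2.1 := hp'.1.1
    gcongr

theorem reg_stepJet {K : ℝ} (hK0 : 0 < K) (P : Params σ η M Γ) (hc : CurveReg σ η c)
    (hK : ∀ (q m m' y : ℝ) (z : ℂ), (q, z, m) ∈ dom σ η → m' ∈ Icc (-1 : ℝ) 1 → y ∈ punct →
      kerDen y (c.a y m' q z m) ≠ 0 ∧
      (‖c.J y m' q z m‖ ≤ K / (|y| + q ^ 2 * |m - m'|) ∧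
      ‖c.Jz y m' q z m‖ ≤ K * (1 / √(wid σ η q z)) / (|y| + q ^ 2 * |m - m'|) ∧
      ‖c.Jh y m' q z m‖ ≤ K * q ^ 2 * (1 / √(wid σ η q z)) / (|y| + q ^ 2 * |m - m'|))) :
    Reg (dom σ η) (stepJet c).val (stepJet c).dz (stepJet c).dh := by
  have hcont := fun p (hp : p ∈ dom σ η) => continuousOn_integrands hc
    hp
    (fun y hy m hm => (hK _ _ m y _ hp hm hy).1)
  have hloc : ∀ p ∈ dom σ η, ∃ V ∈ 𝓝 p, V ⊆ dom σ η ∧ ∃ S : ℝ, 0 ≤ S ∧ ∀ p' ∈ V, p.1 / 2 ≤ p'.1 ∧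
      ∀ y ∈ punct, ∀ m' ∈ Icc (-1) 1,
        ‖c.J y m' p'.1 p'.2.1 p'.2.2‖ ≤ S / (|y| + p'.1 ^ 2 * |p'.2.2 - m'|) ∧
        ‖c.Jz y m' p'.1 p'.2.1 p'.2.2‖ ≤ S / (|y| + p'.1 ^ 2 * |p'.2.2 - m'|) ∧
        ‖c.Jh y m' p'.1 p'.2.1 p'.2.2‖ ≤ S / (|y| + p'.1 ^ 2 * |p'.2.2 - m'|) := by
    rintro ⟨q, z, h⟩ hp
    obtain ⟨V, hV, hVs, S, hS1, hS⟩ := exists_nhds_weight P hp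
    refine ⟨V, hV, hVs, K * S, by positivity, fun p' hp' => ⟨(hS p' hp').2, fun y hy m' hm' => ?_⟩⟩
    obtain ⟨-, h1, h2, h3⟩ := hK p'.1 p'.2.2 m' y p'.2.1 (hVs hp') hm' hy
    have hq1 := (dom_le_one P.σ_le P.η_pos P.η_le (hVs hp')).2
    have hq0 := (hVs hp').1
    have hS' := (hS p' hp').1
    refine ⟨h1.trans ?_, h2.trans ?_, h3.trans ?_⟩
    · gcongr; nlinarith
    · gcongr
    · gcongr
      exact mul_le_of_le_one_right hK0.le (pow_le_one₀ hq0.le hq1)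
  have hinner : ∀ y ∈ punct, Reg (dom σ η) (fun q z h => ∫ m in Icc (-1) 1, c.J y m q z h)
      (fun q z h => ∫ m in Icc (-1) 1, c.Jz y m q z h)
      (fun q z h => ∫ m in Icc (-1) 1, c.Jh y m q z h) := by
    intro y hy
    have hcm : ContinuousOn (fun m' : ℝ => (y, m')) (Icc (-1) 1) := by fun_prop
    have hmm : MapsTo (fun m' : ℝ => (y, m')) (Icc (-1) 1) (punct ×ˢ Icc (-1 : ℝ) 1) :=
      fun m' hm' => ⟨hy, hm'⟩
    refine Reg.integral (isOpen_dom σ η) ?_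
      (fun p hp => ((hcont p hp).1.comp hcm hmm).aestronglyMeasurable measurableSet_Icc)
      (fun p hp => ((hcont p hp).2.1.comp hcm hmm).aestronglyMeasurable measurableSet_Icc)
      (fun p hp => ((hcont p hp).2.2.comp hcm hmm).aestronglyMeasurable measurableSet_Icc) ?_
    · filter_upwards [ae_restrict_mem measurableSet_Icc] with m hm using reg_integrand hc
        (lt_of_le_of_lt (abs_le.2 hm) (by norm_num))
        fun q z h hp => (hK q h m y z hp hm hy).1
    · intro p hp
      obtain ⟨V, hV, -, S, hS0, hS⟩ := hloc p hp
      refine ⟨V, hV, fun _ => S / |y|, integrable_const _, ?_⟩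
      filter_upwards [ae_restrict_mem measurableSet_Icc] with m hm p' hp'
      obtain ⟨-, h1⟩ := hS p' hp'
      obtain ⟨h1, h2, h3⟩ := h1 y hy m hm
      have hy0 := (punct_abs hy).1
      have hle : S / (|y| + p'.1 ^ 2 * |p'.2.2 - m|) ≤ S / |y| := by
        gcongr; exact le_add_of_nonneg_right (by positivity)
      exact ⟨h1.trans hle, h2.trans hle, h3.trans hle⟩
  have hms : ∀ F : ℝ × ℝ → ℂ, ContinuousOn F (punct ×ˢ Icc (-1) 1) →
      AEStronglyMeasurable (fun y => ∫ m in Icc (-1) 1, F (y, m)) (volume.restrict punct) := by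
    intro F hF
    have : AEStronglyMeasurable F
        ((volume.restrict punct).prod (volume.restrict (Icc (-1) 1))) := by
      rw [Measure.prod_restrict]
      exact hF.aestronglyMeasurable (measurableSet_punct.prod measurableSet_Icc)
    exact this.integral_prod_right'
  have houter : Reg (dom σ η) (fun q z h => ∫ y in punct, ∫ m in Icc (-1) 1, c.J y m q z h)
      (fun q z h => ∫ y in punct, ∫ m in Icc (-1) 1, c.Jz y m q z h)
      (fun q z h => ∫ y in punct, ∫ m in Icc (-1) 1, c.Jh y m q z h) := by
    refine Reg.integral

      (isOpen_dom σ η) ?_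
      (fun p hp => hms _ (hcont p hp).1) (fun p hp => hms _ (hcont p hp).2.1)
      (fun p hp => hms _ (hcont p hp).2.2) ?_
    · filter_upwards [ae_restrict_mem measurableSet_punct] with y hy using hinner y hy
    · intro p hp
      obtain ⟨V, hV, hVs, S, hS0, hS⟩ := hloc p hp
      have hq0 := hp.1
      refine ⟨V, hV, fun y => S / (p.1 / 2) * 4 * |y| ^ (-(1 / 2) : ℝ),
        (integrableOn_punct_rpow (by norm_num)).const_mul _, ?_⟩
      filter_upwards [ae_restrict_mem measurableSet_punct] with y hy p' hp'
      obtain ⟨hq, h1⟩ := hS p' hp'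
      have hq' := (hVs hp').1
      have hm := (hVs hp').2.2.le
      have hy0 := (punct_abs hy).1
      have hle : S / p'.1 * (4 * |y| ^ (-(1 / 2) : ℝ))
          ≤ S / (p.1 / 2) * 4 * |y| ^ (-(1 / 2) : ℝ) := by
        rw [← mul_assoc]; gcongr
      exact ⟨(norm_integral_le_of_inv hq' hy0 hm hS0 fun m hm => (h1 y hy m hm).1).trans hle,
        (norm_integral_le_of_inv hq' hy0 hm hS0 fun m hm => (h1 y hy m hm).2.1).trans hle,
        (norm_integral_le_of_inv hq' hy0 hm hS0 fun m hm => (h1 y hy m hm).2.2).trans hle⟩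
  exact ((reg_baseJet (dom σ η)).sub (houter.smul_time (by fun_prop))).congr_derivs
    (fun _ _ _ => zero_sub _) (fun _ _ _ => rfl)

/-- The step map is Lipschitz from curves to jets. -/
theorem exists_step_bounds (M : ℝ) (hM : 0 ≤ M) : ∃ K : ℝ, 0 < K ∧
    ∀ (σ η : ℝ) (Γ : ℂ → ℂ) (c : Curve), Params σ η M Γ → NearBase σ η M Γ c →
      Reg (dom σ η) (stepJet c).val (stepJet c).dz (stepJet c).dh ∧
      JetClose σ η K (stepJet c) baseJet ∧
      ∀ (c' : Curve) (ν : ℝ), NearBase σ η M Γ c' → 0 ≤ ν → CurveClose σ η ν c c' →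
        JetClose σ η (K * ν) (stepJet c) (stepJet c') := by
  obtain ⟨K, hK0, hK⟩ := exists_integrand_bounds M hM
  refine ⟨64 *
    K, by positivity, fun σ η Γ c P hc => ⟨(reg_stepJet hK0 P hc.reg fun q m m' y z hp hm' hy => ⟨(hK σ η Γ c P hc q m m' y z hp hm' hy).1, (hK σ η Γ c P hc q m m' y z hp hm' hy).2.1⟩), ?_, ?_⟩⟩
  · intro q z m hp
    have hq0 := hp.1
    have hm := hp.2.2.le
    have hb := fun y hy m' hm' => (hK σ η Γ c P hc q m m' y z hp hm' hy).2.1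
    have hn : ‖(2 * q : ℂ)‖ = 2 * q := by
      rw [norm_mul, Complex.norm_real, norm_of_nonneg hq0.le]; simp
    have hS0 : 0 ≤ 1 / √(wid σ η q z) := by positivity
    refine ⟨?_, ?_, ?_⟩
    · have := norm_integral_integral_le hq0 hm hK0.le fun y hy m' hm' => (hb y hy m' hm').1
      simp only [stepJet, baseJet, sub_sub_cancel_left, norm_neg, norm_mul _ (∫ _ in _, _), hn]
      calc _ ≤ 2 * q * (K / q * 32) := by gcongr
        _ = _ := by field_simp; ring
    · have := norm_integral_integral_le hq0 hm (by positivity)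
        fun y hy m' hm' => (hb y hy m' hm').2.1
      simp only [stepJet, baseJet, sub_zero, norm_neg, norm_mul _ (∫ _ in _, _), hn]
      calc _ ≤ 2 * q * (K * (1 / √(wid σ η q z)) / q * 32) := by gcongr
        _ = _ := by field_simp; ring
    · have := norm_integral_integral_le hq0 hm (by positivity)
        fun y hy m' hm' => (hb y hy m' hm').2.2
      simp only [stepJet, baseJet, sub_sub_cancel_left, norm_neg, norm_mul _ (∫ _ in _, _), hn]
      calc _ ≤ 2 * q * (K * q ^ 2 * (1 / √(wid σ η q z)) / q * 32) := by gcongr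
        _ = _ := by field_simp; ring
  · intro c' ν hc' hν hcl q z m hp
    have hq0 := hp.1
    have hm := hp.2.2.le
    have hb := fun y hy m' hm' => hK σ η Γ c P hc q m m' y z hp hm' hy
    have hb' := fun y hy m' hm' => hK σ η Γ c' P hc' q m m' y z hp hm' hy
    have hd := fun y hy m' hm' => (hb y hy m' hm').2.2 c' ν hc' hν hcl
    obtain ⟨c1, c2, c3⟩ := continuousOn_integrands hc.reg hp fun y hy m' hm' => (hb y hy m' hm').1
    obtain ⟨c1', c2', c3'⟩ := continuousOn_integrands hc'.reg hp
      fun y hy m' hm' => (hb' y hy m' hm').1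
    have hn : ‖(2 * q : ℂ)‖ = 2 * q := by
      rw [norm_mul, Complex.norm_real, norm_of_nonneg hq0.le]; simp
    refine ⟨?_, ?_, ?_⟩
    · have := norm_double_integral_sub_le hq0 hm hK0.le (by positivity) c1 c1'
        (fun y hy m' hm' => (hb y hy m' hm').2.1.1) (fun y hy m' hm' => (hb' y hy m' hm').2.1.1)
        (fun y hy m' hm' => (hd y hy m' hm').1)
      simp only [stepJet, sub_sub_sub_cancel_left]
      rw [← mul_sub, norm_mul, hn, norm_sub_rev]
      calc _ ≤ 2 * q * (K * ν / q * 32) := by gcongr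
        _ = _ := by field_simp; ring
    · have := norm_double_integral_sub_le hq0 hm (by positivity) (by positivity) c2 c2'
        (fun y hy m' hm' => (hb y hy m' hm').2.1.2.1)
        (fun y hy m' hm' => (hb' y hy m' hm').2.1.2.1) (fun y hy m' hm' => (hd y hy m' hm').2.1)
      simp only [stepJet, neg_sub_neg]
      rw [← mul_sub, norm_mul, hn, norm_sub_rev]
      calc _ ≤ 2 * q * (K * ν * (1 / √(wid σ η q z)) / q * 32) := by gcongr
        _ = _ := by field_simp; ring
    · have := norm_double_integral_sub_le hq0 hm (by positivity) (by positivity) c3 c3'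
        (fun y hy m' hm' => (hb y hy m' hm').2.1.2.2)
        (fun y hy m' hm' => (hb' y hy m' hm').2.1.2.2) (fun y hy m' hm' => (hd y hy m' hm').2.2)
      simp only [stepJet, sub_sub_sub_cancel_left]
      rw [← mul_sub, norm_mul, hn, norm_sub_rev]
      calc _ ≤ 2 * q * (K * ν * q ^ 2 * (1 / √(wid σ η q z)) / q * 32) := by gcongr
        _ = _ := by field_simp; ring

end Step

theorem tendstoLocallyUniformlyOn_of_geometric {X : Type*} [TopologicalSpace X] {s : Set X}
    {f : ℕ → X → ℂ} {g : X → ℂ} {w : X → ℝ} (hw : ContinuousOn w s)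
    (h : ∀ n, ∀ x ∈ s, ‖f n x - g x‖ ≤ w x / 2 ^ n) : TendstoLocallyUniformlyOn f g atTop s := by
  rw [tendstoLocallyUniformlyOn_iff]
  intro ε hε x hx
  have hW : ∀ᶠ x' in 𝓝[s] x, w x' < |w x| + 1 :=
    (hw x hx).eventually (gt_mem_nhds (by linarith [le_abs_self (w x)]))
  refine ⟨_, inter_mem hW self_mem_nhdsWithin, ?_⟩
  filter_upwards
    [(tendsto_const_nhds.div_atTop (tendsto_pow_atTop_atTop_of_one_lt one_lt_two)).eventually
    (gt_mem_nhds hε)] with n hn x' hx'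
  rw [dist_comm, dist_eq_norm]
  refine (h n x' hx'.2).trans_lt (lt_of_le_of_lt ?_ hn)
  have : w x' < |w x| + 1 := hx'.1
  gcongr

/-- A geometrically convergent sequence of regular jets has a regular limit. -/
theorem exists_jet_limit {σ η N : ℝ} {e : ℕ → Jet}
    (hreg : ∀ n, Reg (dom σ η) (e n).val (e n).dz (e n).dh)
    (hcl : ∀ n, JetClose σ η (N / 2 ^ n) (e n) (e (n + 1))) :
    ∃ E : Jet, Reg (dom σ η) E.val E.dz E.dh ∧ (∀ n, JetClose σ η (2 * N / 2 ^ n) (e n) E) ∧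
      ∀ q z h, (q, z, h) ∈ dom σ η →
        Tendsto (fun n => (e n).val q z h) atTop (𝓝 (E.val q z h)) := by
  have key : ∀ (f : ℕ → ℂ) (w : ℝ), (∀ n, ‖f n - f (n + 1)‖ ≤ N / 2 ^ n * w) →
      Tendsto f atTop (𝓝 (limUnder atTop f)) ∧
      ∀ n, ‖f n - limUnder atTop f‖ ≤ 2 * N / 2 ^ n * w := by
    intro f w hf
    have hf' : ∀ n, dist (f n) (f (n + 1)) ≤ (2 * N * w) / 2 / 2 ^ n := by
      intro n; rw [dist_eq_norm]; refine (hf n).trans (le_of_eq ?_); ring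
    have hc := cauchySeq_of_le_geometric_two hf'
    have ht := CauchySeq.tendsto_limUnder hc
    refine ⟨ht, fun n => ?_⟩
    have := dist_le_of_le_geometric_two_of_tendsto hf' ht n
    rw [dist_eq_norm] at this
    refine this.trans (le_of_eq ?_); ring
  let E : Jet := ⟨fun q z h => limUnder atTop fun n => (e n).val q z h,
    fun q z h => limUnder atTop fun n => (e n).dz q z h,
    fun q z h => limUnder atTop fun n => (e n).dh q z h⟩
  have k1 := fun q z h hp =>
    key (fun n => (e n).val q z h) 1 fun n => by
      rw [mul_one]; exact (hcl n q z h hp).1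
  have k2 := fun q z h hp =>
    key (fun n => (e n).dz q z h) (1 / √(wid σ η q z)) fun n => by
      rw [mul_one_div]; exact (hcl n q z h hp).2.1
  have k3 := fun q z h hp =>
    key (fun n => (e n).dh q z h) (q ^ 2 / √(wid σ η q z)) fun n => by
      rw [← mul_div_assoc]; exact (hcl n q z h hp).2.2
  have hw0 : ContinuousOn (fun p => 1 / √(wid σ η p.1 p.2.1)) (dom σ η) := by
    have hcw : Continuous fun p : ℝ × ℂ × ℝ => wid σ η p.1 p.2.1 := by
      have : Continuous fun p : ℝ × ℂ × ℝ => p.2.1.im := by fun_prop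
      exact (continuous_const.sub this.abs).sub (continuous_fst.div_const _)
    exact continuousOn_const.div hcw.sqrt.continuousOn
      fun p hp => (sqrt_pos.2 (wid_pos hp)).ne'
  have hw2 : ContinuousOn (fun p : ℝ × ℂ × ℝ => 2 * N * (1 / √(wid σ η p.1 p.2.1))) (dom σ η) :=
    continuousOn_const.mul hw0
  have hw3 : ContinuousOn (fun p : ℝ × ℂ × ℝ => 2 * N * (p.1 ^ 2 * (1 / √(wid σ η p.1 p.2.1))))
      (dom σ η) :=
    continuousOn_const.mul (ContinuousOn.mul (by fun_prop) hw0)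
  have b2 : ∀ n, ∀ p ∈ dom σ η, ‖(e n).dz p.1 p.2.1 p.2.2 - E.dz p.1 p.2.1 p.2.2‖
      ≤ 2 * N * (1 / √(wid σ η p.1 p.2.1)) / 2 ^ n := fun n p hp =>
    ((k2 p.1 p.2.1 p.2.2 hp).2 n).trans (le_of_eq (by ring))
  have b3 : ∀ n, ∀ p ∈ dom σ η, ‖(e n).dh p.1 p.2.1 p.2.2 - E.dh p.1 p.2.1 p.2.2‖
      ≤ 2 * N * (p.1 ^ 2 * (1 / √(wid σ η p.1 p.2.1))) / 2 ^ n := fun n p hp =>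
    ((k3 p.1 p.2.1 p.2.2 hp).2 n).trans (le_of_eq (by ring))
  refine ⟨E, ⟨?_, ?_, ?_, ?_, ?_⟩, ?_, fun q z h hp => (k1 q z h hp).1⟩
  · exact TendstoLocallyUniformlyOn.continuousOn

      (tendstoLocallyUniformlyOn_of_geometric (w := fun _ => 2 * N) continuousOn_const
        fun n p hp => (((k1 p.1 p.2.1 p.2.2 hp).2 n).trans (le_of_eq (by ring))))
          (Frequently.of_forall fun n => (hreg n).cont)
  · exact TendstoLocallyUniformlyOn.continuousOn

      (tendstoLocallyUniformlyOn_of_geometric hw2 b2)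
        (Frequently.of_forall fun n => (hreg n).cont_z)
  · exact TendstoLocallyUniformlyOn.continuousOn

      (tendstoLocallyUniformlyOn_of_geometric hw3 b3)
        (Frequently.of_forall fun n => (hreg n).cont_h)
  · intro q z h hp
    have hco : Continuous fun w : ℂ => (q, w, h) := by fun_prop
    have hO := (isOpen_dom σ η).preimage hco
    refine hasDerivAt_of_tendstoLocallyUniformlyOn hO
      (f' := fun n w => (e n).dz q w h)
      (tendstoLocallyUniformlyOn_of_geometric (hw2.comp hco.continuousOn (mapsTo_preimage _ _))
        fun n w hw => b2 n _ hw)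
      (Eventually.of_forall fun n w hw => (hreg n).dz q w h hw)
      (fun w hw => (k1 q w h hw).1) hp
  · intro q z h hp
    have hco : Continuous fun w : ℝ => (q, z, w) := by fun_prop
    have hO := (isOpen_dom σ η).preimage hco
    refine hasDerivAt_of_tendstoLocallyUniformlyOn hO
      (f' := fun n w => (e n).dh q z w)
      (tendstoLocallyUniformlyOn_of_geometric (hw3.comp hco.continuousOn (mapsTo_preimage _ _))
        fun n w hw => b3 n _ hw)
      (Eventually.of_forall fun n w hw => (hreg n).dh q z w hw)
      (fun w hw => (k1 q z w hw).1) hp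
  · refine fun n q z h hp => ⟨((k1 q z h hp).2 n).trans (le_of_eq (by ring)),
      ((k2 q z h hp).2 n).trans (le_of_eq (by ring)),
      ((k3 q z h hp).2 n).trans (le_of_eq (by ring))⟩

/-- `2π`-periodicity and symmetry under conjugation. -/
def SymFun (f : ℂ → ℂ) : Prop :=
  (∀ z, f (z + 2 * π) = f z) ∧ ∀ z, f (starRingEnd ℂ z) = starRingEnd ℂ (f z)

theorem SymFun.deriv {f : ℂ → ℂ} (hf : SymFun f) : SymFun (deriv f) := by
  constructor
  · intro z
    rw [← (deriv_comp_add_const f (2 * π : ℂ) z)]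
    congr 1
    ext w; exact hf.1 w
  · intro z
    have h1 : (starRingEnd ℂ ∘ f ∘ starRingEnd ℂ) = f := by
      ext w; simp [hf.2 w]
    conv_lhs => rw [← h1]
    rw [deriv_conj_conj]
    simp

theorem SymFun.add {f g : ℂ → ℂ} (hf : SymFun f) (hg : SymFun g) : SymFun fun z => f z + g z :=
  ⟨fun z => by beta_reduce; rw [hf.1, hg.1], fun z => by beta_reduce; rw [hf.2, hg.2, map_add]⟩

theorem SymFun.sub {f g : ℂ → ℂ} (hf : SymFun f) (hg : SymFun g) : SymFun fun z => f z - g z :=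
  ⟨fun z => by beta_reduce; rw [hf.1, hg.1], fun z => by beta_reduce; rw [hf.2, hg.2, map_sub]⟩

theorem SymFun.mul {f g : ℂ → ℂ} (hf : SymFun f) (hg : SymFun g) : SymFun fun z => f z * g z :=
  ⟨fun z => by beta_reduce; rw [hf.1, hg.1], fun z => by beta_reduce; rw [hf.2, hg.2, map_mul]⟩

theorem SymFun.neg {f : ℂ → ℂ} (hf : SymFun f) : SymFun fun z => -f z :=
  ⟨fun z => by beta_reduce; rw [hf.1], fun z => by beta_reduce; rw [hf.2, map_neg]⟩

theorem SymFun.const (r : ℝ) : SymFun fun _ => (r : ℂ) :=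
  ⟨fun _ => rfl, fun _ => by beta_reduce; rw [Complex.conj_ofReal]⟩

theorem SymFun.shift {f : ℂ → ℂ} (hf : SymFun f) (y : ℝ) : SymFun fun z => f (z - y) := by
  constructor
  · intro z
    have : z + 2 * π - y = (z - y) + 2 * π := by ring
    beta_reduce
    rw [this, hf.1]
  · intro z
    beta_reduce
    rw [← hf.2, map_sub, Complex.conj_ofReal]

theorem SymFun.integral {α : Type*} [MeasurableSpace α] {μ : Measure α} {f : α → ℂ → ℂ}
    (hf : ∀ a, SymFun (f a)) : SymFun fun z => ∫ a, f a z ∂μ := by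
  constructor
  · intro z; simp only [(hf _).1]
  · intro z; simp only [(hf _).2]; exact integral_conj

theorem conj_kerDen (y : ℝ) (a : ℂ) :
    kerDen y (starRingEnd ℂ a) = starRingEnd ℂ (kerDen y a) := by
  rw [kerDen, kerDen, map_sub, Complex.cosh_conj, ← Complex.cos_conj, Complex.conj_ofReal]

theorem conj_ker (y : ℝ) (a : ℂ) : ker y (starRingEnd ℂ a) = starRingEnd ℂ (ker y a) := by
  rw [ker, ker, map_mul, map_mul, map_inv₀, conj_kerDen, Complex.conj_ofReal, ← Complex.sin_conj,
    Complex.conj_ofReal]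

theorem conj_kerD (y : ℝ) (a : ℂ) : kerD y (starRingEnd ℂ a) = starRingEnd ℂ (kerD y a) := by
  rw [kerD, kerD, map_mul, map_mul, map_mul, map_pow, map_inv₀, map_neg, conj_kerDen,
    Complex.conj_ofReal, ← Complex.sin_conj, Complex.conj_ofReal, Complex.sinh_conj]

theorem SymFun.ker {f : ℂ → ℂ} (hf : SymFun f) (y : ℝ) : SymFun fun z => ker y (f z) :=
  ⟨fun z => by beta_reduce; rw [hf.1], fun z => by beta_reduce; rw [hf.2, conj_ker]⟩

theorem SymFun.kerD {f : ℂ → ℂ} (hf : SymFun f) (y : ℝ) : SymFun fun z => kerD y (f z) :=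
  ⟨fun z => by beta_reduce; rw [hf.1], fun z => by beta_reduce; rw [hf.2, conj_kerD]⟩

/-- Symmetry of a jet. -/
def SymJet (e : Jet) : Prop :=
  ∀ q h, (SymFun fun z => e.val q z h) ∧ SymFun fun z => e.dz q z h

theorem SymJet.step {Γ : ℂ → ℂ} {e : Jet} (hΓ : SymFun Γ) (he : SymJet e) :
    SymJet (stepJet (curveOf Γ e)) := by
  have hg : ∀ q h, SymFun fun z => (curveOf Γ e).g q z h := fun q h =>
    hΓ.add ((SymFun.const q).mul (SymFun.integral fun l => (he (q * l) h).1))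
  have hu : ∀ q h, SymFun fun z => (curveOf Γ e).u q z h := fun q h =>
    hΓ.deriv.add ((SymFun.const q).mul (SymFun.integral fun l => (he (q * l) h).2))
  have hux : ∀ q h, SymFun fun z => (curveOf Γ e).ux q z h := fun q h =>
    hΓ.deriv.deriv.add ((SymFun.const q).mul
      (SymFun.integral fun l => (he (q * l) h).2.deriv))
  have ha := fun y m q h =>
    (hg q h).sub ((hg q m).shift y)
  have hb := fun y m q h =>
    (hu q h).sub ((hu q m).shift y)
  have hbx := fun y m q h =>
    (hux q h).sub ((hux q m).shift y)
  have h2 := fun q => by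
    have := SymFun.const (2 * q); push_cast at this; exact this
  have h4 := fun q h => by
    have := SymFun.const (4 * q * h); push_cast at this; exact this
  intro q h
  constructor
  · exact (h4 q h).sub ((h2 q).mul (SymFun.integral fun y => SymFun.integral fun m =>
      ((ha y m q h).ker y).mul (hb y m q h)))
  · exact ((h2 q).mul (SymFun.integral fun y => SymFun.integral fun m =>
      ((((ha y m q h).kerD y).mul (hb y m q h)).mul (hb y m q h)).add
        (((ha y m q h).ker y).mul (hbx y m q h)))).neg

theorem symJet_base : SymJet baseJet := fun q h =>
  ⟨by have := SymFun.const (4 * q * h); push_cast at this; exact this,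
   by have := SymFun.const 0; push_cast at this; exact this⟩

/-- The evolution of the level sets has a solution on shrinking strips. -/
theorem exists_fixedPoint (M : ℝ) (hM : 0 ≤ M) : ∃ η N : ℝ, 0 < η ∧ η ≤ 1 ∧ 0 < N ∧
    ∀ (σ : ℝ) (Γ : ℂ → ℂ), Params σ η M Γ → SymFun Γ →
    ∃ e : Jet, Reg (dom σ η) e.val e.dz e.dh ∧ JetClose σ η N e baseJet ∧
      NearBase σ η M Γ (curveOf Γ e) ∧ JetClose σ η 0 (stepJet (curveOf Γ e)) e ∧
      ∀ q z h, (q, z, h) ∈ dom σ η → e.val q (z + 2 * π) h = e.val q z h ∧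
        e.val q (starRingEnd ℂ z) h = starRingEnd ℂ (e.val q z h) := by
  obtain ⟨K, hK0, hK⟩ := exists_step_bounds M hM
  set r := (16 * (1 + M))⁻¹ with hr
  set η := min 1 (min (r / (12 * K)) (1 / (12 * K))) with hη
  have hη0 : 0 < η := by positivity
  have hη1 : η ≤ 1 := min_le_left _ _
  have e1 : 6 * η * (2 * K) ≤ r := by
    have : η ≤ r / (12 * K) := (min_le_right _ _).trans (min_le_left _ _)
    rw [le_div_iff₀ (by positivity)] at this
    linarith
  have e2 : K * (6 * η) ≤ 1 / 2 := by
    have : η ≤ 1 / (12 * K) := (min_le_right _ _).trans (min_le_right _ _)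
    rw [le_div_iff₀ (by positivity)] at this
    linarith
  refine ⟨η, 2 * K, hη0, hη1, by positivity, fun σ Γ P hΓ => ?_⟩
  have hb0 : JetClose σ η (2 * K) baseJet baseJet := fun q z h _ => by
    simp; exact ⟨by positivity, by positivity, by positivity⟩
  have hnear : ∀ e : Jet, Reg (dom σ η) e.val e.dz e.dh → JetClose σ η (2 * K) e baseJet →
      NearBase σ η M Γ (curveOf Γ e) := by
    refine fun e he hcl => ⟨curveReg_curveOf P.σ_le hη0 hη1 (by positivity) P.ext.diff he hcl, ?_⟩
    have := curveClose_curveOf (Γ := Γ) P.σ_le hη0 hη1 (by positivity) (by positivity) he hcl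
      (reg_baseJet _) hb0 hcl
    intro q z h hp
    obtain ⟨h1, h2, h3, h4⟩ := this q z h hp
    exact ⟨h1.trans e1, h2.trans (by gcongr), h3.trans (by gcongr), h4.trans (by gcongr)⟩
  have hcontr : ∀ e e' : Jet, ∀ ν : ℝ, 0 ≤ ν → Reg (dom σ η) e.val e.dz e.dh →
      JetClose σ η (2 * K) e baseJet → Reg (dom σ η) e'.val e'.dz e'.dh →
      JetClose σ η (2 * K) e' baseJet → JetClose σ η ν e e' →
      JetClose σ η (ν / 2) (stepJet (curveOf Γ e)) (stepJet (curveOf Γ e')) := by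
    intro e e' ν hν he hcl he' hcl' h
    have h1 := curveClose_curveOf (Γ := Γ) P.σ_le hη0 hη1 (by positivity) hν he hcl he' hcl' h
    refine ((hK σ η Γ _ P (hnear e he hcl)).2.2 _ _ (hnear e' he' hcl') (by positivity) h1).mono ?_
    calc K * (6 * η * ν) = K * (6 * η) * ν := by ring
      _ ≤ 1 / 2 * ν := by gcongr
      _ = ν / 2 := by ring
  let s : ℕ → Jet := fun n => (fun e => stepJet (curveOf Γ e))^[n] baseJet
  have hs : ∀ n, s (n + 1) = stepJet (curveOf Γ (s n)) := fun n =>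
    Function.iterate_succ_apply' _ _ _
  have hs0 : s 0 = baseJet := rfl
  have hsr : ∀ n, Reg (dom σ η) (s n).val (s n).dz (s n).dh ∧ JetClose σ η K (s n) baseJet := by
    intro n
    induction n with
    | zero =>
      refine ⟨reg_baseJet _, fun q z h _ => ?_⟩
      simp only [hs0, sub_self, norm_zero]; exact ⟨by positivity, by positivity, by positivity⟩
    | succ n ih =>
      have := hK σ η Γ _ P (hnear _ ih.1 (ih.2.mono (by linarith)))
      rw [hs]; exact ⟨this.1, this.2.1⟩
  have hs2 : ∀ n, JetClose σ η (2 * K) (s n) baseJet := fun n => (hsr n).2.mono (by linarith)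
  have hsym : ∀ n, SymJet (s n) := by
    intro n
    induction n with
    | zero => exact symJet_base
    | succ n ih => rw [hs]; exact ih.step hΓ
  have hcl : ∀ n, JetClose σ η (K / 2 ^ n) (s n) (s (n + 1)) := by
    intro n
    induction n with
    | zero =>
      intro q z h hp
      obtain ⟨h1, h2, h3⟩ := (hsr 1).2 q z h hp
      rw [hs0, pow_zero, div_one]
      rw [norm_sub_rev] at h1 h2 h3
      exact ⟨h1, h2, h3⟩
    | succ n ih =>
      have := hcontr _ _ _ (by positivity) (hsr n).1 (hs2 n) (hsr (n + 1)).1 (hs2 (n + 1)) ih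
      rw [hs n, hs (n + 1), pow_succ, ← div_div]
      rwa [← hs n] at this ⊢
  obtain ⟨E, hE, hEc, hEt⟩ := exists_jet_limit (fun n => (hsr n).1) hcl
  have hE2 : JetClose σ η (2 * K) E baseJet := by
    intro q z h hp
    obtain ⟨h1, h2, h3⟩ := hEc 0 q z h hp
    rw [hs0, pow_zero, div_one] at h1 h2 h3
    rw [norm_sub_rev] at h1 h2 h3
    exact ⟨h1, h2, h3⟩
  refine ⟨E, hE, hE2, hnear E hE hE2, ?_, ?_⟩
  · have hall : ∀ n : ℕ, JetClose σ η (3 * K / 2 ^ n) (stepJet (curveOf Γ E)) E := by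
      intro n
      have hrev : JetClose σ η (2 * K / 2 ^ n) E (s n) := by
        intro q z h hp
        obtain ⟨h1, h2, h3⟩ := hEc n q z h hp
        rw [norm_sub_rev] at h1 h2 h3
        exact ⟨h1, h2, h3⟩
      have h1 := hcontr E (s n) _ (by positivity) hE hE2 (hsr n).1 (hs2 n) hrev
      rw [← hs] at h1
      refine (h1.trans (hEc (n + 1))).mono
        (le_of_eq_of_le ?_
        (div_le_div_of_nonneg_right (by linarith : 2 * K ≤ 3 * K) (by positivity)))
      rw [pow_succ]; field_simp; ring
    have ht : ∀ w : ℝ, Tendsto (fun n : ℕ => 3 * K / 2 ^ n * w) atTop (𝓝 (0 * w)) := fun w =>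
      (tendsto_const_nhds.div_atTop (tendsto_pow_atTop_atTop_of_one_lt one_lt_two)).mul_const w
    refine fun q z h hp => ⟨?_, ?_, ?_⟩
    · have := ge_of_tendsto' (ht 1) fun n => (by
        rw [mul_one]; exact (hall n q z h hp).1 : _ ≤ 3 * K / 2 ^ n * 1)
      simpa using this
    · have := ge_of_tendsto' (ht (1 / √(wid σ η q z))) fun n => (by
        rw [mul_one_div]; exact (hall n q z h hp).2.1 : _ ≤ 3 * K / 2 ^ n * (1 / √(wid σ η q z)))
      rw [zero_mul] at this
      simpa using this
    · have := ge_of_tendsto' (ht (q ^ 2 / √(wid σ η q z))) fun n => (by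
        rw [← mul_div_assoc]; exact (hall n q z h hp).2.2 :
          _ ≤ 3 * K / 2 ^ n * (q ^ 2 / √(wid σ η q z)))
      rw [zero_mul] at this
      simpa using this
  · intro q z h hp
    have hp1 : (q, z + 2 * π, h) ∈ dom σ η := ⟨hp.1, by simpa using hp.2.1, hp.2.2⟩
    constructor
    · refine tendsto_nhds_unique (hEt _ _ _ hp1) ?_
      simp only [(hsym _ q h).1.1 z]
      exact hEt _ _ _ hp
    · refine tendsto_nhds_unique (hEt _ _ _ ⟨hp.1, by simpa using hp.2.1, hp.2.2⟩) ?_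
      simp only [(hsym _ q h).1.2 z]
      exact (Complex.continuous_conj.tendsto _).comp (hEt _ _ _ hp)

/-- `γ₀` extends holomorphically to the disc of radius `r` around `x`. -/
def ExtendsAt (γ₀ : ℝ → ℝ) (r x : ℝ) : Prop :=
  ∃ F : ℂ → ℂ, DifferentiableOn ℂ F (Metric.ball (x : ℂ) r) ∧
    ∀ t : ℝ, (t : ℂ) ∈ Metric.ball (x : ℂ) r → F t = γ₀ t

theorem exists_extendsAt {γ₀ : ℝ → ℝ} {x : ℝ} (h : AnalyticAt ℝ γ₀ x) :
    ∃ r > 0, ExtendsAt γ₀ r x := by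
  obtain ⟨p, R, hp⟩ := h
  obtain ⟨r, hr0, hrR⟩ := ENNReal.lt_iff_exists_nnreal_btwn.1 hp.r_pos
  refine ⟨r, (by exact_mod_cast hr0), fun z => ∑' n, (p.coeff n : ℂ) * (z - x) ^ n, ?_, ?_⟩
  · refine Complex.differentiableOn_tsum_of_summable_norm
      (p.summable_norm_mul_pow (hrR.trans_le hp.r_le)) (fun n => by fun_prop)
      isOpen_ball fun n w hw => ?_
    rw [norm_mul, norm_pow, Complex.norm_real, p.norm_apply_eq_norm_coef]
    have : ‖w - x‖ ≤ r := by
      rw [← dist_eq_norm]; exact (mem_ball.1 hw).le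
    gcongr
  · intro t ht
    have ht' : t - x ∈ eball 0 R := by
      rw [mem_ball, dist_eq_norm, ← Complex.ofReal_sub, Complex.norm_real] at ht
      refine eball_subset_eball hrR.le ?_
      rw [eball_coe]
      simpa using ht
    have h1 := hp.hasSum ht'
    simp at h1
    rw [← (Complex.hasSum_ofReal.2 h1).tsum_eq]
    refine tsum_congr fun n => ?_
    push_cast; ring

theorem ExtendsAt.mono {γ₀ : ℝ → ℝ} {r r' x x' : ℝ} (h : ExtendsAt γ₀ r x)
    (hs : r' + |x' - x| ≤ r) : ExtendsAt γ₀ r' x' := by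
  obtain ⟨F, h1, h2⟩ := h
  have hsub : Metric.ball (x' : ℂ) r' ⊆ Metric.ball (x : ℂ) r :=
    ball_subset_ball' (by
      rw [dist_eq_norm, ← Complex.ofReal_sub, Complex.norm_real]; exact hs)
  exact ⟨F, h1.mono hsub, fun t ht => h2 t (hsub ht)⟩

theorem exists_uniform_extendsAt {γ₀ : ℝ → ℝ} (hper : Function.Periodic γ₀ (2 * π))
    (han : AnalyticOnNhd ℝ γ₀ univ) : ∃ r > 0, ∀ x, ExtendsAt γ₀ r x := by
  choose R hR0 hR using fun x => exists_extendsAt (han x (mem_univ x))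
  obtain ⟨δ, hδ, hδ'⟩ := lebesgue_number_lemma_of_metric
    isCompact_Icc (fun _ => isOpen_ball)
    (fun x _ => mem_iUnion.2 ⟨x, mem_ball_self (half_pos (hR0 x))⟩)
  have hc : ∃ r > 0, ∀ x ∈ Icc 0 (2 * π), ExtendsAt γ₀ r x := by
    refine ⟨δ / 2, by positivity, fun x hx => ?_⟩
    obtain ⟨x₀, hx₀⟩ := hδ' x hx
    refine (hR x₀).mono ?_
    have h1 := hx₀ (mem_ball_self hδ)
    have h2 : x + δ / 2 ∈ Metric.ball x₀ (R x₀ / 2) := hx₀ (by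
      rw [mem_ball, dist_eq, add_sub_cancel_left, abs_of_pos (by linarith)]; linarith)
    have h3 : x - δ / 2 ∈ Metric.ball x₀ (R x₀ / 2) := hx₀ (by
      rw [mem_ball, dist_eq, sub_sub_cancel_left, abs_neg, abs_of_pos (by linarith)]
      linarith)
    rw [mem_ball, dist_eq] at h2 h3
    have := hR0 x₀
    rcases abs_cases (x - x₀) with h | h <;> rcases abs_cases (x + δ / 2 - x₀) with h' | h' <;>
      rcases abs_cases (x - δ / 2 - x₀) with h'' | h'' <;> linarith
  obtain ⟨r, hr, hrx⟩ := hc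
  refine ⟨r, hr, fun x => ?_⟩
  have h2π : 0 < 2 * π := by positivity
  obtain ⟨F, hF, hFt⟩ := hrx (toIcoMod h2π 0 x) (by
    have := toIcoMod_mem_Ico' h2π x
    exact ⟨this.1, this.2.le⟩)
  set k := toIcoDiv h2π 0 x with hk
  have hx : toIcoMod h2π 0 x = x - k * (2 * π) := by
    rw [toIcoMod, zsmul_eq_mul]
  rw [hx] at hF hFt
  have hmem : ∀ z : ℂ, z ∈ ball (x : ℂ) r →
      z - (k * (2 * π) : ℝ) ∈ ball ((x - k * (2 * π) : ℝ) : ℂ) r := by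
    intro z hz
    rw [mem_ball, dist_eq_norm] at hz ⊢
    rwa [Complex.ofReal_sub, sub_sub_sub_cancel_right]
  refine ⟨fun z => F (z - (k * (2 * π) : ℝ)), hF.comp (by fun_prop) hmem, fun t ht => ?_⟩
  have := hFt (t - k * (2 * π)) (by
    have := hmem _ ht
    rwa [← Complex.ofReal_sub] at this)
  rw [Complex.ofReal_sub] at this
  beta_reduce
  rw [this, hper.sub_int_mul_eq]

theorem iteratedDeriv_eq_of_eq_on_real {F : ℂ → ℂ} {f : ℝ → ℝ} {c : ℂ} {r : ℝ}
    (hF : DifferentiableOn ℂ F (Metric.ball c r)) (hf : AnalyticOnNhd ℝ f univ)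
    (h : ∀ t : ℝ, (t : ℂ) ∈ Metric.ball c r → F t = f t) (n : ℕ) :
    ∀ t : ℝ, (t : ℂ) ∈ Metric.ball c r → iteratedDeriv n F t = (iteratedDeriv n f t : ℝ) := by
  induction n generalizing F f with
  | zero => simpa using h
  | succ n ih =>
    intro t ht
    rw [iteratedDeriv_succ', iteratedDeriv_succ']
    refine ih (hF.deriv isOpen_ball) hf.deriv ?_ t ht
    intro t ht
    have h1 :=
      ((hF.differentiableAt (isOpen_ball.mem_nhds ht)).hasDerivAt).comp_ofReal
    have h2 :=
      (hf t (mem_univ t)).differentiableAt.hasDerivAt.ofReal_comp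
    have h3 : (fun s => F s) =ᶠ[𝓝 t] fun s => (f s : ℂ) := by
      have :=
        (isOpen_ball.preimage Complex.continuous_ofReal).mem_nhds ht
      filter_upwards [this] with s hs using h s hs
    exact (h2.congr_of_eventuallyEq h3).unique h1 |>.symm

/-- The holomorphic extension of a real analytic function by its Taylor series in the imaginary
direction. -/
def complexExt (f : ℝ → ℝ) (z : ℂ) : ℂ :=
  ∑' n : ℕ, ((n.factorial : ℂ))⁻¹ * ((z.im * Complex.I) ^ n * ((iteratedDeriv n f z.re : ℝ) : ℂ))

theorem symFun_complexExt {f : ℝ → ℝ} (hper : Function.Periodic f (2 * π)) :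
    SymFun (complexExt f) := by
  constructor
  · intro z
    have h : ∀ n, iteratedDeriv n f (z.re + 2 * π) = iteratedDeriv n f z.re := by
      intro n
      have := iteratedDeriv_comp_add_const n f (2 * π)
      rw [funext hper] at this
      exact (congrFun this z.re).symm
    have e1 : (z + 2 * π : ℂ).re = z.re + 2 * π := by simp
    have e2 : (z + 2 * π : ℂ).im = z.im := by simp
    simp only [complexExt, e1, e2, h]
  · intro z
    simp only [complexExt, Complex.conj_re, Complex.conj_im]
    rw [Complex.conj_tsum]
    refine tsum_congr fun n => ?_
    simp only [map_mul, map_inv₀, map_pow, Complex.conj_ofReal, Complex.conj_I, map_natCast,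
      Complex.ofReal_neg]
    ring

theorem complexExt_eq {f : ℝ → ℝ} (hf : AnalyticOnNhd ℝ f univ) {F : ℂ → ℂ} {x r : ℝ}
    (hF : DifferentiableOn ℂ F (Metric.ball (x : ℂ) r))
    (h : ∀ t : ℝ, (t : ℂ) ∈ Metric.ball (x : ℂ) r → F t = f t) {z : ℂ}
    (hz : |z.im| + |z.re - x| < r) : complexExt f z = F z := by
  have hb : Metric.ball (z.re : ℂ) (r - |z.re - x|) ⊆ Metric.ball (x : ℂ) r :=
    ball_subset_ball' (by
      rw [dist_eq_norm, ← Complex.ofReal_sub, Complex.norm_real, norm_eq_abs]; linarith)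
  have e : z - z.re = z.im * Complex.I := by
    rw [sub_eq_iff_eq_add', Complex.re_add_im]
  have hzm : z ∈ ball (z.re : ℂ) (r - |z.re - x|) := by
    rw [mem_ball, dist_eq_norm, e, norm_mul, Complex.norm_I, mul_one, Complex.norm_real,
      norm_eq_abs]
    linarith
  rw [← (Complex.hasSum_taylorSeries_on_ball (hF.mono hb) hzm).tsum_eq, complexExt]
  refine tsum_congr fun n => ?_
  have hre : (z.re : ℂ) ∈ ball (x : ℂ) r := by
    refine hb (mem_ball_self ?_); linarith [abs_nonneg z.im]
  rw [e, iteratedDeriv_eq_of_eq_on_real hF hf h n _ hre, smul_eq_mul, smul_eq_mul]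

theorem exists_holomorphic_extension {γ₀ : ℝ → ℝ} (hper : Function.Periodic γ₀ (2 * π))
    (han : AnalyticOnNhd ℝ γ₀ univ) : ∃ Γ : ℂ → ℂ, SymFun Γ ∧ (∀ x : ℝ, Γ x = γ₀ x) ∧
      ∃ M : ℝ, ∃ σ > 0, σ ≤ 1 ∧ ExtBounds σ M Γ := by
  obtain ⟨r, hr, hx⟩ := exists_uniform_extendsAt hper han
  have hsym := symFun_complexExt hper
  set Γ := complexExt γ₀ with hΓ
  have hreal : ∀ x : ℝ, Γ x = γ₀ x := by
    intro x
    obtain ⟨F, hF, hFt⟩ := hx x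
    rw [hΓ, complexExt_eq han hF hFt (by simpa using hr), hFt x (mem_ball_self hr)]
  have hd : DifferentiableOn ℂ Γ {z | |z.im| < r} := by
    intro z hz
    have hz' := hz
    obtain ⟨F, hF, hFt⟩ := hx z.re
    refine DifferentiableAt.differentiableWithinAt ?_
    have hcont : Continuous fun w : ℂ => |w.im| + |w.re - z.re| := by fun_prop
    have hFz : DifferentiableAt ℂ F z := by
      refine hF.differentiableAt (isOpen_ball.mem_nhds ?_)
      rw [mem_ball, dist_eq_norm]
      have e : z - z.re = z.im * Complex.I := by
        rw [sub_eq_iff_eq_add', Complex.re_add_im]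
      rw [e, norm_mul, Complex.norm_I, mul_one, Complex.norm_real, norm_eq_abs]
      exact hz'
    refine hFz.congr_of_eventuallyEq ?_
    filter_upwards [(hcont.continuousAt.eventually (gt_mem_nhds (by simpa using hz')))] with w
      hw using complexExt_eq han hF hFt hw
  have hO := isOpen_strip_im r
  have hd1 := hd.deriv hO
  have hKs : (Icc 0 (2 * π) ×ℂ Icc (-(r / 2)) (r / 2)) ⊆ {z : ℂ | |z.im| < r} := by
    intro z hz
    have := abs_le.2 hz.2
    show |z.im| < r
    linarith
  have hbd : ∀ f : ℂ → ℂ, SymFun f → DifferentiableOn ℂ f {z | |z.im| < r} →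
      ∃ C, ∀ z : ℂ, |z.im| ≤ r / 2 → ‖f z‖ ≤ C := by
    intro f hf hfd
    obtain ⟨C, hC⟩ := (isCompact_Icc.reProdIm isCompact_Icc).exists_bound_of_continuousOn
      (hfd.continuousOn.mono hKs)
    refine ⟨C, fun z hz => ?_⟩
    have h2π : 0 < 2 * π := by positivity
    have hm := toIcoMod_mem_Ico' h2π z.re
    set k := toIcoDiv h2π 0 z.re with hk
    rw [show toIcoMod h2π 0 z.re = z.re - k * (2 * π) by rw [toIcoMod, zsmul_eq_mul]] at hm
    have hp : Function.Periodic f (2 * π : ℂ) := hf.1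
    rw [← hp.sub_int_mul_eq k]
    refine hC _ ⟨?_, ?_⟩
    · have : (z - k * (2 * π) : ℂ).re = z.re - k * (2 * π) := by simp
      rw [mem_preimage, this]; exact ⟨hm.1, hm.2.le⟩
    · have : (z - k * (2 * π) : ℂ).im = z.im := by simp
      rw [mem_preimage, this]; exact abs_le.1 hz
  obtain ⟨C₁, hC₁⟩ := hbd _ hsym.deriv hd1
  obtain ⟨C₂, hC₂⟩ := hbd _ hsym.deriv.deriv (hd1.deriv hO)
  set M := max C₁ C₂ with hM
  have hM0 : 0 ≤
    M := ((norm_nonneg _).trans (hC₁ 0 (by rw [Complex.zero_im, abs_zero]; linarith))).trans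
    (le_max_left _ _)
  set σ := min (r / 2) (min 1 ((16 * (1 + M)) ^ 2)⁻¹) with hσ
  have hσr : σ ≤ r / 2 := min_le_left _ _
  refine ⟨Γ, hsym, hreal, M, σ, (by positivity), (min_le_right _ _).trans (min_le_left _ _), hM0,
    hd.mono fun z (hz : |z.im| < σ) => (by linarith : |z.im| < r),
    fun z hz => (hC₁ z (by linarith)).trans (le_max_left _ _),
    fun z hz => (hC₂ z (by linarith)).trans (le_max_right _ _), fun z hz => ?_⟩
  have hre : (deriv Γ z.re).im = 0 := by
    have := hsym.deriv.2 (z.re : ℂ)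
    rw [Complex.conj_ofReal] at this
    exact Complex.conj_eq_iff_im.1 this.symm
  have hcv : Convex ℝ {w : ℂ | |w.im| ≤ r / 2} := by
    have : {w : ℂ | |w.im| ≤ r / 2} = Complex.imLm ⁻¹' closedBall 0 (r / 2) := by
      ext w; simp
    rw [this]
    exact (convex_closedBall 0 (r / 2)).linear_preimage _
  have hin1 : (z.re : ℂ) ∈ {w : ℂ | |w.im| ≤ r / 2} := by
    rw [mem_ofPred_eq, Complex.ofReal_im, abs_zero]; linarith
  have hin2 : z ∈ {w : ℂ | |w.im| ≤ r / 2} := by rw [mem_ofPred_eq]; linarith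
  have hmv := hcv.norm_image_sub_le_of_norm_deriv_le (C := M)
    (fun w hw => by
      have : |w.im| ≤ r / 2 := hw
      exact hd1.differentiableAt (hO.mem_nhds (by rw [mem_ofPred_eq]; linarith)))
    (fun w hw => (hC₂ w hw).trans (le_max_right _ _)) hin1 hin2
  have e : z - z.re = z.im * Complex.I := by
    rw [sub_eq_iff_eq_add', Complex.re_add_im]
  rw [e, norm_mul, Complex.norm_I, mul_one, Complex.norm_real, norm_eq_abs] at hmv
  have h1 : |(deriv Γ z).im| ≤ M * σ := by
    have := Complex.abs_im_le_norm (deriv Γ z - deriv Γ z.re)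
    rw [Complex.sub_im, hre, sub_zero] at this
    exact this.trans (hmv.trans (by gcongr))
  have h2 : M * σ ≤ (1 + M) * ((16 * (1 + M)) ^ 2)⁻¹ := by
    gcongr
    · linarith
    · exact (min_le_right _ _).trans (min_le_right _ _)
  refine h1.trans (h2.trans ?_)
  have e3 : (1 + M) * ((16 * (1 + M)) ^ 2)⁻¹ = (16 * (1 + M))⁻¹ * (1 / 16) := by field_simp
  rw [e3]
  exact mul_le_of_le_one_right (by positivity) (by norm_num)

/-- A fixed point of the evolution of the level sets, with the bounds it comes with. -/
structure Solved (σ η M N : ℝ) (Γ : ℂ → ℂ) (e : Jet) : Prop where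
  params : Params σ η M Γ
  σ_pos : 0 < σ
  N_nonneg : 0 ≤ N
  reg : Reg (dom σ η) e.val e.dz e.dh
  close : JetClose σ η N e baseJet
  near : NearBase σ η M Γ (curveOf Γ e)
  fixed : JetClose σ η 0 (stepJet (curveOf Γ e)) e

/-- The region, for signed root times, in which the width of the strip stays bounded below. -/
def core (σ η : ℝ) : Set (ℝ × ℂ × ℝ) :=
  {p | |p.1| < η * σ / 2 ∧ |p.2.1.im| < σ / 4 ∧ |p.2.2| < 2}

theorem isOpen_core (σ η : ℝ) : IsOpen (core σ η) := by
  have h1 : IsOpen {p : ℝ × ℂ × ℝ | |p.1| < η * σ / 2} := isOpen_lt (by fun_prop) continuous_const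
  have h2 : IsOpen {p : ℝ × ℂ × ℝ | |p.2.1.im| < σ / 4} := isOpen_lt (by fun_prop) continuous_const
  have h3 : IsOpen {p : ℝ × ℂ × ℝ | |p.2.2| < 2} := isOpen_lt (by fun_prop) continuous_const
  exact h1.inter (h2.inter h3)

theorem core_shift {σ η q : ℝ} {z : ℂ} {h h' : ℝ} (y : ℝ) (hh' : |h'| < 2)
    (hp : (q, z, h) ∈ core σ η) : (q, z - y, h') ∈ core σ η :=
  ⟨hp.1, by simpa using hp.2.1, hh'⟩

theorem mem_dom_of_core {σ η q : ℝ} {z : ℂ} {h : ℝ} (hη : 0 < η) (hp : (q, z, h) ∈ core σ η)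
    (hq : q ≠ 0) : (|q|, z, h) ∈ dom σ η ∧ σ / 4 ≤ wid σ η |q| z := by
  obtain ⟨h1, h2, h3⟩ := hp
  have h4 : |q| / η < σ / 2 := by rw [div_lt_iff₀ hη]; linarith
  refine ⟨⟨abs_pos.2 hq, ?_, h3⟩, ?_⟩
  · simp only; linarith [abs_nonneg z.im]
  · rw [wid]; linarith

theorem continuousOn_core {σ η C : ℝ} (hη : 0 < η) {W : ℝ → ℂ → ℝ → ℂ}
    (hW : ContinuousOn (fun p : ℝ × ℂ × ℝ => W p.1 p.2.1 p.2.2) (dom σ η))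
    (hC : ∀ q z h, (q, z, h) ∈ dom σ η → σ / 4 ≤ wid σ η q z → ‖W q z h‖ ≤ C * q)
    (h0 : ∀ z h, W 0 z h = 0) :
    ContinuousOn (fun p : ℝ × ℂ × ℝ => W |p.1| p.2.1 p.2.2) (core σ η) := by
  rintro ⟨q, z, h⟩ hp
  by_cases hq : q = 0
  · subst hq
    show Tendsto _ _ _
    simp only [abs_zero, h0]
    have ht : Tendsto (fun p => C * |p.1|) (𝓝[core σ η] (0, z, h)) (𝓝 0) := by
      have : Continuous fun p : ℝ × ℂ × ℝ => C * |p.1| := by fun_prop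
      have := this.tendsto ((0, z, h) : ℝ × ℂ × ℝ)
      simp at this
      exact this.mono_left nhdsWithin_le_nhds
    refine squeeze_zero_norm' ?_ ht
    filter_upwards [self_mem_nhdsWithin] with p hp'
    by_cases hp0 : p.1 = 0
    · rw [hp0, abs_zero, h0, norm_zero, mul_zero]
    · obtain ⟨h1, h2⟩ := mem_dom_of_core hη hp' hp0
      exact hC _ _ _ h1 h2
  · have h1 :=
      hW.continuousAt ((isOpen_dom σ η).mem_nhds ((mem_dom_of_core hη hp hq).1))
    have h2 : Continuous fun p : ℝ × ℂ × ℝ => (|p.1|, p.2.1, p.2.2) := by fun_prop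
    exact (ContinuousAt.comp_of_eq h1 h2.continuousAt rfl).continuousWithinAt

theorem norm_mul_avg_le {σ η C : ℝ} (hη : 0 < η) {w : ℝ → ℂ → ℝ → ℂ}
    (hC0 : 0 ≤ C) (hC : ∀ q z h, (q, z, h) ∈ dom σ η → ‖w q z h‖ ≤ C / wid σ η q z ^ 2)
    {q h : ℝ} {z : ℂ} (hp : (q, z, h) ∈ dom σ η) :
    ‖(q : ℂ) * avg w q z h‖ ≤ C / wid σ η q z ^ 2 * q := by
  have hs := wid_pos hp
  have hq := hp.1
  have h1 : ‖avg w q z h‖ ≤ C / wid σ η q z ^ 2 * volume.real (Ioo (0 : ℝ) 1) := by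
    refine norm_setIntegral_le_of_norm_le_const (by simp) fun l hl => ?_
    obtain ⟨h1, h2⟩ := dom_scale hη hp hl
    exact (hC _ _ _ h1).trans (by gcongr)
  rw [norm_mul, Complex.norm_real, norm_of_nonneg hq.le, mul_comm]
  gcongr
  simpa using h1

theorem hasDerivAt_mul_avg {σ η C : ℝ} (hη : 0 < η) {w : ℝ → ℂ → ℝ → ℂ}
    (hw : ContinuousOn (fun p : ℝ × ℂ × ℝ => w p.1 p.2.1 p.2.2) (dom σ η))
    (hC : ∀ q z h, (q, z, h) ∈ dom σ η → ‖w q z h‖ ≤ C / wid σ η q z ^ 2)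
    {q h : ℝ} {z : ℂ} (hp : (q, z, h) ∈ dom σ η) :
    HasDerivAt (fun r : ℝ => (r : ℂ) * avg w r z h) (w q z h) q := by
  have hq := hp.1
  have hin : IntervalIntegrable (fun r => w r z h) volume 0 q := by
    have h1 : IntervalIntegrable (fun l => w (q * l) z h) volume 0 1 := by
      rw [intervalIntegrable_iff_integrableOn_Ioo_of_le zero_le_one]; exact integrable_avg hη hw hC
        hp
    simpa [hq.ne'] using h1.comp_mul_left (c := q⁻¹)
  have hcr : ContinuousAt (fun r => w r z h) q := by
    have h1 :=
      hw.continuousAt ((isOpen_dom σ η).mem_nhds hp)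
    have h2 : Continuous fun r : ℝ => (r, z, h) := by fun_prop
    exact ContinuousAt.comp_of_eq h1 h2.continuousAt rfl
  have hO :=
    (isOpen_dom σ η).preimage (by fun_prop : Continuous fun r => (r, z, h))
  have hms : StronglyMeasurableAtFilter (fun r => w r z h) (𝓝 q) volume := by
    refine ContinuousOn.stronglyMeasurableAtFilter hO ?_ q hp
    have h2 : ContinuousOn (fun r => (r, z, h)) {r : ℝ | (r, z, h) ∈ dom σ η} := by fun_prop
    exact hw.comp h2 fun r hr => hr
  refine (intervalIntegral.integral_hasDerivAt_right hin hms hcr).congr_of_eventuallyEq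
    (Eventually.of_forall fun r => ?_)
  show (r : ℂ) * avg w r z h = _
  rw [avg, ← integral_Ioc_eq_integral_Ioo, ← intervalIntegral.integral_of_le zero_le_one,
    ← Complex.real_smul, intervalIntegral.smul_integral_comp_mul_left (fun s => w s z h), mul_zero,
    mul_one]

theorem exists_integrand_bounded (M : ℝ) (hM : 0 ≤ M) : ∃ K : ℝ, 0 < K ∧
    ∀ (σ η : ℝ) (Γ : ℂ → ℂ) (c : Curve), Params σ η M Γ → NearBase σ η M Γ c →
    ∀ (q m m' y : ℝ) (z : ℂ), (q, z, m) ∈ dom σ η → m' ∈ Icc (-1 : ℝ) 1 → y ∈ punct →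
      (32 * (1 + M) ^ 2)⁻¹ * |y| ^ 2 ≤ ‖kerDen y (c.a y m' q z m)‖ ∧
      ‖c.J y m' q z m‖ ≤ K * (1 / √(wid σ η q z)) := by
  obtain ⟨k, hk, hker⟩ := exists_ker_bounds (c := (32 * (1 + M) ^ 2)⁻¹) (A := M + 3)
    (by positivity) (by linarith)
  refine ⟨k * (2 * M + 4), by positivity, ?_⟩
  intro σ η Γ c P hc q m m' y z hp hm' hy
  have hm1 := abs_le.2 hm'
  obtain ⟨hy0, hyπ⟩ := punct_abs hy
  obtain ⟨r0, r1⟩ := P.radius_bounds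
  obtain ⟨d1, d2, d3⟩ :=
    near_bounds P.η_pos P.η_le P.σ_le P.ext le_rfl hc.reg P.base_reg hc.close hp hm1 hyπ
  obtain ⟨s1, -⟩ := near_slope_bounds P.η_pos P.σ_le P.ext r1 hc.reg hc.close y hp hm1
  set D := |y| + q ^ 2 * |m - m'| with hD
  have hD0 : 0 < D := by positivity
  have hyD : |y| ≤ D := le_add_of_nonneg_right (by positivity)
  refine ⟨le_trans (by gcongr) d1, ?_⟩
  obtain ⟨k1, -⟩ := hker y D _ _ hyD hD0 d3 d2 d2 d1 d1
  rw [Curve.J, norm_mul]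
  calc _ ≤ k / D * ((2 * M + 4) * D * (1 / √(wid σ η q z))) := by gcongr
    _ = _ := by field_simp

namespace Solved

variable {σ η M N : ℝ} {Γ : ℂ → ℂ} {e : Jet}

theorem curve_zero (z : ℂ) (h : ℝ) : (curveOf Γ e).g 0 z h = Γ z ∧
    (curveOf Γ e).u 0 z h = deriv Γ z ∧ (curveOf Γ e).gh 0 z h = 0 := by
  simp [curveOf]

theorem crude_core (H : Solved σ η M N Γ e) {w : ℝ → ℂ → ℝ → ℂ}
    (hC : ∀ q z h, (q, z, h) ∈ dom σ η → ‖w q z h‖ ≤ (3 * N + 8) / wid σ η q z ^ 2) (q : ℝ) (z : ℂ)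
    (h : ℝ) (hp : (q, z, h) ∈ dom σ η) (hs : σ / 4 ≤ wid σ η q z) :
    ‖(q : ℂ) * avg w q z h‖ ≤ (3 * N + 8) / (σ / 4) ^ 2 * q := by
  have hσ := H.σ_pos
  have hN := H.N_nonneg
  have hq := hp.1
  refine (norm_mul_avg_le H.params.η_pos (by positivity) hC hp).trans ?_
  gcongr

theorem continuousOn_g (H : Solved σ η M N Γ e) :
    ContinuousOn (fun p : ℝ × ℂ × ℝ => (curveOf Γ e).g |p.1| p.2.1 p.2.2) (core σ η) ∧
    ContinuousOn (fun p : ℝ × ℂ × ℝ => (curveOf Γ e).u |p.1| p.2.1 p.2.2) (core σ η) ∧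
    ContinuousOn (fun p : ℝ × ℂ × ℝ => (curveOf Γ e).gh |p.1| p.2.1 p.2.2) (core σ η) := by
  have P := H.params
  have hcr := H.close.crude P.σ_le P.η_pos P.η_le H.N_nonneg H.reg
  have hΓ := reg_of_holomorphic P.η_pos P.ext.diff
  have hσ := H.σ_pos
  have hm : MapsTo (fun p : ℝ × ℂ × ℝ => p.2.1) (core σ η) {z : ℂ | |z.im| < σ} := fun p hp => by
    have := hp.2.1
    show |p.2.1.im| < σ
    linarith
  have hc : ContinuousOn (fun p => p.2.1) (core σ η) := by fun_prop
  have h1 := continuousOn_core P.η_pos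
    ((H.near.reg.reg.cont.sub hΓ.cont).congr fun p _ => (add_sub_cancel_left _ _).symm)
    (H.crude_core fun q z h hp => (hcr q z h hp).1) (fun z h => by simp)
  have h2 := continuousOn_core P.η_pos
    ((H.near.reg.reg_u.cont.sub hΓ.cont_z).congr fun p _ => (add_sub_cancel_left _ _).symm)
    (H.crude_core fun q z h hp => (hcr q z h hp).2.1) (fun z h => by simp)
  have h3 := continuousOn_core P.η_pos (W := fun q z h => q * avg e.dh q z h)
    H.near.reg.reg.cont_h
    (H.crude_core fun q z h hp => (hcr q z h hp).2.2.1) (fun z h => by simp)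
  exact ⟨(P.ext.diff.continuousOn.comp hc hm).add h1,
    ((P.ext.diff.deriv (isOpen_strip_im σ)).continuousOn.comp hc hm).add h2, h3⟩

theorem continuousOn_ab (H : Solved σ η M N Γ e) {y m : ℝ} (hm : |m| < 2) :
    ContinuousOn (fun p : ℝ × ℂ × ℝ => (curveOf Γ e).a y m |p.1| p.2.1 p.2.2) (core σ η) ∧
    ContinuousOn (fun p : ℝ × ℂ × ℝ => (curveOf Γ e).b y m |p.1| p.2.1 p.2.2) (core σ η) := by
  obtain ⟨h1, h2, -⟩ := H.continuousOn_g
  have hc : ContinuousOn (fun p => (p.1, p.2.1 - (y : ℂ), m)) (core σ η) := by fun_prop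
  have hmp : MapsTo (fun p : ℝ × ℂ × ℝ => (p.1, p.2.1 - (y : ℂ), m)) (core σ η) (core σ η) :=
    fun p hp => core_shift y hm hp
  exact ⟨h1.sub (h1.comp hc hmp), h2.sub (h2.comp hc hmp)⟩

theorem exists_core_bounds (H : Solved σ η M N Γ e) : ∃ K : ℝ, 0 < K ∧
    ∀ p ∈ core σ η, ∀ m ∈ Icc (-1 : ℝ) 1, ∀ y ∈ punct,
      (32 * (1 + M) ^ 2)⁻¹ * |y| ^ 2 ≤ ‖kerDen y ((curveOf Γ e).a y m |p.1| p.2.1 p.2.2)‖ ∧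
      ‖(curveOf Γ e).J y m |p.1| p.2.1 p.2.2‖ ≤ K := by
  have P := H.params
  have hσ := H.σ_pos
  have hM := P.ext.nonneg
  obtain ⟨K, hK0, hK⟩ := exists_integrand_bounded M hM
  set c := curveOf Γ e with hc
  have hne : ∀ p ∈ core σ η, p.1 ≠ 0 → ∀ m ∈ Icc (-1) 1, ∀ y ∈ punct,
      (32 * (1 + M) ^ 2)⁻¹ * |y| ^ 2 ≤ ‖kerDen y (c.a y m |p.1| p.2.1 p.2.2)‖ ∧
      ‖c.J y m |p.1| p.2.1 p.2.2‖ ≤ K * (1 / √(σ / 4)) := by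
    rintro ⟨q, z, h⟩ hp hq m hm y hy
    obtain ⟨hd, hs⟩ := mem_dom_of_core P.η_pos hp hq
    obtain ⟨h1, h2⟩ := hK σ η Γ c P H.near |q| h m y z hd hm hy
    refine ⟨h1, h2.trans ?_⟩
    gcongr
  refine ⟨K * (1 / √(σ / 4)), by positivity, ?_⟩
  rintro ⟨q, z, h⟩ hp m hm y hy
  by_cases hq : q = 0
  · subst hq
    have hcq : Continuous fun q : ℝ => (q, z, h) := by fun_prop
    have hev : ∀ᶠ q : ℝ in 𝓝[≠] 0, (q, z, h) ∈ core σ η ∧ q ≠ 0 :=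
      Eventually.and (mem_nhdsWithin_of_mem_nhds (((isOpen_core σ η).preimage hcq).mem_nhds hp))
        self_mem_nhdsWithin
    obtain ⟨ca, cb⟩ := H.continuousOn_ab (lt_of_le_of_lt (abs_le.2 hm) (by norm_num))
    have ta : Tendsto (fun q : ℝ => c.a y m |q| z h) (𝓝[≠] 0) (𝓝 (c.a y m |0| z h)) :=
      ((ContinuousAt.comp_of_eq (ca.continuousAt ((isOpen_core σ η).mem_nhds hp))
        hcq.continuousAt rfl).tendsto).mono_left nhdsWithin_le_nhds
    have h1 := ge_of_tendsto
      (((continuous_kerDen.comp (continuous_const.prodMk continuous_id)).tendsto _).comp ta).norm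
      (hev.mono fun q hq => (hne _ hq.1 hq.2 m hm y hy).1)
    refine ⟨h1, ?_⟩
    have hy0 := (punct_abs hy).1
    have hden :=
      norm_pos_iff.1 (lt_of_lt_of_le (by positivity) h1)
    exact le_of_tendsto
      (((hasDerivAt_ker hden).continuousAt.tendsto.comp ta).mul
      (((ContinuousAt.comp_of_eq (cb.continuousAt ((isOpen_core σ η).mem_nhds hp)) hcq.continuousAt
      rfl).tendsto).mono_left nhdsWithin_le_nhds)).norm
      (hev.mono fun q hq => (hne _ hq.1 hq.2 m hm y hy).2)
  · exact hne _ hp hq m hm y hy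

theorem integrable_J (H : Solved σ η M N Γ e) {p : ℝ × ℂ × ℝ} (hp : p ∈ core σ η) :
    Integrable (fun r : ℝ × ℝ => (curveOf Γ e).J r.1 r.2 |p.1| p.2.1 p.2.2)
      ((volume.restrict punct).prod (volume.restrict (Icc (-1 : ℝ) 1))) := by
  obtain ⟨K, hK0, hK⟩ := H.exists_core_bounds
  obtain ⟨c1, c2, -⟩ := H.continuousOn_g
  have hM := H.params.ext.nonneg
  have hfin : volume punct < ⊤ := (measure_mono sdiff_subset).trans_lt (by simp)
  have : IsFiniteMeasure (volume.restrict punct) := ⟨by simpa using hfin⟩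
  refine Integrable.of_bound (C := K) ?_ ?_
  · rw [Measure.prod_restrict]
    refine ContinuousOn.aestronglyMeasurable ?_ (measurableSet_punct.prod measurableSet_Icc)
    have hm : ContinuousOn (fun r : ℝ × ℝ => (p.1, p.2.1 - (r.1 : ℂ), r.2))
      (punct ×ˢ Icc (-1) 1) := by fun_prop
    have hmaps : MapsTo (fun r : ℝ × ℝ => (p.1, p.2.1 - (r.1 : ℂ), r.2)) (punct ×ˢ Icc (-1) 1)
      (core σ η) := fun r hr => core_shift r.1 (lt_of_le_of_lt (abs_le.2 hr.2) (by norm_num)) hp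
    refine (continuousOn_ker.comp
      (continuousOn_fst.prodMk (continuousOn_const.sub (c1.comp hm hmaps))) fun r hr =>
      ?_).mul (continuousOn_const.sub (c2.comp hm hmaps))
    have hy0 := (punct_abs hr.1).1
    exact norm_pos_iff.1 (lt_of_lt_of_le (by positivity) ((hK p hp r.2 hr.2 r.1 hr.1).1))
  · rw [Measure.prod_restrict]
    filter_upwards [ae_restrict_mem (measurableSet_punct.prod measurableSet_Icc)] with r hr using
      (hK p hp r.2 hr.2 r.1 hr.1).2

end Solved

/-- The velocity of the level sets at root time `|q|`. -/
def lvel (c : Curve) (q : ℝ) (z : ℂ) (h : ℝ) : ℂ :=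
  2 * h - ∫ y in punct, ∫ m in Icc (-1 : ℝ) 1, c.J y m |q| z h

namespace Solved

variable {σ η M N : ℝ} {Γ : ℂ → ℂ} {e : Jet}

theorem continuousOn_lvel (H : Solved σ η M N Γ e) :
    ContinuousOn (fun p : ℝ × ℂ × ℝ => lvel (curveOf Γ e) p.1 p.2.1 p.2.2) (core σ η) := by
  have hfin : volume punct < ⊤ := (measure_mono sdiff_subset).trans_lt (by simp)
  have : IsFiniteMeasure (volume.restrict punct) := ⟨by simpa using hfin⟩
  obtain ⟨K, hK0, hK⟩ := H.exists_core_bounds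
  have hM := H.params.ext.nonneg
  have h1 : ContinuousOn (fun p => ∫ r : ℝ × ℝ,
      (curveOf Γ e).J r.1 r.2 |p.1| p.2.1 p.2.2
        ∂((volume.restrict punct).prod (volume.restrict (Icc (-1) 1)))) (core σ η) := by
    refine continuousOn_of_dominated (bound := fun _ => K)
      (fun p hp => (H.integrable_J hp).aestronglyMeasurable) (fun p hp => ?_)
      (integrable_const _) ?_
    · rw [Measure.prod_restrict]
      filter_upwards [ae_restrict_mem (measurableSet_punct.prod measurableSet_Icc)] with r hr using
        (hK p hp r.2 hr.2 r.1 hr.1).2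
    · rw [Measure.prod_restrict]
      filter_upwards [ae_restrict_mem (measurableSet_punct.prod measurableSet_Icc)] with r hr
      obtain ⟨ca, cb⟩ := H.continuousOn_ab
        (lt_of_le_of_lt (abs_le.2 hr.2) (by norm_num))
      refine (continuousOn_ker.comp (continuousOn_const.prodMk ca) fun p hp => ?_).mul cb
      have hy0 := (punct_abs hr.1).1
      exact norm_pos_iff.1 (lt_of_lt_of_le (by positivity) ((hK p hp r.2 hr.2 r.1 hr.1).1))
  have h2 : ContinuousOn (fun p => (2 * p.2.2 : ℂ)) (core σ η) := by fun_prop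
  refine (h2.sub h1).congr fun p hp => ?_
  simp only [lvel, Pi.sub_apply, (integral_prod _ (H.integrable_J hp))]

theorem lvel_eq (H : Solved σ η M N Γ e) {q : ℝ} {z : ℂ} {h : ℝ} (hp : (q, z, h) ∈ dom σ η) :
    e.val q z h = 2 * q * lvel (curveOf Γ e) q z h := by
  have h1 := (H.fixed q z h hp).1
  have hq := hp.1
  rw [norm_le_zero_iff, sub_eq_zero] at h1
  rw [← h1, stepJet, lvel, abs_of_pos hq]
  ring

theorem lvel_abs (c : Curve) (q : ℝ) (z : ℂ) (h : ℝ) : lvel c |q| z h = lvel c q z h := by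
  rw [lvel, lvel, abs_abs]

theorem hasDerivAt_lvel_z_of_ne (H : Solved σ η M N Γ e) {q : ℝ} {z : ℂ} {h : ℝ}
    (hp : (q, z, h) ∈ core σ η) (hq : q ≠ 0) :
    HasDerivAt (fun w => lvel (curveOf Γ e) q w h) (e.dz |q| z h / (2 * |q|)) z := by
  have hd := (mem_dom_of_core H.params.η_pos hp hq).1
  have hq' : ((|q| : ℝ) : ℂ) ≠ 0 := by simpa using hq
  have hO :=
    (isOpen_dom σ η).preimage (by fun_prop : Continuous fun w => (|q|, w, h))
  refine ((H.reg.dz _ _ _ hd).div_const (2 * |q| : ℂ)).congr_of_eventuallyEq ?_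
  filter_upwards [hO.mem_nhds hd] with w hw
  rw [H.lvel_eq hw, lvel_abs]
  field_simp

theorem hasDerivAt_lvel_h_of_ne (H : Solved σ η M N Γ e) {q : ℝ} {z : ℂ} {h : ℝ}
    (hp : (q, z, h) ∈ core σ η) (hq : q ≠ 0) :
    HasDerivAt (fun m => lvel (curveOf Γ e) q z m) (e.dh |q| z h / (2 * |q|)) h := by
  have hd := (mem_dom_of_core H.params.η_pos hp hq).1
  have hq' : ((|q| : ℝ) : ℂ) ≠ 0 := by simpa using hq
  have hO :=
    (isOpen_dom σ η).preimage (by fun_prop : Continuous fun m => (|q|, z, m))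
  refine ((H.reg.dh _ _ _ hd).div_const (2 * |q| : ℂ)).congr_of_eventuallyEq ?_
  filter_upwards [hO.mem_nhds hd] with w hw
  rw [H.lvel_eq hw, lvel_abs]
  field_simp

theorem differentiableAt_lvel (H : Solved σ η M N Γ e) (q : ℝ) (z : ℂ) (h : ℝ)
    (hp : (q, z, h) ∈ core σ η) : DifferentiableAt ℂ (fun w => lvel (curveOf Γ e) q w h) z := by
  by_cases hq : q = 0
  · subst hq
    obtain ⟨r, hr, hbox⟩ := exists_box_subset (isOpen_core σ η) hp
    have hT : Tendsto (fun q : ℝ => (q, h)) (𝓝[≠] 0) (𝓝 (0, h)) := by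
      have : Continuous fun q : ℝ => (q, h) := by fun_prop
      exact (this.tendsto 0).mono_left nhdsWithin_le_nhds
    have hloc' : TendstoLocallyUniformlyOn (fun q w => lvel (curveOf Γ e) q w h)
        (fun w => lvel (curveOf Γ e) 0 w h) (𝓝[≠] 0) (ball z r) := by
      intro u hu x hx
      obtain ⟨t, ht, h2⟩ := (tendstoLocallyUniformlyOn_of_box H.continuousOn_lvel hr hbox) u hu x hx
      exact ⟨t, ht, hT.eventually h2⟩
    have hdo := hloc'.differentiableOn (by
      have hsm : ∀ᶠ q : ℝ in 𝓝[≠] 0, |q| ≤ r :=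
        mem_nhdsWithin_of_mem_nhds (by
          filter_upwards [closedBall_mem_nhds 0 hr] with q hq using by simpa using hq)
      filter_upwards [hsm, self_mem_nhdsWithin] with q hq hq0 w hw
      refine (H.hasDerivAt_lvel_z_of_ne (hbox q w h (by simpa using hq) ?_ (by simpa using hr.le))
        hq0).differentiableAt.differentiableWithinAt
      rw [← dist_eq_norm]; exact (mem_ball.1 hw).le) isOpen_ball
    exact hdo.differentiableAt (ball_mem_nhds z hr)
  · exact (H.hasDerivAt_lvel_z_of_ne hp hq).differentiableAt

/-- The `h`-derivative of the velocity of the level sets. -/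
def lvelH (e : Jet) (q : ℝ) (z : ℂ) (h : ℝ) : ℂ := if q = 0 then 2 else e.dh |q| z h / (2 * |q|)

theorem lvel_zero (z : ℂ) (h : ℝ) :
    lvel (curveOf Γ e) 0 z h = 2 * h + lvel (curveOf Γ e) 0 z 0 := by
  have : ∀ y m, (curveOf Γ e).J y m |0| z h = (curveOf Γ e).J y m |0| z 0 := by
    intro y m; simp [Curve.J, Curve.a, Curve.b, curveOf]
  simp only [lvel, this]
  push_cast
  ring

theorem hasDerivAt_lvel_h (H : Solved σ η M N Γ e) {q : ℝ} {z : ℂ} {h : ℝ}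
    (hp : (q, z, h) ∈ core σ η) :
    HasDerivAt (fun m => lvel (curveOf Γ e) q z m) (lvelH e q z h) h := by
  by_cases hq : q = 0
  · subst hq
    rw [lvelH, if_pos rfl]
    have h1 : HasDerivAt (fun x : ℝ => (x : ℂ)) 1 h := Complex.ofRealCLM.hasDerivAt
    have h2 := (h1.const_mul (2 : ℂ)).add_const (lvel (curveOf Γ e) 0 z 0)
    rw [mul_one] at h2
    refine h2.congr_of_eventuallyEq (Eventually.of_forall fun m => lvel_zero z m)
  · rw [lvelH, if_neg hq]; exact H.hasDerivAt_lvel_h_of_ne hp hq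

theorem continuousOn_lvelH (H : Solved σ η M N Γ e) :
    ContinuousOn (fun p : ℝ × ℂ × ℝ => lvelH e p.1 p.2.1 p.2.2) (core σ η) := by
  have hσ := H.σ_pos
  have hN := H.N_nonneg
  have hb : ∀ p ∈ core σ η, ‖lvelH e p.1 p.2.1 p.2.2 - 2‖ ≤ N / √(σ / 4) * |p.1| := by
    rintro ⟨q, z, h⟩ hp
    by_cases hq : q = 0
    · simp [lvelH, hq]
    · obtain ⟨hd, hs⟩ := mem_dom_of_core H.params.η_pos hp hq
      have h3 := (H.close _ _ _ hd).2.2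
      have hq0 := abs_pos.2 hq
      have hq' : ((|q| : ℝ) : ℂ) ≠ 0 := by simpa using hq
      simp only [lvelH, if_neg hq]
      have e1 : e.dh |q| z h / (2 * |q|) - 2 = (e.dh |q| z h - baseJet.dh |q| z h) / (2 * |q|) := by
        simp only [baseJet]; field_simp; ring
      have e2 : ‖(2 * (|q| : ℝ) : ℂ)‖ = 2 * |q| := by
        rw [norm_mul, Complex.norm_real, norm_of_nonneg hq0.le]; simp
      rw [e1, norm_div, e2, div_le_iff₀ (by positivity)]
      refine h3.trans ?_
      have : N * |q| ^ 2 / √(wid σ η |q| z) ≤ N * |q| ^ 2 / √(σ / 4) := by gcongr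
      refine this.trans ?_
      have h0 : 0 ≤ N * |q| ^ 2 / √(σ / 4) := by positivity
      calc _ ≤ 2 * (N * |q| ^ 2 / √(σ / 4)) := by linarith
        _ = _ := by ring
  rintro ⟨q, z, h⟩ hp
  by_cases hq : q = 0
  · subst hq
    have ht : Tendsto (fun p => N / √(σ / 4) * |p.1|) (𝓝[core σ η] (0, z, h)) (𝓝 0) := by
      have : Continuous fun p : ℝ × ℂ × ℝ => N / √(σ / 4) * |p.1| := by fun_prop
      have := this.tendsto ((0, z, h) : ℝ × ℂ × ℝ)
      simp only [abs_zero, mul_zero] at this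
      exact this.mono_left nhdsWithin_le_nhds
    have h0 : lvelH e 0 z h = 2 := by simp [lvelH]
    show Tendsto _ _ (𝓝 (lvelH e 0 z h))
    rw [h0, ← tendsto_sub_nhds_zero_iff]
    refine squeeze_zero_norm' ?_ ht
    filter_upwards [self_mem_nhdsWithin] with p hp' using hb p hp'
  · have h1 :=
      H.reg.cont_h.continuousAt
        ((isOpen_dom σ η).mem_nhds ((mem_dom_of_core H.params.η_pos hp hq).1))
    have h2 : Continuous fun p : ℝ × ℂ × ℝ => (|p.1|, p.2.1, p.2.2) := by fun_prop
    have h4 : ContinuousAt (fun p => (2 * ((|p.1| : ℝ) : ℂ))) (q, z, h) := by fun_prop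
    have h5 := (ContinuousAt.comp_of_eq h1 h2.continuousAt rfl).div h4 (by simpa using hq)
    refine ContinuousAt.continuousWithinAt (h5.congr ?_)
    filter_upwards [((isOpen_ne_fun continuous_fst continuous_const).mem_nhds hq)] with p hp'
    have := hp'
    simp only [lvelH, if_neg this]; rfl

theorem continuousOn_lvelZ (H : Solved σ η M N Γ e) :
    ContinuousOn (fun p : ℝ × ℂ × ℝ => deriv (fun w => lvel (curveOf Γ e) p.1 w p.2.2) p.2.1)
      (core σ η) :=
  continuousOn_deriv_of_holomorphic (isOpen_core σ η) H.continuousOn_lvel H.differentiableAt_lvel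

end Solved

/-- The kernel `ker` at real arguments. -/
def rker (y a : ℝ) : ℝ := sin y / (4 * π * (cosh a - cos y))

theorem ker_ofReal (y a : ℝ) : ker y a = rker y a := by
  rw [ker, kerDen, rker, ← Complex.ofReal_sin, ← Complex.ofReal_cos, ← Complex.ofReal_cosh]
  push_cast
  rw [div_eq_mul_inv, mul_inv (4 * (π : ℂ))]
  ring

/-- The space-time domain of the level set functions. -/
def flowDom (T : ℝ) : Set (ℝ × ℝ × ℝ) := Ico 0 T ×ˢ univ ×ˢ Ioo (-2) 2

/-- The level set functions `g t x h` of the solution and their velocity `f`, with derivatives. -/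
structure LevelFlow (γ₀ : ℝ → ℝ) where
  T : ℝ
  M : ℝ
  g : ℝ → ℝ → ℝ → ℝ
  gx : ℝ → ℝ → ℝ → ℝ
  gh : ℝ → ℝ → ℝ → ℝ
  f : ℝ → ℝ → ℝ → ℝ
  fx : ℝ → ℝ → ℝ → ℝ
  fh : ℝ → ℝ → ℝ → ℝ
  R : ℝ
  s₀ : ℝ → ℝ
  T_pos : 0 < T
  one_le_M : 1 ≤ M
  cont_g : ContinuousOn (fun p : ℝ × ℝ × ℝ => g p.1 p.2.1 p.2.2) (flowDom T)
  cont_gx : ContinuousOn (fun p : ℝ × ℝ × ℝ => gx p.1 p.2.1 p.2.2) (flowDom T)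
  cont_gh : ContinuousOn (fun p : ℝ × ℝ × ℝ => gh p.1 p.2.1 p.2.2) (flowDom T)
  cont_f : ContinuousOn (fun p : ℝ × ℝ × ℝ => f p.1 p.2.1 p.2.2) (flowDom T)
  cont_fx : ContinuousOn (fun p : ℝ × ℝ × ℝ => fx p.1 p.2.1 p.2.2) (flowDom T)
  cont_fh : ContinuousOn (fun p : ℝ × ℝ × ℝ => fh p.1 p.2.1 p.2.2) (flowDom T)
  deriv_x : ∀ t ∈ Ico 0 T, ∀ x, ∀ h ∈ Ioo (-2 : ℝ) 2, HasDerivAt (fun y => g t y h) (gx t x h) x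
  deriv_h : ∀ t ∈ Ico 0 T, ∀ x, ∀ h ∈ Ioo (-2 : ℝ) 2, HasDerivAt (fun m => g t x m) (gh t x h) h
  deriv_fx : ∀ t ∈ Ico 0 T, ∀ x, ∀ h ∈ Ioo (-2 : ℝ) 2, HasDerivAt (fun y => f t y h) (fx t x h) x
  deriv_fh : ∀ t ∈ Ico 0 T, ∀ x, ∀ h ∈ Ioo (-2 : ℝ) 2, HasDerivAt (fun m => f t x m) (fh t x h) h
  deriv_t : ∀ t ∈ Ico 0 T, ∀ x, ∀ h ∈ Ioo (-2 : ℝ) 2,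
    HasDerivWithinAt (fun s => g s x h) (f t x h) (Ici 0) t
  deriv_tx : ∀ t ∈ Ico 0 T, ∀ x, ∀ h ∈ Ioo (-2 : ℝ) 2,
    HasDerivWithinAt (fun s => gx s x h) (fx t x h) (Ici 0) t
  deriv_th : ∀ t ∈ Ico 0 T, ∀ x, ∀ h ∈ Ioo (-2 : ℝ) 2,
    HasDerivWithinAt (fun s => gh s x h) (fh t x h) (Ici 0) t
  periodic : ∀ t ∈ Ico 0 T, ∀ x, ∀ h ∈ Ioo (-2 : ℝ) 2, g t (x + 2 * π) h = g t x h
  abs_g_le : ∀ t ∈ Ico 0 T, ∀ x, ∀ h ∈ Ioo (-2 : ℝ) 2, |g t x h| ≤ R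
  abs_gx_le : ∀ t ∈ Ico 0 T, ∀ x, ∀ h ∈ Ioo (-2 : ℝ) 2, |gx t x h| ≤ M
  gx_lip : ∀ t ∈ Ico 0 T, ∀ x x', ∀ h ∈ Ioo (-2 : ℝ) 2, ∀ h' ∈ Ioo (-2 : ℝ) 2,
    |gx t x h - gx t x' h'| ≤ M * (|x - x'| + t * |h - h'|)
  gh_bounds : ∀ t ∈ Ico 0 T, ∀ x, ∀ h ∈ Ioo (-2 : ℝ) 2, t ≤ gh t x h ∧ gh t x h ≤ 3 * t
  velocity : ∀ t ∈ Ico 0 T, ∀ x, ∀ h ∈ Ioo (-2 : ℝ) 2,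
    f t x h = 2 * h - ∫ y in punct, ∫ m in Icc (-1 : ℝ) 1,
      rker y (g t x h - g t (x - y) m) * (gx t x h - gx t (x - y) m)
  init : ∀ x h, g 0 x h = γ₀ x
  f_zero : ∀ x h, f 0 x h = 2 * h + s₀ x
  analytic : ∀ t ∈ Ico 0 T, ∀ h ∈ Ioo (-2 : ℝ) 2, AnalyticOnNhd ℝ (fun x => g t x h) univ
  analytic_s₀ : AnalyticOnNhd ℝ s₀ univ

theorem hasDerivWithinAt_Ici_of_Ioo {φ ψ : ℝ → ℝ} {T : ℝ}
    (hd : ∀ t ∈ Ioo 0 T, HasDerivAt φ (ψ t) t) (hc : ContinuousOn φ (Ico 0 T))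
    (hψ : ContinuousOn ψ (Ico 0 T)) : ∀ t ∈ Ico 0 T, HasDerivWithinAt φ (ψ t) (Ici 0) t := by
  rintro t ⟨ht0, htT⟩
  rcases ht0.eq_or_lt with rfl | ht
  · have hI := Ioo_mem_nhdsGT htT
    refine hasDerivWithinAt_Ici_of_tendsto_deriv
      (fun t ht => (hd t ht).differentiableAt.differentiableWithinAt)
      ((hc 0 ⟨le_rfl, htT⟩).mono Ioo_subset_Ico_self) hI ?_
    have h1 :=
      ((hψ 0 ⟨le_rfl, htT⟩).mono Ioo_subset_Ico_self).mono_left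
        (by rw [nhdsWithin_Ioo_eq_nhdsGT htT])
    refine h1.congr' ?_
    filter_upwards [hI] with t ht using (hd t ht).deriv.symm
  · exact (hd t ⟨ht, htT⟩).hasDerivWithinAt

theorem analyticAt_re_of_differentiable {F : ℂ → ℂ} {σ : ℝ} (hσ : 0 < σ)
    (hF : ∀ z : ℂ, |z.im| < σ → DifferentiableAt ℂ F z) :
    AnalyticOnNhd ℝ (fun x : ℝ => (F x).re) univ := by
  intro x _
  have hd : DifferentiableOn ℂ F {z | |z.im| < σ} := fun z hz => (hF z hz).differentiableWithinAt
  have h1 : AnalyticAt ℂ F x := hd.analyticAt ((isOpen_strip_im σ).mem_nhds (by simpa using hσ))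
  have h3 := Complex.ofRealCLM.analyticAt x
  exact (Complex.reCLM.analyticAt _).comp (h1.restrictScalars.comp h3)

namespace Solved

variable {σ η M N : ℝ} {Γ : ℂ → ℂ} {e : Jet}

theorem sqrt_mem_core {σ η t x h : ℝ} (hσ : 0 < σ) (hη : 0 < η) (ht : t ∈ Ico 0 ((η * σ / 2) ^ 2))
    (hh : h ∈ Ioo (-2 : ℝ) 2) : (√t, (x : ℂ), h) ∈ core σ η := by
  refine ⟨?_, ?_, abs_lt.2 hh⟩
  · rw [abs_of_nonneg (sqrt_nonneg t), sqrt_lt' (by positivity)]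
    exact ht.2
  · simp; positivity

theorem continuousOn_sqrt {σ η : ℝ} (hσ : 0 < σ) (hη : 0 < η) {W : ℝ → ℂ → ℝ → ℂ}
    (hW : ContinuousOn (fun p : ℝ × ℂ × ℝ => W p.1 p.2.1 p.2.2) (core σ η)) :
    ContinuousOn (fun p : ℝ × ℝ × ℝ => (W √p.1 p.2.1 p.2.2).re) (flowDom ((η * σ / 2) ^ 2)) := by
  have hc : ContinuousOn (fun p => (√p.1, (p.2.1 : ℂ), p.2.2))
    (flowDom ((η * σ / 2) ^ 2)) := by fun_prop
  exact Complex.continuous_re.comp_continuousOn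
    (hW.comp hc (fun p hp => sqrt_mem_core hσ hη hp.1 hp.2.2))

theorem hasDerivWithinAt_sqrt (H : Solved σ η M N Γ e) {W w V : ℝ → ℂ → ℝ → ℂ}
    (hW : ContinuousOn (fun p : ℝ × ℂ × ℝ => W |p.1| p.2.1 p.2.2) (core σ η))
    (hV : ContinuousOn (fun p : ℝ × ℂ × ℝ => V p.1 p.2.1 p.2.2) (core σ η))
    (hd : ∀ q z h, (q, z, h) ∈ dom σ η → HasDerivAt (fun r => W r z h) (w q z h) q)
    (hw : ∀ q z h, 0 < q → (q, z, h) ∈ core σ η → w q z h = 2 * q * V q z h) :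
    ∀ t ∈ Ico 0 ((η * σ / 2) ^ 2), ∀ x : ℝ, ∀ h ∈ Ioo (-2 : ℝ) 2,
    HasDerivWithinAt (fun s => (W √s x h).re) ((V √t x h).re) (Ici 0) t := by
  have hσ := H.σ_pos
  have hη := H.params.η_pos
  intro t ht x h hh
  have hcl : ContinuousOn (fun s => (s, x, h)) (Ico 0 ((η * σ / 2) ^ 2)) := by fun_prop
  have hml : MapsTo (fun s : ℝ => (s, x, h)) (Ico 0 ((η * σ / 2) ^ 2))
    (flowDom ((η * σ / 2) ^ 2)) := fun s hs => ⟨hs, mem_univ _, hh⟩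
  have e1 : ∀ s : ℝ, W |√s| x h = W √s x h := fun s => by rw [abs_of_nonneg (sqrt_nonneg s)]
  refine hasDerivWithinAt_Ici_of_Ioo (ψ := fun s => (V √s x h).re)
    ?_ ?_ ((continuousOn_sqrt hσ hη hV).comp hcl hml) t ht
  · intro t ht
    have hmem := sqrt_mem_core (x := x) hσ hη (Ioo_subset_Ico_self ht) hh
    have hq := sqrt_pos.2 ht.1
    have hdm := (mem_dom_of_core hη hmem hq.ne').1
    rw [abs_of_pos hq] at hdm
    have h2 := hasDerivAt_sqrt ht.1.ne'
    have h3 := (hd _ _ _ hdm).scomp t h2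
    refine (Complex.reCLM.hasFDerivAt.comp_hasDerivAt t h3).congr_deriv ?_
    rw [hw _ _ _ hq hmem]
    have hq' : ((√t : ℝ) : ℂ) ≠ 0 := by exact_mod_cast hq.ne'
    rw [Complex.reCLM_apply, Complex.real_smul]
    congr 1
    push_cast
    field_simp
  · simpa only [Function.comp_def, e1] using
      (continuousOn_sqrt hσ hη (W := fun q z h => W |q| z h) hW).comp hcl hml

theorem im_eq_zero (H : Solved σ η M N Γ e) (hΓ : SymFun Γ)
    (hs : ∀ q z h, (q, z, h) ∈ dom σ η → e.val q (starRingEnd ℂ z) h = starRingEnd ℂ (e.val q z h))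
    {q h : ℝ} (x : ℝ) (hp : (q, (x : ℂ), h) ∈ core σ η) :
    ((curveOf Γ e).g |q| x h).im = 0 ∧ ((curveOf Γ e).u |q| x h).im = 0 := by
  have hη := H.params.η_pos
  have hσ := H.σ_pos
  have hΓx : ∀ x : ℝ, (Γ x).im = 0 := fun x => by
    have := hΓ.2 (x : ℂ)
    rw [Complex.conj_ofReal] at this
    exact Complex.conj_eq_iff_im.1 this.symm
  have hg : ∀ x : ℝ, (q, (x : ℂ), h) ∈ core σ η → ((curveOf Γ e).g |q| x h).im = 0 := by
    intro x hp
    by_cases hq : q = 0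
    · rw [hq, abs_zero, (curve_zero _ _).1, hΓx]
    · have h1 : (avg e.val |q| x h).im = 0 := by
        rw [← Complex.conj_eq_iff_im, avg, ← integral_conj]
        refine setIntegral_congr_fun measurableSet_Ioo fun l hl => ?_
        have := hs _ _ _ (dom_scale hη ((mem_dom_of_core hη hp hq).1) hl).1
        rw [Complex.conj_ofReal] at this
        exact this.symm
      simp only [curveOf, Complex.add_im, hΓx, Complex.im_ofReal_mul, h1, mul_zero, add_zero]
  refine ⟨hg x hp, ?_⟩
  have hder : HasDerivAt (fun w => (curveOf Γ e).g |q| w h) ((curveOf Γ e).u |q| x h) x := by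
    by_cases hq : q = 0
    · subst hq
      rw [abs_zero, (curve_zero _ _).2.1]
      simp only [(curve_zero _ _).1]
      exact (H.params.ext.diff.differentiableAt
        ((isOpen_strip_im σ).mem_nhds (by simpa using hσ))).hasDerivAt
    · exact H.near.reg.reg.dz _ _ _ (mem_dom_of_core hη hp hq).1
  have h1 := Complex.imCLM.hasFDerivAt.comp_hasDerivAt x hder.comp_ofReal
  have h2 : (Complex.imCLM ∘ fun s : ℝ => (curveOf Γ e).g |q| s h) = fun _ => 0 := by
    ext s; exact hg s ((fun s => ⟨hp.1, by simpa using hσ, hp.2.2⟩) s)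
  rw [h2] at h1
  exact h1.unique (hasDerivAt_const _ _)

end Solved

theorem nonempty_levelFlow {γ₀ : ℝ → ℝ} (hper : Function.Periodic γ₀ (2 * π))
    (han : AnalyticOnNhd ℝ γ₀ univ) : Nonempty (LevelFlow γ₀) := by
  obtain ⟨Γ, hΓ, hΓx, M, σ, hσ, hσ1, hext⟩ := exists_holomorphic_extension hper han
  obtain ⟨η, N, hη, hη1, hN, hfp⟩ := exists_fixedPoint M hext.nonneg
  have P : Params σ η M Γ := ⟨hext, hσ1, hη, hη1⟩
  obtain ⟨e, hreg, hclose, hnear, hfix, hsym⟩ := hfp σ Γ P hΓ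
  have H : Solved σ η M N Γ e := ⟨P, hσ, hN.le, hreg, hclose, hnear, hfix⟩
  set c := curveOf Γ e with hc
  have hM := hext.nonneg
  obtain ⟨r0, r1⟩ := P.radius_bounds
  set r := (16 * (1 + M))⁻¹ with hr
  set T := (η * σ / 2) ^ 2 with hT
  have habs := fun s => abs_of_nonneg (sqrt_nonneg s)
  have hmem : ∀ t ∈ Ico 0 T, ∀ x : ℝ, ∀ h ∈ Ioo (-2 : ℝ) 2, (√t, (x : ℂ), h) ∈ core σ η :=
    fun t ht x h hh => Solved.sqrt_mem_core hσ hη ht hh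
  have hdom : ∀ t ∈ Ico 0 T, t ≠ 0 → ∀ z : ℂ, ∀ h ∈ Ioo (-2) 2, |z.im| < σ / 4 →
      (√t, z, h) ∈ dom σ η ∧ σ / 4 ≤ wid σ η √t z := by
    intro t ht h0 z h hh hz
    have := mem_dom_of_core (z := z) hη
      ⟨(hmem t ht 0 h hh).1, hz, abs_lt.2 hh⟩ (sqrt_ne_zero'.2 (lt_of_le_of_ne ht.1 h0.symm))
    rwa [habs] at this
  have hreal : ∀ x : ℝ, |((x : ℂ)).im| < σ / 4 := fun x => by
    rw [Complex.ofReal_im, abs_zero]; positivity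
  have him := fun t ht x h hh => H.im_eq_zero hΓ (fun q z h hp => (hsym q z h hp).2) x
    (hmem t ht x h hh)
  simp only [habs] at him
  have hcr := H.close.crude P.σ_le P.η_pos P.η_le H.N_nonneg H.reg
  obtain ⟨cg, cu, cgh⟩ := H.continuousOn_g
  set C := M + 1 + 1 / √(σ / 4) with hC
  have hS0 : 0 ≤ 1 / √(σ / 4) := by positivity
  have hclo := fun t ht (h0 : t ≠ 0) (x : ℝ) h hh => hnear.close √t x h
    (hdom t ht h0 x h hh (hreal x)).1
  have hsq : ∀ t ∈ Ico 0 T, √t ^ 2 = t := fun t ht => sq_sqrt ht.1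
  have h00 : (0 : ℝ) ∈ Ico 0 T := ⟨le_rfl, by positivity⟩
  have hgz : ∀ t ∈ Ico 0 T, ∀ z : ℂ, |z.im| < σ / 4 → ∀ h ∈ Ioo (-2) 2,
      HasDerivAt (fun w => c.g √t w h) (c.u √t z h) z := by
    intro t ht z hz h hh
    by_cases h0 : t = 0
    · subst h0
      rw [sqrt_zero, (Solved.curve_zero _ _).2.1]
      simp only [hc, (Solved.curve_zero _ _).1]
      exact (hext.diff.differentiableAt ((isOpen_strip_im σ).mem_nhds
        (by rw [mem_ofPred_eq]; linarith))).hasDerivAt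
    · exact hnear.reg.reg.dz _ _ _ (hdom t ht h0 z h hh hz).1
  have hEqz : ∀ q z h, 0 < q → (q, z, h) ∈ core σ η →
      e.dz q z h = 2 * q * deriv (fun w => lvel c q w h) z := by
    intro q z h hq hp
    rw [(H.hasDerivAt_lvel_z_of_ne hp hq.ne').deriv, abs_of_pos hq]
    have hq' : (q : ℂ) ≠ 0 := by exact_mod_cast hq.ne'
    field_simp
  have hEqh : ∀ q z h, 0 < q → (q, z, h) ∈ core σ η →
      e.dh q z h = 2 * q * Solved.lvelH e q z h := by
    intro q z h hq hp
    rw [Solved.lvelH, if_neg hq.ne', abs_of_pos hq]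
    have hq' : (q : ℂ) ≠ 0 := by exact_mod_cast hq.ne'
    field_simp
  have hEq : ∀ q z h, 0 < q → (q, z, h) ∈ core σ η → e.val q z h = 2 * q * lvel c q z h := by
    intro q z h hq hp
    have := (mem_dom_of_core hη hp hq.ne').1
    rw [abs_of_pos hq] at this
    exact H.lvel_eq this
  have hlipne : ∀ t ∈ Ico 0 T, t ≠ 0 → ∀ x x' : ℝ, ∀ h ∈ Ioo (-2) 2, ∀ h' ∈ Ioo (-2) 2,
      |(c.u √t x h).re - (c.u √t x' h').re| ≤ C * (|x - x'| + t * |h - h'|) := by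
    intro t ht h0 x x' h hh h' hh'
    obtain ⟨hd, hw⟩ := hdom t ht h0 x h hh (hreal x)
    have hb := hnear.reg.reg_u.norm_sub_shift_le (y := x - x') (A := C) (B := C * t) hd
      (abs_lt.2 hh') (fun w m hw' hwd => ?_) (fun w m hw' hwd => ?_)
    · rw [Complex.ofReal_sub, sub_sub_cancel] at hb
      rw [← Complex.sub_re]
      exact (Complex.abs_re_le_norm _).trans (hb.trans (le_of_eq (by ring)))
    · have h1 := (hnear.close _ _ _ hwd).2.1
      rw [(curveOf_baseJet Γ _ _ _).2.2.1, wid_of_im_eq hw'] at h1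
      have h2 := hext.deriv2_le w (dom_im_lt hη hwd)
      have h3 : r / √(wid σ η √t x) ≤ 1 / √(σ / 4) := by gcongr
      have h4 := norm_le_norm_add_norm_sub' (c.ux √t w m) (deriv (deriv Γ) w)
      linarith
    · have h1 := (hnear.close _ _ _ hwd).2.2.2
      rw [(curveOf_baseJet Γ _ _ _).2.2.2.2, sub_zero, wid_of_im_eq hw', hsq t ht] at h1
      refine h1.trans ?_
      have ht0 := ht.1
      have h3 : r * t / √(wid σ η √t x) ≤ 1 * t / √(σ / 4) := by gcongr
      refine h3.trans ?_
      calc 1 * t / √(σ / 4) = 1 / √(σ / 4) * t := by ring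
        _ ≤ C * t := by gcongr; linarith
  have contu := Solved.continuousOn_sqrt hσ hη (W := fun q z h => c.u |q| z h) cu
  have contg := Solved.continuousOn_sqrt hσ hη (W := fun q z h => c.g |q| z h) cg
  have contgh := Solved.continuousOn_sqrt hσ hη (W := fun q z h => c.gh |q| z h) cgh
  simp only [habs] at contu contg contgh
  have hlip : ∀ t ∈ Ico 0 T, ∀ x x' : ℝ, ∀ h ∈ Ioo (-2) 2, ∀ h' ∈ Ioo (-2) 2,
      |(c.u √t x h).re - (c.u √t x' h').re| ≤ C * (|x - x'| + t * |h - h'|) := by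
    intro t ht x x' h hh h' hh'
    by_cases h0 : t = 0
    · subst h0
      have hcs : ∀ x : ℝ, ∀ h ∈ Ioo (-2) 2, Tendsto (fun s => (c.u √s x h).re) (𝓝[>] 0)
          (𝓝 (c.u √0 x h).re) := by
        intro x h hh
        have h1 : ContinuousOn (fun s => (s, x, h)) (Ico 0 T) := by fun_prop
        have h2 := (contu.comp h1 fun s hs => ⟨hs, mem_univ _, hh⟩) 0 h00
        exact h2.mono_left (by
          rw [← nhdsWithin_Ioo_eq_nhdsGT h00.2]; exact nhdsWithin_mono _ Ioo_subset_Ico_self)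
      have hr : Tendsto (fun s => C * (|x - x'| + s * |h - h'|)) (𝓝[>] 0)
          (𝓝 (C * (|x - x'| + 0 * |h - h'|))) := by
        have : Continuous fun s => C * (|x - x'| + s * |h - h'|) := by fun_prop
        exact (this.tendsto 0).mono_left nhdsWithin_le_nhds
      refine le_of_tendsto_of_tendsto ((hcs x h hh).sub (hcs x' h' hh')).abs hr ?_
      filter_upwards [Ioo_mem_nhdsGT h00.2] with s hs using hlipne s (Ioo_subset_Ico_self hs)
        hs.1.ne' x x' h hh h' hh'
    · exact hlipne t ht h0 x x' h hh h' hh'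
  obtain ⟨B, hB⟩ := (hper.isBounded_of_continuous (by positivity)
    han.continuous).exists_norm_le
  refine ⟨{
    T := T
    R := B + (3 * N + 8) / (σ / 4) ^ 2
    M := C
    g := fun t x h => (c.g √t x h).re
    gx := fun t x h => (c.u √t x h).re
    gh := fun t x h => (c.gh √t x h).re
    f := fun t x h => (lvel c √t x h).re
    fx := fun t x h => (deriv (fun w => lvel c √t w h) x).re
    fh := fun t x h => (Solved.lvelH e √t x h).re
    s₀ := fun x => (lvel c 0 x 0).re
    T_pos := by positivity
    one_le_M := by rw [hC]; linarith
    cont_g := contg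
    cont_gx := contu
    cont_gh := contgh
    cont_f := Solved.continuousOn_sqrt hσ hη H.continuousOn_lvel
    cont_fx := Solved.continuousOn_sqrt hσ hη
      (W := fun q z h => deriv (fun w => lvel c q w h) z) H.continuousOn_lvelZ
    cont_fh := Solved.continuousOn_sqrt hσ hη H.continuousOn_lvelH
    deriv_x := fun t ht x h hh => (hgz t ht x (hreal x) h hh).real_of_complex
    deriv_h := ?_
    deriv_fx := fun t ht x h hh =>
      (H.differentiableAt_lvel _ _ _ (hmem t ht x h hh)).hasDerivAt.real_of_complex
    deriv_fh := fun t ht x h hh => Complex.reCLM.hasFDerivAt.comp_hasDerivAt h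
      (H.hasDerivAt_lvel_h (hmem t ht x h hh))
    deriv_t := ?_
    deriv_tx := ?_
    deriv_th := ?_
    periodic := ?_
    abs_g_le := ?_
    abs_gx_le := ?_
    gx_lip := hlip
    gh_bounds := ?_
    velocity := ?_
    init := fun x h => by
      simp only [sqrt_zero, hc, (Solved.curve_zero _ _).1, hΓx, Complex.ofReal_re]
    f_zero := fun x h => by
      simp only [sqrt_zero, hc]
      rw [Solved.lvel_zero]
      simp
    analytic := ?_
    analytic_s₀ := ?_ }⟩
  · intro t ht x h hh
    by_cases h0 : t = 0
    · subst h0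
      simp only [sqrt_zero, hc, (Solved.curve_zero _ _).1, (Solved.curve_zero _ _).2.2]
      exact hasDerivAt_const _ _
    · exact Complex.reCLM.hasFDerivAt.comp_hasDerivAt h
        (hnear.reg.reg.dh _ _ _ (hdom t ht h0 x h hh (hreal x)).1)
  · exact H.hasDerivWithinAt_sqrt cg H.continuousOn_lvel
      (fun q z h hp =>
        ((hasDerivAt_mul_avg hη H.reg.cont (fun q z h hp => (hcr q z h hp).1) hp).const_add _)) hEq
  · exact H.hasDerivWithinAt_sqrt
      cu H.continuousOn_lvelZ
      (fun q z h hp =>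
        ((hasDerivAt_mul_avg hη H.reg.cont_z (fun q z h hp => (hcr q z h hp).2.1) hp).const_add _))
        hEqz
  · exact H.hasDerivWithinAt_sqrt
      cgh H.continuousOn_lvelH
        (fun q z h hp =>
        (hasDerivAt_mul_avg hη H.reg.cont_h (fun q z h hp => (hcr q z h hp).2.2.1) hp)) hEqh
  · intro t ht x h hh
    have e1 : ((x + 2 * π : ℝ) : ℂ) = x + 2 * π := by push_cast; ring
    show (c.g √t ((x + 2 * π : ℝ) : ℂ) h).re = (c.g √t x h).re
    rw [e1]
    by_cases h0 : t = 0
    · subst h0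
      simp only [sqrt_zero, hc, (Solved.curve_zero _ _).1, hΓ.1]
    · have hd := (hdom t ht h0 x h hh (hreal x)).1
      have h1 : avg e.val √t (x + 2 * π) h = avg e.val √t x h :=
        setIntegral_congr_fun measurableSet_Ioo fun l hl => (hsym _ _ _ (dom_scale hη hd hl).1).1
      simp only [hc, curveOf, h1, hΓ.1]
  · intro t ht x h hh
    refine (Complex.abs_re_le_norm _).trans ?_
    have hb : ‖Γ x‖ ≤ B := by
      rw [hΓx, Complex.norm_real]; exact hB _ (mem_range_self x)
    by_cases h0 : t = 0
    · subst h0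
      rw [sqrt_zero, (Solved.curve_zero _ _).1]
      have : 0 ≤ (3 * N + 8) / (σ / 4) ^ 2 := by positivity
      linarith
    · obtain ⟨hd, hw⟩ := hdom t ht h0 x h hh (hreal x)
      have h1 := H.crude_core (fun q z h hp => (hcr q z h hp).1) _ _ _ hd hw
      have h2 : (3 * N + 8) / (σ / 4) ^ 2 * √t ≤ (3 * N + 8) / (σ / 4) ^ 2 * 1 := by
        gcongr; exact (dom_le_one hσ1 hη hη1 hd).2
      refine (norm_add_le _ _).trans ?_
      linarith
  · intro t ht x h hh
    refine (Complex.abs_re_le_norm _).trans ?_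
    have hb := hext.deriv_le x (by rw [Complex.ofReal_im, abs_zero]; exact hσ)
    by_cases h0 : t = 0
    · subst h0
      rw [sqrt_zero, (Solved.curve_zero _ _).2.1]
      linarith
    · have h1 := (hclo t ht h0 x h hh).1
      rw [(curveOf_baseJet Γ _ _ _).2.1] at h1
      have h4 := norm_le_norm_add_norm_sub' (c.u √t x h) (deriv Γ x)
      linarith
  · intro t ht x h hh
    by_cases h0 : t = 0
    · subst h0
      simp only [sqrt_zero, hc, (Solved.curve_zero _ _).2.2]
      simp
    · have h1 := (hclo t ht h0 x h hh).2.2.1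
      rw [(curveOf_baseJet Γ _ _ _).2.2.2.1] at h1
      have e2 : (2 * ((√t : ℝ) : ℂ) ^ 2) = ((2 * t : ℝ) : ℂ) := by
        rw [← Complex.ofReal_pow, hsq t ht]; push_cast; ring
      rw [e2, hsq t ht] at h1
      have h2 := (Complex.abs_re_le_norm _).trans h1
      rw [Complex.sub_re, Complex.ofReal_re] at h2
      have h3 : r * t ≤ 1 * t := by gcongr; exact ht.1
      have h4 := abs_le.1 (h2.trans h3)
      exact ⟨by linarith, by linarith⟩
  · intro t ht x h hh
    have hrg : ∀ x : ℝ, ∀ h ∈ Ioo (-2 : ℝ) 2, c.g √t x h = ((c.g √t x h).re : ℝ) :=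
      fun x h hh => Complex.ext (by simp) (by simpa using (him t ht x h hh).1)
    have hru : ∀ x : ℝ, ∀ h ∈ Ioo (-2 : ℝ) 2, c.u √t x h = ((c.u √t x h).re : ℝ) :=
      fun x h hh => Complex.ext (by simp) (by simpa using (him t ht x h hh).2)
    have hJ : ∀ y, ∀ m ∈ Icc (-1) 1, c.J y m √t x h
        = ((rker y ((c.g √t x h).re - (c.g √t (x - y : ℝ) m).re)
          * ((c.u √t x h).re - (c.u √t (x - y : ℝ) m).re) : ℝ) : ℂ) := by
      intro y m hm
      have hm2 : m ∈ Ioo (-2 : ℝ) 2 := ⟨by linarith [hm.1], by linarith [hm.2]⟩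
      rw [Curve.J, Curve.a, Curve.b, ← Complex.ofReal_sub, hrg x h hh, hrg (x - y) m hm2,
        hru x h hh, hru (x - y) m hm2, ← Complex.ofReal_sub, ← Complex.ofReal_sub, ker_ofReal,
        ← Complex.ofReal_mul]
      simp
    have hI : ∫ y in punct, ∫ m in Icc (-1) 1, c.J y m √t x h
        = ((∫ y in punct, ∫ m in Icc (-1) 1,
          rker y ((c.g √t x h).re - (c.g √t (x - y : ℝ) m).re)
          * ((c.u √t x h).re - (c.u √t (x - y : ℝ) m).re) : ℝ) : ℂ) := by
      rw [← integral_complex_ofReal]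
      refine setIntegral_congr_fun measurableSet_punct fun y hy => ?_
      show _ = ((_ : ℝ) : ℂ)
      rw [← integral_complex_ofReal]
      exact setIntegral_congr_fun measurableSet_Icc fun m hm => hJ y m hm
    show (lvel c √t x h).re = _
    rw [lvel, habs, hI]
    simp
  · intro t ht h hh
    exact analyticAt_re_of_differentiable (by positivity)
      fun z hz => (hgz t ht z hz h hh).differentiableAt
  · exact analyticAt_re_of_differentiable (by positivity)
      fun z hz => H.differentiableAt_lvel 0 z 0 ⟨by rw [abs_zero]; positivity, hz, by simp⟩

/-- `cosh a - cos y`, which is comparable to the squared distance from the lattice. -/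
def den (y a : ℝ) : ℝ := cosh a - cos y

theorem rker_eq (y a : ℝ) : rker y a = sin y / (4 * π * den y a) := rfl

theorem den_nonneg (y a : ℝ) : 0 ≤ den y a := by
  have h1 := one_le_cosh a
  have h2 := cos_le_one y
  rw [den]; linarith

theorem den_ge {y : ℝ} (hy : |y| ≤ π) (a : ℝ) : (a ^ 2 + y ^ 2) / 5 ≤ den y a := by
  have h1 := one_add_sq_div_two_le_cosh a
  have h2 := cos_le_one_sub_sq_div_five hy
  rw [den]; linarith [sq_nonneg a]

theorem den_pos_of_ne {y a : ℝ} (ha : a ≠ 0) : 0 < den y a := by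
  have h1 := one_lt_cosh.2 ha
  have h2 := cos_le_one y
  rw [den]; linarith

theorem den_pos_of_punct {y a : ℝ} (hy : y ∈ punct) : 0 < den y a := by
  obtain ⟨h0, h1⟩ := punct_abs hy
  have : 0 < y ^ 2 := by rw [← sq_abs]; positivity
  exact lt_of_lt_of_le (by positivity) (den_ge h1 a)

theorem abs_sin_sq_le (y a : ℝ) : sin y ^ 2 ≤ 2 * den y a := by
  have h1 := one_le_cosh a
  have h2 := sin_sq_add_cos_sq y
  rw [den]; nlinarith

theorem abs_rker_le (y a : ℝ) : |rker y a| ≤ 1 / √(den y a) := by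
  rcases (den_nonneg y a).eq_or_lt with h | h
  · rw [rker_eq, ← h]; simp
  · have hsq := sq_sqrt h.le
    have h1 : |sin y| ≤ 2 * √(den y a) := by
      refine abs_le_of_sq_le_sq ?_ (by positivity)
      have := abs_sin_sq_le y a
      rw [mul_pow, hsq]; linarith
    have hpi := pi_gt_three
    rw [rker_eq, abs_div, abs_of_pos (by positivity : 0 < 4 * π * den y a),
      div_le_div_iff₀ (by positivity) (sqrt_pos.2 h)]
    calc |sin y| * √(den y a) ≤ 2 * √(den y a) * √(den y a) := by gcongr
      _ = 2 * den y a := by rw [mul_assoc, ← sq, hsq]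
      _ ≤ 1 * (4 * π * den y a) := by nlinarith

theorem rker_add_two_pi (y a : ℝ) : rker (y + 2 * π) a = rker y a := by
  simp [rker]

theorem den_add_two_pi (y a : ℝ) : den (y + 2 * π) a = den y a := by
  simp [den]

theorem rker_neg (y a : ℝ) : rker (-y) a = -rker y a := by
  simp [rker, neg_div]

theorem continuous_den : Continuous fun p : ℝ × ℝ => den p.1 p.2 := by
  unfold den; fun_prop

theorem continuousAt_rker {y a : ℝ} (h : 0 < den y a) :
    ContinuousAt (fun p : ℝ × ℝ => rker p.1 p.2) (y, a) := by
  have h2 : ContinuousAt (fun p => sin p.1) (y, a) := by fun_prop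
  exact h2.div ((continuous_const.mul continuous_den).continuousAt) (by positivity)

theorem measurable_rker : Measurable fun p : ℝ × ℝ => rker p.1 p.2 := by
  have h2 : Measurable fun p : ℝ × ℝ => sin p.1 := by fun_prop
  exact h2.div ((continuous_const.mul continuous_den).measurable)

theorem exp_abs_le_cosh_sub_one {a : ℝ} (ha : 1 ≤ |a|) : exp |a| / 8 ≤ cosh a - 1 := by
  rw [← cosh_abs, cosh_eq]
  have h2 : 2.7182818283 < exp |a| := by
    exact exp_one_gt_d9.trans_le (exp_le_exp.2 ha)
  have h3 := exp_pos (-|a|)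
  linarith

theorem abs_rker_le_exp {y a : ℝ} (ha : 1 ≤ |a|) : |rker y a| ≤ exp (-|a|) := by
  have h1 := exp_abs_le_cosh_sub_one ha
  have h2 := cos_le_one y
  have h3 : exp |a| / 8 ≤ den y a := by rw [den]; linarith
  have he := exp_pos |a|
  have hpi := pi_gt_three
  rw [rker_eq, abs_div, exp_neg, abs_of_pos (a := 4 * π * den y a) (by
    have : 0 < den y a := by linarith
    positivity), ← one_div]
  refine div_le_div₀ zero_le_one (abs_sin_le_one y) he ?_
  nlinarith

theorem den_le_sq {y a : ℝ} (ha : |a| ≤ 1) : den y a ≤ y ^ 2 + a ^ 2 := by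
  have h1 : cosh a ≤ 1 + a ^ 2 := by
    refine (cosh_le_exp_half_sq a).trans ?_
    have ha2 : a ^ 2 ≤ 1 := by rw [← sq_abs]; exact pow_le_one₀ (abs_nonneg a) ha
    have h2 := abs_exp_sub_one_sub_id_le (x := a ^ 2 / 2) (by
      rw [abs_of_nonneg (by positivity)]; linarith)
    have h3 := (abs_le.1 h2).2
    nlinarith
  have h2 := one_sub_sq_div_two_le_cos (x := y)
  rw [den]; nlinarith

theorem abs_rker_sub_le {y y' a a' : ℝ} (h : 0 < den y a) (h' : 0 < den y' a')
    (ha : |a - a'| ≤ 1) :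
    |rker y a - rker y' a'| ≤ √((y - y') ^ 2 + (a - a') ^ 2) / (√(den y a) * √(den y' a')) := by
  have e : (sin y * den y' a' - sin y' * den y a) ^ 2 +
      (sinh a * den y' a' - sinh a' * den y a) ^ 2 =
      2 * (den y a * den y' a') * den (y - y') (a - a') := by
    simp only [den, cosh_sub, cos_sub]
    linear_combination (cosh a' - cos y') ^ 2 * (sin_sq_add_cos_sq y - cosh_sq a) +
      (cosh a - cos y) ^ 2 * (sin_sq_add_cos_sq y' - cosh_sq a')
  have h1 : 2 * (den y a * den y' a') * den (y - y') (a - a') ≤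
      2 * (den y a * den y' a') * ((y - y') ^ 2 + (a - a') ^ 2) := by gcongr; exact den_le_sq ha
  have e2 : rker y a - rker y' a' =
      (sin y * den y' a' - sin y' * den y a) / (4 * π * (den y a * den y' a')) := by
    rw [rker_eq, rker_eq]
    field_simp
  set Q := (y - y') ^ 2 + (a - a') ^ 2
  set s := √(den y a) with hs
  set s' := √(den y' a') with hs'
  have q := (sq_sqrt h.le).symm
  have q' := (sq_sqrt h'.le).symm
  have p := sqrt_pos.2 h
  have p' := sqrt_pos.2 h'
  have hN : |sin y * den y' a' - sin y' * den y a| ≤ 2 * (s * s') * √Q := by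
    refine abs_le_of_sq_le_sq ?_ (by positivity)
    have h2 : (2 * (s * s') * √Q) ^ 2 = 4 * (den y a * den y' a') * Q := by
      rw [mul_pow, sq_sqrt (by positivity), q, q']; ring
    have h3 : 0 ≤ den y a * den y' a' * Q := by positivity
    linarith [sq_nonneg (sinh a * den y' a' - sinh a' * den y a)]
  rw [e2, abs_div, abs_of_pos (a := 4 * π * _) (by positivity),
    div_le_div_iff₀ (by positivity) (by positivity)]
  calc _ ≤ 2 * (s * s') * √Q * (s * s') := by gcongr
    _ = √Q * (2 * (den y a * den y' a')) := by rw [q, q']; ring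
    _ ≤ _ := by gcongr; linarith [pi_gt_three]

/-- Interpolation between the size and the Lipschitz bound of the kernel. -/
theorem min_interp_le {p p' r d : ℝ} (hp : 0 < p) (hp' : 0 < p') (hr : 0 ≤ r)
    (h1 : d ≤ r / (p * p')) (h2 : d ≤ 1 / p + 1 / p') :
    d ≤ 4 * (r / (p * (p + r)) + r / (p' * (p' + r))) := by
  wlog hle : p ≤ p' generalizing p p'
  · have := this hp' hp (by rwa [mul_comm p']) (by rwa [add_comm]) (le_of_not_ge hle)
    rwa [add_comm (r / (p * (p + r)))]
  have h0 : 0 ≤ r / (p' * (p' + r)) := by positivity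
  suffices d ≤ 4 * (r / (p * (p + r))) by linarith
  by_cases hc : r ≤ p
  · refine h1.trans ?_
    rw [← mul_div_assoc, div_le_div_iff₀ (by positivity) (by positivity)]
    have : p * (p + r) ≤ 4 * (p * p') := by nlinarith
    nlinarith
  · push Not at hc
    have h3 := h2.trans (by
      have := one_div_le_one_div_of_le hp hle
      have e : 2 / p = 1 / p + 1 / p := by ring
      linarith)
    refine h3.trans ?_
    rw [← mul_div_assoc, div_le_div_iff₀ hp (by positivity)]
    nlinarith

namespace LevelFlow

variable {γ₀ : ℝ → ℝ} (Λ : LevelFlow γ₀)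

theorem mem_Ioo_of_Icc {h : ℝ} (hh : h ∈ Icc (-1 : ℝ) 1) : h ∈ Ioo (-2 : ℝ) 2 :=
  ⟨by linarith [hh.1], by linarith [hh.2]⟩

/-- The density: the label of the level set on which a point lies. -/
def ρ (t : ℝ) (x : ℝ × ℝ) : ℝ := sSup ({-1} ∪ {h | h ∈ Icc (-1 : ℝ) 1 ∧ Λ.g t x.1 h < x.2})

theorem g_slope {t : ℝ} (ht : t ∈ Ico 0 Λ.T) (x : ℝ) {h h' : ℝ} (hh : h ∈ Icc (-1 : ℝ) 1)
    (hh' : h' ∈ Icc (-1 : ℝ) 1) (hle : h ≤ h') : t * (h' - h) ≤ Λ.g t x h' - Λ.g t x h := by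
  refine (convex_Icc (-1) 1).mul_sub_le_image_sub_of_le_deriv
    (fun m hm => (Λ.deriv_h t ht x m (mem_Ioo_of_Icc hm)).continuousAt.continuousWithinAt)
    (fun m hm => (Λ.deriv_h t ht x m (mem_Ioo_of_Icc
      (interior_subset hm))).differentiableAt.differentiableWithinAt) (fun m hm => ?_) h hh h' hh'
        hle
  have hm2 := mem_Ioo_of_Icc (interior_subset hm)
  rw [(Λ.deriv_h t ht x m hm2).deriv]
  exact (Λ.gh_bounds t ht x m hm2).1

theorem g_lip_x {t : ℝ} (ht : t ∈ Ico 0 Λ.T) (x x' : ℝ) {h : ℝ} (hh : h ∈ Ioo (-2 : ℝ) 2) :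
    |Λ.g t x h - Λ.g t x' h| ≤ Λ.M * |x - x'| := by
  have := convex_univ.norm_image_sub_le_of_norm_hasDerivWithin_le
    (fun y _ => (Λ.deriv_x t ht y h hh).hasDerivWithinAt) (fun y _ => Λ.abs_gx_le t ht y h hh)
    (mem_univ x') (mem_univ x)
  exact this

theorem le_one_of_mem {t : ℝ} {x : ℝ × ℝ} :
    ∀ h ∈ ({-1} ∪ {h | h ∈ Icc (-1 : ℝ) 1 ∧ Λ.g t x.1 h < x.2} : Set ℝ), h ≤ 1 := by
  rintro h (h1 | h1)
  · rw [mem_singleton_iff.1 h1]; norm_num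
  · exact h1.1.2

theorem ρ_mem (t : ℝ) (x : ℝ × ℝ) : Λ.ρ t x ∈ Icc (-1 : ℝ) 1 :=
  ⟨le_csSup ⟨1, Λ.le_one_of_mem⟩ (Or.inl rfl), csSup_le ⟨-1, Or.inl rfl⟩ Λ.le_one_of_mem⟩

theorem abs_ρ_le (t : ℝ) (x : ℝ × ℝ) : |Λ.ρ t x| ≤ 1 := abs_le.2 (Λ.ρ_mem t x)

theorem lt_ρ_iff {t : ℝ} (ht : t ∈ Ico 0 Λ.T) {x : ℝ × ℝ} {h : ℝ} (hh : h ∈ Ico (-1 : ℝ) 1) :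
    h < Λ.ρ t x ↔ Λ.g t x.1 h < x.2 := by
  have hh2 := Ico_subset_Icc_self hh
  rw [ρ, lt_csSup_iff ⟨1, Λ.le_one_of_mem⟩ ⟨-1, Or.inl rfl⟩]
  constructor
  · rintro ⟨h', (h1 | h1), hlt⟩
    · rw [mem_singleton_iff.1 h1] at hlt; linarith [hh.1]
    · nlinarith [Λ.g_slope ht x.1 hh2 h1.1 hlt.le, ht.1, h1.2]
  · intro hlt
    obtain ⟨m, hm1, hm2⟩ :=
      ((((Λ.deriv_h t ht x.1 h (mem_Ioo_of_Icc hh2)).continuousAt.eventually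
      (gt_mem_nhds hlt)).filter_mono nhdsWithin_le_nhds).and (Ioo_mem_nhdsGT hh.2)).exists
    exact ⟨m, Or.inr ⟨⟨by linarith [hh.1], hm2.2.le⟩, hm1⟩, hm2.1⟩

theorem g_ρ_le {t : ℝ} (ht : t ∈ Ico 0 Λ.T) {x : ℝ × ℝ} (h : -1 < Λ.ρ t x) :
    Λ.g t x.1 (Λ.ρ t x) ≤ x.2 := by
  refine le_of_tendsto ((Λ.deriv_h t ht x.1 _ (mem_Ioo_of_Icc
    (Λ.ρ_mem t x))).continuousAt.tendsto.mono_left (nhdsWithin_le_nhds (s := Iio (Λ.ρ t x)))) ?_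
  filter_upwards [Ioo_mem_nhdsLT h] with m hm using
    ((Λ.lt_ρ_iff ht ⟨hm.1.le, hm.2.trans_le (Λ.ρ_mem t x).2⟩).1 hm.2).le

theorem le_g_ρ {t : ℝ} (ht : t ∈ Ico 0 Λ.T) {x : ℝ × ℝ} (h : Λ.ρ t x < 1) :
    x.2 ≤ Λ.g t x.1 (Λ.ρ t x) :=
  not_lt.1 fun hc => lt_irrefl _ ((Λ.lt_ρ_iff ht ⟨(Λ.ρ_mem t x).1, h⟩).2 hc)

/-- The vertical distance to a level set controls the difference of the labels. -/
theorem abs_sub_g_ge {t : ℝ} (ht : t ∈ Ico 0 Λ.T) (x : ℝ × ℝ) {m : ℝ} (hm : m ∈ Icc (-1 : ℝ) 1) :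
    t * |m - Λ.ρ t x| ≤ |x.2 - Λ.g t x.1 m| := by
  have hr := Λ.ρ_mem t x
  rcases lt_trichotomy m (Λ.ρ t x) with h | h | h
  · rw [abs_of_neg (sub_neg.2 h)]
    refine le_trans ?_ (le_abs_self _)
    linarith [Λ.g_slope ht x.1 hm hr h.le, Λ.g_ρ_le ht (hm.1.trans_lt h)]
  · simp [h]
  · rw [abs_of_pos (sub_pos.2 h), abs_sub_comm]
    refine le_trans ?_ (le_abs_self _)
    linarith [Λ.g_slope ht x.1 hr hm h.le, Λ.le_g_ρ ht (h.trans_le hm.2)]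

theorem ρ_sub_le {t : ℝ} (ht : t ∈ Ioo 0 Λ.T) (x x' : ℝ × ℝ) :
    Λ.ρ t x - Λ.ρ t x' ≤ (|x.2 - x'.2| + Λ.M * |x.1 - x'.1|) / t := by
  have hI := Ioo_subset_Ico_self ht
  have hr := Λ.ρ_mem t x
  have hr' := Λ.ρ_mem t x'
  have hM := Λ.one_le_M
  rw [le_div_iff₀ ht.1]
  by_cases h : Λ.ρ t x ≤ Λ.ρ t x'
  · exact le_trans (mul_nonpos_of_nonpos_of_nonneg (by linarith) ht.1.le) (by positivity)
  push Not at h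
  linarith [Λ.g_slope hI x'.1 hr' hr h.le, Λ.g_ρ_le hI (hr'.1.trans_lt h),
    Λ.le_g_ρ hI (h.trans_le hr.2), le_abs_self (x.2 - x'.2),
    (abs_le.1 (Λ.g_lip_x hI x.1 x'.1 (mem_Ioo_of_Icc hr))).1]

theorem abs_ρ_sub_le {t : ℝ} (ht : t ∈ Ioo 0 Λ.T) (x x' : ℝ × ℝ) :
    |Λ.ρ t x - Λ.ρ t x'| ≤ (|x.2 - x'.2| + Λ.M * |x.1 - x'.1|) / t := by
  refine abs_le.2 ⟨?_, Λ.ρ_sub_le ht x x'⟩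
  have := Λ.ρ_sub_le ht x' x
  rw [abs_sub_comm x'.2, abs_sub_comm x'.1] at this
  linarith

theorem lipschitz_ρ {t : ℝ} (ht : t ∈ Ioo 0 Λ.T) :
    ∃ L : ℝ≥0, LipschitzWith L (Λ.ρ t) := by
  have hM := Λ.one_le_M
  have ht0 := ht.1
  refine ⟨⟨(1 + Λ.M) / t, by positivity⟩, LipschitzWith.of_dist_le_mul fun x x' => ?_⟩
  rw [dist_eq, Prod.dist_eq]
  refine (Λ.abs_ρ_sub_le ht x x').trans ?_
  have h1 : |x.2 - x'.2| ≤ max (dist x.1 x'.1) (dist x.2 x'.2) := le_max_right _ _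
  have h2 : |x.1 - x'.1| ≤ max (dist x.1 x'.1) (dist x.2 x'.2) := le_max_left _ _
  show _ ≤ (1 + Λ.M) / t * _
  rw [div_mul_eq_mul_div]
  gcongr
  rw [add_mul, one_mul]
  gcongr

theorem ae_gradient_ρ {t : ℝ} (ht : t ∈ Ioo 0 Λ.T) : ∀ᵐ x : ℝ × ℝ, DifferentiableAt ℝ (Λ.ρ t) x ∧
    euclLen (dx1 (Λ.ρ t) x, dx2 (Λ.ρ t) x) ≤ 2 * Λ.M / t := by
  obtain ⟨L, hL⟩ := Λ.lipschitz_ρ ht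
  have hM := Λ.one_le_M
  have ht0 := ht.1
  filter_upwards [hL.ae_differentiableAt] with x hx
  have h : ∀ (c : ℝ → ℝ × ℝ) (s₀ : ℝ),
      (∀ s, |(c s).2 - (c s₀).2| + Λ.M * |(c s).1 - (c s₀).1| ≤ Λ.M * |s - s₀|) →
      deriv (fun s => Λ.ρ t (c s)) s₀ ^ 2 ≤ (Λ.M / t) ^ 2 := fun c s₀ hc => by
    refine sq_le_sq.2
      (le_trans
      (norm_deriv_le_of_lip' (f := fun s => Λ.ρ t (c s)) (by positivity) (Eventually.of_forall fun s => ?_)) (le_abs_self _))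
    rw [norm_eq_abs, norm_eq_abs, div_mul_eq_mul_div]
    exact (Λ.abs_ρ_sub_le ht _ _).trans (by gcongr; exact hc s)
  have e1 : dx1 (Λ.ρ t) x ^ 2 ≤ (Λ.M / t) ^ 2 := h (fun s => (s, x.2)) x.1 (by simp)
  have e2 : dx2 (Λ.ρ t) x ^ 2 ≤ (Λ.M / t) ^ 2 := h (fun s => (x.1, s)) x.2 fun s => by
    simpa using le_mul_of_one_le_left (abs_nonneg (s - x.2)) hM
  refine ⟨hx, sqrt_le_iff.2 ⟨by positivity, ?_⟩⟩
  rw [mul_div_assoc, mul_pow]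
  linarith [sq_nonneg (Λ.M / t)]

theorem g_period {t : ℝ} (ht : t ∈ Ico 0 Λ.T) {h : ℝ} (hh : h ∈ Ioo (-2 : ℝ) 2) :
    Function.Periodic (fun x => Λ.g t x h) (2 * π) := fun x => Λ.periodic t ht x h hh

theorem deriv_periodic {w w' : ℝ → ℝ} (hd : ∀ x, HasDerivAt w (w' x) x)
    (hp : Function.Periodic w (2 * π)) : Function.Periodic w' (2 * π) := fun x => by
  have h1 := (hd (x + 2 * π)).comp_add_const x (2 * π)
  rw [funext hp] at h1
  exact h1.unique (hd x)

theorem gx_period {t : ℝ} (ht : t ∈ Ico 0 Λ.T) {h : ℝ} (hh : h ∈ Ioo (-2 : ℝ) 2) :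
    Function.Periodic (fun x => Λ.gx t x h) (2 * π) :=
  deriv_periodic (fun x => Λ.deriv_x t ht x h hh) (Λ.g_period ht hh)

theorem periodic_ρ {t : ℝ} (ht : t ∈ Ico 0 Λ.T) : PeriodicFst (Λ.ρ t) := by
  intro x
  have : ∀ h, (h ∈ Icc (-1) 1 ∧ Λ.g t (x.1 + 2 * π) h < x.2) ↔
      (h ∈ Icc (-1) 1 ∧ Λ.g t x.1 h < x.2) := by
    refine fun h => and_congr_right fun hh => ?_
    rw [Λ.periodic t ht x.1 h (mem_Ioo_of_Icc hh)]
  simp only [ρ, this]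

theorem continuousOn_ρ : ContinuousOn (fun p : ℝ × ℝ × ℝ => Λ.ρ p.1 p.2)
    ((Ico 0 Λ.T ×ˢ univ) \ {p | p.1 = 0 ∧ p.2.2 = γ₀ p.2.1}) := by
  rintro ⟨t, x⟩ ⟨⟨ht, -⟩, hne⟩
  simp only at ht
  have hcg : ∀ h ∈ Ioo (-2) 2, Tendsto (fun p => p.2.2 - Λ.g p.1 p.2.1 h)
      (𝓝[(Ico 0 Λ.T ×ˢ univ) \ {p | p.1 = 0 ∧ p.2.2 = γ₀ p.2.1}] (t, x))
      (𝓝 (x.2 - Λ.g t x.1 h)) := by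
    intro h hh
    have h1 : ContinuousOn (fun p : ℝ × ℝ × ℝ => (p.1, p.2.1, h)) (Ico 0 Λ.T ×ˢ univ) := by fun_prop
    have h2 : ContinuousOn (fun p : ℝ × ℝ × ℝ => p.2.2 - Λ.g p.1 p.2.1 h) (Ico 0 Λ.T ×ˢ univ) :=
      ContinuousOn.sub (by fun_prop) (Λ.cont_g.comp h1 fun p hp => ⟨hp.1, mem_univ _, hh⟩)
    exact (h2.mono sdiff_subset) (t, x) ⟨⟨ht, mem_univ _⟩, hne⟩
  have hmem : ∀ᶠ p : ℝ × ℝ × ℝ in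
      𝓝[(Ico 0 Λ.T ×ˢ univ) \ {p | p.1 = 0 ∧ p.2.2 = γ₀ p.2.1}] (t, x), p.1 ∈ Ico 0 Λ.T := by
    filter_upwards [self_mem_nhdsWithin] with p hp using hp.1.1
  refine tendsto_order.2 ⟨fun a ha => ?_, fun a ha => ?_⟩
  · by_cases ha1 : a < -1
    · exact Eventually.of_forall fun p => ha1.trans_le (Λ.ρ_mem p.1 p.2).1
    have hai : a ∈ Ico (-1 : ℝ) 1 := ⟨not_lt.1 ha1, ha.trans_le (Λ.ρ_mem t x).2⟩
    have h1 := (Λ.lt_ρ_iff ht hai).1 ha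
    filter_upwards [hmem, (hcg a (mem_Ioo_of_Icc ⟨hai.1, hai.2.le⟩)).eventually
      (lt_mem_nhds (sub_pos.2 h1))] with p hp hp2
    exact (Λ.lt_ρ_iff hp hai).2 (sub_pos.1 hp2)
  · by_cases ha1 : 1 < a
    · exact Eventually.of_forall fun p => (Λ.ρ_mem p.1 p.2).2.trans_lt ha1
    push Not at ha1
    obtain ⟨b, hb1, hb2⟩ := exists_between ha
    have hbi : b ∈ Ico (-1 : ℝ) 1 := ⟨(Λ.ρ_mem t x).1.trans hb1.le, by linarith⟩
    have h1 : x.2 - Λ.g t x.1 b < 0 := by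
      rcases ht.1.eq_or_lt with h0 | h0
      · refine sub_neg.2
          (lt_of_le_of_ne (not_lt.1 fun hc => (lt_asymm hb1) ((Λ.lt_ρ_iff ht hbi).2 hc)) fun heq =>
          hne ⟨h0.symm, ?_⟩)
        rw [← h0, Λ.init] at heq; exact heq
      · nlinarith [Λ.g_slope ht x.1 (Λ.ρ_mem t x) (Ico_subset_Icc_self hbi) hb1.le,
          Λ.le_g_ρ ht (hb1.trans hbi.2)]
    filter_upwards [hmem, (hcg b (mem_Ioo_of_Icc ⟨hbi.1, hbi.2.le⟩)).eventually
      (gt_mem_nhds h1)] with p hp hp2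
    have h6 : ¬ b < Λ.ρ p.1 p.2 := fun hc => by
      have := (Λ.lt_ρ_iff hp hbi).1 hc
      linarith
    exact (not_lt.1 h6).trans_lt hb2

theorem level_sets {t : ℝ} (ht : t ∈ Ioo 0 Λ.T) :
    (∀ x : ℝ × ℝ, Λ.g t x.1 1 ≤ x.2 → Λ.ρ t x = 1) ∧
    (∀ x : ℝ × ℝ, x.2 ≤ Λ.g t x.1 (-1) → Λ.ρ t x = -1) ∧
    (∀ x : ℝ × ℝ, Λ.g t x.1 (-1) < x.2 → x.2 < Λ.g t x.1 1 → Λ.ρ t x ∈ Ioo (-1 : ℝ) 1) ∧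
    (∀ h ∈ Ioo (-1 : ℝ) 1, {x : ℝ × ℝ | Λ.ρ t x = h} = {x : ℝ × ℝ | x.2 = Λ.g t x.1 h}) := by
  have hI := Ioo_subset_Ico_self ht
  have hm1 : (-1 : ℝ) ∈ Ico (-1 : ℝ) 1 := ⟨le_rfl, by norm_num⟩
  refine ⟨fun x hx => ?_, fun x hx => ?_, fun x h1 h2 => ⟨(Λ.lt_ρ_iff hI hm1).2 h1, ?_⟩,
    fun h hh => Set.ext fun x => ⟨fun hx => ?_, fun hx => ?_⟩⟩
  · by_contra hne
    have h := lt_of_le_of_ne (Λ.ρ_mem t x).2 hne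
    nlinarith [Λ.g_slope hI x.1 (Λ.ρ_mem t x) ⟨by norm_num, le_rfl⟩ h.le, Λ.le_g_ρ hI h, ht.1]
  · refine le_antisymm (not_lt.1 fun hc => ?_) (Λ.ρ_mem t x).1
    linarith [(Λ.lt_ρ_iff hI hm1).1 hc]
  · refine lt_of_le_of_ne (Λ.ρ_mem t x).2 fun h3 => ?_
    have := Λ.g_ρ_le hI (by rw [h3]; norm_num)
    rw [h3] at this
    linarith
  · subst hx
    exact le_antisymm (Λ.le_g_ρ hI hh.2) (Λ.g_ρ_le hI hh.1)
  · have hge := Λ.abs_sub_g_ge hI x ⟨hh.1.le, hh.2.le⟩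
    rw [show x.2 = _ from hx, sub_self, abs_zero] at hge
    exact (sub_eq_zero.1 (abs_nonpos_iff.1 (le_of_mul_le_mul_left (by simpa using hge) ht.1))).symm

end LevelFlow

/-- A function of `(x, h)` with continuous partial derivatives on a neighbourhood of the slab. -/
structure C1Data (w wx wh : ℝ → ℝ → ℝ) : Prop where
  cont_x : ContinuousOn (fun p : ℝ × ℝ => wx p.1 p.2) (univ ×ˢ Ioo (-2) 2)
  cont_h : ContinuousOn (fun p : ℝ × ℝ => wh p.1 p.2) (univ ×ˢ Ioo (-2) 2)
  dx : ∀ x, ∀ h ∈ Ioo (-2 : ℝ) 2, HasDerivAt (fun y => w y h) (wx x h) x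
  dh : ∀ x, ∀ h ∈ Ioo (-2 : ℝ) 2, HasDerivAt (fun m => w x m) (wh x h) h

namespace C1Data

variable {w wx wh v vx vh : ℝ → ℝ → ℝ}

theorem sub (a : C1Data w wx wh) (b : C1Data v vx vh) :
    C1Data (fun x h => w x h - v x h) (fun x h => wx x h - vx x h) (fun x h => wh x h - vh x h) :=
  ⟨a.cont_x.sub b.cont_x, a.cont_h.sub b.cont_h, fun x h hh => (a.dx x h hh).sub (b.dx x h hh),
    fun x h hh => (a.dh x h hh).sub (b.dh x h hh)⟩

theorem const_mul (a : C1Data w wx wh) (c : ℝ) :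
    C1Data (fun x h => c * w x h) (fun x h => c * wx x h) (fun x h => c * wh x h) :=
  ⟨a.cont_x.const_mul c, a.cont_h.const_mul c, fun x h hh => (a.dx x h hh).const_mul c,
    fun x h hh => (a.dh x h hh).const_mul c⟩

theorem isOpen_dom : IsOpen ((univ : Set ℝ) ×ˢ Ioo (-2 : ℝ) 2) := isOpen_univ.prod isOpen_Ioo

theorem continuous_toSpanSingleton :
    Continuous fun r : ℝ => ContinuousLinearMap.toSpanSingleton ℝ r :=
  (ContinuousLinearMap.toSpanSingletonCLE).continuous

theorem hasStrictFDerivAt (a : C1Data w wx wh) {p : ℝ × ℝ} (hp : p.2 ∈ Ioo (-2 : ℝ) 2) :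
    HasStrictFDerivAt (fun p : ℝ × ℝ => w p.1 p.2)
      ((ContinuousLinearMap.toSpanSingleton ℝ (wx p.1 p.2)).coprod
        (ContinuousLinearMap.toSpanSingleton ℝ (wh p.1 p.2))) p := by
  have hn := isOpen_dom.mem_nhds ⟨mem_univ _, hp⟩
  refine hasStrictFDerivAt_uncurry_coprod
    (f₁ := fun x h => ContinuousLinearMap.toSpanSingleton ℝ (wx x h))
    (f₂ := fun x h => ContinuousLinearMap.toSpanSingleton ℝ (wh x h)) ?_ ?_
      (continuous_toSpanSingleton.continuousAt.comp (a.cont_x.continuousAt hn))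
      (continuous_toSpanSingleton.continuousAt.comp (a.cont_h.continuousAt hn))
  · filter_upwards [hn] with q hq using (a.dx q.1 q.2 hq.2).hasFDerivAt
  · filter_upwards [hn] with q hq using (a.dh q.1 q.2 hq.2).hasFDerivAt

theorem slab_subset : slab ⊆ (univ : Set ℝ) ×ˢ Ioo (-2 : ℝ) 2 := fun _ hp =>
  ⟨mem_univ _, LevelFlow.mem_Ioo_of_Icc hp.2⟩

theorem uniqueDiffOn_slab : UniqueDiffOn ℝ slab :=
  uniqueDiffOn_univ.prod (uniqueDiffOn_Icc (by norm_num))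

theorem memC1 (a : C1Data w wx wh) (hp : ∀ x, ∀ h ∈ Ioo (-2 : ℝ) 2, w (x + 2 * π) h = w x h) :
    MemC1 (fun p => w p.1 p.2) := by
  refine ⟨ContDiffOn.mono ?_ slab_subset, fun x hx => hp x.1 x.2 (slab_subset hx).2⟩
  have h := contDiffOn_succ_iff_fderiv_of_isOpen (𝕜 := ℝ) (n := 0)
    (f := fun p : ℝ × ℝ => w p.1 p.2) isOpen_dom
  rw [zero_add] at h
  refine h.2
    ⟨fun p hp => (a.hasStrictFDerivAt hp.2).hasFDerivAt.differentiableAt.differentiableWithinAt,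
    by simp, ?_⟩
  rw [contDiffOn_zero]
  have hts : Continuous fun r : ℝ × ℝ => (ContinuousLinearMap.toSpanSingleton ℝ r.1).coprod
      (ContinuousLinearMap.toSpanSingleton ℝ r.2) := by
    have h1 := continuous_toSpanSingleton
    have h2 := ((h1.comp continuous_fst).clm_comp (continuous_const
      (y := ContinuousLinearMap.fst ℝ ℝ ℝ))).add ((h1.comp continuous_snd).clm_comp
      (continuous_const (y := ContinuousLinearMap.snd ℝ ℝ ℝ)))
    refine h2.congr fun r => ?_
    ext <;> simp
  exact (hts.comp_continuousOn (a.cont_x.prodMk a.cont_h)).congr fun p hp =>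
    ((a.hasStrictFDerivAt hp.2).hasFDerivAt.fderiv)

theorem c1Norm_le (a : C1Data w wx wh) {ε : ℝ}
    (hb : ∀ x, ∀ h ∈ Icc (-1 : ℝ) 1, |w x h| ≤ ε ∧ |wx x h| ≤ ε ∧ |wh x h| ≤ ε) :
    c1Norm (fun p => w p.1 p.2) ≤ ENNReal.ofReal (3 * ε) := by
  refine iSup₂_le fun p hp => ?_
  obtain ⟨h1, h2, h3⟩ := hb p.1 p.2 hp.2
  have hε := (abs_nonneg _).trans h1
  rw [((a.hasStrictFDerivAt (slab_subset hp).2).hasFDerivAt.hasFDerivWithinAt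
    (s := slab)).fderivWithin (uniqueDiffOn_slab p hp), ← ofReal_norm, ← ofReal_norm,
    ← ENNReal.ofReal_add (norm_nonneg _) (norm_nonneg _)]
  refine ENNReal.ofReal_le_ofReal ?_
  have h4 : ‖(ContinuousLinearMap.toSpanSingleton ℝ (wx p.1 p.2)).coprod
        (ContinuousLinearMap.toSpanSingleton ℝ (wh p.1 p.2))‖ ≤ 2 * ε := by
    refine ContinuousLinearMap.opNorm_le_bound _ (by positivity) fun q => ?_
    have e1 : |q.1| ≤ ‖q‖ := norm_fst_le q
    have e2 : |q.2| ≤ ‖q‖ := norm_snd_le q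
    rw [norm_eq_abs]
    calc _ ≤ |q.1 * wx p.1 p.2| + |q.2 * wh p.1 p.2| := abs_add_le _ _
      _ ≤ ‖q‖ * ε + ‖q‖ * ε := by rw [abs_mul, abs_mul]; gcongr
      _ = _ := by ring
  rw [norm_eq_abs]
  linarith

end C1Data

namespace LevelFlow

variable {γ₀ : ℝ → ℝ} (Λ : LevelFlow γ₀)

theorem f_periodic {t : ℝ} (ht : t ∈ Ico 0 Λ.T) (x : ℝ) {h : ℝ} (hh : h ∈ Ioo (-2 : ℝ) 2) :
    Λ.f t (x + 2 * π) h = Λ.f t x h := by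
  rw [Λ.velocity t ht _ h hh, Λ.velocity t ht _ h hh]
  congr 1
  refine setIntegral_congr_fun measurableSet_punct fun y hy =>
    setIntegral_congr_fun measurableSet_Icc fun m hm => ?_
  have hm2 := mem_Ioo_of_Icc hm
  have e : x + 2 * π - y = x - y + 2 * π := by ring
  have h1 := Λ.gx_period ht hh x
  have h2 := Λ.gx_period ht hm2 (x - y)
  simp only at h1 h2 ⊢
  rw [e, Λ.periodic t ht x h hh, Λ.periodic t ht _ m hm2, h1, h2]

theorem fx_periodic {t : ℝ} (ht : t ∈ Ico 0 Λ.T) (x : ℝ) {h : ℝ} (hh : h ∈ Ioo (-2 : ℝ) 2) :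
    Λ.fx t (x + 2 * π) h = Λ.fx t x h :=
  deriv_periodic (fun x => Λ.deriv_fx t ht x h hh) (fun x => Λ.f_periodic ht x hh) x

theorem fh_periodic {t : ℝ} (ht : t ∈ Ico 0 Λ.T) (x : ℝ) {h : ℝ} (hh : h ∈ Ioo (-2 : ℝ) 2) :
    Λ.fh t (x + 2 * π) h = Λ.fh t x h := by
  refine ((Λ.deriv_fh t ht (x + 2 * π) h hh).congr_of_eventuallyEq ?_).unique
    (Λ.deriv_fh t ht x h hh)
  filter_upwards [isOpen_Ioo.mem_nhds hh] with m hm using (Λ.f_periodic ht x hm).symm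

theorem slice_continuousOn {W : ℝ → ℝ → ℝ → ℝ}
    (hW : ContinuousOn (fun p : ℝ × ℝ × ℝ => W p.1 p.2.1 p.2.2) (flowDom Λ.T)) {t : ℝ}
    (ht : t ∈ Ico 0 Λ.T) : ContinuousOn (fun p : ℝ × ℝ => W t p.1 p.2) (univ ×ˢ Ioo (-2) 2) := by
  have h1 : ContinuousOn (fun p : ℝ × ℝ => (t, p.1, p.2)) (univ ×ˢ Ioo (-2) 2) := by fun_prop
  exact hW.comp h1 fun p hp => ⟨ht, mem_univ _, hp.2⟩

theorem c1Data_g {t : ℝ} (ht : t ∈ Ico 0 Λ.T) : C1Data (Λ.g t) (Λ.gx t) (Λ.gh t) :=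
  ⟨Λ.slice_continuousOn Λ.cont_gx ht, Λ.slice_continuousOn Λ.cont_gh ht, Λ.deriv_x t ht,
    Λ.deriv_h t ht⟩

theorem c1Data_f {t : ℝ} (ht : t ∈ Ico 0 Λ.T) : C1Data (Λ.f t) (Λ.fx t) (Λ.fh t) :=
  ⟨Λ.slice_continuousOn Λ.cont_fx ht, Λ.slice_continuousOn Λ.cont_fh ht, Λ.deriv_fx t ht,
    Λ.deriv_fh t ht⟩

theorem eventually_abs_sub_le {W : ℝ → ℝ → ℝ → ℝ}
    (hW : ContinuousOn (fun p : ℝ × ℝ × ℝ => W p.1 p.2.1 p.2.2) (flowDom Λ.T))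
    (hp : ∀ {t}, t ∈ Ico 0 Λ.T → ∀ x {h}, h ∈ Ioo (-2 : ℝ) 2 → W t (x + 2 * π) h = W t x h)
    {t : ℝ} (ht : t ∈ Ico 0 Λ.T) {ε : ℝ} (hε : 0 < ε) :
    ∀ᶠ s in 𝓝[Ico 0 Λ.T] t, ∀ x, ∀ h ∈ Icc (-1 : ℝ) 1, |W s x h - W t x h| ≤ ε := by
  have hcc : ContinuousOn (Function.uncurry fun (s : ℝ) (p : ℝ × ℝ) => W s p.1 p.2)
      (Ico 0 Λ.T ×ˢ (Icc 0 (2 * π) ×ˢ Icc (-1 : ℝ) 1)) :=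
    hW.mono fun p hp => ⟨hp.1, mem_univ _, mem_Ioo_of_Icc hp.2.2⟩
  obtain ⟨v, hv, hvu⟩ := (isCompact_Icc.prod isCompact_Icc).mem_uniformity_of_prod hcc ht
    (dist_mem_uniformity hε)
  filter_upwards [hv, self_mem_nhdsWithin] with s hsv hs x h hh
  have h2π : 0 < 2 * π := by positivity
  have hper : ∀ r ∈ Ico 0 Λ.T, W r x h = W r (toIcoMod h2π 0 x) h := fun r hr =>
    (Function.Periodic.sub_zsmul_eq (f := fun x => W r x h)
      (fun x => hp hr x (mem_Ioo_of_Icc hh)) (toIcoDiv h2π 0 x)).symm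
  rw [hper s hs, hper t ht]
  have hm := toIcoMod_mem_Ico' h2π x
  exact le_of_lt (hvu s hsv (toIcoMod h2π 0 x, h) ⟨⟨hm.1, hm.2.le⟩, hh⟩)

theorem eventually_f_sub_le {t : ℝ} (ht : t ∈ Ico 0 Λ.T) {ε : ℝ} (hε : 0 < ε) :
    ∀ᶠ s in 𝓝[Ico 0 Λ.T] t, ∀ x, ∀ h ∈ Icc (-1 : ℝ) 1, |Λ.f s x h - Λ.f t x h| ≤ ε ∧
      |Λ.fx s x h - Λ.fx t x h| ≤ ε ∧ |Λ.fh s x h - Λ.fh t x h| ≤ ε := by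
  filter_upwards [Λ.eventually_abs_sub_le Λ.cont_f Λ.f_periodic ht hε,
    Λ.eventually_abs_sub_le Λ.cont_fx Λ.fx_periodic ht hε,
    Λ.eventually_abs_sub_le Λ.cont_fh Λ.fh_periodic ht hε] with s h1 h2 h3 x h hh
  exact ⟨h1 x h hh, h2 x h hh, h3 x h hh⟩

theorem abs_slope_sub_le {φ ψ : ℝ → ℝ} {s t ε : ℝ} (hs : s ∈ Ico 0 Λ.T) (ht : t ∈ Ico 0 Λ.T)
    (hst : s ≠ t) (hd : ∀ r ∈ Ico 0 Λ.T, HasDerivWithinAt φ (ψ r) (Ici 0) r)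
    (hb : ∀ r ∈ Ico 0 Λ.T, |r - t| ≤ |s - t| → |ψ r - ψ t| ≤ ε) :
    |(s - t)⁻¹ * (φ s - φ t) - ψ t| ≤ ε := by
  have hsub : ∀ r ∈ uIcc t s, r ∈ Ico 0 Λ.T := fun r hr =>
    (ordConnected_Ico.uIcc_subset ht hs) hr
  have := (convex_uIcc t s).norm_image_sub_le_of_norm_hasDerivWithin_le
    (f := fun r => φ r - r * ψ t)
    (fun r hr => ((hd r (hsub r hr)).mono fun y hy => (hsub y hy).1).sub
      ((hasDerivWithinAt_id _ _).mul_const _))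
    (fun r hr => by
      rw [one_mul]
      exact hb r (hsub r hr) (abs_sub_left_of_mem_uIcc hr))
    left_mem_uIcc right_mem_uIcc
  rw [norm_eq_abs, norm_eq_abs] at this
  have hne := sub_ne_zero.2 hst
  have e : (s - t)⁻¹ * (φ s - φ t) - ψ t = (s - t)⁻¹ * (φ s - s * ψ t - (φ t - t * ψ t)) := by
    field_simp; ring
  rw [e, abs_mul, abs_inv, inv_mul_le_iff₀ (abs_pos.2 hne)]
  linarith

theorem tendsto_c1Norm {ι : Type*} {l : Filter ι} {F : ι → ℝ × ℝ → ℝ}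
    (h : ∀ r > 0, ∀ᶠ s in l, c1Norm (F s) ≤ ENNReal.ofReal (3 * r)) :
    Tendsto (fun s => c1Norm (F s)) l (𝓝 0) := by
  refine ENNReal.tendsto_nhds_zero.2 fun ε hε => ?_
  rcases eq_or_ne ε ⊤ with rfl | h0
  · exact Eventually.of_forall fun s => le_top
  · filter_upwards [h (ε.toReal / 3) (div_pos (ENNReal.toReal_pos hε.ne' h0) (by norm_num))] with s
      hs
    rwa [mul_div_cancel₀ _ (by norm_num), ENNReal.ofReal_toReal h0] at hs

theorem tendsto_slope {t : ℝ} (ht : t ∈ Ico 0 Λ.T) :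
    Tendsto (fun s => c1Norm (fun x => (s - t)⁻¹ * (Λ.g s x.1 x.2 - Λ.g t x.1 x.2) - Λ.f t x.1 x.2))
      (𝓝[Ico 0 Λ.T \ {t}] t) (𝓝 0) := by
  refine tendsto_c1Norm fun ε hε => ?_
  obtain ⟨δ, hδ, hb⟩ := mem_nhdsWithin_iff.1 (Λ.eventually_f_sub_le ht hε)
  filter_upwards [self_mem_nhdsWithin, mem_nhdsWithin_of_mem_nhds (ball_mem_nhds t hδ)] with s hs
    hsd
  refine C1Data.c1Norm_le (((Λ.c1Data_g hs.1).sub (Λ.c1Data_g ht)).const_mul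
    ((s - t)⁻¹) |>.sub (Λ.c1Data_f ht)) fun x h hh => ?_
  have hh2 := mem_Ioo_of_Icc hh
  have hb' : ∀ r ∈ Ico 0 Λ.T, |r - t| ≤ |s - t| → _ := fun r hr hrs =>
    hb ⟨lt_of_le_of_lt hrs hsd, hr⟩ x h hh
  exact ⟨Λ.abs_slope_sub_le hs.1 ht hs.2
      (fun r hr => Λ.deriv_t r hr x h hh2) fun r hr hrs => (hb' r hr hrs).1,
    Λ.abs_slope_sub_le hs.1 ht hs.2
      (fun r hr => Λ.deriv_tx r hr x h hh2) fun r hr hrs => (hb' r hr hrs).2.1,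
    Λ.abs_slope_sub_le hs.1 ht hs.2
      (fun r hr => Λ.deriv_th r hr x h hh2) fun r hr hrs => (hb' r hr hrs).2.2⟩

theorem tendsto_f {t : ℝ} (ht : t ∈ Ico 0 Λ.T) :
    Tendsto (fun s => c1Norm (fun x => Λ.f s x.1 x.2 - Λ.f t x.1 x.2)) (𝓝[Ico 0 Λ.T] t) (𝓝 0) := by
  refine tendsto_c1Norm fun ε hε => ?_
  filter_upwards [self_mem_nhdsWithin, Λ.eventually_f_sub_le ht hε] with s hs h using
    ((Λ.c1Data_f hs).sub (Λ.c1Data_f ht)).c1Norm_le h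

theorem memC1C1 : MemC1C1 Λ.T (fun t x => Λ.g t x.1 x.2) :=
  ⟨fun t x => Λ.f t x.1 x.2,
    fun _ ht => ⟨(Λ.c1Data_g ht).memC1 fun x h hh => Λ.periodic _ ht x h hh,
    (Λ.c1Data_f ht).memC1 fun x _ hh => Λ.f_periodic ht x hh⟩,
    fun _ ht => Λ.tendsto_slope ht, fun _ ht => Λ.tendsto_f ht⟩

theorem tendsto_initial : Tendsto (fun t => c1Norm (fun x : ℝ × ℝ =>
    t⁻¹ * (Λ.g t x.1 x.2 - (γ₀ x.1 + t * (2 * x.2 + Λ.s₀ x.1))))) (𝓝[>] 0) (𝓝 0) := by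
  have hle : 𝓝[>] 0 ≤ 𝓝[Ico 0 Λ.T \ {0}] 0 := by
    rw [← nhdsWithin_Ioo_eq_nhdsGT Λ.T_pos]
    exact nhdsWithin_mono _ fun s hs => ⟨Ioo_subset_Ico_self hs, hs.1.ne'⟩
  refine ((Λ.tendsto_slope ⟨le_rfl, Λ.T_pos⟩).mono_left hle).congr' ?_
  filter_upwards [self_mem_nhdsWithin] with t ht
  have ht0 := (mem_Ioi.1 ht).ne'
  congr 1
  ext x
  rw [Λ.f_zero, Λ.init, sub_zero]
  field_simp
  ring

end LevelFlow

theorem integral_poisson_le {d : ℝ} (hd : d ≠ 0) :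
    Integrable (fun y : ℝ => |d| / (y ^ 2 + d ^ 2)) ∧ ∫ y : ℝ, |d| / (y ^ 2 + d ^ 2) = π := by
  have hp := abs_pos.2 hd
  have e : (fun y => |d| / (y ^ 2 + d ^ 2)) = fun y => |d|⁻¹ * (1 + (y / |d|) ^ 2)⁻¹ := by
    ext y
    rw [← sq_abs d]
    field_simp
    ring
  rw [e]
  refine ⟨(integrable_inv_one_add_sq.comp_div hp.ne').const_mul _, ?_⟩
  rw [integral_const_mul, Measure.integral_comp_div (fun y => (1 + y ^ 2)⁻¹) |d|,
    integral_univ_inv_one_add_sq, abs_abs, smul_eq_mul]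
  field_simp

theorem abs_sinh_le_mul_cosh {u B : ℝ} (h : |u| ≤ B) : |sinh u| ≤ |u| * cosh B := by
  have hB := (abs_nonneg u).trans h
  rw [abs_sinh]
  have h1 := h.trans (le_abs_self B)
  have := (convex_Icc 0 B).norm_image_sub_le_of_norm_hasDerivWithin_le

    (fun x _ => (hasDerivAt_sinh x).hasDerivWithinAt)
    (fun x hx => by
      rw [norm_eq_abs, abs_of_pos (cosh_pos x)]
      exact cosh_le_cosh.2 (by rw [abs_of_nonneg hx.1, abs_of_nonneg hB]; exact hx.2))
    ⟨le_rfl, hB⟩ ⟨abs_nonneg _, h⟩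
  rw [sinh_zero, sub_zero, sub_zero, norm_eq_abs, norm_eq_abs, abs_abs,
    abs_of_nonneg (sinh_nonneg_iff.2 (abs_nonneg u))] at this
  linarith

theorem den_ge_of_lip {M y a d : ℝ} (hy : |y| ≤ π) (ha : |a - d| ≤ M * |y|) :
    (y ^ 2 + d ^ 2) / (10 * (M ^ 2 + 1)) ≤ den y a := by
  refine le_trans ?_ (den_ge hy a)
  have h1 : (a - d) ^ 2 ≤ M ^ 2 * y ^ 2 := by
    rw [← sq_abs (a - d), ← sq_abs y, ← mul_pow]
    exact pow_le_pow_left₀ (abs_nonneg _) ha 2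
  rw [div_le_div_iff₀ (by positivity) (by norm_num)]
  nlinarith [sq_nonneg (a + (a - d))]

/-- Cancellation of the odd kernel along a curve with bounded curvature. -/
theorem abs_rker_add_rker_neg_le {M B y a a' d : ℝ} (hM : 1 ≤ M) (hy0 : y ≠ 0) (hy : |y| ≤ π)
    (ha : |a - d| ≤ M * |y|) (ha' : |a' - d| ≤ M * |y|) (hs : |a + a' - 2 * d| ≤ 2 * M * y ^ 2)
    (hd0 : d ≠ 0) (hd : |d| ≤ B) :
    |rker y a + rker (-y) a'| ≤
      100 * (M ^ 2 + 1) ^ 2 * M ^ 2 * cosh (B + 16 * M) * cosh (4 * M) *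
        (1 + |d| / (y ^ 2 + d ^ 2)) := by
  have hπ := pi_le_four
  have hπ3 := pi_gt_three
  set u := y ^ 2 + d ^ 2 with hu
  have hu0 : 0 < u := by positivity
  have hE : u / (10 * (M ^ 2 + 1)) ≤ den y a := den_ge_of_lip hy ha
  have hE' : u / (10 * (M ^ 2 + 1)) ≤ den y a' := den_ge_of_lip hy ha'
  have hN : 0 < u / (10 * (M ^ 2 + 1)) := by positivity
  have hEp := hN.trans_le hE
  have hEp' := hN.trans_le hE'
  have e : rker y a + rker (-y) a' =
      sin y * (2 * sinh ((a' + a) / 2) * sinh ((a' - a) / 2)) / (4 * π * (den y a * den y a')) := by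
    rw [rker_neg, rker_eq, rker_eq]
    have h1 : 2 * sinh ((a' + a) / 2) * sinh ((a' - a) / 2) = den y a' - den y a := by
      have h2 := cosh_add ((a' + a) / 2) ((a' - a) / 2)
      have h3 := cosh_sub ((a' + a) / 2) ((a' - a) / 2)
      rw [show (a' + a) / 2 + (a' - a) / 2 = a' by ring] at h2
      rw [show (a' + a) / 2 - (a' - a) / 2 = a by ring] at h3
      rw [den, den, h2, h3]; ring
    rw [h1]
    field_simp
    ring
  have hy2 : y ^ 2 ≤ 16 := by
    rw [← sq_abs]; nlinarith [abs_nonneg y]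
  have hsum : |(a' + a) / 2| ≤ |d| + M * y ^ 2 := by
    have : (a' + a) / 2 = (a + a' - 2 * d) / 2 + d := by ring
    rw [this]
    refine (abs_add_le _ _).trans ?_
    rw [abs_div, abs_two]; linarith
  have hdif : |(a' - a) / 2| ≤ M * |y| := by
    have : a' - a = (a' - d) - (a - d) := by ring
    rw [this, abs_div, abs_two]
    have := abs_sub (a' - d) (a - d)
    linarith
  have hs1 := abs_sinh_le_mul_cosh (B := B + 16 * M)
    (hsum.trans (by nlinarith))
  have hs2 := abs_sinh_le_mul_cosh (B := 4 * M)
    (hdif.trans (by nlinarith))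
  set c1 := cosh (B + 16 * M)
  set c2 := cosh (4 * M)
  have hc1 : 0 < c1 := cosh_pos _
  have hc2 : 0 < c2 := cosh_pos _
  have h5 : y ^ 2 ≤ u := by rw [hu]; nlinarith [sq_nonneg d]
  clear_value c1 c2 u
  rw [e, abs_div, abs_mul, abs_mul, abs_mul, abs_two,
    abs_of_pos (a := 4 * π * (den y a * den y a')) (by positivity)]
  have hnum : |sin y| * (2 * |sinh ((a' + a) / 2)| * |sinh ((a' - a) / 2)|) ≤
      |y| * (2 * ((|d| + M * y ^ 2) * c1) * (M * |y| * c2)) := by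
    have h1 : |sin y| ≤ |y| := abs_sin_le_abs
    have h2 : |sinh ((a' + a) / 2)| ≤ (|d| + M * y ^ 2) * c1 := hs1.trans (by gcongr)
    have h3 : |sinh ((a' - a) / 2)| ≤ M * |y| * c2 := hs2.trans (by gcongr)
    gcongr
  have hden : 2 * (u / (10 * (M ^ 2 + 1))) ^ 2 ≤ 4 * π * (den y a * den y a') := by
    have : (u / (10 * (M ^ 2 + 1))) ^ 2 ≤ den y a * den y a' := by
      rw [sq]; gcongr
    nlinarith
  refine (div_le_div₀ (by positivity) hnum (by positivity) hden).trans ?_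
  rw [div_le_iff₀ (by positivity)]
  have e2 : 100 * (M ^ 2 + 1) ^ 2 * M ^ 2 * c1 * c2 * (1 + |d| / u) *
      (2 * (u / (10 * (M ^ 2 + 1))) ^ 2) = 2 * M ^ 2 * c1 * c2 * ((u + |d|) * u) := by
    field_simp
    ring
  rw [e2]
  have e3 : |y| * (2 * ((|d| + M * y ^ 2) * c1) * (M * |y| * c2)) =
      2 * c1 * c2 * (M * ((|d| + M * y ^ 2) * |y| ^ 2)) := by ring
  rw [e3, sq_abs]
  have h4 : M * ((|d| + M * y ^ 2) * y ^ 2) ≤ M ^ 2 * ((u + |d|) * u) := by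
    have h6 : (|d| + M * y ^ 2) ≤ M * (u + |d|) := by nlinarith [abs_nonneg d]
    have h7 :=
      mul_le_mul h6 h5 (sq_nonneg y) (by positivity)
    calc M * ((|d| + M * y ^ 2) * y ^ 2) ≤ M * (M * (u + |d|) * u) :=
          mul_le_mul_of_nonneg_left h7 (by linarith)
      _ = _ := by ring
  calc _ ≤ 2 * c1 * c2 * (M ^ 2 * ((u + |d|) * u)) :=
        mul_le_mul_of_nonneg_left h4 (by positivity)
    _ = _ := by ring

theorem abs_rker_le_of_lip {M y a d : ℝ} (hy : |y| ≤ π) (ha : |a - d| ≤ M * |y|)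
    (hu : 0 < y ^ 2 + d ^ 2) :
    |rker y a| ≤ √(10 * (M ^ 2 + 1)) / √(y ^ 2 + d ^ 2) := by
  refine (abs_rker_le y a).trans ?_
  have h2 := sqrt_le_sqrt (den_ge_of_lip hy ha)
  rw [sqrt_div' _ (by positivity)] at h2
  have h3 : 0 < √(10 * (M ^ 2 + 1)) := sqrt_pos.2 (by positivity)
  have h4 := sqrt_pos.2 hu
  calc _ ≤ 1 / (√(y ^ 2 + d ^ 2) / √(10 * (M ^ 2 + 1))) :=
        one_div_le_one_div_of_le (by positivity) h2
    _ = _ := by field_simp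

theorem integral_punct_neg (F : ℝ → ℝ) : ∫ y in punct, F (-y) = ∫ y in punct, F y := by
  have h : (Neg.neg : ℝ → ℝ) ⁻¹' punct = punct := by
    ext y
    simp only [punct, mem_preimage, Set.mem_sdiff, mem_singleton_iff, neg_eq_zero]
    constructor <;> rintro ⟨⟨h1, h2⟩, h3⟩ <;> exact ⟨⟨by linarith, by linarith⟩, h3⟩
  have := (Measure.measurePreserving_neg (volume : Measure ℝ)).setIntegral_preimage_emb
    (MeasurableEquiv.neg ℝ).measurableEmbedding F punct
  rwa [h] at this

theorem volume_punct_le : volume punct ≤ ENNReal.ofReal 8 := by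
  refine (measure_mono sdiff_subset).trans ?_
  rw [volume_Ioo]
  exact ENNReal.ofReal_le_ofReal (by linarith [pi_le_four])

instance isFiniteMeasure_punct : IsFiniteMeasure (volume.restrict punct) :=
  isFiniteMeasure_restrict.2 (volume_punct_le.trans_lt ENNReal.ofReal_lt_top).ne

theorem norm_integral_punct_le {F : ℝ → ℝ} {C : ℝ} (h : ∀ y ∈ punct, |F y| ≤ C) :
    |∫ y in punct, F y| ≤ C * 8 := by
  have hC := (abs_nonneg _).trans (h 1 (by
    refine ⟨⟨?_, ?_⟩, one_ne_zero⟩ <;> linarith [pi_gt_three]))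
  refine (norm_setIntegral_le_of_norm_le_const
    (volume_punct_le.trans_lt ENNReal.ofReal_lt_top) (f := F) h).trans ?_
  gcongr
  exact ENNReal.toReal_le_of_le_ofReal (by norm_num) volume_punct_le

theorem integrableOn_rker_mul {M d C : ℝ} {a w : ℝ → ℝ} (ha : Continuous a) (hw : Continuous w)
    (hal : ∀ y, |a y - d| ≤ M * |y|) (hd : d ≠ 0) (hwb : ∀ y, |w y| ≤ C) :
    IntegrableOn (fun y => rker y (a y) * w y) punct := by
  refine Integrable.mono' (integrable_const (√(10 * (M ^ 2 + 1)) / |d| * C))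
    (((measurable_rker.comp (measurable_id.prodMk ha.measurable)).mul
    hw.measurable).aestronglyMeasurable) ?_
  · refine (ae_restrict_iff' measurableSet_punct).2 (ae_of_all _ fun y hy => ?_)
    rw [norm_eq_abs, abs_mul]
    refine mul_le_mul ((abs_rker_le_of_lip (punct_abs hy).2 (hal y) (by positivity)).trans ?_)
      (hwb y) (abs_nonneg _) (by positivity)
    gcongr
    rw [← sqrt_sq_eq_abs]
    exact sqrt_le_sqrt (by nlinarith)

/-- The velocity induced by a single sheet is bounded up to the sheet. -/
theorem abs_integral_rker_mul_le {M B : ℝ} (hM : 1 ≤ M) : ∃ C, 0 ≤ C ∧ ∀ a w : ℝ → ℝ,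
    Continuous a → Continuous w → (∀ y, |a y - a 0| ≤ M * |y|) →
    (∀ y, |a y + a (-y) - 2 * a 0| ≤ 2 * M * y ^ 2) → a 0 ≠ 0 → |a 0| ≤ B →
    (∀ y, |w y| ≤ M) → (∀ y, |w y - w 0| ≤ M * |y|) →
    |∫ y in punct, rker y (a y) * w y| ≤ C := by
  set K := 100 * (M ^ 2 + 1) ^ 2 * M ^ 2 * cosh (B + 16 * M) * cosh (4 * M) with hK
  refine ⟨√(10 * (M ^ 2 + 1)) * M * 8 + M * (K * (8 + π)), by positivity,
    fun a w ha hw hal hsym h0 hB hwb hwl => ?_⟩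
  have i0 := integrableOn_rker_mul ha (w := fun _ => 1) continuous_const hal h0 (C := 1) (by simp)
  have i1 := integrableOn_rker_mul ha (hw.sub continuous_const) (w := fun y => w y - w 0) hal h0
    (fun y => (abs_sub _ _).trans (add_le_add (hwb y) (hwb 0)))
  have e : ∫ y in punct, rker y (a y) * w y =
      (∫ y in punct, rker y (a y) * (w y - w 0)) + w 0 * ∫ y in punct, rker y (a y) * 1 := by
    rw [← integral_const_mul, ← integral_add i1 (i0.const_mul _)]
    congr 1; ext y; ring
  have b1 : |∫ y in punct, rker y (a y) * (w y - w 0)| ≤ √(10 * (M ^ 2 + 1)) * M * 8 := by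
    refine norm_integral_punct_le fun y hy => ?_
    rw [abs_mul]
    have hs : 0 < y ^ 2 + a 0 ^ 2 := by rw [← sq_abs y]; positivity
    have h1 := abs_rker_le_of_lip (punct_abs hy).2 (hal y) hs
    have h2 : |y| ≤ √(y ^ 2 + a 0 ^ 2) := by
      rw [← sqrt_sq_eq_abs]; exact sqrt_le_sqrt (by nlinarith)
    have h3 := sqrt_pos.2 hs
    calc _ ≤ √(10 * (M ^ 2 + 1)) / √(y ^ 2 + a 0 ^ 2) * (M * √(y ^ 2 + a 0 ^ 2)) := by
          refine mul_le_mul h1 ((hwl y).trans (by gcongr)) (abs_nonneg _) (by positivity)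
      _ = _ := by field_simp
  have b2 : |∫ y in punct, rker y (a y) * 1| ≤ K * (8 + π) := by
    have e2 : (∫ y in punct, rker y (a y) * 1) + (∫ y in punct, rker y (a y) * 1) =
        ∫ y in punct, (rker y (a y) + rker (-y) (a (-y))) := by
      nth_rewrite 2 [← integral_punct_neg]
      have i2 : IntegrableOn (fun y => rker (-y) (a (-y)) * 1) punct := by
        have := integrableOn_rker_mul (ha.comp continuous_neg) (w := fun _ => -1) (C := 1)
          continuous_const (fun y => by simpa using hal (-y)) h0 (by simp)
        refine this.congr (ae_of_all _ fun y => ?_)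
        simp [rker_neg]
      rw [← integral_add i0 i2]
      simp
    obtain ⟨p1, p2⟩ := integral_poisson_le h0
    have hb : |∫ y in punct, (rker y (a y) + rker (-y) (a (-y)))| ≤
        ∫ y in punct, K * (1 + |a 0| / (y ^ 2 + a 0 ^ 2)) := by
      rw [← norm_eq_abs]
      refine norm_integral_le_of_norm_le (((integrable_const 1).add p1.integrableOn).const_mul K)
        ((ae_restrict_iff' measurableSet_punct).2 (ae_of_all _ fun y hy => ?_))
      obtain ⟨y0, y1⟩ := punct_abs hy
      rw [hK]
      exact abs_rker_add_rker_neg_le hM (abs_pos.1 y0) y1 (hal y) (by simpa using hal (-y))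
        (hsym y) h0 hB
    rw [← e2, integral_const_mul, integral_add (integrable_const 1) p1.integrableOn] at hb
    have h1 : ∫ y in punct, (1 : ℝ) ≤ 8 := by
      have := norm_integral_punct_le (F := fun _ => 1) (C := 1) (by simp)
      exact (le_abs_self _).trans (by linarith)
    have h2 : ∫ y in punct, |a 0| / (y ^ 2 + a 0 ^ 2) ≤ π := by
      rw [← p2]
      exact setIntegral_le_integral p1 (ae_of_all _ fun y => by positivity)
    rw [← two_mul, abs_mul, abs_two] at hb
    have h3 : K * ((∫ y in punct, 1) + ∫ y in punct, |a 0| / (y ^ 2 + a 0 ^ 2)) ≤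
        K * (8 + π) := by gcongr
    linarith [abs_nonneg (∫ y in punct, rker y (a y) * 1)]
  rw [e]
  refine (abs_add_le _ _).trans (add_le_add b1 ?_)
  rw [abs_mul]
  exact mul_le_mul (hwb 0) b2 (abs_nonneg _) (by linarith)

namespace LevelFlow

variable {γ₀ : ℝ → ℝ} (Λ : LevelFlow γ₀)

/-- Truncation of a label to `[-1, 1]`. -/
def clamp (m : ℝ) : ℝ := max (-1) (min m 1)

theorem clamp_mem (m : ℝ) : clamp m ∈ Icc (-1 : ℝ) 1 :=
  ⟨le_max_left _ _, max_le (by norm_num) (min_le_right _ _)⟩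

theorem clamp_mem' (m : ℝ) : clamp m ∈ Ioo (-2 : ℝ) 2 := mem_Ioo_of_Icc (clamp_mem m)

theorem clamp_eq {m : ℝ} (hm : m ∈ Icc (-1 : ℝ) 1) : clamp m = m := by
  rw [clamp, min_eq_left hm.2, max_eq_right hm.1]

theorem continuous_clamp : Continuous clamp := by unfold clamp; fun_prop

/-- The level functions, with labels truncated to `[-1, 1]`. -/
def gc (t z m : ℝ) : ℝ := Λ.g t z (clamp m)

/-- The slopes of the level functions, with labels truncated to `[-1, 1]`. -/
def gxc (t z m : ℝ) : ℝ := Λ.gx t z (clamp m)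

theorem continuousOn_clamp {W : ℝ → ℝ → ℝ → ℝ}
    (hW : ContinuousOn (fun p : ℝ × ℝ × ℝ => W p.1 p.2.1 p.2.2) (flowDom Λ.T)) :
    ContinuousOn (fun p : ℝ × ℝ × ℝ => W p.1 p.2.1 (clamp p.2.2)) (Ico 0 Λ.T ×ˢ univ) := by
  have h1 : Continuous (fun p : ℝ × ℝ × ℝ => (p.1, p.2.1, clamp p.2.2)) := by
    have := continuous_clamp
    fun_prop
  exact hW.comp h1.continuousOn fun p hp => ⟨hp.1, mem_univ _, clamp_mem' _⟩

/-- Densities on the level curves for which the induced velocity is bounded. -/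
structure Weight (W : ℝ → ℝ → ℝ → ℝ) : Prop where
  cont : ContinuousOn (fun p : ℝ × ℝ × ℝ => W p.1 p.2.1 p.2.2) (Ico 0 Λ.T ×ˢ univ)
  periodic : ∀ t ∈ Ico 0 Λ.T, ∀ z m, W t (z + 2 * π) m = W t z m
  bound : ∀ t ∈ Ico 0 Λ.T, ∀ z m, |W t z m| ≤ Λ.M
  lip : ∀ t ∈ Ico 0 Λ.T, ∀ z z' m, |W t z m - W t z' m| ≤ Λ.M * |z - z'|

theorem weight_one : Λ.Weight (fun _ _ _ => 1) := by
  have hM := Λ.one_le_M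
  refine ⟨continuousOn_const, fun _ _ _ _ => rfl, fun _ _ _ _ => by simpa using hM,
    fun _ _ z z' _ => ?_⟩
  rw [sub_self, abs_zero]
  positivity

theorem weight_gxc : Λ.Weight Λ.gxc := by
  refine ⟨Λ.continuousOn_clamp Λ.cont_gx, fun t ht z m => Λ.gx_period ht (clamp_mem' m) z,
    fun t ht z m => Λ.abs_gx_le t ht z _ (clamp_mem' m), fun t ht z z' m => ?_⟩
  simpa [gxc] using Λ.gx_lip t ht z z' _ (clamp_mem' m) _ (clamp_mem' m)

theorem continuousOn_gc : ContinuousOn (fun p : ℝ × ℝ × ℝ => Λ.gc p.1 p.2.1 p.2.2)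
    (Ico 0 Λ.T ×ˢ univ) := Λ.continuousOn_clamp Λ.cont_g

theorem continuous_slice {W : ℝ → ℝ → ℝ → ℝ}
    (hW : ContinuousOn (fun p : ℝ × ℝ × ℝ => W p.1 p.2.1 p.2.2) (Ico 0 Λ.T ×ˢ univ)) {t : ℝ}
    (ht : t ∈ Ico 0 Λ.T) : Continuous (fun p : ℝ × ℝ => W t p.1 p.2) := by
  have h1 : Continuous (fun p : ℝ × ℝ => (t, p)) := by fun_prop
  rw [← continuousOn_univ]
  exact hW.comp h1.continuousOn fun p _ => ⟨ht, mem_univ _⟩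

theorem continuous_gc {t : ℝ} (ht : t ∈ Ico 0 Λ.T) : Continuous (fun p : ℝ × ℝ => Λ.gc t p.1 p.2) :=
  Λ.continuous_slice Λ.continuousOn_gc ht

theorem gc_periodic {t : ℝ} (ht : t ∈ Ico 0 Λ.T) (z m : ℝ) : Λ.gc t (z + 2 * π) m = Λ.gc t z m :=
  Λ.periodic t ht z _ (clamp_mem' m)

theorem gc_lip {t : ℝ} (ht : t ∈ Ico 0 Λ.T) (z z' m : ℝ) :
    |Λ.gc t z m - Λ.gc t z' m| ≤ Λ.M * |z - z'| := Λ.g_lip_x ht z z' (clamp_mem' m)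

theorem abs_gc_le {t : ℝ} (ht : t ∈ Ico 0 Λ.T) (z m : ℝ) : |Λ.gc t z m| ≤ Λ.R :=
  Λ.abs_g_le t ht z _ (clamp_mem' m)

theorem hasDerivAt_gc {t : ℝ} (ht : t ∈ Ico 0 Λ.T) (z m : ℝ) :
    HasDerivAt (fun z => Λ.gc t z m) (Λ.gxc t z m) z := Λ.deriv_x t ht z _ (clamp_mem' m)

theorem gc_second_diff {t : ℝ} (ht : t ∈ Ico 0 Λ.T) (z m y : ℝ) :
    |Λ.gc t (z - y) m + Λ.gc t (z + y) m - 2 * Λ.gc t z m| ≤ 2 * Λ.M * y ^ 2 := by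
  have hM := Λ.one_le_M
  have hd : ∀ s, HasDerivAt (fun s => Λ.gc t (z - s) m + Λ.gc t (z + s) m)
      (-Λ.gxc t (z - s) m + Λ.gxc t (z + s) m) s := fun s => by
    have h1 := (Λ.hasDerivAt_gc ht (z - s) m).comp_const_sub z s
    have h2 := (Λ.hasDerivAt_gc ht (z + s) m).comp_const_add z s
    exact h1.add h2
  have hb : ∀ s ∈ uIcc 0 y, ‖-Λ.gxc t (z - s) m + Λ.gxc t (z + s) m‖ ≤ 2 * Λ.M * |y| := by
    intro s hs
    have h1 := Λ.weight_gxc.lip t ht (z + s) (z - s) m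
    rw [show z + s - (z - s) = 2 * s by ring, abs_mul, abs_two] at h1
    have h2 : |s| ≤ |y| := by simpa using abs_sub_left_of_mem_uIcc hs
    rw [norm_eq_abs, neg_add_eq_sub]
    nlinarith
  have := (convex_uIcc 0 y).norm_image_sub_le_of_norm_hasDerivWithin_le
    (fun s _ => (hd s).hasDerivWithinAt) hb left_mem_uIcc right_mem_uIcc
  simp only [norm_eq_abs, sub_zero, add_zero] at this
  rw [two_mul (Λ.gc t z m)]
  rwa [mul_assoc, ← sq, sq_abs] at this

/-- The potential of one level curve with density `W`. -/
def sheet (W : ℝ → ℝ → ℝ → ℝ) (t : ℝ) (x : ℝ × ℝ) (m : ℝ) : ℝ :=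
  ∫ y in punct, rker y (x.2 - Λ.gc t (x.1 - y) m) * W t (x.1 - y) m

/-- The superposition of the sheets over all labels. -/
def pot (W : ℝ → ℝ → ℝ → ℝ) (t : ℝ) (x : ℝ × ℝ) : ℝ := ∫ m in Icc (-1 : ℝ) 1, Λ.sheet W t x m

/-- The velocity field. -/
def v (t : ℝ) (x : ℝ × ℝ) : ℝ × ℝ := (Λ.pot (fun _ _ _ => 1) t x, Λ.pot Λ.gxc t x)

theorem integral_Ioc_eq_punct (F : ℝ → ℝ) : ∫ y in Ioc (-π) π, F y = ∫ y in punct, F y := by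
  refine setIntegral_congr_set ?_
  exact ((sdiff_null_ae_eq_self (measure_singleton 0)).trans Ioo_ae_eq_Ioc).symm

theorem sheet_periodic {W : ℝ → ℝ → ℝ → ℝ} (hW : Λ.Weight W) {t : ℝ} (ht : t ∈ Ico 0 Λ.T)
    (x : ℝ × ℝ) (m : ℝ) : Λ.sheet W t (x.1 + 2 * π, x.2) m = Λ.sheet W t x m := by
  simp only [sheet]
  congr 1; ext y
  rw [show x.1 + 2 * π - y = x.1 - y + 2 * π by ring, Λ.gc_periodic ht, hW.periodic t ht]

theorem periodic_v {t : ℝ} (ht : t ∈ Ico 0 Λ.T) : PeriodicFst (Λ.v t) := by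
  intro x
  simp only [v, pot, Λ.sheet_periodic Λ.weight_one ht, Λ.sheet_periodic Λ.weight_gxc ht]

theorem continuous_curve {W : ℝ → ℝ → ℝ → ℝ}
    (hW : ContinuousOn (fun p : ℝ × ℝ × ℝ => W p.1 p.2.1 p.2.2) (Ico 0 Λ.T ×ˢ univ)) {t : ℝ}
    (ht : t ∈ Ico 0 Λ.T) (x m : ℝ) : Continuous fun y => W t (x - y) m :=
  (Λ.continuous_slice hW ht).comp (by fun_prop : Continuous fun y => (x - y, m))

theorem sheet_curve {t : ℝ} (ht : t ∈ Ico 0 Λ.T) (x : ℝ × ℝ) (m : ℝ) :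
    Continuous (fun y => x.2 - Λ.gc t (x.1 - y) m) ∧
    ∀ y, |(x.2 - Λ.gc t (x.1 - y) m) - (x.2 - Λ.gc t x.1 m)| ≤ Λ.M * |y| :=
  ⟨continuous_const.sub (Λ.continuous_curve Λ.continuousOn_gc ht x.1 m), fun y => by
    simpa using Λ.gc_lip ht x.1 (x.1 - y) m⟩

/-- The sheets are bounded, uniformly in time and with exponential decay in the vertical
variable. -/
theorem exists_sheet_bound : ∃ C, 0 < C ∧ ∀ W, Λ.Weight W → ∀ t ∈ Ico 0 Λ.T, ∀ x : ℝ × ℝ, ∀ m,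
    x.2 ≠ Λ.gc t x.1 m → |Λ.sheet W t x m| ≤ C * exp (-|x.2|) := by
  have hM := Λ.one_le_M
  have hR := (abs_nonneg _).trans (Λ.abs_gc_le ⟨le_rfl, Λ.T_pos⟩ 0 0)
  obtain ⟨C, hC0, hC⟩ := abs_integral_rker_mul_le hM
  refine ⟨C * exp (Λ.R + 1) + Λ.M * exp Λ.R * 8, by positivity, fun W hW t ht x m hne => ?_⟩
  rw [add_mul]
  by_cases hx : |x.2| ≤ Λ.R + 1
  · have h1 : |Λ.sheet W t x m| ≤ C := by
      obtain ⟨c1, c2⟩ := Λ.sheet_curve ht x m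
      refine hC (fun y => x.2 - Λ.gc t (x.1 - y) m) (fun y => W t (x.1 - y) m) c1
        (Λ.continuous_curve hW.cont ht _ _) ?_ ?_ ?_ ?_ (fun y => hW.bound t ht _ _)
          (fun y => by simpa using hW.lip t ht (x.1 - y) x.1 m)
      · simpa using c2
      · intro y
        refine le_trans (le_of_eq ?_) (Λ.gc_second_diff ht x.1 m y)
        rw [← abs_neg]; congr 1; ring
      · simpa [sub_eq_zero] using hne
      · exact (abs_sub _ _).trans (add_le_add hx (Λ.abs_gc_le ht _ _))
    have h3 : C ≤ C * exp (Λ.R + 1) * exp (-|x.2|) := by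
      rw [mul_assoc, ← exp_add]
      exact le_mul_of_one_le_right hC0 (one_le_exp (by linarith))
    have h4 : 0 ≤ Λ.M * exp Λ.R * 8 * exp (-|x.2|) := by positivity
    linarith
  · push Not at hx
    have h1 : |Λ.sheet W t x m| ≤ exp (Λ.R - |x.2|) * Λ.M * 8 := by
      refine norm_integral_punct_le fun y _ => ?_
      rw [abs_mul]
      have h2 : |x.2| - Λ.R ≤ |x.2 - Λ.gc t (x.1 - y) m| := by
        have := abs_sub_abs_le_abs_sub x.2 (Λ.gc t (x.1 - y) m)
        linarith [Λ.abs_gc_le ht (x.1 - y) m]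
      refine mul_le_mul ((abs_rker_le_exp (by linarith)).trans ?_) (hW.bound t ht _ _)
        (abs_nonneg _) (exp_pos _).le
      exact exp_le_exp.2 (by linarith)
    have h3 : exp (Λ.R - |x.2|) = exp Λ.R * exp (-|x.2|) := by rw [← exp_add]; congr 1
    have h4 : 0 ≤ C * exp (Λ.R + 1) * exp (-|x.2|) := by positivity
    rw [h3] at h1
    linarith

/-- Space-time away from the initial interface. -/
def offInterface : Set (ℝ × ℝ × ℝ) := (Ico 0 Λ.T ×ˢ univ) \ {p | p.1 = 0 ∧ p.2.2 = γ₀ p.2.1}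

theorem ae_ne_gc {p : ℝ × ℝ × ℝ} (hp : p ∈ Λ.offInterface) :
    ∀ᵐ m ∂(volume.restrict (Icc (-1 : ℝ) 1)), p.2.2 ≠ Λ.gc p.1 p.2.1 m := by
  obtain ⟨⟨ht, -⟩, hne⟩ := hp
  rcases ht.1.eq_or_lt with h0 | h0
  · refine ae_of_all _ fun m h => hne ⟨h0.symm, ?_⟩
    rw [h, ← h0, gc, Λ.init]
  · refine (ae_restrict_iff' measurableSet_Icc).2
      (Filter.Eventually.mono (compl_mem_ae_iff.2 (measure_singleton (Λ.ρ p.1 p.2))) fun m hm hI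
      h => hm ?_)
    have := Λ.abs_sub_g_ge ht p.2 hI
    rw [gc, clamp_eq hI] at h
    rw [h, sub_self, abs_zero] at this
    refine sub_eq_zero.1 (abs_nonpos_iff.1 ?_)
    by_contra! h3; nlinarith

theorem stronglyMeasurable_sheet {W : ℝ → ℝ → ℝ → ℝ} (hW : Λ.Weight W) {t : ℝ}
    (ht : t ∈ Ico 0 Λ.T) (x : ℝ × ℝ) : StronglyMeasurable (Λ.sheet W t x) := by
  have c3 : Continuous fun p : ℝ × ℝ => ((x.1 - p.2, p.1) : ℝ × ℝ) := by fun_prop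
  have :=
    ((measurable_rker.comp
      (measurable_snd.prodMk
      (continuous_const (y := x.2) |>.sub ((Λ.continuous_gc ht).comp c3)).measurable)).mul
      ((Λ.continuous_slice hW.cont ht).comp c3).measurable).stronglyMeasurable
  exact this.integral_prod_right

theorem continuousWithinAt_sheet {W : ℝ → ℝ → ℝ → ℝ} (hW : Λ.Weight W) {p : ℝ × ℝ × ℝ}
    (hp : p ∈ Λ.offInterface) {m : ℝ} (hm : p.2.2 ≠ Λ.gc p.1 p.2.1 m) :
    ContinuousWithinAt (fun p : ℝ × ℝ × ℝ => Λ.sheet W p.1 p.2 m) Λ.offInterface p := by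
  have hsub : Λ.offInterface ⊆ Ico 0 Λ.T ×ˢ univ := sdiff_subset
  have hcomp : ∀ {U : ℝ → ℝ → ℝ → ℝ},
      ContinuousOn (fun p : ℝ × ℝ × ℝ => U p.1 p.2.1 p.2.2) (Ico 0 Λ.T ×ˢ univ) → ∀ y,
      ContinuousOn (fun p => U p.1 (p.2.1 - y) m) Λ.offInterface := by
    intro U hU y
    have c : Continuous fun p : ℝ × ℝ × ℝ => (p.1, p.2.1 - y, m) := by fun_prop
    exact hU.comp c.continuousOn fun q hq => ⟨(hsub hq).1, mem_univ _⟩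
  have hδ : ContinuousWithinAt (fun p => |p.2.2 - Λ.gc p.1 p.2.1 m|)
      Λ.offInterface p := by
    have h1 := hcomp Λ.continuousOn_gc 0 p hp
    simp at h1
    have h2 : ContinuousWithinAt (fun p => p.2.2) Λ.offInterface p := by fun_prop
    exact (h2.sub h1).abs
  have hδ0 := abs_pos.2 (sub_ne_zero.2 hm)
  refine continuousWithinAt_of_dominated
    (bound := fun _ => √(10 * (Λ.M ^ 2 + 1)) / (|p.2.2 - Λ.gc p.1 p.2.1 m| / 2) * Λ.M) ?_ ?_
    (integrable_const _) ?_
  · filter_upwards [self_mem_nhdsWithin] with q hq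
    obtain ⟨c1, -⟩ := Λ.sheet_curve (hsub hq).1 q.2 m
    exact ((measurable_rker.comp (measurable_id.prodMk c1.measurable)).mul
      (Λ.continuous_curve hW.cont (hsub hq).1 _ _).measurable).aestronglyMeasurable
  · filter_upwards [self_mem_nhdsWithin, (hδ.eventually (lt_mem_nhds (half_lt_self hδ0)))] with q hq
      hqd
    refine (ae_restrict_iff' measurableSet_punct).2 (ae_of_all _ fun y hy => ?_)
    rw [norm_eq_abs, abs_mul]
    obtain ⟨-, c2⟩ := Λ.sheet_curve (hsub hq).1 q.2 m
    have hy0 := (punct_abs hy).1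
    refine mul_le_mul
      ((abs_rker_le_of_lip (punct_abs hy).2 (c2 y) (by rw [← sq_abs y]; positivity)).trans ?_)
      (hW.bound _ (hsub hq).1 _ _) (abs_nonneg _) (by positivity)
    refine div_le_div_of_nonneg_left (sqrt_nonneg _) (by positivity) (hqd.le.trans ?_)
    rw [← sqrt_sq_eq_abs]
    exact sqrt_le_sqrt (by nlinarith)
  · refine (ae_restrict_iff' measurableSet_punct).2 (ae_of_all _ fun y hy => ?_)
    have h1 : ContinuousWithinAt (fun q => (y, q.2.2 - Λ.gc q.1 (q.2.1 - y) m))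
        Λ.offInterface p := by
      have h2 : ContinuousWithinAt (fun p => p.2.2) Λ.offInterface p := by fun_prop
      exact continuousWithinAt_const.prodMk (h2.sub (hcomp Λ.continuousOn_gc y p hp))
    exact (ContinuousAt.comp_continuousWithinAt
      (f := fun q : ℝ × ℝ × ℝ => (y, q.2.2 - Λ.gc q.1 (q.2.1 - y) m))
      (continuousAt_rker (den_pos_of_punct hy)) h1).mul
      (hcomp hW.cont y p hp)

theorem continuousOn_pot {W : ℝ → ℝ → ℝ → ℝ} (hW : Λ.Weight W) :
    ContinuousOn (fun p : ℝ × ℝ × ℝ => Λ.pot W p.1 p.2) Λ.offInterface := by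
  intro p hp
  have hsub : Λ.offInterface ⊆ Ico 0 Λ.T ×ˢ univ := sdiff_subset
  obtain ⟨C, hC0, hC⟩ := Λ.exists_sheet_bound
  refine continuousWithinAt_of_dominated (bound := fun _ => C) ?_ ?_ (integrable_const _) ?_
  · filter_upwards [self_mem_nhdsWithin] with q hq using
      (Λ.stronglyMeasurable_sheet hW (hsub hq).1 q.2).aestronglyMeasurable
  · filter_upwards [self_mem_nhdsWithin] with q hq
    filter_upwards [Λ.ae_ne_gc hq] with m hm
    exact (hC W hW _ (hsub hq).1 _ m hm).trans (mul_le_of_le_one_right hC0.le (by simp))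
  · filter_upwards [Λ.ae_ne_gc hp] with m hm using Λ.continuousWithinAt_sheet hW hp hm

theorem continuousOn_v : ContinuousOn (fun p : ℝ × ℝ × ℝ => Λ.v p.1 p.2)
    ((Ico 0 Λ.T ×ˢ univ) \ {p | p.1 = 0 ∧ p.2.2 = γ₀ p.2.1}) :=
  (Λ.continuousOn_pot Λ.weight_one).prodMk (Λ.continuousOn_pot Λ.weight_gxc)

theorem exists_pot_bound : ∃ C, 0 < C ∧ ∀ W, Λ.Weight W → ∀ t ∈ Ioo 0 Λ.T, ∀ x : ℝ × ℝ,
    |Λ.pot W t x| ≤ C * exp (-|x.2|) := by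
  obtain ⟨C, hC0, hC⟩ := Λ.exists_sheet_bound
  refine ⟨C * 2, by positivity, fun W hW t ht x => ?_⟩
  have hI := Ioo_subset_Ico_self ht
  have hoff : ((t, x) : ℝ × ℝ × ℝ) ∈ Λ.offInterface := ⟨⟨hI, mem_univ _⟩, fun h => ht.1.ne' h.1⟩
  have h1 : ‖∫ m in Icc (-1) 1, Λ.sheet W t x m‖ ≤ ∫ m in Icc (-1 : ℝ) 1, C * exp (-|x.2|) := by
    refine norm_integral_le_of_norm_le (integrable_const _) ?_
    filter_upwards [Λ.ae_ne_gc hoff] with m hm using hC W hW t hI x m hm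
  rw [norm_eq_abs] at h1
  refine h1.trans_eq ?_
  simp
  ring

end LevelFlow

theorem den_ge_of_abs_le {y : ℝ} (hy : |y| ≤ π + 1) (a : ℝ) : (a ^ 2 + y ^ 2) / 20 ≤ den y a := by
  by_cases h : |y| ≤ π
  · have := den_ge h a
    nlinarith
  · push Not at h
    have h1 := one_add_sq_div_two_le_cosh a
    have h2 : cos y ≤ 0 := by
      rw [← cos_abs, ← neg_nonneg, ← cos_sub_pi]
      exact cos_nonneg_of_mem_Icc ⟨by linarith [pi_pos], by linarith [pi_gt_three]⟩
    have h3 : y ^ 2 ≤ 20 := by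
      rw [← sq_abs]
      have : |y| ≤ 4.1416 := by linarith [pi_lt_d4]
      nlinarith [abs_nonneg y]
    rw [den]
    nlinarith

theorem sqrt_den_ge {y a s : ℝ} (hy : |y| ≤ π + 1) (hs0 : 0 ≤ s) (hs : s ≤ |a|) :
    (|y| + s) / 8 ≤ √(den y a) := by
  refine le_sqrt_of_sq_le (le_trans ?_ (den_ge_of_abs_le hy a))
  have : s ^ 2 ≤ a ^ 2 := by rw [← sq_abs a]; exact pow_le_pow_left₀ hs0 hs 2
  rw [← sq_abs y]
  nlinarith

theorem lintegral_interp_le {t c r : ℝ} (ht : 0 < t) (hc : 0 < c) (hr : 0 < r) (μ : ℝ) :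
    ∫⁻ m, ENNReal.ofReal (r / ((c + t * |m - μ|) * (c + t * |m - μ| + r))) =
      ENNReal.ofReal (2 / t * log (1 + r / c)) := by
  have hd : ∀ s ∈ Ici 0, HasDerivAt (fun s => t⁻¹ * (log (c + t * s) - log (c + t * s + r)))
      (r / ((c + t * s) * (c + t * s + r))) s := by
    intro s hs
    have hs0 := mul_nonneg ht.le hs
    have h1 : HasDerivAt (fun s => c + t * s) t s := by
      simpa using ((hasDerivAt_id s).const_mul t).const_add c
    have h2 := ((h1.log (by positivity)).sub ((h1.add_const r).log (by positivity))).const_mul t⁻¹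
    refine h2.congr_deriv ?_
    field_simp
    ring
  have hpos : ∀ s ∈ Ioi 0, 0 ≤ r / ((c + t * s) * (c + t * s + r)) := by
    intro s hs
    have hs0 := mul_nonneg ht.le (le_of_lt hs)
    positivity
  have hlim : Tendsto (fun s => t⁻¹ * (log (c + t * s) - log (c + t * s + r))) atTop (𝓝 0) := by
    have h1 : Tendsto (fun s => c + t * s) atTop atTop :=
      tendsto_atTop_add_const_left _ _ (tendsto_id.const_mul_atTop ht)
    have h3 : Tendsto (fun s => log (1 - r / (c + t * s + r))) atTop (𝓝 0) := by
      have : Tendsto (fun s => 1 - r / (c + t * s + r)) atTop (𝓝 (1 - 0)) :=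
        tendsto_const_nhds.sub ((h1.atTop_add (tendsto_const_nhds (x := r))).const_div_atTop r)
      rw [sub_zero] at this
      simpa using (this.log one_ne_zero)
    rw [show 0 = t⁻¹ * 0 by ring]
    refine (h3.const_mul _).congr' ?_
    filter_upwards [eventually_ge_atTop 0] with s hs
    rw [← log_div (by positivity) (by positivity)]
    congr 2
    field_simp
    ring
  have hval : ∫ s, r / ((c + t * |s|) * (c + t * |s| + r)) = 2 / t * log (1 + r / c) := by
    rw [(integral_comp_abs (f := fun s => r / ((c + t * s) * (c + t * s + r)))),
      (integral_Ioi_of_hasDerivAt_of_nonneg' hd hpos hlim), mul_zero, add_zero, ← neg_sub, sub_zero,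
      ← mul_neg, neg_sub,
      ← log_div (by positivity) (by positivity), add_div, div_self hc.ne']
    ring
  have hlog : 0 < log (1 + r / c) := log_pos (by linarith [div_pos hr hc])
  have hInt : Integrable fun s => r / ((c + t * |s|) * (c + t * |s| + r)) := by
    by_contra h
    rw [integral_undef h] at hval
    have : 0 < 2 / t * log (1 + r / c) := by positivity
    linarith
  rw [lintegral_sub_right_eq_self
    (fun m => ENNReal.ofReal (r / ((c + t * |m|) * (c + t * |m| + r)))) μ, ← hval,
    ofReal_integral_eq_lintegral_ofReal hInt (ae_of_all _ fun s => by positivity)]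

theorem lintegral_log_le {r : ℝ} (hr : 0 < r) (hr1 : r ≤ 1) :
    ∫⁻ y in Ioo (-5 : ℝ) 5, ENNReal.ofReal (log (1 + r / |y|)) ≤
      ENNReal.ofReal (12 * (r * (1 + |log r|))) := by
  have e : ∀ y : ℝ, y ≠ 0 → log (1 + r / |y|) = log (|y| + r) - log y := by
    intro y hy
    rw [← log_abs y, ← log_div (by positivity) (by positivity), add_div,
      div_self (abs_pos.2 hy).ne']
  have hc : Continuous fun y : ℝ => log (|y| + r) :=
    Continuous.log (by fun_prop) fun y => by positivity
  have hae : ∀ᵐ y : ℝ, y ≠ 0 := compl_mem_ae_iff.2 (measure_singleton 0)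
  have h1 : ∫⁻ y in Ioo (-5) 5, ENNReal.ofReal (log (1 + r / |y|)) =
      ENNReal.ofReal (∫ y in Ioo (-5) 5, (log (|y| + r) - log y)) := by
    rw [ofReal_integral_eq_lintegral_ofReal
      ((intervalIntegrable_iff_integrableOn_Ioo_of_le (by norm_num)).1
      ((hc.intervalIntegrable _ _).sub intervalIntegral.intervalIntegrable_log'))]
    · refine lintegral_congr_ae (ae_restrict_of_ae ?_)
      filter_upwards [hae] with y hy
      rw [e y hy]
    · refine ae_restrict_of_ae ?_
      filter_upwards [hae] with y hy
      rw [← e y hy]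
      exact log_nonneg (by simp; positivity)
  rw [h1]
  refine ENNReal.ofReal_le_ofReal ?_
  rw [← integral_Ioc_eq_integral_Ioo, ← intervalIntegral.integral_of_le (by norm_num),
    intervalIntegral.integral_sub (hc.intervalIntegrable _ _)
      intervalIntegral.intervalIntegrable_log', integral_log,
    ← intervalIntegral.integral_add_adjacent_intervals (hc.intervalIntegrable _ _)
      (hc.intervalIntegrable _ _)]
  have hp : ∫ y in 0..5, log (|y| + r) = ∫ y in r..(5 + r), log y := by
    rw [← zero_add r, add_comm 0 r]
    simp only [add_zero]
    have := intervalIntegral.integral_comp_add_right (a := 0) (b := 5) log r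
    rw [zero_add] at this
    rw [← this]
    refine intervalIntegral.integral_congr fun y hy => ?_
    rw [uIcc_of_le (by norm_num)] at hy
    simp only [abs_of_nonneg hy.1]
  have hn : ∫ y in (-5)..0, log (|y| + r) = ∫ y in r..(5 + r), log y := by
    rw [← hp]
    have := intervalIntegral.integral_comp_neg (a := 0) (b := 5) fun y => log (|y| + r)
    simp at this
    exact this.symm
  rw [hp, hn, integral_log, log_neg_eq_log]
  have l1 : log (5 + r) ≤ log 5 + r / 5 := by
    have : 5 + r = 5 * (1 + r / 5) := by ring
    rw [this, log_mul (by norm_num) (by positivity)]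
    have := log_le_sub_one_of_pos (x := 1 + r / 5) (by positivity)
    linarith
  have l2 : log 5 ≤ 4 := by
    have := log_le_sub_one_of_pos (x := 5) (by norm_num)
    linarith
  have l3 : -log r ≤ |log r| := neg_le_abs _
  nlinarith [
    mul_nonneg hr.le (abs_nonneg (log r))]

namespace LevelFlow

variable {γ₀ : ℝ → ℝ} (Λ : LevelFlow γ₀)

theorem sqrt_den_ge_curve {t : ℝ} (ht : t ∈ Ico 0 Λ.T) {y : ℝ} (hy : |y| ≤ π + 1) (z b : ℝ)
    {m : ℝ} (hm : m ∈ Icc (-1 : ℝ) 1) :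
    (|y| + t * |m - Λ.ρ t (z, b)|) / 8 ≤ √(den y (b - Λ.gc t z m)) := by
  refine sqrt_den_ge hy (mul_nonneg ht.1 (abs_nonneg _)) ?_
  rw [gc, clamp_eq hm]
  exact Λ.abs_sub_g_ge ht (z, b) hm

/-- Lebesgue measure on one period of the horizontal variable times the labels. -/
def labelMeasure : Measure (ℝ × ℝ) := (volume.restrict punct).prod (volume.restrict (Icc (-1) 1))

instance : IsFiniteMeasure labelMeasure := by unfold labelMeasure; infer_instance

/-- The distance from the point `(c + e, b)` to the point of label `q` on the level curves. -/
def gap (t e b c : ℝ) (q : ℝ × ℝ) : ℝ := √(den (e + q.1) (b - Λ.gc t (c - q.1) q.2))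

theorem measurable_gap {t : ℝ} (ht : t ∈ Ico 0 Λ.T) (r e b c : ℝ) : Measurable fun q =>
    ENNReal.ofReal (r / (Λ.gap t e b c q * (Λ.gap t e b c q + r))) := by
  have h : Measurable (Λ.gap t e b c) := (continuous_sqrt.comp (continuous_den.comp
    ((by fun_prop : Continuous fun q : ℝ × ℝ => e + q.1).prodMk (continuous_const.sub
    ((Λ.continuous_gc ht).comp
      (by fun_prop : Continuous fun q : ℝ × ℝ => (c - q.1, q.2))))))).measurable
  fun_prop

theorem lintegral_gap_le {t : ℝ} (ht : t ∈ Ioo 0 Λ.T) {r e : ℝ} (b c : ℝ) (he : |e| ≤ 1)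
    (hr : 0 < r) (hr1 : r ≤ 1) :
    ∫⁻ q, ENNReal.ofReal (r / (Λ.gap t e b c q * (Λ.gap t e b c q + r))) ∂labelMeasure ≤
    ENNReal.ofReal (1536 / t * (r * (1 + |log r|))) := by
  have hI := Ioo_subset_Ico_self ht
  have ht0 := ht.1
  rw [labelMeasure, lintegral_prod _ (Λ.measurable_gap hI r e b c).aemeasurable]
  calc _ ≤ ∫⁻ y in punct, ENNReal.ofReal (128 / t) * (Ioo (-5) 5).indicator
        (fun y => ENNReal.ofReal (log (1 + r / |y|))) (y + e) := by
        refine lintegral_mono_ae ((ae_restrict_iff' measurableSet_punct).2 ?_)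
        filter_upwards [(compl_mem_ae_iff.2 (measure_singleton (-e)) : ∀ᵐ y : ℝ, y ≠ -e)]
          with y hye hy
        have hye' : e + y ≠ 0 := fun h => hye (show y = -e by linarith)
        have hyl : |e + y| ≤ π + 1 := (abs_add_le _ _).trans (by linarith [(punct_abs hy).2])
        have hmem : y + e ∈ Ioo (-5) 5 := by
          have := abs_le.1 hyl
          constructor <;> linarith [pi_lt_d4]
        rw [indicator_of_mem hmem, ← ENNReal.ofReal_mul (by positivity)]
        calc _ ≤ ∫⁻ m, ENNReal.ofReal 64 * ENNReal.ofReal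
              (r / ((|e + y| + t * |m - Λ.ρ t (c - y, b)|) *
                (|e + y| + t * |m - Λ.ρ t (c - y, b)| + r))) := by
              refine (setLIntegral_mono' measurableSet_Icc fun m hm => ?_).trans
                (setLIntegral_le_lintegral _ _)
              rw [← ENNReal.ofReal_mul (by norm_num)]
              refine ENNReal.ofReal_le_ofReal ?_
              have h2 : _ ≤ Λ.gap t e b c (y, m) := Λ.sqrt_den_ge_curve hI hyl (c - y) b hm
              have h4 : 0 ≤ Λ.gap t e b c (y, m) := sqrt_nonneg _
              set q := |e + y| + t * |m - Λ.ρ t (c - y, b)|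
              have h3 : q / 8 * (q / 8 + r / 8) ≤
                  Λ.gap t e b c (y, m) * (Λ.gap t e b c (y, m) + r) := by
                gcongr
                linarith
              refine (div_le_div_of_nonneg_left hr.le (by positivity) h3).trans_eq ?_
              field_simp
              norm_num
          _ = _ := by
              rw [lintegral_const_mul' _ _ ENNReal.ofReal_ne_top,
                lintegral_interp_le ht0 (abs_pos.2 hye') hr, ← ENNReal.ofReal_mul (by norm_num),
                add_comm y e]
              congr 1
              ring
    _ ≤ ∫⁻ y, ENNReal.ofReal (128 / t) * (Ioo (-5) 5).indicator
        (fun y => ENNReal.ofReal (log (1 + r / |y|))) (y + e) := setLIntegral_le_lintegral _ _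
    _ ≤ ENNReal.ofReal (128 / t) * ENNReal.ofReal (12 * (r * (1 + |log r|))) := by
        rw [lintegral_const_mul' _ _ ENNReal.ofReal_ne_top, lintegral_add_right_eq_self
          ((Ioo (-5) 5).indicator (fun y => ENNReal.ofReal (log (1 + r / |y|)))),
          lintegral_indicator measurableSet_Ioo]
        gcongr
        exact lintegral_log_le hr hr1
    _ = _ := by
        rw [← ENNReal.ofReal_mul (by positivity)]
        congr 1
        ring

theorem den_pos_curve {t : ℝ} (ht : t ∈ Ico 0 Λ.T) {x : ℝ × ℝ} {m : ℝ}
    (hne : x.2 ≠ Λ.gc t x.1 m) (z : ℝ) : 0 < den (x.1 - z) (x.2 - Λ.gc t z m) := by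
  by_cases ha : x.2 - Λ.gc t z m = 0
  · have h1 : cos (x.1 - z) ≠ 1 := by
      intro h
      obtain ⟨n, hn⟩ := (cos_eq_one_iff _).1 h
      have hP : Function.Periodic (fun z => Λ.gc t z m) (2 * π) := fun z => Λ.gc_periodic ht z m
      have h2 := hP.int_mul n z
      simp only [show z + n * (2 * π) = x.1 by linarith] at h2
      exact hne (by rw [h2]; linarith)
    rw [ha, den, cosh_zero]
    have := lt_of_le_of_ne (cos_le_one (x.1 - z)) h1
    linarith
  · exact den_pos_of_ne ha

theorem integrableOn_sheet {W : ℝ → ℝ → ℝ → ℝ} (hW : Λ.Weight W) {p : ℝ × ℝ × ℝ}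
    (hp : p ∈ Λ.offInterface) : IntegrableOn (Λ.sheet W p.1 p.2) (Icc (-1) 1) := by
  obtain ⟨C, hC0, hC⟩ := Λ.exists_sheet_bound
  have ht := hp.1.1
  refine Integrable.mono' (integrable_const (C * exp (-|p.2.2|)))
    (Λ.stronglyMeasurable_sheet hW ht p.2).aestronglyMeasurable ?_
  filter_upwards [Λ.ae_ne_gc hp] with m hm using hC W hW _ ht _ m hm

theorem mem_offInterface {t : ℝ} (ht : t ∈ Ioo 0 Λ.T) (x : ℝ × ℝ) :
    ((t, x) : ℝ × ℝ × ℝ) ∈ Λ.offInterface :=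
  ⟨⟨Ioo_subset_Ico_self ht, mem_univ _⟩, fun h => ht.1.ne' h.1⟩

end LevelFlow

/-- The logarithmic kernel, the fundamental solution of the Laplacian on the cylinder. -/
def lker (y a : ℝ) : ℝ := log (den y a) / (4 * π)

/-- The vertical derivative of the logarithmic kernel. -/
def sker (y a : ℝ) : ℝ := sinh a / (4 * π * den y a)

theorem hasDerivAt_den {α β : ℝ → ℝ} {α' β' s : ℝ} (hα : HasDerivAt α α' s)
    (hβ : HasDerivAt β β' s) : HasDerivAt (fun s => den (α s) (β s))
      (sin (α s) * α' + sinh (β s) * β') s := by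
  refine (hβ.cosh.sub hα.cos).congr_deriv ?_
  ring

theorem hasDerivAt_lker {α β : ℝ → ℝ} {α' β' s : ℝ} (hα : HasDerivAt α α' s)
    (hβ : HasDerivAt β β' s) (h : 0 < den (α s) (β s)) : HasDerivAt (fun s => lker (α s) (β s))
      (rker (α s) (β s) * α' + sker (α s) (β s) * β') s := by
  refine (((hasDerivAt_den hα hβ).log h.ne').div_const (4 * π)).congr_deriv ?_
  rw [rker_eq, sker]
  field_simp

theorem continuousAt_sker {y a : ℝ} (h : 0 < den y a) :
    ContinuousAt (fun p : ℝ × ℝ => sker p.1 p.2) (y, a) := by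
  have h2 : ContinuousAt (fun p => sinh p.2) (y, a) := by fun_prop
  exact h2.div ((continuous_const.mul continuous_den).continuousAt) (by positivity)

/-- Periodic kernels with at most an inverse-distance singularity. -/
structure SingKernel (k : ℝ → ℝ → ℝ) : Prop where
  meas : Measurable fun p : ℝ × ℝ => k p.1 p.2
  periodic : ∀ y a, k (y + 2 * π) a = k y a
  bound : ∀ B : ℝ, ∃ C, 0 ≤ C ∧ ∀ y a, |a| ≤ B → |k y a| ≤ C * (1 / √(den y a))

theorem singKernel_rker : SingKernel rker :=
  ⟨measurable_rker, rker_add_two_pi, fun _ => ⟨1, zero_le_one, fun y a _ => by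
    rw [one_mul]; exact abs_rker_le y a⟩⟩

theorem den_le_cosh_add_one {y a B : ℝ} (ha : |a| ≤ B) : den y a ≤ cosh B + 1 := by
  have h1 := cosh_le_cosh.2 (ha.trans (le_abs_self B))
  have h2 := neg_one_le_cos y
  rw [den]; linarith

theorem singKernel_sker : SingKernel sker := by
  refine ⟨?_, fun y a => by rw [sker, sker, den_add_two_pi], fun B => ⟨√(cosh B + 1), sqrt_nonneg _,
    fun y a ha => ?_⟩⟩
  · have h1 : Measurable fun p : ℝ × ℝ => 4 * π * den p.1 p.2 :=
      (continuous_const.mul continuous_den).measurable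
    have h2 : Measurable fun p : ℝ × ℝ => sinh p.2 := by fun_prop
    exact h2.div h1
  · rcases (den_nonneg y a).eq_or_lt with h | h
    · rw [sker, ← h]; simp
    · have h1 : |sinh a| ≤ √(cosh B + 1) * √(den y a) := by
        rw [← sqrt_mul (by have := cosh_pos B; linarith), ← sqrt_sq_eq_abs]
        refine sqrt_le_sqrt ?_
        have h2 : sinh a ^ 2 = (cosh a + 1) * (cosh a - 1) := by
          have := cosh_sq a; nlinarith
        have h3 := cosh_le_cosh.2 (ha.trans (le_abs_self B))
        rw [h2]
        exact mul_le_mul (by linarith) (by rw [den]; linarith [cos_le_one y])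
          (by linarith [one_le_cosh a])
          (by linarith [cosh_pos B])
      rw [sker, abs_div, abs_of_pos (a := 4 * π * den y a) (by positivity), mul_one_div,
        div_le_div_iff₀ (by positivity) (sqrt_pos.2 h)]
      have hπ := pi_gt_three
      calc |sinh a| * √(den y a) ≤ √(cosh B + 1) * √(den y a) * √(den y a) := by gcongr
        _ = √(cosh B + 1) * (1 * den y a) := by rw [mul_assoc, (mul_self_sqrt h.le), one_mul]
        _ ≤ _ := by gcongr; linarith

theorem singKernel_lker : SingKernel lker := by
  refine ⟨(continuous_den.measurable.log).div_const _,
    fun y a => by rw [lker, lker, den_add_two_pi], fun B => ⟨2 * (cosh B + 2),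
    by have := cosh_pos B; positivity, fun y a ha => ?_⟩⟩
  rcases (den_nonneg y a).eq_or_lt with h | h
  · rw [lker, ← h]; simp
  · have hs := sqrt_pos.2 h
    set w := √(den y a) with hw
    have hd := (mul_self_sqrt h.le).symm
    have hU := den_le_cosh_add_one (y := y) ha
    have h1 : |log w| ≤ w + 1 / w := by
      have h2 := log_le_sub_one_of_pos hs
      have h3 := log_le_sub_one_of_pos (one_div_pos.2 hs)
      rw [one_div, log_inv] at h3
      have := inv_pos.2 hs
      rw [abs_le, one_div]
      constructor <;> linarith
    have h4 : w ≤ (cosh B + 1) * (1 / w) := by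
      rw [mul_one_div, le_div_iff₀ hs]; linarith
    rw [lker, hd, log_mul hs.ne' hs.ne', abs_div, abs_of_pos (a := 4 * π) (by positivity),
      ← two_mul, abs_mul, abs_two, div_le_iff₀ (by positivity)]
    have hp : 0 ≤ 2 * (cosh B + 2) * (1 / w) := by have := cosh_pos B; positivity
    have hπ := pi_gt_three
    nlinarith

namespace LevelFlow

variable {γ₀ : ℝ → ℝ} (Λ : LevelFlow γ₀)

/-- The integrand of a layer potential at `x`, parametrized by the distance to `c`. -/
def curveInt (k : ℝ → ℝ → ℝ) (W : ℝ → ℝ → ℝ → ℝ) (t : ℝ) (x : ℝ × ℝ) (c : ℝ) (q : ℝ × ℝ) : ℝ :=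
  k (x.1 - c + q.1) (x.2 - Λ.gc t (c - q.1) q.2) * W t (c - q.1) q.2

/-- The layer potential with kernel `k` and density `W` on the level curves. -/
def layer (k : ℝ → ℝ → ℝ) (W : ℝ → ℝ → ℝ → ℝ) (t : ℝ) (x : ℝ × ℝ) : ℝ :=
  ∫ m in Icc (-1 : ℝ) 1, ∫ y in punct, k y (x.2 - Λ.gc t (x.1 - y) m) * W t (x.1 - y) m

variable {k k' : ℝ → ℝ → ℝ} {W : ℝ → ℝ → ℝ → ℝ}

theorem measurable_curveInt (hk : SingKernel k) (hW : Λ.Weight W) {t : ℝ} (ht : t ∈ Ico 0 Λ.T)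
    (c : ℝ) : Measurable fun p : (ℝ × ℝ) × ℝ × ℝ => Λ.curveInt k W t p.1 c p.2 := by
  have h1 : Continuous fun p : (ℝ × ℝ) × ℝ × ℝ => ((c - p.2.1, p.2.2) : ℝ × ℝ) := by fun_prop
  have h2 : Continuous fun p : (ℝ × ℝ) × ℝ × ℝ => p.1.1 - c + p.2.1 := by fun_prop
  have h4 : Continuous fun p : (ℝ × ℝ) × ℝ × ℝ => p.1.2 := by fun_prop
  exact (hk.meas.comp (h2.measurable.prodMk (h4.sub ((Λ.continuous_gc ht).comp h1)).measurable)).mul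
    ((Λ.continuous_slice hW.cont ht).comp h1).measurable

theorem exists_lintegral_curveInt_le (hk : SingKernel k) (hW : Λ.Weight W) {t : ℝ}
    (ht : t ∈ Ioo 0 Λ.T) (B : ℝ) : ∃ C : ℝ, ∀ x : ℝ × ℝ, ∀ c, |x.1 - c| ≤ 1 → |x.2| ≤ B →
      ∫⁻ q, ‖Λ.curveInt k W t x c q‖ₑ ∂labelMeasure ≤ ENNReal.ofReal C := by
  have hM := Λ.one_le_M
  have hI := Ioo_subset_Ico_self ht
  obtain ⟨K, hK0, hK⟩ := hk.bound (B + Λ.R)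
  set S := √(cosh (B + Λ.R) + 1) with hS
  refine ⟨K * (S + 1) * Λ.M * (1536 / t * (1 * (1 + |log 1|))), fun x c hxc hxB => ?_⟩
  rw [ENNReal.ofReal_mul (by positivity)]
  refine le_trans (lintegral_mono fun q => ?_)
    ((lintegral_const_mul' _ _ ENNReal.ofReal_ne_top).le.trans
    (mul_le_mul_right (Λ.lintegral_gap_le ht x.2 c hxc one_pos le_rfl) _))
  rw [← ENNReal.ofReal_mul (by positivity), ← ofReal_norm]
  refine ENNReal.ofReal_le_ofReal ?_
  rw [curveInt, norm_eq_abs, abs_mul, mul_right_comm]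
  have ha := (abs_sub x.2 (Λ.gc t (c - q.1) q.2)).trans (add_le_add hxB (Λ.abs_gc_le hI _ _))
  refine mul_le_mul ((hK (x.1 - c + q.1) _ ha).trans ?_) (hW.bound t hI _ _) (abs_nonneg _)
    (by rw [gap]; positivity)
  rw [mul_assoc]
  gcongr
  have h1 : Λ.gap t (x.1 - c) x.2 c q ≤ S := sqrt_le_sqrt (den_le_cosh_add_one ha)
  change 1 / Λ.gap t (x.1 - c) x.2 c q ≤ _
  have h0 : 0 ≤ Λ.gap t (x.1 - c) x.2 c q := sqrt_nonneg _
  rcases h0.eq_or_lt with h | h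
  · simp [← h]
  · rw [mul_one_div, div_le_div_iff₀ h (by positivity)]
    nlinarith

theorem integrable_curveInt (hk : SingKernel k) (hW : Λ.Weight W) {t : ℝ} (ht : t ∈ Ioo 0 Λ.T)
    {x : ℝ × ℝ} {c : ℝ} (hc : |x.1 - c| ≤ 1) :
    Integrable (Λ.curveInt k W t x c) labelMeasure := by
  obtain ⟨C, hC⟩ := Λ.exists_lintegral_curveInt_le hk hW ht |x.2|
  exact ⟨((Λ.measurable_curveInt hk hW (Ioo_subset_Ico_self ht) c).comp
    measurable_prodMk_left).aestronglyMeasurable,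
    (hC x c hc le_rfl).trans_lt ENNReal.ofReal_lt_top⟩

theorem kernel_shift (hk : SingKernel k) (hW : Λ.Weight W) {t : ℝ} (ht : t ∈ Ico 0 Λ.T)
    (x : ℝ × ℝ) (c m : ℝ) : ∫ y in punct, k y (x.2 - Λ.gc t (x.1 - y) m) * W t (x.1 - y) m =
      ∫ y in punct, k (x.1 - c + y) (x.2 - Λ.gc t (c - y) m) * W t (c - y) m := by
  have hP : Function.Periodic (fun z => k (x.1 - z) (x.2 - Λ.gc t z m) * W t z m) (2 * π) := by
    intro z
    have h1 : k (x.1 - (z + 2 * π)) (x.2 - Λ.gc t z m) = k (x.1 - z) (x.2 - Λ.gc t z m) := by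
      rw [← hk.periodic]; congr 1; ring
    simp only
    rw [Λ.gc_periodic ht, hW.periodic t ht, h1]
  have h2 : ∀ c, ∫ y in punct, k (x.1 - c + y) (x.2 - Λ.gc t (c - y) m) * W t (c - y) m =
      ∫ z in (-π)..π, k (x.1 - z) (x.2 - Λ.gc t z m) * W t z m := by
    intro c
    rw [← integral_Ioc_eq_punct, ← intervalIntegral.integral_of_le (by linarith [pi_pos])]
    have h2 := intervalIntegral.integral_comp_sub_left (a := -π) (b := π)
      (fun z => k (x.1 - z) (x.2 - Λ.gc t z m) * W t z m) c
    simp only [← sub_add, sub_neg_eq_add] at h2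
    rw [h2]
    have h3 := hP.intervalIntegral_add_eq (c - π) (-π)
    rwa [show c - π + 2 * π = c + π by ring, show -π + 2 * π = π by ring] at h3
  rw [h2, ← h2 x.1]
  simp

theorem layer_eq (hk : SingKernel k) (hW : Λ.Weight W) {t : ℝ} (ht : t ∈ Ioo 0 Λ.T)
    {x : ℝ × ℝ} {c : ℝ} (hc : |x.1 - c| ≤ 1) :
    Λ.layer k W t x = ∫ q, Λ.curveInt k W t x c q ∂labelMeasure := by
  have h := Λ.integrable_curveInt hk hW ht hc
  rw [labelMeasure] at h ⊢
  rw [integral_prod_symm _ h, layer]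
  exact integral_congr_ae
    (ae_of_all _ fun m => (Λ.kernel_shift hk hW (Ioo_subset_Ico_self ht) x c m))

/-- A layer potential is the primitive, along a coordinate direction, of the layer potential with
the differentiated kernel. -/
theorem layer_sub_layer (hk : SingKernel k) (hk' : SingKernel k') (hW : Λ.Weight W) {t : ℝ}
    (ht : t ∈ Ioo 0 Λ.T) (x : ℝ × ℝ) {d : ℝ × ℝ} (hd1 : |d.1| ≤ 1) (hd2 : |d.2| ≤ 1)
    (hder : ∀ᵐ q ∂labelMeasure, ∀ τ, HasDerivAt
      (fun τ => k (τ * d.1 + q.1) (x.2 + τ * d.2 - Λ.gc t (x.1 - q.1) q.2))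
      (k' (τ * d.1 + q.1) (x.2 + τ * d.2 - Λ.gc t (x.1 - q.1) q.2)) τ)
    (hcont : ∀ᵐ q ∂labelMeasure, Continuous fun τ =>
      k' (τ * d.1 + q.1) (x.2 + τ * d.2 - Λ.gc t (x.1 - q.1) q.2)) {h : ℝ} (hh : |h| ≤ 1) :
    Λ.layer k W t (x + h • d) - Λ.layer k W t x =
      ∫ τ in (0 : ℝ)..h, Λ.layer k' W t (x + τ • d) := by
  have hτ : ∀ τ ∈ uIcc 0 h, |τ| ≤ 1 := fun τ hτ => by
    have : |τ| ≤ |h| := by simpa using abs_sub_left_of_mem_uIcc hτ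
    exact this.trans hh
  have hc : ∀ τ : ℝ, |τ| ≤ 1 → |(x + τ • d).1 - x.1| ≤ 1 := fun τ h1 => by
    simp
    exact mul_le_one₀ h1 (abs_nonneg _) hd1
  have hc0 : |x.1 - x.1| ≤ 1 := by simp
  obtain ⟨C, hC⟩ := Λ.exists_lintegral_curveInt_le hk' hW ht (|x.2| + 1)
  have hInt : Integrable (Function.uncurry fun τ q => Λ.curveInt k' W t (x + τ • d) x.1 q)
      ((volume.restrict (uIoc 0 h)).prod labelMeasure) := by
    have hm : Measurable
      (Function.uncurry fun (τ : ℝ) q => Λ.curveInt k' W t (x + τ • d) x.1 q) := by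
      have h1 : Measurable fun p : ℝ × ℝ × ℝ => ((x + p.1 • d, p.2) : (ℝ × ℝ) × ℝ × ℝ) :=
        (measurable_const.add (measurable_fst.smul_const d)).prodMk measurable_snd
      exact (Λ.measurable_curveInt hk' hW (Ioo_subset_Ico_self ht) x.1).comp h1
    refine ⟨hm.aestronglyMeasurable, ?_⟩
    rw [HasFiniteIntegral, lintegral_prod _ hm.enorm.aemeasurable]
    calc _ ≤ ∫⁻ τ in uIoc 0 h, ENNReal.ofReal C := by
          refine setLIntegral_mono' measurableSet_uIoc fun τ hτ' => ?_
          have h1 := hτ τ (uIoc_subset_uIcc hτ')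
          refine hC _ _ (hc τ h1) ?_
          simp
          refine (abs_add_le _ _).trans ?_
          gcongr
          rw [abs_mul]
          exact mul_le_one₀ h1 (abs_nonneg _) hd2
      _ < ⊤ := by
          rw [setLIntegral_const]
          refine ENNReal.mul_lt_top ENNReal.ofReal_lt_top ?_
          rw [uIoc, volume_Ioc]
          exact ENNReal.ofReal_lt_top
  rw [(intervalIntegral.integral_congr fun τ h1 => Λ.layer_eq hk' hW ht (hc τ (hτ τ h1))),
    intervalIntegral_integral_swap hInt, Λ.layer_eq hk hW ht (hc h hh),
    Λ.layer_eq hk hW ht hc0, ← integral_sub (Λ.integrable_curveInt hk hW ht (hc h hh))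
      (Λ.integrable_curveInt hk hW ht hc0)]
  refine integral_congr_ae ?_
  filter_upwards [hder, hcont] with q h1 h2
  simp only [curveInt, Prod.fst_add, Prod.snd_add, Prod.smul_fst, Prod.smul_snd, smul_eq_mul,
    add_sub_cancel_left]
  rw [intervalIntegral.integral_mul_const, intervalIntegral.integral_eq_sub_of_hasDerivAt
    (fun τ _ => h1 τ) (h2.intervalIntegrable _ _)]
  ring

theorem ae_label_ne {t : ℝ} (ht : t ∈ Ioo 0 Λ.T) (x : ℝ × ℝ) :
    ∀ᵐ q ∂labelMeasure, x.2 - Λ.gc t (x.1 - q.1) q.2 ≠ 0 := by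
  have h1 : Continuous fun p : ℝ × ℝ => ((x.1 - p.1, p.2) : ℝ × ℝ) := by fun_prop
  have hm : MeasurableSet {q : ℝ × ℝ | x.2 - Λ.gc t (x.1 - q.1) q.2 ≠ 0} :=
    (isOpen_ne_fun (continuous_const.sub ((Λ.continuous_gc (Ioo_subset_Ico_self ht)).comp h1))
      continuous_const).measurableSet
  refine (Measure.ae_prod_mem_iff_ae_ae_mem hm).2 (ae_of_all _ fun y => ?_)
  filter_upwards [Λ.ae_ne_gc (Λ.mem_offInterface ht (x.1 - y, x.2))] with m hm using
    sub_ne_zero.2 hm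

theorem ae_label_punct : ∀ᵐ q ∂labelMeasure, q.1 ∈ punct := by
  refine (Measure.ae_prod_mem_iff_ae_ae_mem
    (measurable_fst measurableSet_punct)).2 ?_
  filter_upwards [ae_restrict_mem measurableSet_punct] with y hy using ae_of_all _ fun m => hy

theorem abs_pot_sub_le (hW : Λ.Weight W) {t : ℝ} (ht : t ∈ Ioo 0 Λ.T)
    {x x' : ℝ × ℝ} (hne : x ≠ x') (hle : euclLen (x - x') ≤ 1) :
    |Λ.pot W t x - Λ.pot W t x'| ≤
      12288 * Λ.M / t * (euclLen (x - x') * (1 + |log (euclLen (x - x'))|)) := by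
  have hI := Ioo_subset_Ico_self ht
  have ht0 := ht.1
  have hM := Λ.one_le_M
  set r := euclLen (x - x') with hr
  have hr0 : 0 < r := by
    refine sqrt_pos.2 ?_
    by_contra h
    push Not at h
    exact hne (sub_eq_zero.1 (Prod.ext (show (x - x').1 = 0 by nlinarith)
      (show (x - x').2 = 0 by nlinarith)))
  have hc0 : |x.1 - x.1| ≤ 1 := by simp
  have hc' : |x'.1 - x.1| ≤
    1 := by rw [abs_sub_comm]; exact (abs_le_sqrt (by simp; positivity)).trans hle
  set P := Λ.gap t (x.1 - x.1) x.2 x.1 with hP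
  set P' := Λ.gap t (x'.1 - x.1) x'.2 x.1 with hP'
  have key : ‖Λ.pot W t x - Λ.pot W t x'‖ₑ ≤ ∫⁻ q,
      (ENNReal.ofReal (4 * Λ.M) * ENNReal.ofReal (r / (P q * (P q + r))) +
        ENNReal.ofReal (4 * Λ.M) * ENNReal.ofReal (r / (P' q * (P' q + r)))) ∂labelMeasure := by
    change ‖Λ.layer rker W t x - Λ.layer rker W t x'‖ₑ ≤ _
    rw [Λ.layer_eq singKernel_rker hW ht hc0, Λ.layer_eq singKernel_rker hW ht hc',
      ← integral_sub (Λ.integrable_curveInt singKernel_rker hW ht hc0)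
        (Λ.integrable_curveInt singKernel_rker hW ht hc')]
    refine (enorm_integral_le_lintegral_enorm _).trans (lintegral_mono_ae ?_)
    filter_upwards [Λ.ae_label_ne ht x, Λ.ae_label_ne ht (x.1, x'.2)] with q hq hq'
    have hd := den_pos_of_ne (y := x.1 - x.1 + q.1) hq
    have hd' := den_pos_of_ne (y := x'.1 - x.1 + q.1) hq'
    have hpp := sqrt_pos.2 hd
    have hpp' := sqrt_pos.2 hd'
    rw [← ENNReal.ofReal_mul (by positivity), ← ENNReal.ofReal_mul (by positivity),
      ← ENNReal.ofReal_add (by positivity) (by positivity), ← ofReal_norm]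
    refine ENNReal.ofReal_le_ofReal ?_
    rw [curveInt, curveInt, ← sub_mul, norm_eq_abs, abs_mul]
    have h3 := abs_rker_sub_le hd hd' (by
      rw [sub_sub_sub_cancel_right]; exact (abs_le_sqrt (by simp; positivity)).trans hle)
    have h4 : √((x.1 - x.1 + q.1 - (x'.1 - x.1 + q.1)) ^ 2 +
        (x.2 - Λ.gc t (x.1 - q.1) q.2 - (x'.2 - Λ.gc t (x.1 - q.1) q.2)) ^ 2) = r := by
      rw [hr, euclLen]
      congr 1
      simp
    rw [h4] at h3
    calc _ ≤ 4 * (r / (P q * (P q + r)) + r / (P' q * (P' q + r))) * Λ.M :=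
          mul_le_mul (min_interp_le hpp hpp' hr0.le h3 ((abs_sub _ _).trans
            (add_le_add (abs_rker_le _ _) (abs_rker_le _ _)))) (hW.bound t hI _ _)
            (abs_nonneg _) (by positivity)
      _ = _ := by ring
  rw [lintegral_add_left ((Λ.measurable_gap hI _ _ _ _).const_mul _),
    lintegral_const_mul' _ _ ENNReal.ofReal_ne_top,
    lintegral_const_mul' _ _ ENNReal.ofReal_ne_top, ← mul_add] at key
  have := key.trans (mul_le_mul_right (add_le_add (Λ.lintegral_gap_le ht x.2 x.1 hc0 hr0 hle)
    (Λ.lintegral_gap_le ht x'.2 x.1 hc' hr0 hle)) _)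
  rw [← ENNReal.ofReal_add (by positivity) (by positivity), ← ENNReal.ofReal_mul (by positivity),
    ← ofReal_norm, ENNReal.ofReal_le_ofReal_iff (by positivity)] at this
  refine this.trans_eq ?_
  ring

theorem v_logLipschitz {t : ℝ} (ht : t ∈ Ioo 0 Λ.T) (x x' : ℝ × ℝ) (hle : euclLen (x - x') ≤ 1) :
    euclLen (Λ.v t x - Λ.v t x') ≤
      24576 * Λ.M / t * (euclLen (x - x') * (1 + |log (euclLen (x - x'))|)) := by
  rcases eq_or_ne x x' with rfl | hne
  · simp [euclLen]
  have h1 := Λ.abs_pot_sub_le Λ.weight_one ht hne hle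
  set B := 12288 * Λ.M / t * (euclLen (x - x') * (1 + |log (euclLen (x - x'))|)) with hB
  have hB0 := (abs_nonneg _).trans h1
  have e : 24576 * Λ.M / t * (euclLen (x - x') * (1 + |log (euclLen (x - x'))|)) = 2 * B := by
    rw [hB]; ring
  rw [e, euclLen]
  refine sqrt_le_iff.2 ⟨by positivity, ?_⟩
  simp only [v, Prod.fst_sub, Prod.snd_sub]
  rw [← sq_abs, ← sq_abs (Λ.pot Λ.gxc t x - _)]
  nlinarith [pow_le_pow_left₀ (abs_nonneg _) h1 2,
    pow_le_pow_left₀ (abs_nonneg _) (Λ.abs_pot_sub_le Λ.weight_gxc ht hne hle) 2]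

theorem layer_lker_horizontal (hW : Λ.Weight W) {t : ℝ} (ht : t ∈ Ioo 0 Λ.T) (x : ℝ × ℝ) {h : ℝ}
    (hh : |h| ≤ 1) : Λ.layer lker W t (x.1 + h, x.2) - Λ.layer lker W t x =
      ∫ τ in (0 : ℝ)..h, Λ.layer rker W t (x.1 + τ, x.2) := by
  have e : ∀ τ : ℝ, x + τ • ((1, 0) : ℝ × ℝ) = (x.1 + τ, x.2) := fun τ => by ext <;> simp
  have := Λ.layer_sub_layer singKernel_lker singKernel_rker hW ht x (d := (1, 0)) (by simp)
    (by simp) ?_ ?_ hh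
  · simpa only [e] using this
  · filter_upwards [Λ.ae_label_ne ht x] with q hq τ
    simpa using hasDerivAt_lker ((hasDerivAt_id τ).add_const q.1)
      (hasDerivAt_const τ (x.2 - Λ.gc t (x.1 - q.1) q.2)) (den_pos_of_ne hq)
  · filter_upwards [Λ.ae_label_ne ht x] with q hq
    simp
    refine continuous_iff_continuousAt.2 fun τ => ?_
    exact ContinuousAt.comp
      (f := fun τ : ℝ => ((τ + q.1, x.2 - Λ.gc t (x.1 - q.1) q.2) : ℝ × ℝ))
      (continuousAt_rker (den_pos_of_ne hq)) (by fun_prop)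

theorem layer_lker_vertical (hW : Λ.Weight W) {t : ℝ} (ht : t ∈ Ioo 0 Λ.T) (x : ℝ × ℝ) {h : ℝ}
    (hh : |h| ≤ 1) : Λ.layer lker W t (x.1, x.2 + h) - Λ.layer lker W t x =
      ∫ τ in (0 : ℝ)..h, Λ.layer sker W t (x.1, x.2 + τ) := by
  have e : ∀ τ : ℝ, x + τ • ((0, 1) : ℝ × ℝ) = (x.1, x.2 + τ) := fun τ => by ext <;> simp
  have := Λ.layer_sub_layer singKernel_lker singKernel_sker hW ht x (d := (0, 1)) (by simp)
    (by simp) ?_ ?_ hh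
  · simpa only [e] using this
  · filter_upwards [ae_label_punct] with q hq τ
    simpa using hasDerivAt_lker (hasDerivAt_const τ q.1)
      (((hasDerivAt_id τ).const_add x.2).sub_const (Λ.gc t (x.1 - q.1) q.2)) (den_pos_of_punct hq)
  · filter_upwards [ae_label_punct] with q hq
    simp
    refine continuous_iff_continuousAt.2 fun τ => ?_
    exact ContinuousAt.comp
      (f := fun τ : ℝ => ((q.1, x.2 + τ - Λ.gc t (x.1 - q.1) q.2) : ℝ × ℝ))
      (continuousAt_sker (den_pos_of_punct hq)) (by fun_prop)

end LevelFlow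

/-- The harmonic conjugate of the logarithmic kernel, with a slit at `y = 0`. -/
def aker (y a : ℝ) : ℝ :=
  arctan (cos (y / 2) * sinh (a / 2) / (sin (y / 2) * cosh (a / 2))) / (2 * π)

theorem hasDerivAt_aker {a : ℝ → ℝ} {a' y : ℝ} (ha : HasDerivAt a a' y) (hy : sin (y / 2) ≠ 0) :
    HasDerivAt (fun y => aker y (a y)) (rker y (a y) * a' - sker y (a y)) y := by
  have hy2 : HasDerivAt (fun y : ℝ => y / 2) (1 / 2) y := (hasDerivAt_id y).div_const 2
  have ha2 := ha.div_const 2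
  have hC : cosh (a y / 2) ≠ 0 := (cosh_pos _).ne'
  refine ((((hy2.cos.mul ha2.sinh).div (hy2.sin.mul ha2.cosh) (mul_ne_zero hy hC)).arctan).div_const
    (2 * π)).congr_deriv ?_
  have e1 : sin y = 2 * sin (y / 2) * cos (y / 2) := by
    rw [← sin_two_mul]; congr 1; ring
  have e2 : sinh (a y) = 2 * sinh (a y / 2) * cosh (a y / 2) := by
    rw [← sinh_two_mul]; congr 1; ring
  have e3 : cos (y / 2) ^ 2 = 1 - sin (y / 2) ^ 2 := cos_sq' _
  have e4 : cosh (a y / 2) ^ 2 = 1 + sinh (a y / 2) ^ 2 := by rw [cosh_sq]; ring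
  have e5 : den y (a y) = 2 * (sin (y / 2) ^ 2 + sinh (a y / 2) ^ 2) := by
    have h2 := cos_two_mul (y / 2)
    have h3 := cosh_two_mul (a y / 2)
    rw [mul_div_cancel₀ _ two_ne_zero] at h2 h3
    rw [den, h2, h3]; linarith
  rw [rker_eq, sker, e1, e2, e5]
  simp
  set s := sin (y / 2)
  set c := cos (y / 2)
  set S := sinh (a y / 2)
  set C := cosh (a y / 2)
  have hsum : 1 + (c * S / (s * C)) ^ 2 = (s ^ 2 + S ^ 2) / (s * C) ^ 2 := by
    field_simp
    rw [e3, e4]; ring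
  rw [hsum]
  field_simp
  have h6 : C ^ 2 - S ^ 2 = 1 := by rw [e4]; ring
  have h7 : s ^ 2 + c ^ 2 = 1 := by rw [e3]; ring
  linear_combination 4 * s * c * a' * h6 - 4 * S * C * h7

theorem tendsto_aker {a : ℝ → ℝ} (ha : Continuous a) (h0 : 0 < a 0) :
    Tendsto (fun y => aker y (a y)) (𝓝[>] 0) (𝓝 (1 / 4)) := by
  have hN : Continuous fun y => cos (y / 2) * sinh (a y / 2) := by fun_prop
  have hD : Continuous fun y => sin (y / 2) * cosh (a y / 2) := by fun_prop
  have hD0 : Tendsto (fun y => sin (y / 2) * cosh (a y / 2)) (𝓝[>] 0) (𝓝[>] 0) := by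
    refine tendsto_nhdsWithin_iff.2 ⟨by simpa using (hD.tendsto 0).mono_left nhdsWithin_le_nhds, ?_⟩
    filter_upwards [Ioo_mem_nhdsGT one_pos] with y hy using
      mul_pos (sin_pos_of_pos_of_lt_pi (by linarith [hy.1])
      (by linarith [hy.2, pi_gt_three])) (cosh_pos _)
  have h1 := ((hN.tendsto 0).mono_left nhdsWithin_le_nhds).pos_mul_atTop
    (by simpa using h0) (tendsto_inv_nhdsGT_zero.comp hD0)
  have := ((tendsto_arctan_atTop.mono_right nhdsWithin_le_nhds).comp h1).div_const (2 * π)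
  rwa [show π / 2 / (2 * π) = 1 / 4 by field_simp; norm_num] at this

theorem continuousAt_kernel {k : ℝ → ℝ → ℝ}
    (hk : ∀ {y a}, 0 < den y a → ContinuousAt (fun p : ℝ × ℝ => k p.1 p.2) (y, a)) {a : ℝ → ℝ}
    (ha : Continuous a) {y : ℝ} (hpos : 0 < den y (a y)) : ContinuousAt (fun y => k y (a y)) y :=
  ContinuousAt.comp (f := fun y => (y, a y)) (hk hpos)
    (by fun_prop)

/-- The jump of the normal velocity across a sheet. -/
theorem integral_sker_sub_rker {a a' : ℝ → ℝ} (ha : ∀ y, HasDerivAt a (a' y) y)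
    (hcont : Continuous a') (hpos : ∀ y, 0 < den y (a y)) (h0 : a 0 ≠ 0) :
    ∫ y in punct, (sker y (a y) - rker y (a y) * a' y) = if 0 < a 0 then 1 / 2 else -(1 / 2) := by
  have hπ := pi_pos
  have half : ∀ {a a' : ℝ → ℝ}, (∀ y, HasDerivAt a (a' y) y) → Continuous a' →
      (∀ y, 0 < den y (a y)) → 0 < a 0 →
      Continuous (fun y => sker y (a y) - rker y (a y) * a' y) ∧
      ∫ y in 0..π, (sker y (a y) - rker y (a y) * a' y) = 1 / 4 := by
    intro a a' ha hcont hpos h0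
    have hac := continuous_iff_continuousAt.2 fun y => (ha y).continuousAt
    have hd :=
      continuous_iff_continuousAt.2 fun y =>
        (continuousAt_kernel continuousAt_sker hac (hpos y)).sub
        ((continuousAt_kernel continuousAt_rker hac (hpos y)).mul hcont.continuousAt)
    have hder : ∀ y, 0 < y → y ≤ π → HasDerivAt (fun y => -aker y (a y))
        (sker y (a y) - rker y (a y) * a' y) y := fun y h1 h2 => by
      simpa using (hasDerivAt_aker (ha y)
        (sin_pos_of_pos_of_lt_pi (by linarith) (by linarith)).ne').fun_neg
    refine ⟨hd, ?_⟩
    rw [intervalIntegral.integral_eq_sub_of_hasDerivAt_of_tendsto hπ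
      (fun y hy => hder y hy.1 hy.2.le) (hd.intervalIntegrable _ _) (tendsto_aker hac h0).neg
      ((hder π hπ le_rfl).continuousAt.tendsto.mono_left nhdsWithin_le_nhds)]
    simp [aker]
  have full : ∀ {a a' : ℝ → ℝ}, (∀ y, HasDerivAt a (a' y) y) → Continuous a' →
      (∀ y, 0 < den y (a y)) → 0 < a 0 →
      ∫ y in punct, (sker y (a y) - rker y (a y) * a' y) = 1 / 2 := by
    intro a a' ha hcont hpos h0
    obtain ⟨hd, h1⟩ := half ha hcont hpos h0
    have h2 := (half (a := fun y => a (-y)) (a' := fun y => -a' (-y))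
      (fun y => ((ha (-y)).comp y (hasDerivAt_neg y)).congr_deriv (by simp)) (by fun_prop)
      (fun y => by simpa [den] using hpos (-y)) (by simpa using h0)).2
    have h3 := intervalIntegral.integral_comp_neg (a := 0) (b := π)
      fun y => sker y (a y) - rker y (a y) * a' y
    rw [← LevelFlow.integral_Ioc_eq_punct, ← intervalIntegral.integral_of_le (by linarith),
      ← intervalIntegral.integral_add_adjacent_intervals (hd.intervalIntegrable _ _)
        (hd.intervalIntegrable _ _), h1]
    simp only [rker, sker, den, sin_neg, cos_neg, mul_neg, neg_div, neg_mul] at h2 h3 ⊢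
    linarith
  split_ifs with h
  · exact full ha hcont hpos h
  · have := full (fun y => (ha y).neg) hcont.neg (fun y => by simpa [den] using hpos y)
      (by simpa using lt_of_le_of_ne (not_lt.1 h) h0)
    rw [← this, ← integral_neg]
    congr 1; ext y
    simp [rker, sker, den]
    ring

namespace LevelFlow

variable {γ₀ : ℝ → ℝ} (Λ : LevelFlow γ₀)

theorem curve_facts {t : ℝ} (ht : t ∈ Ico 0 Λ.T) (x : ℝ × ℝ) (m : ℝ) :
    (∀ y, HasDerivAt (fun y => x.2 - Λ.gc t (x.1 - y) m) (Λ.gxc t (x.1 - y) m) y) ∧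
    Continuous (fun y => Λ.gxc t (x.1 - y) m) ∧
    (x.2 ≠ Λ.gc t x.1 m → ∀ y, 0 < den y (x.2 - Λ.gc t (x.1 - y) m)) := by
  refine ⟨fun y => ?_, ?_, fun hne y => ?_⟩
  · have := ((Λ.hasDerivAt_gc ht (x.1 - y) m).comp_const_sub x.1 y).const_sub x.2
    rwa [neg_neg] at this
  · have c3 : Continuous fun y => ((x.1 - y, m) : ℝ × ℝ) := by fun_prop
    exact (Λ.continuous_slice Λ.weight_gxc.cont ht).comp c3
  · have := Λ.den_pos_curve ht hne (x.1 - y)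
    rwa [sub_sub_cancel] at this

theorem continuous_kernel_curve {k : ℝ → ℝ → ℝ}
    (hk : ∀ {y a}, 0 < den y a → ContinuousAt (fun p : ℝ × ℝ => k p.1 p.2) (y, a)) {t : ℝ}
    (ht : t ∈ Ico 0 Λ.T) {x : ℝ × ℝ} {m : ℝ} (hne : x.2 ≠ Λ.gc t x.1 m) :
    Continuous fun y => k y (x.2 - Λ.gc t (x.1 - y) m) :=
  continuous_iff_continuousAt.2 fun y =>
    continuousAt_kernel hk (Λ.sheet_curve ht x m).1 ((Λ.curve_facts ht x m).2.2 hne y)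

theorem integrableOn_punct_of_continuous {F : ℝ → ℝ} (hF : Continuous F) : IntegrableOn F punct :=
  (hF.integrableOn_Ioc).mono_set (sdiff_subset.trans Ioo_subset_Ioc_self)

theorem layer_sker_gxc {t : ℝ} (ht : t ∈ Ioo 0 Λ.T) (x : ℝ × ℝ) :
    Λ.layer sker Λ.gxc t x = -(Λ.v t x).1 := by
  have hI := Ioo_subset_Ico_self ht
  have hπ := pi_pos
  rw [layer, v, pot, ← integral_neg]
  refine integral_congr_ae ?_
  filter_upwards [Λ.ae_ne_gc (Λ.mem_offInterface ht x)] with m hm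
  obtain ⟨h1, h2, h3⟩ := Λ.curve_facts hI x m
  have hs := Λ.continuous_kernel_curve continuousAt_sker hI hm
  have hr := Λ.continuous_kernel_curve continuousAt_rker hI hm
  have hsum : ∫ y in punct, (rker y (x.2 - Λ.gc t (x.1 - y) m) * 1 +
      sker y (x.2 - Λ.gc t (x.1 - y) m) * Λ.gxc t (x.1 - y) m) = 0 := by
    rw [← integral_Ioc_eq_punct, ← intervalIntegral.integral_of_le (by linarith),
      intervalIntegral.integral_eq_sub_of_hasDerivAt
        (fun y _ => hasDerivAt_lker (hasDerivAt_id' y) (h1 y) (h3 hm y))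
        (((hr.mul continuous_const).add (hs.mul h2)).intervalIntegrable _ _)]
    have e : Λ.gc t (x.1 - -π) m = Λ.gc t (x.1 - π) m := by
      rw [← Λ.gc_periodic hI (x.1 - π)]; congr 1; ring
    simp only [lker, den, cos_neg, e, sub_self]
  have i1 : IntegrableOn (fun y => rker y (x.2 - Λ.gc t (x.1 - y) m) * 1) punct :=
    integrableOn_punct_of_continuous (hr.mul continuous_const)
  have i2 : IntegrableOn (fun y => sker y (x.2 - Λ.gc t (x.1 - y) m) * Λ.gxc t (x.1 - y) m)
      punct := integrableOn_punct_of_continuous (hs.mul h2)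
  rw [integral_add i1 i2] at hsum
  rw [sheet]
  linarith

theorem integral_label_sign {r : ℝ} (hr : r ∈ Icc (-1 : ℝ) 1) :
    ∫ m in Icc (-1 : ℝ) 1, ((Iio r).indicator (fun _ => (1 : ℝ)) m - 1 / 2) = r := by
  have h2 : Icc (-1) 1 ∩ Iio r = Ico (-1) r := by ext m; grind
  rw [integral_sub ((integrable_const 1).indicator measurableSet_Iio) (integrable_const _),
    setIntegral_indicator measurableSet_Iio, h2]
  simp [max_eq_left (by linarith [hr.1] : 0 ≤ r + 1)]
  norm_num

theorem layer_sker_one {t : ℝ} (ht : t ∈ Ioo 0 Λ.T) (x : ℝ × ℝ) :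
    Λ.layer sker (fun _ _ _ => 1) t x = (Λ.v t x).2 + Λ.ρ t x := by
  have hI := Ioo_subset_Ico_self ht
  have hoff := Λ.mem_offInterface ht x
  have i0 :=
    Λ.integrableOn_sheet Λ.weight_gxc hoff
  have i1 : IntegrableOn (fun m => (Iio (Λ.ρ t x)).indicator (fun _ => (1 : ℝ)) m - 1 / 2)
    (Icc (-1) 1) := ((integrable_const 1).indicator measurableSet_Iio).sub
      (integrable_const (1 / 2 : ℝ))
  have e : (Λ.v t x).2 + Λ.ρ t x = ∫ m in Icc (-1) 1, (Λ.sheet Λ.gxc t x m +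
      ((Iio (Λ.ρ t x)).indicator (fun _ => 1) m - 1 / 2)) := by
    rw [integral_add i0 i1, integral_label_sign (Λ.ρ_mem t x)]
    rfl
  rw [e, layer]
  refine integral_congr_ae ?_
  have hlt : ∀ᵐ m ∂(volume.restrict (Icc (-1) 1)), m ∈ Ico (-1 : ℝ) 1 := by
    rw [Measure.restrict_congr_set Ico_ae_eq_Icc.symm]
    exact ae_restrict_mem measurableSet_Ico
  filter_upwards [Λ.ae_ne_gc hoff, hlt] with m hm hmI
  obtain ⟨d1, d2, d3⟩ := Λ.curve_facts hI x m
  have key := integral_sker_sub_rker d1 d2 (d3 hm) (by simpa [sub_eq_zero] using hm)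
  have i2 : IntegrableOn (fun y => rker y (x.2 - Λ.gc t (x.1 - y) m) * Λ.gxc t (x.1 - y) m)
      punct := integrableOn_punct_of_continuous
        ((Λ.continuous_kernel_curve continuousAt_rker hI hm).mul d2)
  rw [integral_sub
    (integrableOn_punct_of_continuous (Λ.continuous_kernel_curve continuousAt_sker hI hm))
    i2] at key
  have hiff : 0 < x.2 - Λ.gc t (x.1 - 0) m ↔ m ∈ Iio (Λ.ρ t x) := by
    rw [sub_pos, sub_zero, gc, clamp_eq ⟨hmI.1, hmI.2.le⟩, mem_Iio, Λ.lt_ρ_iff hI hmI]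
  have key2 : (if 0 < x.2 - Λ.gc t (x.1 - 0) m then 1 / 2 else -(1 / 2)) =
      (Iio (Λ.ρ t x)).indicator (fun _ => (1 : ℝ)) m - 1 / 2 := by
    by_cases h : m ∈ Iio (Λ.ρ t x) <;> simp only [hiff, h, indicator] <;> norm_num
  rw [key2] at key
  simp
  rw [sheet]
  linarith

end LevelFlow

/-- A function on the plane with continuous partial derivatives. -/
structure HasPartials (P P₁ P₂ : ℝ × ℝ → ℝ) : Prop where
  cont_fst : Continuous P₁
  cont_snd : Continuous P₂
  fst : ∀ x, HasDerivAt (fun s => P (s, x.2)) (P₁ x) x.1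
  snd : ∀ x, HasDerivAt (fun s => P (x.1, s)) (P₂ x) x.2

namespace HasPartials

variable {P P₁ P₂ : ℝ × ℝ → ℝ}

theorem hasFDerivAt (h : HasPartials P P₁ P₂) (x : ℝ × ℝ) :
    HasFDerivAt P ((ContinuousLinearMap.toSpanSingleton ℝ (P₁ x)).coprod
      (ContinuousLinearMap.toSpanSingleton ℝ (P₂ x))) x := by
  have hts :=
    (ContinuousLinearMap.toSpanSingletonCLE (𝕜 := ℝ) (E := ℝ)).continuous
  exact (hasStrictFDerivAt_uncurry_coprod (f := fun a b => P (a, b))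
    (f₁ := fun a b => ContinuousLinearMap.toSpanSingleton ℝ (P₁ (a, b)))
    (f₂ := fun a b => ContinuousLinearMap.toSpanSingleton ℝ (P₂ (a, b)))
    (Eventually.of_forall fun q => (h.fst q).hasFDerivAt)
    (Eventually.of_forall fun q => (h.snd q).hasFDerivAt)
    (hts.comp h.cont_fst).continuousAt (hts.comp h.cont_snd).continuousAt).hasFDerivAt

theorem continuous (h : HasPartials P P₁ P₂) : Continuous P :=
  continuous_iff_continuousAt.2 fun x => (h.hasFDerivAt x).continuousAt

theorem hasDerivAt_comp (h : HasPartials P P₁ P₂) {α β : ℝ → ℝ} {α' β' s : ℝ}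
    (hα : HasDerivAt α α' s) (hβ : HasDerivAt β β' s) :
    HasDerivAt (fun s => P (α s, β s)) (α' * P₁ (α s, β s) + β' * P₂ (α s, β s)) s := by
  have :=
    (h.hasFDerivAt (α s, β s)).comp_hasDerivAt s (hα.prodMk hβ)
  refine this.congr_deriv ?_
  simp [ContinuousLinearMap.coprod_apply]

theorem of_contDiff {φ : ℝ × ℝ → ℝ} (h : ContDiff ℝ ∞ φ) : HasPartials φ (dx1 φ) (dx2 φ) ∧
    ContDiff ℝ ∞ (dx1 φ) ∧ ContDiff ℝ ∞ (dx2 φ) ∧ dx2 (dx1 φ) = dx1 (dx2 φ) := by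
  have hp : ∀ {f : ℝ × ℝ → ℝ} {f'} {x : ℝ × ℝ}, HasFDerivAt f f' x →
      HasDerivAt (fun s => f (s, x.2)) (f' (1, 0)) x.1 ∧
      HasDerivAt (fun s => f (x.1, s)) (f' (0, 1)) x.2 := fun hf =>
    ⟨hf.comp_hasDerivAt _ ((hasDerivAt_id _).prodMk (hasDerivAt_const _ _)),
      hf.comp_hasDerivAt _ ((hasDerivAt_const _ _).prodMk (hasDerivAt_id _))⟩
  have hd := fun x => hp (h.differentiable (by simp) x).hasFDerivAt
  have e1 : dx1 φ = fun x => fderiv ℝ φ x (1, 0) := funext fun x => (hd x).1.deriv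
  have e2 : dx2 φ = fun x => fderiv ℝ φ x (0, 1) := funext fun x => (hd x).2.deriv
  have hf : ContDiff ℝ ∞ (fderiv ℝ φ) := h.fderiv_right (by simp)
  have c1 : ContDiff ℝ ∞ (dx1 φ) := by rw [e1]; exact hf.clm_apply contDiff_const
  have c2 : ContDiff ℝ ∞ (dx2 φ) := by rw [e2]; exact hf.clm_apply contDiff_const
  refine ⟨⟨c1.continuous, c2.continuous, fun x => ?_, fun x => ?_⟩, c1, c2, ?_⟩
  · rw [e1]; exact (hd x).1
  · rw [e2]; exact (hd x).2
  · ext x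
    have hc := fun v => hp ((hf.differentiable (by simp) x).hasFDerivAt.clm_apply
      (hasFDerivAt_const v x))
    rw [e1, e2, dx2, (hc _).2.deriv, dx1, (hc _).1.deriv]
    simpa using (contDiff_infty.1 h 2).contDiffAt.isSymmSndFDerivAt (by simp) _ _

end HasPartials

theorem integrable_prod_of_continuous {F : ℝ × ℝ → ℝ} (hF : Continuous F) (a b c d : ℝ) :
    Integrable F ((volume.restrict (Ioc a b)).prod (volume.restrict (Ioc c d))) := by
  rw [Measure.prod_restrict]
  exact (hF.continuousOn.integrableOn_compact (isCompact_Icc.prod isCompact_Icc)).mono_set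
    (prod_mono Ioc_subset_Icc_self Ioc_subset_Icc_self)

theorem intervalIntegral_swap {F : ℝ × ℝ → ℝ} (hF : Continuous F) {a b c d : ℝ} (hab : a ≤ b)
    (hcd : c ≤ d) : ∫ x in a..b, ∫ y in c..d, F (x, y) = ∫ y in c..d, ∫ x in a..b, F (x, y) := by
  simp only [intervalIntegral.integral_of_le hab, intervalIntegral.integral_of_le hcd]
  exact integral_integral_swap (integrable_prod_of_continuous hF a b c d)

theorem dx_eq_zero {φ : ℝ × ℝ → ℝ} {R : ℝ} (h : ∀ x, R < |x.2| → φ x = 0) {x : ℝ × ℝ}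
    (hx : R < |x.2|) : dx1 φ x = 0 ∧ dx2 φ x = 0 := by
  constructor
  · have := funext fun s => h (s, x.2) hx
    rw [dx1, this, deriv_const]
  · have : (fun s => φ (x.1, s)) =ᶠ[𝓝 x.2] fun _ => 0 := by
      filter_upwards [(isOpen_lt continuous_const continuous_abs).mem_nhds hx] with s hs using
        h (x.1, s) hs
    rw [dx2, this.deriv_eq, deriv_const]

theorem integral_Ioi_eq_of_support {F : ℝ → ℝ} {R Y S : ℝ} (hF : ∀ s, R < |s| → F s = 0)
    (hS0 : 0 ≤ S) (hS : R ≤ Y + S) : ∫ s in Ioi Y, F s = ∫ s in (0 : ℝ)..S, F (Y + s) := by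
  rw [intervalIntegral.integral_comp_add_left, intervalIntegral.integral_of_le (by linarith),
    add_zero]
  refine setIntegral_eq_of_subset_of_forall_sdiff_eq_zero measurableSet_Ioi Ioc_subset_Ioi_self
    fun s hs => hF s ?_
  have h1 : Y + S < s := by
    by_contra h
    exact hs.2 ⟨hs.1, not_lt.1 h⟩
  exact lt_of_lt_of_le (hS.trans_lt h1) (le_abs_self s)

/-- Stokes' formula above a periodic graph, for a stream function with continuous gradient. -/
theorem integral_above_graph {P P₁ P₂ φ : ℝ × ℝ → ℝ} {Y Y' : ℝ → ℝ} {R B : ℝ}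
    (hP : HasPartials P P₁ P₂) (hPp : PeriodicFst P) (hφ : ContDiff ℝ ∞ φ) (hφp : PeriodicFst φ)
    (hφR : ∀ x, R < |x.2| → φ x = 0) (hY : ∀ s, HasDerivAt Y (Y' s) s) (hY' : Continuous Y')
    (hYp : Function.Periodic Y (2 * π)) (hYB : ∀ s, |Y s| ≤ B) :
    ∫ a in Ioc (-π) π, ∫ b in Ioi (Y a), (P₁ (a, b) * dx2 φ (a, b) - P₂ (a, b) * dx1 φ (a, b)) =
      -∫ a in Ioc (-π) π, φ (a, Y a) * (P₁ (a, Y a) + Y' a * P₂ (a, Y a)) := by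
  have hπ : -π ≤ π := by linarith [pi_pos]
  obtain ⟨p0, c1, c2, hcomm⟩ := HasPartials.of_contDiff hφ
  have p1 := (HasPartials.of_contDiff c1).1
  have p2 := (HasPartials.of_contDiff c2).1
  set S := |R| + B + 1
  have hB0 := (abs_nonneg _).trans (hYB 0)
  have hS0 : 0 ≤ S := by positivity
  have hSY : ∀ a, R < Y a + S := fun a => by linarith [(abs_le.1 (hYB a)).1, le_abs_self R]
  have hYc := continuous_iff_continuousAt.2 fun s => (hY s).continuousAt
  set τ : ℝ × ℝ → ℝ × ℝ := fun q => (q.1, Y q.1 + q.2)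
  set α : ℝ × ℝ → ℝ := fun q => (P₁ (τ q) + Y' q.1 * P₂ (τ q)) * dx2 φ (τ q) +
    P (τ q) * (dx1 (dx2 φ) (τ q) + Y' q.1 * dx2 (dx2 φ) (τ q)) with hα
  set β : ℝ × ℝ → ℝ := fun q => P₂ (τ q) * (dx1 φ (τ q) + Y' q.1 * dx2 φ (τ q)) +
    P (τ q) * (dx2 (dx1 φ) (τ q) + Y' q.1 * dx2 (dx2 φ) (τ q)) with hβ
  have := hP.cont_fst
  have := hP.cont_snd
  have := hP.continuous
  have := p1.cont_snd
  have := p2.cont_fst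
  have := p2.cont_snd
  have cα : Continuous α := by fun_prop
  have iβ : ∀ a, IntervalIntegrable (fun s => β (a, s)) volume 0 S := fun a =>
    Continuous.intervalIntegrable (by fun_prop) _ _
  have inner : ∀ a, ∫ b in Ioi (Y a), (P₁ (a, b) * dx2 φ (a, b) - P₂ (a, b) * dx1 φ (a, b)) =
      (∫ s in 0..S, α (a, s)) - ∫ s in 0..S, β (a, s) := by
    intro a
    rw [integral_Ioi_eq_of_support (fun s hs => by
      obtain ⟨h1, h2⟩ := dx_eq_zero hφR (x := (a, s)) hs
      rw [h1, h2]; ring) hS0 (hSY a).le, ← intervalIntegral.integral_sub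
      (Continuous.intervalIntegrable (by fun_prop) _ _) (iβ a)]
    refine intervalIntegral.integral_congr fun s _ => ?_
    simp only [hβ, hcomm]
    ring
  have vertical : ∀ a, ∫ s in 0..S, β (a, s) =
      -(P (a, Y a) * (dx1 φ (a, Y a) + Y' a * dx2 φ (a, Y a))) := by
    intro a
    have hd : ∀ s, HasDerivAt (fun s => P (a, Y a + s) *
        (dx1 φ (a, Y a + s) + Y' a * dx2 φ (a, Y a + s))) (β (a, s)) s := by
      intro s
      have hs : HasDerivAt (fun s => Y a + s) 1 s := (hasDerivAt_id s).const_add _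
      have h0 := hasDerivAt_const s a
      refine ((hP.hasDerivAt_comp h0 hs).mul ((p1.hasDerivAt_comp h0 hs).add
        ((p2.hasDerivAt_comp h0 hs).const_mul (Y' a)))).congr_deriv ?_
      simp; ring
    rw [intervalIntegral.integral_eq_sub_of_hasDerivAt (fun s _ => hd s) (iβ a)]
    obtain ⟨h1, h2⟩ := dx_eq_zero hφR (x := (a, Y a + S)) ((hSY a).trans_le (le_abs_self _))
    rw [h1, h2, add_zero]; ring
  have e : -π + 2 * π = π := by ring
  have hYπ : Y π = Y (-π) := by simpa [e] using hYp (-π)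
  have per : ∀ {f : ℝ × ℝ → ℝ}, PeriodicFst f → ∀ b, f (π, b) = f (-π, b) := fun hf b => by
    simpa [e] using hf (-π, b)
  have horizontal : ∫ a in (-π)..π, ∫ s in 0..S, α (a, s) = 0 := by
    rw [intervalIntegral_swap cα hπ hS0]
    refine (intervalIntegral.integral_congr fun s _ => ?_).trans
      (intervalIntegral.integral_zero)
    have hd : ∀ a, HasDerivAt (fun a => P (a, Y a + s) * dx2 φ (a, Y a + s)) (α (a, s)) a := by
      intro a
      have hs : HasDerivAt (fun a => Y a + s) (Y' a) a := (hY a).add_const _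
      refine ((hP.hasDerivAt_comp (hasDerivAt_id' a) hs).mul
        (p2.hasDerivAt_comp (hasDerivAt_id' a) hs)).congr_deriv ?_
      simp; ring
    have h2 : ∀ b, dx2 φ (π, b) = dx2 φ (-π, b) := fun b => by simp only [dx2, per hφp]
    rw [intervalIntegral.integral_eq_sub_of_hasDerivAt (fun a _ => hd a)
      (Continuous.intervalIntegrable (by fun_prop) _ _), hYπ, per hPp, h2, sub_self]
  have k1 : Continuous fun a => P (a, Y a) * (dx1 φ (a, Y a) + Y' a * dx2 φ (a, Y a)) := by fun_prop
  have k2 : Continuous fun a => φ (a, Y a) * (P₁ (a, Y a) + Y' a * P₂ (a, Y a)) := by fun_prop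
  have boundary : (∫ a in (-π)..π, P (a, Y a) * (dx1 φ (a, Y a) + Y' a * dx2 φ (a, Y a))) +
      ∫ a in (-π)..π, φ (a, Y a) * (P₁ (a, Y a) + Y' a * P₂ (a, Y a)) = 0 := by
    rw [← intervalIntegral.integral_add (k1.intervalIntegrable _ _) (k2.intervalIntegrable _ _),
      intervalIntegral.integral_eq_sub_of_hasDerivAt (f := fun a => P (a, Y a) * φ (a, Y a))
        (fun a _ => ?_) ((k1.fun_add k2).intervalIntegrable _ _), hYπ, per hPp, per hφp, sub_self]
    refine ((hP.hasDerivAt_comp (hasDerivAt_id' a) (hY a)).mul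
      (p0.hasDerivAt_comp (hasDerivAt_id' a) (hY a))).congr_deriv ?_
    ring
  have cI : Continuous fun a => ∫ s in (0 : ℝ)..S, α (a, s) :=
    intervalIntegral.continuous_parametric_intervalIntegral_of_continuous'
      cα 0 S
  simp only [inner, vertical, sub_neg_eq_add]
  rw [← intervalIntegral.integral_of_le hπ, ← intervalIntegral.integral_of_le hπ,
    intervalIntegral.integral_add (cI.intervalIntegrable _ _) (k1.intervalIntegrable _ _),
      horizontal]
  linarith

theorem hasDerivAt_of_primitive {F f : ℝ → ℝ} {x : ℝ} (hf : Continuous f)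
    (h : ∀ s, |s| ≤ 1 → F (x + s) - F x = ∫ τ in (0 : ℝ)..s, f (x + τ)) : HasDerivAt F (f x) x := by
  have h1 : HasDerivAt (fun s => F x + ∫ u in x..s, f u) (f x) x :=
    (hf.integral_hasStrictDerivAt x x).hasDerivAt.const_add _
  refine h1.congr_of_eventuallyEq ?_
  filter_upwards [closedBall_mem_nhds x one_pos] with s hs
  have h2 := h (s - x) (by rwa [mem_closedBall, dist_eq] at hs)
  rw [intervalIntegral.integral_comp_add_left, add_zero, add_sub_cancel] at h2
  linarith

theorem integrableOn_strip_of_continuous {F : ℝ × ℝ → ℝ} {R : ℝ} (hF : Continuous F)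
    (hs : ∀ x, R < |x.2| → F x = 0) : IntegrableOn F strip := by
  have h1 : IntegrableOn F (Icc (-π) π ×ˢ Icc (-R) R) :=
    hF.continuousOn.integrableOn_compact (isCompact_Icc.prod isCompact_Icc)
  refine h1.of_forall_sdiff_eq_zero (measurableSet_Ioc.prod MeasurableSet.univ) fun x hx => hs x ?_
  by_contra hle
  exact hx.2 ⟨Ioc_subset_Icc_self hx.1.1, abs_le.1 (not_lt.1 hle)⟩

theorem integral_strip {F : ℝ × ℝ → ℝ} (h : IntegrableOn F strip) :
    ∫ x in strip, F x = ∫ a in Ioc (-π) π, ∫ b, F (a, b) := by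
  have := setIntegral_prod F h
  rwa [Measure.restrict_univ] at this

/-- A smooth periodic function of the plane with bounded vertical support. -/
structure IsSpaceTest (R : ℝ) (φ : ℝ × ℝ → ℝ) : Prop where
  smooth : ContDiff ℝ ∞ φ
  periodic : PeriodicFst φ
  support : ∀ x, R < |x.2| → φ x = 0

namespace IsSpaceTest

variable {R : ℝ} {φ : ℝ × ℝ → ℝ}

theorem dx1 (h : IsSpaceTest R φ) : IsSpaceTest R (dx1 φ) := by
  refine ⟨(HasPartials.of_contDiff h.smooth).2.1, fun x => ?_,
    fun _ hx => (dx_eq_zero h.support hx).1⟩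
  rw [MacroIPM.dx1, ← (deriv_comp_add_const (f := fun s => φ (s, x.2)) (2 * π) x.1)]
  exact congrArg (deriv · x.1) (funext fun s => h.periodic (s, x.2))

theorem dx2 (h : IsSpaceTest R φ) : IsSpaceTest R (dx2 φ) :=
  ⟨(HasPartials.of_contDiff h.smooth).2.2.1, fun x => congrArg (deriv · x.2)
    (funext fun s => h.periodic (x.1, s)), fun _ hx => (dx_eq_zero h.support hx).2⟩

/-- The product of a continuous vector field with the gradient of a test function. -/
theorem integrableOn_grad {P₁ P₂ : ℝ × ℝ → ℝ} (h : IsSpaceTest R φ) (h1 : Continuous P₁)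
    (h2 : Continuous P₂) : IntegrableOn (fun x => P₁ x * MacroIPM.dx1 φ x + P₂ x * MacroIPM.dx2 φ x)
      strip :=
  integrableOn_strip_of_continuous ((h1.mul h.dx1.smooth.continuous).add
    (h2.mul h.dx2.smooth.continuous)) fun x hx => by
      rw [h.dx1.support x hx, h.dx2.support x hx]; ring

end IsSpaceTest

/-- Gradients are orthogonal to curls. -/
theorem integral_strip_curl {P P₁ P₂ φ : ℝ × ℝ → ℝ} {R : ℝ} (hP : HasPartials P P₁ P₂)
    (hPp : PeriodicFst P) (hφ : IsSpaceTest R φ) :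
    ∫ x in strip, (-P₂ x * dx1 φ x + P₁ x * dx2 φ x) = 0 := by
  have h := integral_above_graph (Y := fun _ => -(|R| + 1))
    hP hPp hφ.smooth hφ.periodic hφ.support (fun s => hasDerivAt_const _ _) continuous_const
    (fun _ => rfl) (fun s => by rw [abs_neg, abs_of_pos (by positivity)])
  have h0 : ∀ a, φ (a, -(|R| + 1)) = 0 := fun a => hφ.support _ (by
    simp only [abs_neg]
    rw [abs_of_pos (by positivity)]
    linarith [le_abs_self R])
  simp only [h0, zero_mul, integral_zero, neg_zero] at h
  rw [integral_strip (hφ.integrableOn_grad hP.cont_snd.fun_neg hP.cont_fst), ← h]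
  refine setIntegral_congr_fun measurableSet_Ioc fun a _ => ?_
  rw [← setIntegral_eq_integral_of_forall_compl_eq_zero fun b hb => ?_]
  · congr 1; ext b; ring
  rw [mem_Ioi, not_lt] at hb
  obtain ⟨h1, h2⟩ := dx_eq_zero hφ.support (x := (a, b)) (by linarith [neg_le_abs b, le_abs_self R])
  rw [h1, h2]; ring

namespace LevelFlow

variable {γ₀ : ℝ → ℝ} (Λ : LevelFlow γ₀)

theorem continuous_of_offInterface {E : Type*} [TopologicalSpace E] {F : ℝ → ℝ × ℝ → E}
    (hF : ContinuousOn (fun p : ℝ × ℝ × ℝ => F p.1 p.2) Λ.offInterface) {t : ℝ}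
    (ht : t ∈ Ioo 0 Λ.T) : Continuous (F t) := by
  have h1 : Continuous (fun x : ℝ × ℝ => (t, x)) := by fun_prop
  rw [← continuousOn_univ]
  exact hF.comp h1.continuousOn fun x _ => Λ.mem_offInterface ht x

theorem continuous_v {t : ℝ} (ht : t ∈ Ioo 0 Λ.T) : Continuous (Λ.v t) :=
  Λ.continuous_of_offInterface Λ.continuousOn_v ht

theorem continuous_ρ {t : ℝ} (ht : t ∈ Ioo 0 Λ.T) : Continuous (Λ.ρ t) :=
  Λ.continuous_of_offInterface Λ.continuousOn_ρ ht

theorem layer_periodic {k : ℝ → ℝ → ℝ} {W : ℝ → ℝ → ℝ → ℝ} (hW : Λ.Weight W) {t : ℝ}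
    (ht : t ∈ Ico 0 Λ.T) : PeriodicFst (Λ.layer k W t) := by
  intro x
  simp only [layer, show ∀ y, x.1 + 2 * π - y = x.1 - y + 2 * π from fun y => by ring,
    Λ.gc_periodic ht, hW.periodic t ht]

theorem hasPartials_layer {W : ℝ → ℝ → ℝ → ℝ} (hW : Λ.Weight W) {t : ℝ} (ht : t ∈ Ioo 0 Λ.T)
    {P₂ : ℝ × ℝ → ℝ} (h2 : ∀ x, Λ.layer sker W t x = P₂ x) (hc : Continuous P₂) :
    HasPartials (Λ.layer lker W t) (Λ.pot W t) P₂ := by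
  have hc1 := Λ.continuous_of_offInterface (Λ.continuousOn_pot hW) ht
  refine ⟨hc1, hc, fun x => ?_, fun x => ?_⟩
  · exact hasDerivAt_of_primitive
      (hc1.comp (Continuous.prodMk_left x.2)) fun s hs => Λ.layer_lker_horizontal hW ht x hs
  · refine hasDerivAt_of_primitive (f := fun s => P₂ (x.1, s))
      (hc.comp (Continuous.prodMk_right x.1)) fun s hs => ?_
    simp only [← h2]
    exact Λ.layer_lker_vertical hW ht x hs

/-- The stream function. -/
theorem hasPartials_stream {t : ℝ} (ht : t ∈ Ioo 0 Λ.T) : HasPartials (Λ.layer lker Λ.gxc t)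
    (fun x => (Λ.v t x).2) (fun x => -(Λ.v t x).1) :=
  Λ.hasPartials_layer Λ.weight_gxc ht (Λ.layer_sker_gxc ht) (Λ.continuous_v ht).fst.neg

/-- The negative of the pressure. -/
theorem hasPartials_pressure {t : ℝ} (ht : t ∈ Ioo 0 Λ.T) :
    HasPartials (Λ.layer lker (fun _ _ _ => 1) t)
      (fun x => (Λ.v t x).1) (fun x => (Λ.v t x).2 + Λ.ρ t x) :=
  Λ.hasPartials_layer Λ.weight_one ht (Λ.layer_sker_one ht)
    ((Λ.continuous_v ht).snd.add (Λ.continuous_ρ ht))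

theorem exists_v_bound : ∃ C, 0 < C ∧ ∀ t ∈ Ioo 0 Λ.T, ∀ x : ℝ × ℝ,
    |(Λ.v t x).1| ≤ C * exp (-|x.2|) ∧ |(Λ.v t x).2| ≤ C * exp (-|x.2|) := by
  obtain ⟨C, hC0, hC⟩ := Λ.exists_pot_bound
  exact ⟨C, hC0, fun t ht x => ⟨hC _ Λ.weight_one t ht x, hC _ Λ.weight_gxc t ht x⟩⟩

theorem exists_v_bound' : ∃ C, ∀ t ∈ Ioo 0 Λ.T, ∀ x : ℝ × ℝ,
    |(Λ.v t x).1| ≤ C ∧ |(Λ.v t x).2| ≤ C := by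
  obtain ⟨C, hC0, hC⟩ := Λ.exists_v_bound
  refine ⟨C, fun t ht x => ?_⟩
  have h1 : C * exp (-|x.2|) ≤ C := mul_le_of_le_one_right hC0.le (by simp)
  exact ⟨(hC t ht x).1.trans h1, (hC t ht x).2.trans h1⟩

theorem incompressible_slice {t : ℝ} (ht : t ∈ Ioo 0 Λ.T) {R : ℝ} {φ : ℝ × ℝ → ℝ}
    (hφ : IsSpaceTest R φ) :
    ∫ x in strip, ((Λ.v t x).1 * dx1 φ x + (Λ.v t x).2 * dx2 φ x) = 0 := by
  simpa using integral_strip_curl (Λ.hasPartials_stream ht)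
    (Λ.layer_periodic Λ.weight_gxc (Ioo_subset_Ico_self ht)) hφ

theorem darcy_slice {t : ℝ} (ht : t ∈ Ioo 0 Λ.T) {R : ℝ} {φ : ℝ × ℝ → ℝ}
    (hφ : IsSpaceTest R φ) :
    ∫ x in strip, ((Λ.v t x).1 * (-dx2 φ x) + ((Λ.v t x).2 + Λ.ρ t x) * dx1 φ x) = 0 := by
  rw [← neg_eq_zero, ← integral_neg, ← integral_strip_curl (Λ.hasPartials_pressure ht)
    (Λ.layer_periodic Λ.weight_one (Ioo_subset_Ico_self ht)) hφ]
  congr 1; ext x; ring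

/-- The level curves are transported by the flow. -/
theorem normal_velocity {t : ℝ} (ht : t ∈ Ioo 0 Λ.T) (x : ℝ) {h : ℝ} (hh : h ∈ Icc (-1 : ℝ) 1) :
    (Λ.v t (x, Λ.g t x h)).2 - Λ.gx t x h * (Λ.v t (x, Λ.g t x h)).1 = Λ.f t x h - 2 * h := by
  have hc : |((x, Λ.g t x h) : ℝ × ℝ).1 - x| ≤ 1 := by simp
  have i1 := Λ.integrable_curveInt singKernel_rker Λ.weight_gxc ht hc
  have i2 := Λ.integrable_curveInt singKernel_rker Λ.weight_one ht hc
  have e1 : (Λ.v t (x, Λ.g t x h)).2 = _ := Λ.layer_eq singKernel_rker Λ.weight_gxc ht hc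
  have e2 : (Λ.v t (x, Λ.g t x h)).1 = _ := Λ.layer_eq singKernel_rker Λ.weight_one ht hc
  have i3 := i1.sub (i2.const_mul (Λ.gx t x h))
  rw [e1, e2, ← integral_const_mul, ← integral_sub i1 (i2.const_mul _)]
  rw [labelMeasure] at i3 ⊢
  refine (integral_prod _ i3).trans ?_
  rw [Λ.velocity t (Ioo_subset_Ico_self ht) x h (mem_Ioo_of_Icc hh), sub_sub_cancel_left,
    ← integral_neg]
  refine setIntegral_congr_fun measurableSet_punct fun y _ => ?_
  rw [← integral_neg]
  refine setIntegral_congr_fun measurableSet_Icc fun m hm => ?_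
  simp only [Pi.sub_apply, curveInt, gc, gxc, clamp_eq hm]
  ring

theorem flux_slice {t : ℝ} (ht : t ∈ Ioo 0 Λ.T) {R : ℝ} {φ : ℝ × ℝ → ℝ} (hφ : IsSpaceTest R φ)
    {h : ℝ} (hh : h ∈ Icc (-1 : ℝ) 1) :
    ∫ a in Ioc (-π) π, ∫ b in Ioi (Λ.g t a h),
      ((Λ.v t (a, b)).1 * dx1 φ (a, b) + (Λ.v t (a, b)).2 * dx2 φ (a, b)) =
      -∫ a in Ioc (-π) π, φ (a, Λ.g t a h) * (Λ.f t a h - 2 * h) := by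
  have hI := Ioo_subset_Ico_self ht
  have hh2 := mem_Ioo_of_Icc hh
  have hc : Continuous fun a => ((a, h) : ℝ × ℝ) := by fun_prop
  have hY' : Continuous fun a => Λ.gx t a h := by
    simpa only [Function.comp_def, gxc, clamp_eq hh] using
      (Λ.continuous_slice Λ.weight_gxc.cont hI).comp hc
  have := integral_above_graph (Λ.hasPartials_stream ht)
    (Λ.layer_periodic Λ.weight_gxc hI) hφ.smooth hφ.periodic hφ.support
    (fun a => Λ.deriv_x t hI a h hh2) hY' (Λ.g_period hI hh2) (fun a => Λ.abs_g_le t hI a h hh2)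
  have e : ∀ a, (Λ.v t (a, Λ.g t a h)).2 + Λ.gx t a h * -(Λ.v t (a, Λ.g t a h)).1 =
      Λ.f t a h - 2 * h := fun a => by
    rw [← Λ.normal_velocity ht a hh]; ring
  simp only [e] at this
  rw [← this]
  congr 1; ext a; congr 1; ext b; ring

end LevelFlow

theorem integrableOn_spaceTime {F : ℝ × ℝ × ℝ → ℝ} {R T : ℝ} (hF : Continuous F)
    (hs : ∀ t ∈ Ioo 0 T, ∀ x : ℝ × ℝ, R < |x.2| → F (t, x) = 0) :
    Integrable F ((volume.restrict (Ioo 0 T)).prod (volume.restrict strip)) := by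
  rw [Measure.prod_restrict]
  have h1 : IntegrableOn F (Icc 0 T ×ˢ Icc (-π) π ×ˢ Icc (-R) R) :=
    hF.continuousOn.integrableOn_compact (isCompact_Icc.prod (isCompact_Icc.prod isCompact_Icc))
  refine IntegrableOn.of_forall_sdiff_eq_zero h1
    (measurableSet_Ioo.prod (measurableSet_Ioc.prod MeasurableSet.univ)) fun p hp =>
      hs p.1 hp.1.1 p.2 ?_
  by_contra hle
  exact hp.2 ⟨Ioo_subset_Icc_self hp.1.1, Ioc_subset_Icc_self hp.1.2.1, abs_le.1 (not_lt.1 hle)⟩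

/-- The fundamental theorem of calculus in time, integrated over a box. -/
theorem integral_time_deriv {S a b c d : ℝ} (hS : 0 ≤ S) {k Ψ : ℝ → ℝ × ℝ → ℝ}
    (hk : ContinuousOn (fun p : ℝ × ℝ × ℝ => k p.1 p.2) (Icc 0 S ×ˢ univ))
    (hd : ∀ t ∈ Icc 0 S, ∀ q, HasDerivWithinAt (fun τ => Ψ τ q) (k t q) (Ici 0) t)
    (hΨ : Continuous (Ψ 0)) (hend : ∀ q, Ψ S q = 0) :
    ∫ t in Ioc 0 S, ∫ x in Ioc a b, ∫ s in Ioc c d, k t (x, s) =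
      -∫ x in Ioc a b, ∫ s in Ioc c d, Ψ 0 (x, s) := by
  set ν := (volume.restrict (Ioc a b)).prod (volume.restrict (Ioc c d)) with hν
  have hslice : ∀ t ∈ Icc 0 S, Continuous (k t) := fun t ht => by
    rw [← continuousOn_univ]
    exact hk.comp (f := fun q => (t, q)) (by fun_prop) fun q _ => ⟨ht, mem_univ _⟩
  have e1 : ∫ t in Ioc 0 S, ∫ x in Ioc a b, ∫ s in Ioc c d, k t (x, s) =
      ∫ t in Ioc 0 S, ∫ q, k t q ∂ν := by
    exact setIntegral_congr_fun measurableSet_Ioc fun t ht =>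
      ((integral_prod _
      (integrable_prod_of_continuous (hslice t (Ioc_subset_Icc_self ht)) a b c d)).symm)
  have hi : Integrable (fun p => k p.1 p.2) ((volume.restrict (Ioc 0 S)).prod ν) := by
    rw [hν, Measure.prod_restrict, Measure.prod_restrict]
    exact ((hk.mono (prod_mono_right (subset_univ _))).integrableOn_compact
      (isCompact_Icc.prod (isCompact_Icc.prod isCompact_Icc))).mono_set
      (prod_mono Ioc_subset_Icc_self
      (prod_mono Ioc_subset_Icc_self Ioc_subset_Icc_self))
  have e2 : ∀ q, ∫ t in Ioc 0 S, k t q = -Ψ 0 q := fun q => by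
    rw [← intervalIntegral.integral_of_le hS, intervalIntegral.integral_eq_sub_of_hasDerivAt_of_le
      hS
      (f := fun τ => Ψ τ q), hend, zero_sub]
    · exact fun t ht => ((hd t ht q).continuousWithinAt).mono Icc_subset_Ici_self
    · exact fun t ht => (hd t (Ioo_subset_Icc_self ht) q).hasDerivAt (Ici_mem_nhds ht.1)
    · refine ContinuousOn.intervalIntegrable ?_
      rw [uIcc_of_le hS]
      exact hk.comp (f := fun t => (t, q)) (by fun_prop) fun t ht => ⟨ht, mem_univ _⟩
  rw [e1, integral_integral_swap hi]
  simp only [e2]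
  rw [integral_neg, hν, integral_prod _ (integrable_prod_of_continuous hΨ a b c d)]

/-- A test function with explicit bounds for its support. -/
structure IsTestOn (T S R : ℝ) (φ : ℝ → ℝ × ℝ → ℝ) : Prop where
  smooth : ContDiff ℝ ∞ (fun p : ℝ × ℝ × ℝ => φ p.1 p.2)
  periodic : ∀ t, PeriodicFst (φ t)
  S_pos : 0 < S
  S_lt : S < T
  R_nonneg : 0 ≤ R
  zero_late : ∀ t x, S ≤ t → φ t x = 0
  zero_far : ∀ t x, 0 ≤ t → R < |x.2| → φ t x = 0

theorem IsTest.exists_isTestOn {T : ℝ} {φ : ℝ → ℝ × ℝ → ℝ} (hφ : IsTest T φ) (hT : 0 < T) :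
    ∃ S R, IsTestOn T S R φ := by
  obtain ⟨S, hS, R, h⟩ := hφ.compactSupport
  have hm := max_lt hS hT
  refine ⟨(max S 0 + T) / 2, |R|, hφ.smooth, hφ.periodic, by linarith [le_max_right S 0],
    by linarith, abs_nonneg _, fun t x ht => ?_, fun t x ht hx => ?_⟩
  · by_contra hne
    have := (h t x (by linarith [le_max_right S 0]) hne).1
    linarith [le_max_left S 0]
  · by_contra hne
    linarith [(h t x ht hne).2, le_abs_self R]

namespace IsTestOn

variable {T S R : ℝ} {φ : ℝ → ℝ × ℝ → ℝ}

theorem hasDerivWithinAt_comp (h : IsTestOn T S R φ) {c : ℝ → ℝ × ℝ × ℝ} {c' : ℝ × ℝ × ℝ} {τ : ℝ}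
    {s : Set ℝ} (hc : HasDerivWithinAt c c' s τ) : HasDerivWithinAt (fun τ => φ (c τ).1 (c τ).2)
      (fderiv ℝ (fun p : ℝ × ℝ × ℝ => φ p.1 p.2) (c τ) c') s τ :=
  (h.smooth.differentiable (by simp) _).hasFDerivAt.comp_hasDerivWithinAt τ hc

theorem deriv_comp (h : IsTestOn T S R φ) {c : ℝ → ℝ × ℝ × ℝ} {c' : ℝ × ℝ × ℝ} {τ : ℝ}
    (hc : HasDerivAt c c' τ) : deriv (fun τ => φ (c τ).1 (c τ).2) τ =
      fderiv ℝ (fun p : ℝ × ℝ × ℝ => φ p.1 p.2) (c τ) c' :=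
  (h.hasDerivWithinAt_comp hc.hasDerivWithinAt).hasDerivAt univ_mem |>.deriv

theorem dt_eq (h : IsTestOn T S R φ) (t : ℝ) (x : ℝ × ℝ) :
    dt φ t x = fderiv ℝ (fun p : ℝ × ℝ × ℝ => φ p.1 p.2) (t, x) (1, 0) :=
  h.deriv_comp ((hasDerivAt_id' t).prodMk (hasDerivAt_const t x))

theorem dx2_eq (h : IsTestOn T S R φ) (t : ℝ) (x : ℝ × ℝ) :
    dx2 (φ t) x = fderiv ℝ (fun p : ℝ × ℝ × ℝ => φ p.1 p.2) (t, x) (0, 0, 1) :=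
  h.deriv_comp
    ((hasDerivAt_const x.2 t).prodMk ((hasDerivAt_const x.2 x.1).prodMk (hasDerivAt_id' x.2)))

theorem continuous_fderiv (h : IsTestOn T S R φ) (v : ℝ × ℝ × ℝ) :
    Continuous fun p => fderiv ℝ (fun p : ℝ × ℝ × ℝ => φ p.1 p.2) p v :=
  (h.smooth.continuous_fderiv (by simp)).clm_apply continuous_const

theorem continuous_dt (h : IsTestOn T S R φ) :
    Continuous fun p : ℝ × ℝ × ℝ => dt φ p.1 p.2 := by
  simpa only [h.dt_eq] using h.continuous_fderiv _

theorem continuous_dx1 (h : IsTestOn T S R φ) :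
    Continuous fun p : ℝ × ℝ × ℝ => dx1 (φ p.1) p.2 :=
  (h.continuous_fderiv (0, 1, 0)).congr fun p => (h.deriv_comp ((hasDerivAt_const p.2.1 p.1).prodMk
    ((hasDerivAt_id' p.2.1).prodMk (hasDerivAt_const p.2.1 p.2.2)))).symm

theorem continuous_dx2 (h : IsTestOn T S R φ) :
    Continuous fun p : ℝ × ℝ × ℝ => dx2 (φ p.1) p.2 := by
  simpa only [h.dx2_eq] using h.continuous_fderiv _

theorem hasDerivWithinAt_graph (h : IsTestOn T S R φ) {c : ℝ → ℝ} {c' t a : ℝ} {s : Set ℝ}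
    (hc : HasDerivWithinAt c c' s t) : HasDerivWithinAt (fun τ => φ τ (a, c τ))
      (dt φ t (a, c t) + c' * dx2 (φ t) (a, c t)) s t := by
  refine (h.hasDerivWithinAt_comp ((hasDerivWithinAt_id t s).prodMk
    ((hasDerivWithinAt_const t s a).prodMk hc))).congr_deriv ?_
  rw [h.dt_eq, h.dx2_eq, ← smul_eq_mul c', ← map_smul, ← map_add]
  simp

theorem isSpaceTest (h : IsTestOn T S R φ) {t : ℝ} (ht : 0 ≤ t) : IsSpaceTest R (φ t) :=
  ⟨h.smooth.comp (contDiff_prodMk_right t), h.periodic t, fun x hx => h.zero_far t x ht hx⟩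

theorem dt_eq_zero {x : ℝ × ℝ} {s t : ℝ} (ht : s < t) (h : ∀ τ, s < τ → φ τ x = 0) : dt φ t x =
    0 := by
  have : (fun τ => φ τ x) =ᶠ[𝓝 t] fun _ => 0 := eventually_of_mem (Ioi_mem_nhds ht) h
  rw [dt, this.deriv_eq, deriv_const]

theorem dt_far (h : IsTestOn T S R φ) {t : ℝ} (ht : 0 < t) {x : ℝ × ℝ} (hx : R < |x.2|) :
    dt φ t x = 0 :=
  dt_eq_zero ht fun s hs => h.zero_far s x hs.le hx

theorem dt_late (h : IsTestOn T S R φ) {t : ℝ} (ht : S < t) (x : ℝ × ℝ) : dt φ t x = 0 :=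
  dt_eq_zero ht fun s hs => h.zero_late s x hs.le

theorem dx_late (h : IsTestOn T S R φ) {t : ℝ} (ht : S < t) (x : ℝ × ℝ) :
    dx1 (φ t) x = 0 ∧ dx2 (φ t) x = 0 := by
  have := funext fun x => h.zero_late t x ht.le
  simp [dx1, dx2, this]

theorem integral_Ioo_eq (h : IsTestOn T S R φ) {F : ℝ → ℝ} (hF : ∀ t, S < t → F t = 0) :
    ∫ t in Ioo 0 T, F t = ∫ t in Ioc 0 S, F t := by
  refine setIntegral_eq_of_subset_of_forall_sdiff_eq_zero measurableSet_Ioo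
    (fun t ht => ⟨ht.1, ht.2.trans_lt h.S_lt⟩) fun t ht => hF t ?_
  by_contra hle
  exact ht.2 ⟨ht.1.1, not_lt.1 hle⟩

end IsTestOn

theorem integral_dx2_eq_zero {R : ℝ} {φ : ℝ × ℝ → ℝ} (hφ : IsSpaceTest R φ) (a : ℝ) :
    ∫ b, dx2 φ (a, b) = 0 := by
  have hi : ∀ {ψ : ℝ × ℝ → ℝ}, IsSpaceTest R ψ → Integrable fun b => ψ (a, b) := fun {ψ} hψ => by
    refine (hψ.smooth.continuous.comp (Continuous.prodMk_right a)).integrable_of_hasCompactSupport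
      (HasCompactSupport.intro (isCompact_Icc (a := -R) (b := R)) fun b hb => hψ.support _ ?_)
    by_contra hle
    exact hb (abs_le.1 (not_lt.1 hle))
  exact integral_eq_zero_of_hasDerivAt_of_integrable
    (fun b => ((HasPartials.of_contDiff hφ.smooth).1).snd (a, b)) (hi hφ.dx2) (hi hφ)

theorem integral_Ioi_dx2 {R Y D : ℝ} {φ : ℝ × ℝ → ℝ} (hφ : IsSpaceTest R φ) (hD : 0 ≤ D)
    (hY : R < Y + D) (a : ℝ) : ∫ s in Ioc 0 D, dx2 φ (a, Y + s) = -φ (a, Y) := by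
  have hP := (HasPartials.of_contDiff hφ.smooth).1
  rw [← intervalIntegral.integral_of_le hD, intervalIntegral.integral_eq_sub_of_hasDerivAt
    (f := fun s => φ (a, Y + s)), hφ.support (a, Y + D) (hY.trans_le (le_abs_self _)), add_zero,
    zero_sub]
  · exact fun s _ => (hP.snd (a, Y + s)).comp_const_add Y s
  · exact (hP.cont_snd.comp (by fun_prop : Continuous fun s => (a, Y + s))).intervalIntegrable _ _

namespace LevelFlow

variable {γ₀ : ℝ → ℝ} (Λ : LevelFlow γ₀)

theorem measurableSet_superlevel {t : ℝ} (ht : t ∈ Ioo 0 Λ.T) (h : ℝ) :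
    MeasurableSet {x | h < Λ.ρ t x} :=
  measurableSet_lt measurable_const (Λ.continuous_ρ ht).measurable

theorem zero_mem : (0 : ℝ) ∈ Ico 0 Λ.T := ⟨le_rfl, Λ.T_pos⟩

theorem hasDerivAt_init (Λ : LevelFlow γ₀) (x : ℝ) : HasDerivAt γ₀ (deriv γ₀ x) x := by
  have := Λ.deriv_x 0 Λ.zero_mem x 0 (by norm_num)
  simp only [Λ.init] at this
  exact this.differentiableAt.hasDerivAt

theorem continuous_init (Λ : LevelFlow γ₀) : Continuous γ₀ :=
  continuous_iff_continuousAt.2 fun x => (Λ.hasDerivAt_init x).continuousAt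

theorem integral_superlevel {t : ℝ} (ht : t ∈ Ioo 0 Λ.T) {h : ℝ} (hh : h ∈ Ico (-1 : ℝ) 1)
    {F : ℝ × ℝ → ℝ} (hF : IntegrableOn F strip) :
    ∫ x in strip ∩ {x | h < Λ.ρ t x}, F x =
      ∫ a in Ioc (-π) π, ∫ b in Ioi (Λ.g t a h), F (a, b) := by
  have hm := Λ.measurableSet_superlevel ht h
  rw [← setIntegral_indicator hm, integral_strip (Integrable.indicator hF hm)]
  refine setIntegral_congr_fun measurableSet_Ioc fun a _ => ?_
  rw [← integral_indicator measurableSet_Ioi]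
  congr 1
  ext b
  simp only [indicator_apply, mem_ofPred_eq, mem_Ioi, Λ.lt_ρ_iff (Ioo_subset_Ico_self ht) hh]

/-- The derivative of `φ` along the flow of `v`. -/
def material (φ : ℝ → ℝ × ℝ → ℝ) (t : ℝ) (x : ℝ × ℝ) : ℝ :=
  dt φ t x + ((Λ.v t x).1 * dx1 (φ t) x + (Λ.v t x).2 * dx2 (φ t) x)

variable {S R : ℝ} {φ : ℝ → ℝ × ℝ → ℝ}

theorem superlevel_slice (hφ : IsTestOn Λ.T S R φ) {t : ℝ} (ht : t ∈ Ioo 0 Λ.T) {h : ℝ}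
    (hh : h ∈ Ico (-1 : ℝ) 1) :
    ∫ x in strip, {x | h < Λ.ρ t x}.indicator (fun x => Λ.material φ t x + 2 * h * dx2 (φ t) x) x =
      ∫ a in Ioc (-π) π, ∫ s in Ioc 0 (R + |Λ.R| + 1), (dt φ t (a, Λ.g t a h + s)
        + Λ.f t a h * dx2 (φ t) (a, Λ.g t a h + s)) := by
  have hI := Ioo_subset_Ico_self ht
  have hhc := Ico_subset_Icc_self hh
  have hh2 := mem_Ioo_of_Icc hhc
  have hs := hφ.isSpaceTest ht.1.le
  set D := R + |Λ.R| + 1 with hD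
  have hD0 : 0 ≤ D := by have := hφ.R_nonneg; positivity
  have hgD : ∀ a, R < Λ.g t a h + D := fun a => by
    linarith [le_abs_self Λ.R, (abs_le.1 (Λ.abs_g_le t hI a h hh2)).1]
  have hct :=
    hφ.continuous_dt.comp (by fun_prop : Continuous fun x => (t, x))
  have i1 : IntegrableOn (dt φ t) strip :=
    integrableOn_strip_of_continuous hct fun x hx => hφ.dt_far ht.1 hx
  have i2 := hs.integrableOn_grad (Λ.continuous_v ht).fst (Λ.continuous_v ht).snd
  have i3 : IntegrableOn (fun x => 2 * h * dx2 (φ t) x) strip :=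
    (integrableOn_strip_of_continuous hs.dx2.smooth.continuous hs.dx2.support).const_mul _
  have j : ∀ {F : ℝ × ℝ → ℝ}, IntegrableOn F strip →
      IntegrableOn F (strip ∩ {x | h < Λ.ρ t x}) := fun hF => hF.mono_set inter_subset_left
  have hcg :=
    continuous_iff_continuousAt.2 fun a => (Λ.deriv_x t hI a h hh2).continuousAt
  have hcf :=
    continuous_iff_continuousAt.2 fun a => (Λ.deriv_fx t hI a h hh2).continuousAt
  have iI : ∀ {F : ℝ → ℝ} {a b}, Continuous F → IntegrableOn F (Ioc a b) := fun hF =>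
    hF.continuousOn.integrableOn_Icc.mono_set Ioc_subset_Icc_self
  have e1 : ∀ a, ∫ b in Ioi (Λ.g t a h), dt φ t (a, b) =
      ∫ s in Ioc 0 D, dt φ t (a, Λ.g t a h + s) := fun a => by
    rw [← intervalIntegral.integral_of_le hD0]
    exact integral_Ioi_eq_of_support
      (fun s hs => hφ.dt_far ht.1 hs) hD0 (hgD a).le
  have e3 : ∀ a, ∫ b in Ioi (Λ.g t a h), 2 * h * dx2 (φ t) (a, b) = -(2 * h * φ t (a, Λ.g t a h)) :=
    fun a => by
    rw [integral_const_mul, integral_Ioi_eq_of_support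
      (fun s hs' => hs.dx2.support (a, s) hs') hD0 (hgD a).le, intervalIntegral.integral_of_le hD0,
      integral_Ioi_dx2 hs hD0 (hgD a) a]
    ring
  simp only [material]
  rw [setIntegral_indicator (Λ.measurableSet_superlevel ht h),
    integral_add (Integrable.fun_add (j i1) (j i2)) (j i3), integral_add (j i1) (j i2),
    Λ.integral_superlevel ht hh i1, Λ.integral_superlevel ht hh i2,
    Λ.integral_superlevel ht hh i3, Λ.flux_slice ht hs hhc]
  simp only [e1, e3]
  rw [← integral_neg]
  have := hs.smooth.continuous
  have := hs.dx2.smooth.continuous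
  have k1 : IntegrableOn (fun a => ∫ s in Ioc 0 D, dt φ t (a, Λ.g t a h + s)) (Ioc (-π) π) := iI (by
    simp only [← intervalIntegral.integral_of_le hD0]
    exact intervalIntegral.continuous_parametric_intervalIntegral_of_continuous' (by fun_prop) _ _)
  have k2 : IntegrableOn (fun a => -(φ t (a, Λ.g t a h) * (Λ.f t a h - 2 * h))) (Ioc (-π) π) :=
    iI (by fun_prop)
  rw [← integral_add k1 k2, ← integral_add (Integrable.fun_add k1 k2) (iI (by fun_prop))]
  refine setIntegral_congr_fun measurableSet_Ioc fun a _ => ?_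
  rw [integral_add (iI (by fun_prop)) (iI (by fun_prop)), integral_const_mul,
    integral_Ioi_dx2 hs hD0 (hgD a) a]
  ring

/-- The region above a level curve is transported. -/
theorem superlevel_balance (hφ : IsTestOn Λ.T S R φ) {h : ℝ} (hh : h ∈ Ico (-1 : ℝ) 1) :
    ∫ t in Ioo 0 Λ.T, ∫ x in strip, {x | h < Λ.ρ t x}.indicator (fun x =>
      Λ.material φ t x + 2 * h * dx2 (φ t) x) x =
      -∫ x in strip, {x | γ₀ x.1 < x.2}.indicator (φ 0) x := by
  have hh2 := mem_Ioo_of_Icc (Ico_subset_Icc_self hh)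
  have hs0 := hφ.isSpaceTest le_rfl
  set D := R + |Λ.R| + 1 with hD
  have hD0 : 0 ≤ D := by have := hφ.R_nonneg; positivity
  have hγ := Λ.continuous_init
  rw [hφ.integral_Ioo_eq fun t ht => by simp [material, hφ.dt_late ht, hφ.dx_late ht]]
  have hmap : MapsTo (fun p : ℝ × ℝ × ℝ => (p.1, p.2.1, h)) (Icc 0 S ×ˢ univ) (flowDom Λ.T) :=
    fun p hp => ⟨⟨hp.1.1, hp.1.2.trans_lt hφ.S_lt⟩, mem_univ _, hh2⟩
  have cg :=
    Λ.cont_g.comp (by fun_prop : Continuous fun p : ℝ × ℝ × ℝ => (p.1, p.2.1, h)).continuousOn hmap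
  have cf :=
    Λ.cont_f.comp (by fun_prop : Continuous fun p : ℝ × ℝ × ℝ => (p.1, p.2.1, h)).continuousOn hmap
  have cm : ContinuousOn (fun p : ℝ × ℝ × ℝ => (p.1, p.2.1, Λ.g p.1 p.2.1 h + p.2.2))
      (Icc 0 S ×ˢ univ) := by fun_prop
  have e2 := integral_time_deriv (a := -π) (b := π) (c := 0) (d := D) hφ.S_pos.le

    ((hφ.continuous_dt.comp_continuousOn cm).add (cf.mul (hφ.continuous_dx2.comp_continuousOn cm)))
    (fun t ht q => hφ.hasDerivWithinAt_graph
      ((Λ.deriv_t t ⟨ht.1, ht.2.trans_lt hφ.S_lt⟩ q.1 h hh2).add_const q.2))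
    (by
      simp only [Λ.init]
      exact hs0.smooth.continuous.comp (by fun_prop))
    (fun q => hφ.zero_late _ _ le_rfl)
  rw [(setIntegral_congr_fun measurableSet_Ioc fun t ht => Λ.superlevel_slice hφ
    ⟨ht.1, ht.2.trans_lt hφ.S_lt⟩ hh), e2]
  congr 1
  have hi : IntegrableOn ({x : ℝ × ℝ | γ₀ x.1 < x.2}.indicator (φ 0)) strip :=
    Integrable.indicator (integrableOn_strip_of_continuous hs0.smooth.continuous hs0.support)
      (measurableSet_lt (by fun_prop) (by fun_prop))
  rw [integral_strip hi]
  refine setIntegral_congr_fun measurableSet_Ioc fun a _ => ?_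
  simp only [Λ.init]
  have hg : R ≤ γ₀ a + D := by
    linarith [le_abs_self Λ.R, (abs_le.1 (Λ.abs_g_le 0 Λ.zero_mem a h hh2)).1, Λ.init a h]
  rw [← intervalIntegral.integral_of_le hD0, ← integral_Ioi_eq_of_support
    (fun s hs => hs0.support (a, s) hs) hD0 hg,
    ← integral_indicator measurableSet_Ioi]
  rfl

theorem total_balance (hφ : IsTestOn Λ.T S R φ) :
    ∫ t in Ioo 0 Λ.T, ∫ x in strip, Λ.material φ t x = -∫ x in strip, φ 0 x := by
  have hs0 := hφ.isSpaceTest le_rfl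
  have cut : ∀ {F : ℝ × ℝ → ℝ}, Continuous F → (∀ x, R < |x.2| → F x = 0) →
      ∫ x in strip, F x = ∫ a in Ioc (-π) π, ∫ s in Ioc (-(R + 1)) R, F (a, s) := by
    intro F hF hs
    rw [integral_strip (integrableOn_strip_of_continuous hF hs)]
    refine setIntegral_congr_fun measurableSet_Ioc fun a _ =>
      (setIntegral_eq_integral_of_forall_compl_eq_zero fun b hb => hs _ ?_).symm
    by_contra hle
    have := abs_le.1 (not_lt.1 hle)
    exact hb ⟨by linarith, this.2⟩
  rw [hφ.integral_Ioo_eq fun t ht => by simp [material, hφ.dt_late ht, hφ.dx_late ht]]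
  have e1 : ∫ t in Ioc 0 S, ∫ x in strip, Λ.material φ t x =
      ∫ t in Ioc 0 S, ∫ a in Ioc (-π) π, ∫ s in Ioc (-(R + 1)) R, dt φ t (a, s) := by
    refine setIntegral_congr_fun measurableSet_Ioc fun t ht => ?_
    have htT : t ∈ Ioo 0 Λ.T := ⟨ht.1, ht.2.trans_lt hφ.S_lt⟩
    have hs := hφ.isSpaceTest ht.1.le
    have hct : Continuous (dt φ t) :=
      hφ.continuous_dt.comp (by fun_prop : Continuous fun x => (t, x))
    simp only [material]
    rw [integral_add (integrableOn_strip_of_continuous hct fun x hx => hφ.dt_far ht.1 hx)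
      (hs.integrableOn_grad (Λ.continuous_v htT).fst (Λ.continuous_v htT).snd),
      Λ.incompressible_slice htT hs, add_zero]
    exact cut hct fun x hx => hφ.dt_far ht.1 hx
  have e2 := integral_time_deriv (a := -π) (b := π) (c := -(R + 1)) (d := R) hφ.S_pos.le
    hφ.continuous_dt.continuousOn
    (fun t _ q => by
      simpa using (hφ.hasDerivWithinAt_graph (a := q.1) (hasDerivWithinAt_const t (Ici 0) q.2)))
    hs0.smooth.continuous (fun q => hφ.zero_late _ _ le_rfl)
  rw [e1, e2, cut hs0.smooth.continuous hs0.support]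

theorem vertical_balance (hφ : IsTestOn Λ.T S R φ) :
    ∫ t in Ioo 0 Λ.T, ∫ x in strip, dx2 (φ t) x = 0 := by
  refine (setIntegral_congr_fun (g := fun _ => 0) measurableSet_Ioo fun t ht => ?_).trans (by simp)
  have hs := hφ.isSpaceTest ht.1.le
  rw [integral_strip (integrableOn_strip_of_continuous hs.dx2.smooth.continuous hs.dx2.support)]
  simp [integral_dx2_eq_zero hs]

end LevelFlow

theorem abs_deriv_le_of_lipschitzOn {η : ℝ → ℝ} {L : ℝ≥0} (hη : LipschitzOnWith L η (Icc (-1) 1))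
    {h : ℝ} (hh : h ∈ Ioo (-1 : ℝ) 1) : |deriv η h| ≤ L :=
  norm_deriv_le_of_lipschitzOn (Icc_mem_nhds hh.1 hh.2) hη

theorem integrableOn_deriv_mul {η : ℝ → ℝ} {L : ℝ≥0} (hη : LipschitzOnWith L η (Icc (-1) 1))
    {w : ℝ → ℝ} (hw : Continuous w) : IntegrableOn (fun s => deriv η s * w s) (Icc (-1) 1) := by
  obtain ⟨C, hC⟩ := isCompact_Icc.exists_bound_of_continuousOn
    (hw.continuousOn (s := Icc (-1 : ℝ) 1))
  rw [integrableOn_Icc_iff_integrableOn_Ioo]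
  refine Measure.integrableOn_of_bounded (M := L * C) (by simp)
    ((measurable_deriv η).mul hw.measurable).aestronglyMeasurable ?_
  filter_upwards [ae_restrict_mem measurableSet_Ioo] with h hh
  rw [norm_mul]
  exact mul_le_mul (abs_deriv_le_of_lipschitzOn hη hh) (hC h (Ioo_subset_Icc_self hh))
    (norm_nonneg _) L.2

/-- The entropy and its flux as superpositions of elementary ones. -/
theorem entropy_layer_cake {η : ℝ → ℝ} {L : ℝ≥0} (hη : LipschitzOnWith L η (Icc (-1) 1))
    {r : ℝ} (hr : r ∈ Icc (-1 : ℝ) 1) (b d : ℝ) :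
    η r * b + entropyFlux η r * d = η (-1) * b + entropyFlux η (-1) * d
      + ∫ h in Ioc (-1 : ℝ) 1, (Iio r).indicator (fun h => deriv η h * (b + 2 * h * d)) h := by
  have hI : ∀ {w : ℝ → ℝ}, Continuous w → ∀ {x y : ℝ}, x ∈ Icc (-1 : ℝ) 1 → y ∈ Icc (-1 : ℝ) 1 →
      IntervalIntegrable (fun s => deriv η s * w s) volume x y := fun hw x y hx hy =>
    ((integrableOn_deriv_mul hη hw).mono_set (uIcc_subset_Icc hx hy)).intervalIntegrable
  have hm1 : (-1) ∈ Icc (-1 : ℝ) 1 := by norm_num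
  have h0 : 0 ∈ Icc (-1 : ℝ) 1 := by norm_num
  have e1 : Ioc (-1) 1 ∩ Iio r = Ioo (-1) r := by ext h; grind
  have e2 :=
    (hη.mono (uIcc_subset_Icc hm1 hr)).absolutelyContinuousOnInterval.integral_deriv_eq_sub
  have e3 : entropyFlux η r - entropyFlux η (-1) = ∫ s in (-1)..r, deriv η s * (2 * s) := by
    have : ∀ u, entropyFlux η u = ∫ s in (0 : ℝ)..u, deriv η s * (2 * s) := fun u => by
      rw [entropyFlux]; congr 1; ext s; ring
    rw [this, this, intervalIntegral.integral_interval_sub_left (hI (by fun_prop) h0 hr)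
      (hI (by fun_prop) h0 hm1)]
  rw [setIntegral_indicator measurableSet_Iio, e1, ← integral_Ioc_eq_integral_Ioo,
    ← intervalIntegral.integral_of_le hr.1]
  have e4 : ∫ s in (-1)..r, deriv η s * (b + 2 * s * d) =
      (∫ s in (-1)..r, deriv η s) * b + (∫ s in (-1)..r, deriv η s * (2 * s)) * d := by
    rw [← intervalIntegral.integral_mul_const, ← intervalIntegral.integral_mul_const,
      ← intervalIntegral.integral_add (hI continuous_const hm1 hr)
        ((hI (by fun_prop) hm1 hr).mul_const d)]
    congr 1; ext s; ring
  rw [e4, e2, ← e3]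
  ring

theorem integral_entropy_layer_cake {α : Type*} [MeasurableSpace α] {μ : Measure α} [SFinite μ]
    {η : ℝ → ℝ} {L : ℝ≥0} (hη : LipschitzOnWith L η (Icc (-1) 1)) {r B D : α → ℝ}
    (hrm : AEMeasurable r μ) (hr : ∀ p, r p ∈ Icc (-1 : ℝ) 1) (hB : Integrable B μ)
    (hD : Integrable D μ) :
    Integrable (fun p => η (r p) * B p + entropyFlux η (r p) * D p) μ ∧
    ∫ p, (η (r p) * B p + entropyFlux η (r p) * D p) ∂μ =
      η (-1) * ∫ p, B p ∂μ + entropyFlux η (-1) * ∫ p, D p ∂μ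
      + ∫ h in Ioc (-1 : ℝ) 1,
        deriv η h * ∫ p, {p | h < r p}.indicator (fun p => B p + 2 * h * D p) p ∂μ := by
  set F : α → ℝ → ℝ := fun p h =>
    (Iio (r p)).indicator (fun h => deriv η h * (B p + 2 * h * D p)) h with hF
  set ν := μ.prod (volume.restrict (Ioc (-1 : ℝ) 1))
  have hi : Integrable (fun q => F q.1 q.2) ν := by
    refine (((hB.abs.add (hD.abs.const_mul 2)).const_mul (L : ℝ)).comp_fst _).mono'
      ((((measurable_deriv η).comp measurable_snd).aestronglyMeasurable.mul
      (hB.1.comp_fst.add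
      ((measurable_snd.const_mul 2).aestronglyMeasurable.mul hD.1.comp_fst))).indicator₀
      (nullMeasurableSet_lt measurable_snd.aemeasurable hrm.comp_fst)) ?_
    have hae : ∀ᵐ q : α × ℝ ∂ν, q.2 ∈ Ioo (-1) 1 := by
      refine Measure.quasiMeasurePreserving_snd.ae ?_
      rw [← Measure.restrict_congr_set Ioo_ae_eq_Ioc]
      exact ae_restrict_mem measurableSet_Ioo
    filter_upwards [hae] with q hq
    refine (norm_indicator_le_norm_self _ _).trans ?_
    rw [norm_mul]
    refine mul_le_mul (abs_deriv_le_of_lipschitzOn hη hq)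
      ((abs_add_le _ _).trans (add_le_add le_rfl ?_)) (norm_nonneg _) L.2
    rw [abs_mul, abs_mul, abs_two]
    have := abs_le.2 ⟨hq.1.le, hq.2.le⟩
    nlinarith [abs_nonneg (D q.1)]
  have e :=
    funext fun p => entropy_layer_cake hη (hr p) (B p) (D p)
  have i1 : Integrable (fun p => η (-1) * B p) μ := hB.const_mul _
  have i2 : Integrable (fun p => entropyFlux η (-1) * D p) μ := hD.const_mul _
  have i12 : Integrable (fun p => η (-1) * B p + entropyFlux η (-1) * D p) μ := i1.add i2
  have i3 := hi.integral_prod_left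
  rw [e]
  refine ⟨i12.add i3, ?_⟩
  rw [integral_add i12 i3, integral_add i1 i2, integral_const_mul, integral_const_mul,
    integral_integral_swap hi]
  congr 2
  ext h
  rw [← integral_const_mul]
  congr 1
  ext p
  by_cases hp : h < r p <;> simp [hF, hp]

namespace LevelFlow

variable {γ₀ : ℝ → ℝ} (Λ : LevelFlow γ₀)

/-- Lebesgue measure on one period of space-time. -/
def spaceTime : Measure (ℝ × ℝ × ℝ) := (volume.restrict (Ioo 0 Λ.T)).prod (volume.restrict strip)

theorem aestronglyMeasurable_of_offInterface {E : Type*} [TopologicalSpace E]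
    [TopologicalSpace.PseudoMetrizableSpace E] [SecondCountableTopology E]
    {F : ℝ × ℝ × ℝ → E} (hF : ContinuousOn F Λ.offInterface) :
    AEStronglyMeasurable F Λ.spaceTime := by
  rw [spaceTime, Measure.prod_restrict]
  borelize E
  exact ((hF.mono fun p hp => Λ.mem_offInterface hp.1 p.2).aemeasurable
    (measurableSet_Ioo.prod (measurableSet_Ioc.prod MeasurableSet.univ))).aestronglyMeasurable

theorem ae_spaceTime : ∀ᵐ p ∂Λ.spaceTime, p.1 ∈ Ioo 0 Λ.T := by
  rw [spaceTime, Measure.prod_restrict]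
  filter_upwards [ae_restrict_mem (measurableSet_Ioo.prod
    (measurableSet_Ioc.prod MeasurableSet.univ))] with p hp using hp.1

instance : SFinite Λ.spaceTime := by rw [spaceTime]; infer_instance

theorem integrable_dx2 {S R : ℝ} {φ : ℝ → ℝ × ℝ → ℝ} (hφ : IsTestOn Λ.T S R φ) :
    Integrable (fun p : ℝ × ℝ × ℝ => dx2 (φ p.1) p.2) Λ.spaceTime :=
  integrableOn_spaceTime hφ.continuous_dx2 fun _ ht x hx => (hφ.isSpaceTest ht.1.le).dx2.support x
    hx

theorem integrable_material {S R : ℝ} {φ : ℝ → ℝ × ℝ → ℝ} (hφ : IsTestOn Λ.T S R φ) :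
    Integrable (fun p : ℝ × ℝ × ℝ => Λ.material φ p.1 p.2) Λ.spaceTime := by
  obtain ⟨C, hC⟩ := Λ.exists_v_bound'
  have hv := Λ.aestronglyMeasurable_of_offInterface Λ.continuousOn_v
  refine (integrableOn_spaceTime hφ.continuous_dt fun t ht x hx => hφ.dt_far ht.1 hx).add
    (((integrableOn_spaceTime hφ.continuous_dx1 fun t ht x hx =>
    (hφ.isSpaceTest ht.1.le).dx1.support x hx).bdd_mul (c := C)
    (continuous_fst.comp_aestronglyMeasurable hv) ?_).add
    ((Λ.integrable_dx2 hφ).bdd_mul (c := C) (continuous_snd.comp_aestronglyMeasurable hv) ?_))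
  · filter_upwards [Λ.ae_spaceTime] with p hp using (hC p.1 hp p.2).1
  · filter_upwards [Λ.ae_spaceTime] with p hp using (hC p.1 hp p.2).2

/-- The entropy balance holds with equality. -/
theorem entropy_balance {η : ℝ → ℝ} {L : ℝ≥0} (hη : LipschitzOnWith L η (Icc (-1) 1))
    {φ : ℝ → ℝ × ℝ → ℝ} (hφ : IsTest Λ.T φ) :
    entropyForm Λ.T (twoPhase γ₀) Λ.ρ Λ.v η φ = 0 := by
  obtain ⟨S, R, hφ⟩ := hφ.exists_isTestOn Λ.T_pos
  have hs0 := hφ.isSpaceTest le_rfl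
  have hrm :=
    (Λ.aestronglyMeasurable_of_offInterface Λ.continuousOn_ρ).aemeasurable
  have hB := Λ.integrable_material hφ
  have hD := Λ.integrable_dx2 hφ
  obtain ⟨hi, hI⟩ := integral_entropy_layer_cake hη hrm (fun p => Λ.ρ_mem p.1 p.2) hB hD
  have e1 : ∫ t in Ioo 0 Λ.T, ∫ x in strip, (η (Λ.ρ t x) * dt φ t x
        + η (Λ.ρ t x) * (Λ.v t x).1 * dx1 (φ t) x
        + (η (Λ.ρ t x) * (Λ.v t x).2 + entropyFlux η (Λ.ρ t x)) * dx2 (φ t) x) =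
      ∫ p, (η (Λ.ρ p.1 p.2) * Λ.material φ p.1 p.2 + entropyFlux η (Λ.ρ p.1 p.2) * dx2 (φ p.1) p.2)
        ∂Λ.spaceTime := by
    refine Eq.trans ?_ (integral_prod _ hi).symm
    congr 1; ext t; congr 1; ext x; simp only [material]; ring
  have e2 : ∫ p, Λ.material φ p.1 p.2 ∂Λ.spaceTime = -∫ x in strip, φ 0 x :=
    (integral_prod _ hB).trans (Λ.total_balance hφ)
  have e3 : ∫ p, dx2 (φ p.1) p.2 ∂Λ.spaceTime = 0 :=
    (integral_prod _ hD).trans (Λ.vertical_balance hφ)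
  set c := ∫ x in strip, {x | γ₀ x.1 < x.2}.indicator (φ 0) x with hc
  have e4 : ∀ h ∈ Ico (-1) 1, ∫ p, {p : ℝ × ℝ × ℝ | h < Λ.ρ p.1 p.2}.indicator
      (fun p => Λ.material φ p.1 p.2 + 2 * h * dx2 (φ p.1) p.2) p ∂Λ.spaceTime = -c := by
    intro h hh
    exact (integral_prod _
      ((hB.add (hD.const_mul (2 * h))).indicator₀
      (nullMeasurableSet_lt aemeasurable_const hrm))).trans (Λ.superlevel_balance hφ hh)
  have e5 : ∫ h in Ioc (-1) 1, deriv η h * ∫ p, {p : ℝ × ℝ × ℝ | h < Λ.ρ p.1 p.2}.indicator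
      (fun p => Λ.material φ p.1 p.2 + 2 * h * dx2 (φ p.1) p.2) p ∂Λ.spaceTime =
      (η 1 - η (-1)) * -c := by
    have hη' : LipschitzOnWith L η (uIcc (-1) 1) := by rwa [uIcc_of_le (by norm_num)]
    rw [← hη'.absolutelyContinuousOnInterval.integral_deriv_eq_sub,
      intervalIntegral.integral_of_le (by norm_num), ← integral_mul_const,
      integral_Ioc_eq_integral_Ioo, integral_Ioc_eq_integral_Ioo]
    refine setIntegral_congr_fun measurableSet_Ioo fun h hh => ?_
    simp only [e4 h (Ioo_subset_Ico_self hh)]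
  have e6 : ∫ x in strip, η (twoPhase γ₀ x) * φ 0 x =
      η (-1) * (∫ x in strip, φ 0 x) + (η 1 - η (-1)) * c := by
    have hγ := Λ.continuous_init
    have j0 :=
      integrableOn_strip_of_continuous hs0.smooth.continuous hs0.support
    rw [hc, ← integral_const_mul, ← integral_const_mul, ← integral_add (j0.const_mul _)
      ((Integrable.indicator j0 (measurableSet_lt (by fun_prop) (by fun_prop))).const_mul _)]
    congr 1
    ext x
    by_cases hx : γ₀ x.1 < x.2 <;> simp [twoPhase, hx]
    ring
  rw [entropyForm, e1, hI, e2, e3, e5, e6]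
  ring

end LevelFlow

theorem entropyFlux_id (u : ℝ) : entropyFlux (fun s => s) u = u ^ 2 := by
  simp only [entropyFlux, deriv_id'']
  rw [intervalIntegral.integral_const_mul, integral_id]
  ring

theorem memLp_exp_neg_abs (C : ℝ) :
    MemLp (fun x : ℝ × ℝ => C * exp (-|x.2|)) 2 (volume.restrict strip) := by
  have hc : Continuous fun x : ℝ × ℝ => C * exp (-|x.2|) := by fun_prop
  rw [memLp_two_iff_integrable_sq hc.aestronglyMeasurable, strip, Measure.volume_eq_prod,
    ← Measure.prod_restrict, Measure.restrict_univ]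
  have h1 : Integrable fun b => exp (-|b|) := by
    rw [← integrableOn_univ, ← Iic_union_Ioi]
    refine IntegrableOn.union ?_ ?_
    · refine (integrableOn_exp_Iic 0).congr_fun (fun b hb => ?_) measurableSet_Iic
      simp only [abs_of_nonpos (mem_Iic.1 hb), neg_neg]
    · refine (integrableOn_exp_neg_Ioi 0).congr_fun (fun b hb => ?_) measurableSet_Ioi
      simp only [abs_of_pos (mem_Ioi.1 hb)]
  have h2 : Integrable fun b => (C * exp (-|b|)) ^ 2 := by
    refine (h1.const_mul (C ^ 2)).mono' (Continuous.aestronglyMeasurable (by fun_prop))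
      (ae_of_all _ fun b => ?_)
    rw [norm_of_nonneg (sq_nonneg _), mul_pow]
    refine mul_le_mul_of_nonneg_left ?_ (sq_nonneg C)
    exact pow_le_of_le_one (exp_pos _).le (exp_le_one_iff.2 (by simp)) two_ne_zero
  exact h2.comp_snd _

namespace LevelFlow

variable {γ₀ : ℝ → ℝ} (Λ : LevelFlow γ₀)

theorem isWeakSolution : IsWeakSolution Λ.T (twoPhase γ₀) Λ.ρ Λ.v where
  periodic_density _ ht := Λ.periodic_ρ ht
  periodic_velocity _ ht := Λ.periodic_v ht
  density_mem := memLp_top_of_bound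
    (Λ.aestronglyMeasurable_of_offInterface Λ.continuousOn_ρ) 1
    (ae_of_all _ fun p => Λ.abs_ρ_le p.1 p.2)
  velocity_measurable := Λ.aestronglyMeasurable_of_offInterface Λ.continuousOn_v
  velocity_bound := by
    obtain ⟨C, -, hC⟩ := Λ.exists_v_bound
    refine ⟨(eLpNorm (fun x => C * exp (-|x.2|)) 2 (volume.restrict strip)).toNNReal, ?_⟩
    filter_upwards [ae_restrict_mem measurableSet_Ioo] with t ht
    rw [ENNReal.coe_toNNReal (memLp_exp_neg_abs C).2.ne]
    exact eLpNorm_mono_real fun x => max_le (hC t ht x).1 (hC t ht x).2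
  mass φ hφ := by
    have h := Λ.entropy_balance (η := fun s => s) LipschitzWith.id.lipschitzOnWith hφ
    simpa only [entropyForm, entropyFlux_id] using h
  incompressible φ hφ := by
    obtain ⟨S, R, hφ⟩ := hφ.exists_isTestOn Λ.T_pos
    exact (setIntegral_congr_fun (g := fun _ => 0) measurableSet_Ioo fun t ht =>
      (Λ.incompressible_slice ht (hφ.isSpaceTest ht.1.le))).trans (by simp)
  darcy φ hφ := by
    obtain ⟨S, R, hφ⟩ := hφ.exists_isTestOn Λ.T_pos
    exact (setIntegral_congr_fun (g := fun _ => 0) measurableSet_Ioo fun t ht =>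
      (Λ.darcy_slice ht (hφ.isSpaceTest ht.1.le))).trans (by simp)

theorem isEntropySolution : IsEntropySolution Λ.T (twoPhase γ₀) Λ.ρ Λ.v := by
  refine ⟨Λ.isWeakSolution, fun η hη φ hφ _ => ?_⟩
  obtain ⟨L, hL⟩ := ((hη.locallyLipschitzOn isOpen_univ).mono
    (subset_univ (Icc (-1) 1))).exists_lipschitzOnWith_of_compact isCompact_Icc
  exact (Λ.entropy_balance hL hφ).ge

theorem gx_zero (x : ℝ) {h : ℝ} (hh : h ∈ Ioo (-2 : ℝ) 2) : Λ.gx 0 x h = deriv γ₀ x := by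
  have := Λ.deriv_x 0 Λ.zero_mem x h hh
  simp only [Λ.init] at this
  exact this.deriv.symm

theorem gxc_zero (x m : ℝ) : Λ.gxc 0 x m = deriv γ₀ x := Λ.gx_zero x (clamp_mem' m)

theorem gc_zero (x m : ℝ) : Λ.gc 0 x m = γ₀ x := Λ.init x _

theorem abs_deriv_init_sub_le (x y : ℝ) : |deriv γ₀ x - deriv γ₀ y| ≤ Λ.M * |x - y| := by
  simpa only [Λ.gxc_zero] using Λ.weight_gxc.lip 0 Λ.zero_mem x y 0

theorem continuous_deriv_init (Λ : LevelFlow γ₀) : Continuous (deriv γ₀) := by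
  exact (LipschitzWith.of_dist_le_mul (K := ⟨Λ.M, by linarith [Λ.one_le_M]⟩) fun x y =>
    (Λ.abs_deriv_init_sub_le x y)).continuous

/-- The regularised integrand of the normal velocity of the initial interface. -/
def slip (γ₀ : ℝ → ℝ) (y : ℝ × ℝ) (z : ℝ) : ℝ :=
  2 * (rker z (y.2 - γ₀ (y.1 - z)) * (deriv γ₀ (y.1 - z) - deriv γ₀ y.1))

theorem abs_slip_le (y : ℝ × ℝ) {z : ℝ} (hz : z ∈ punct) : |slip γ₀ y z| ≤ 6 * Λ.M := by
  obtain ⟨h0, hπ⟩ := punct_abs hz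
  have h1 : |rker z (y.2 - γ₀ (y.1 - z))| ≤ 3 / |z| := by
    refine (abs_rker_le _ _).trans ?_
    have h2 : |z| / 3 ≤ √(den z (y.2 - γ₀ (y.1 - z))) := by
      refine le_sqrt_of_sq_le (le_trans ?_ (den_ge hπ _))
      rw [div_pow, sq_abs]
      nlinarith
    calc 1 / √(den z (y.2 - γ₀ (y.1 - z))) ≤ 1 / (|z| / 3) :=
          one_div_le_one_div_of_le (by positivity) h2
      _ = 3 / |z| := by field_simp
  have h3 : |deriv γ₀ (y.1 - z) - deriv γ₀ y.1| ≤ Λ.M * |z| := by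
    have := Λ.abs_deriv_init_sub_le (y.1 - z) y.1
    rwa [sub_sub_cancel_left, abs_neg] at this
  rw [slip, abs_mul, abs_mul, abs_two]
  have h4 := mul_le_mul h1 h3 (abs_nonneg _) (by positivity)
  have h5 : 3 / |z| * (Λ.M * |z|) = 3 * Λ.M := by field_simp
  linarith

theorem integrableOn_slip (Λ : LevelFlow γ₀) (y : ℝ × ℝ) : IntegrableOn (slip γ₀ y) punct := by
  have c := Λ.continuous_init
  have c' := Λ.continuous_deriv_init
  refine Integrable.mono' (integrable_const (6 * Λ.M)) ?_ ?_
  · have h0 : Continuous fun z => ((z, y.2 - γ₀ (y.1 - z)) : ℝ × ℝ) := by fun_prop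
    have h2 : Continuous fun z => deriv γ₀ (y.1 - z) - deriv γ₀ y.1 := by fun_prop
    have h3 := ((measurable_rker.comp h0.measurable).mul h2.measurable).const_mul 2
    exact h3.aestronglyMeasurable
  · filter_upwards [ae_restrict_mem measurableSet_punct] with z hz using Λ.abs_slip_le y hz

theorem continuous_integral_slip (Λ : LevelFlow γ₀) : Continuous fun y => ∫ z in punct,
    slip γ₀ y z := by
  have c := Λ.continuous_init
  have c' := Λ.continuous_deriv_init
  refine continuous_of_dominated (bound := fun _ => 6 * Λ.M)
    (fun y => (Λ.integrableOn_slip y).1) (fun y => ?_) (integrable_const _) ?_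
  · filter_upwards [ae_restrict_mem measurableSet_punct] with z hz using Λ.abs_slip_le y hz
  · filter_upwards [ae_restrict_mem measurableSet_punct] with z hz
    rw [continuous_iff_continuousAt]
    intro y
    have h1 : ContinuousAt (fun y : ℝ × ℝ => rker z (y.2 - γ₀ (y.1 - z))) y :=
      ContinuousAt.comp
        (f := fun y : ℝ × ℝ => (z, y.2 - γ₀ (y.1 - z)))
        (continuousAt_rker (den_pos_of_punct hz)) (by fun_prop)
    exact (h1.mul (by fun_prop : Continuous fun y =>
      deriv γ₀ (y.1 - z) - deriv γ₀ y.1).continuousAt).const_mul 2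

theorem s₀_eq (x : ℝ) : Λ.s₀ x = ∫ z in punct, slip γ₀ (x, γ₀ x) z := by
  have h1 := Λ.velocity 0 Λ.zero_mem x 0 (by norm_num)
  rw [Λ.f_zero, mul_zero, zero_add, zero_sub, ← integral_neg] at h1
  rw [h1]
  refine setIntegral_congr_fun measurableSet_punct fun z _ => ?_
  have : ∫ m in Icc (-1) 1, rker z (Λ.g 0 x 0 - Λ.g 0 (x - z) m)
      * (Λ.gx 0 x 0 - Λ.gx 0 (x - z) m) = ∫ m in Icc (-1 : ℝ) 1,
      rker z (γ₀ x - γ₀ (x - z)) * (deriv γ₀ x - deriv γ₀ (x - z)) := by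
    refine setIntegral_congr_fun measurableSet_Icc fun m hm => ?_
    simp only [Λ.init, Λ.gx_zero x (h := 0) (by norm_num), Λ.gx_zero (x - z) (mem_Ioo_of_Icc hm)]
  simp only [this, slip]
  norm_num
  ring

theorem normalPart_v {y : ℝ × ℝ} (hy : y.2 ≠ γ₀ y.1) (x : ℝ) :
    normalPart γ₀ x (Λ.v 0 y) = (deriv γ₀ y.1 - deriv γ₀ x) * (Λ.v 0 y).1
      + ∫ z in punct, slip γ₀ y z := by
  have c := Λ.continuous_init
  have c' := Λ.continuous_deriv_init
  have hi : ∀ {w : ℝ → ℝ}, Continuous w → (∀ z, |w z| ≤ Λ.M) →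
      IntegrableOn (fun z => rker z (y.2 - γ₀ (y.1 - z)) * w z) punct := fun hw hb => by
    refine integrableOn_rker_mul (M := Λ.M) (by fun_prop) hw (fun z => ?_)
      (sub_ne_zero.2 hy) hb
    simpa only [Λ.gc_zero, sub_sub_sub_cancel_left, sub_sub_cancel] using Λ.gc_lip Λ.zero_mem y.1
      (y.1 - z) 0
  have hb := fun z => by
    simpa only [Λ.gxc_zero] using Λ.weight_gxc.bound 0 Λ.zero_mem (y.1 - z) 0
  have i1 := hi (by fun_prop) hb
  have e1 : (Λ.v 0 y).1 = 2 * ∫ z in punct, rker z (y.2 - γ₀ (y.1 - z)) * 1 := by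
    simp only [v, pot, sheet, Λ.gc_zero]
    norm_num
  have e2 : (Λ.v 0 y).2 = 2 * ∫ z in punct, rker z (y.2 - γ₀ (y.1 - z)) * deriv γ₀ (y.1 - z) := by
    simp only [v, pot, sheet, Λ.gc_zero, Λ.gxc_zero]
    norm_num
  have e3 : ∫ z in punct, slip γ₀ y z = (Λ.v 0 y).2 - deriv γ₀ y.1 * (Λ.v 0 y).1 := by
    rw [e1, e2, ← integral_const_mul, ← integral_const_mul, ← integral_const_mul,
      ← integral_sub (i1.const_mul 2)
        (((hi (w := fun _ => 1) continuous_const fun _ => by simpa using Λ.one_le_M).const_mul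
        2).const_mul _)]
    congr 1; ext z; rw [slip]; ring
  rw [e3, normalPart]
  ring

/-- The normal component of the initial velocity at the interface. -/
theorem tendsto_normalPart_v (x : ℝ) : Tendsto (fun y => normalPart γ₀ x (Λ.v 0 y))
    (𝓝[{y : ℝ × ℝ | y.2 ≠ γ₀ y.1}] (x, γ₀ x)) (𝓝 (Λ.s₀ x)) := by
  obtain ⟨C, hC0, hC⟩ := Λ.exists_sheet_bound
  have hb : ∀ y : ℝ × ℝ, y.2 ≠ γ₀ y.1 → |(Λ.v 0 y).1| ≤ 2 * C := fun y hy => by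
    have h1 : ∀ m, |Λ.sheet (fun _ _ _ => 1) 0 y m| ≤ C := fun m => by
      refine (hC _ Λ.weight_one 0 Λ.zero_mem y m (by rwa [Λ.gc_zero])).trans ?_
      have : exp (-|y.2|) ≤ 1 := exp_le_one_iff.2 (by simp)
      nlinarith
    have h2 := norm_setIntegral_le_of_norm_le_const (μ := volume) (s := Icc (-1 : ℝ) 1)
      (f := Λ.sheet (fun _ _ _ => 1) 0 y) (by simp) fun m _ => h1 m
    rw [volume_real_Icc] at h2
    norm_num at h2
    rwa [mul_comm]
  have t1 : Tendsto (fun y => (deriv γ₀ y.1 - deriv γ₀ x) * (Λ.v 0 y).1)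
      (𝓝[{y : ℝ × ℝ | y.2 ≠ γ₀ y.1}] (x, γ₀ x)) (𝓝 0) := by
    have c' := Λ.continuous_deriv_init
    have h1 : Tendsto (fun y => deriv γ₀ y.1 - deriv γ₀ x)
        (𝓝[{y : ℝ × ℝ | y.2 ≠ γ₀ y.1}] (x, γ₀ x)) (𝓝 0) := by
      have : Continuous fun y : ℝ × ℝ => deriv γ₀ y.1 - deriv γ₀ x := by fun_prop
      simpa using (this.tendsto (x, γ₀ x)).mono_left nhdsWithin_le_nhds
    simp_rw [mul_comm (deriv γ₀ _ - _)]
    refine bdd_le_mul_tendsto_zero' (2 * C) ?_ h1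
    filter_upwards [self_mem_nhdsWithin] with y hy using hb y hy
  have t :=
    t1.add ((Λ.continuous_integral_slip.tendsto (x, γ₀ x)).mono_left (nhdsWithin_le_nhds (s := {y : ℝ × ℝ | y.2 ≠ γ₀ y.1})))
  rw [zero_add, ← Λ.s₀_eq] at t
  refine t.congr' ?_
  filter_upwards [self_mem_nhdsWithin] with y hy using (Λ.normalPart_v hy x).symm

theorem integral_annulus {F : ℝ → ℝ} {ε : ℝ} (hε : 0 < ε) (hεπ : ε < π)
    (h : IntegrableOn F {y | ε < |y| ∧ |y| < π}) :
    ∫ y in {y | ε < |y| ∧ |y| < π}, F y = (∫ y in ε..π, F y) + ∫ y in -π..-ε, F y := by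
  have e : {y : ℝ | ε < |y| ∧ |y| < π} = Ioo ε π ∪ Ioo (-π) (-ε) := by
    ext y
    grind
  rw [e] at h ⊢
  rw [setIntegral_union ?_ measurableSet_Ioo h.left_of_union h.right_of_union,
    intervalIntegral.integral_of_le hεπ.le, intervalIntegral.integral_of_le (by linarith),
    integral_Ioc_eq_integral_Ioo, integral_Ioc_eq_integral_Ioo]
  exact Set.disjoint_left.2 fun y h1 h2 => by linarith [h1.1, h2.2]

/-- The height of a point of the initial interface relative to a neighbour. -/
def rise (γ₀ : ℝ → ℝ) (x y : ℝ) : ℝ := γ₀ x - γ₀ (x - y)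

theorem hasDerivAt_rise (Λ : LevelFlow γ₀) (x y : ℝ) :
    HasDerivAt (rise γ₀ x) (deriv γ₀ (x - y)) y := by
  exact (((Λ.hasDerivAt_init (x - y)).comp y ((hasDerivAt_id' y).const_sub x)).const_sub
    (γ₀ x)).congr_deriv (by simp)

theorem abs_lker_sub_le (Λ : LevelFlow γ₀) : ∃ C, ∀ x ε, 0 < ε → ε < 1 →
    |lker (-ε) (rise γ₀ x (-ε)) - lker ε (rise γ₀ x ε)| ≤ C * ε := by
  have hM := Λ.one_le_M
  refine ⟨10 * Λ.M ^ 2 * cosh Λ.M ^ 2, fun x ε hε hε1 => ?_⟩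
  set a := rise γ₀ x ε with ha
  set b := rise γ₀ x (-ε) with hb
  have hl : ∀ s, |rise γ₀ x s| ≤ Λ.M * |s| := fun s => by
    simpa only [Λ.gc_zero, sub_sub_cancel, rise] using Λ.gc_lip Λ.zero_mem x (x - s) 0
  have ha1 : |a| ≤ Λ.M * ε := by simpa [abs_of_pos hε] using hl ε
  have hb1 : |b| ≤ Λ.M * ε := by simpa [abs_of_pos hε] using hl (-ε)
  have hs : |(b + a) / 2| ≤ Λ.M * ε ^ 2 := by
    have := Λ.gc_second_diff Λ.zero_mem x 0 ε
    simp only [Λ.gc_zero] at this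
    rw [abs_div, abs_two, show b + a = -(γ₀ (x - ε) + γ₀ (x + ε) - 2 * γ₀ x) by
      rw [ha, hb, rise, rise, sub_neg_eq_add]; ring, abs_neg]
    linarith
  have hq : |(b - a) / 2| ≤ Λ.M * ε := by
    rw [abs_div, abs_two]
    linarith [abs_sub b a]
  have hε2 : ε ^ 2 ≤ 1 := by nlinarith
  have hd : |den (-ε) b - den ε a| ≤ 2 * Λ.M ^ 2 * cosh Λ.M ^ 2 * ε ^ 3 := by
    have e : den (-ε) b - den ε a = 2 * (sinh ((b + a) / 2) * sinh ((b - a) / 2)) := by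
      have h1 := cosh_add ((b + a) / 2) ((b - a) / 2)
      have h2 := cosh_sub ((b + a) / 2) ((b - a) / 2)
      rw [show (b + a) / 2 + (b - a) / 2 = b by ring] at h1
      rw [show (b + a) / 2 - (b - a) / 2 = a by ring] at h2
      rw [den, den, cos_neg, h1, h2]; ring
    have k1 : |sinh ((b + a) / 2)| ≤ Λ.M * ε ^ 2 * cosh Λ.M :=
      (abs_sinh_le_mul_cosh (B := Λ.M) (hs.trans (by nlinarith))).trans (by gcongr)
    have k2 : |sinh ((b - a) / 2)| ≤ Λ.M * ε * cosh Λ.M :=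
      (abs_sinh_le_mul_cosh (B := Λ.M) (hq.trans (by nlinarith))).trans (by gcongr)
    rw [e, abs_mul, abs_mul, abs_two]
    have := mul_le_mul k1 k2 (abs_nonneg _) (by positivity)
    nlinarith
  have hεπ : |ε| ≤ π := by rw [abs_of_pos hε]; linarith [pi_gt_three]
  have pa := (by nlinarith : ε ^ 2 / 5 ≤ (a ^ 2 + ε ^ 2) / 5).trans
    (den_ge hεπ a)
  have pb :=
    (by nlinarith : ε ^ 2 / 5 ≤ (b ^ 2 + (-ε) ^ 2) / 5).trans
    (den_ge (by rwa [abs_neg]) b)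
  have hp : 0 < ε ^ 2 / 5 := by positivity
  have key : ∀ {u w : ℝ}, ε ^ 2 / 5 ≤ u → ε ^ 2 / 5 ≤ w →
      |u - w| ≤ 2 * Λ.M ^ 2 * cosh Λ.M ^ 2 * ε ^ 3 →
      log u - log w ≤ 10 * Λ.M ^ 2 * cosh Λ.M ^ 2 * ε := fun {u w} hu hw huw => by
    have hu0 := hp.trans_le hu
    have hw0 := hp.trans_le hw
    rw [← log_div hu0.ne' hw0.ne']
    refine (log_le_sub_one_of_pos (by positivity)).trans ?_
    rw [div_sub_one hw0.ne', div_le_iff₀ hw0]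
    refine (le_abs_self _).trans (huw.trans ?_)
    have : 10 * Λ.M ^ 2 * cosh Λ.M ^ 2 * ε * (ε ^ 2 / 5) ≤ 10 * Λ.M ^ 2 * cosh Λ.M ^ 2 * ε * w := by
      gcongr
    linarith
  have h2 := key pa pb (by rwa [abs_sub_comm])
  rw [lker, lker, ← sub_div, abs_div, abs_of_pos (by positivity : 0 < 4 * π)]
  refine (div_le_self (abs_nonneg _) (by linarith [pi_gt_three])).trans ?_
  exact abs_le.2 ⟨by linarith, (key pb pa hd)⟩

/-- The normal component of the truncated Biot-Savart integral. -/
theorem normalPart_truncated (Λ : LevelFlow γ₀) (hper : Function.Periodic γ₀ (2 * π)) (x : ℝ)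
    {ε : ℝ}
    (hε : 0 < ε) (hεπ : ε < π) :
    normalPart γ₀ x (truncatedSheetVelocity γ₀ x ε) =
      (∫ y in {y | ε < |y| ∧ |y| < π}, slip γ₀ (x, γ₀ x) y)
        + 2 * deriv γ₀ x * (lker (-ε) (rise γ₀ x (-ε)) - lker ε (rise γ₀ x ε)) := by
  have c := Λ.continuous_init
  have c' := Λ.continuous_deriv_init
  have cr : Continuous (rise γ₀ x) := by unfold rise; fun_prop
  set A : Set ℝ := {y | ε < |y| ∧ |y| < π} with hA
  obtain ⟨K, hK, hm⟩ : ∃ K, IsCompact K ∧ ∀ y, y ∈ K ↔ |y| ≤ π ∧ ε ≤ |y| :=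
    ⟨closedBall 0 π \ ball 0 ε, (isCompact_closedBall _ _).diff isOpen_ball, by simp⟩
  have hAK : A ⊆ K := fun y hy => (hm y).2 ⟨hy.2.le, hy.1.le⟩
  have hpos : ∀ y ∈ K, 0 < den y (rise γ₀ x y) := by
    intro y hy
    rw [hm] at hy
    have : 0 < y ^ 2 := by rw [← sq_abs]; have := hε.trans_le hy.2; positivity
    exact lt_of_lt_of_le (by positivity) (den_ge hy.1 _)
  have ck : ∀ {k : ℝ → ℝ → ℝ},
    (∀ {y a}, 0 < den y a → ContinuousAt (fun p : ℝ × ℝ => k p.1 p.2) (y, a)) →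
      ContinuousOn (fun y => k y (rise γ₀ x y)) K :=
    fun {k} hk y hy => (ContinuousAt.comp
      (f := fun y : ℝ => (y, rise γ₀ x y)) (hk (hpos y hy))
      (by fun_prop : Continuous fun y => (y, rise γ₀ x y)).continuousAt).continuousWithinAt
  have c1 := ck continuousAt_rker
  have c2 := ck continuousAt_sker
  have cd : Continuous fun y => deriv γ₀ (x - y) := by fun_prop
  set G : ℝ → ℝ × ℝ := fun y => (2 * deriv γ₀ (x - y)) •
    (-sker y (rise γ₀ x y), rker y (rise γ₀ x y))
    with hG
  have iG : IntegrableOn G A := by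
    have cG :=
      (cd.const_mul 2).continuousOn.smul (c2.neg.prodMk c1)
    exact (cG.integrableOn_compact hK).mono_set hAK
  have e1 : truncatedSheetVelocity γ₀ x ε = ∫ y in A, G y := by
    rw [← ((Measure.measurePreserving_sub_left (volume : Measure ℝ) x).setIntegral_preimage_emb
      (Homeomorph.subLeft x).measurableEmbedding G A), truncatedSheetVelocity]
    refine integral_congr_ae (ae_of_all _ fun z => ?_)
    simp only [hG, biotSavart, sub_sub_cancel, sker, rker, rise, den, neg_div]
  set ℓ : ℝ × ℝ →L[ℝ] ℝ := -deriv γ₀ x • ContinuousLinearMap.fst ℝ ℝ ℝ + ContinuousLinearMap.snd ℝ ℝ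
    ℝ
    with hℓ
  have e2 : normalPart γ₀ x (truncatedSheetVelocity γ₀ x ε) = ∫ y in A, ℓ (G y) := by
    rw [ℓ.integral_comp_comm iG, ← e1]
    simp [hℓ, normalPart]
  set D : ℝ → ℝ := fun y => rker y (rise γ₀ x y) + sker y (rise γ₀ x y) * deriv γ₀ (x - y) with hD
  have cD :=
    c1.add (c2.mul cd.continuousOn)
  have iD : IntegrableOn D A := (cD.integrableOn_compact hK).mono_set hAK
  have iS : IntegrableOn (slip γ₀ (x, γ₀ x)) A := (Λ.integrableOn_slip _).mono_set fun y hy =>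
    ⟨abs_lt.1 hy.2, fun h => by
      rw [mem_singleton_iff] at h
      have := hy.1
      rw [h, abs_zero] at this
      linarith⟩
  have e3 : ∫ y in A, ℓ (G y) = (∫ y in A, slip γ₀ (x, γ₀ x) y) + 2 * deriv γ₀ x * ∫ y in A,
    D y := by
    rw [← integral_const_mul, ← integral_add iS (iD.const_mul _)]
    congr 1
    ext y
    simp only [hℓ, hG, hD, slip, rise, add_apply, smul_apply,
      ContinuousLinearMap.coe_fst', ContinuousLinearMap.coe_snd', Prod.smul_mk]
    ring
  have hd := fun y hy => by
    simpa using hasDerivAt_lker (hasDerivAt_id' y) (Λ.hasDerivAt_rise x y) (hpos y hy)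
  have ftc : ∀ {u w : ℝ}, uIcc u w ⊆ K →
      ∫ y in u..w, D y = lker w (rise γ₀ x w) - lker u (rise γ₀ x u) := fun hs =>
    intervalIntegral.integral_eq_sub_of_hasDerivAt (fun y hy => hd y (hs hy))
      (cD.mono hs).intervalIntegrable
  have s1 : uIcc ε π ⊆ K := fun y hy => by
    rw [uIcc_of_le hεπ.le] at hy
    rw [hm, abs_of_pos (hε.trans_le hy.1)]
    exact ⟨hy.2, hy.1⟩
  have s2 : uIcc (-π) (-ε) ⊆ K := fun y hy => by
    rw [uIcc_of_le (by linarith)] at hy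
    rw [hm, abs_of_neg (by linarith [hy.2])]
    exact ⟨by linarith [hy.1], by linarith [hy.2]⟩
  have e4 : lker (-π) (rise γ₀ x (-π)) = lker π (rise γ₀ x π) := by
    have : γ₀ (x - -π) = γ₀ (x - π) := by rw [← hper (x - π)]; congr 1; ring
    rw [lker, lker, rise, rise, den, den, this, cos_neg]
  rw [e2, e3, integral_annulus hε hεπ iD, ftc s1, ftc s2, e4]
  ring

theorem tendsto_truncated (Λ : LevelFlow γ₀) (hper : Function.Periodic γ₀ (2 * π)) (x : ℝ) :
    Tendsto (fun ε => normalPart γ₀ x (truncatedSheetVelocity γ₀ x ε)) (𝓝[>] 0) (𝓝 (Λ.s₀ x)) := by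
  have hA : ∀ ε, MeasurableSet {y : ℝ | ε < |y|} := fun ε =>
    measurableSet_lt measurable_const measurable_abs
  have t1 : Tendsto (fun ε => ∫ y in punct, {y : ℝ | ε < |y|}.indicator (slip γ₀ (x, γ₀ x)) y)
      (𝓝[>] 0) (𝓝 (Λ.s₀ x)) := by
    rw [Λ.s₀_eq]
    refine tendsto_integral_filter_of_dominated_convergence (fun _ => 6 * Λ.M)
      (Eventually.of_forall fun ε => (Λ.integrableOn_slip _).1.indicator (hA ε)) ?_
      (integrable_const _) ?_
    · refine Eventually.of_forall fun ε => ?_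
      filter_upwards [ae_restrict_mem measurableSet_punct] with y hy using
        (norm_indicator_le_norm_self _ _).trans (Λ.abs_slip_le _ hy)
    · filter_upwards [ae_restrict_mem measurableSet_punct] with y hy
      refine tendsto_const_nhds.congr' ?_
      filter_upwards [mem_nhdsWithin_of_mem_nhds (Iio_mem_nhds (punct_abs hy).1)] with ε hε using
        (indicator_of_mem (show y ∈ {y : ℝ | ε < |y|} from hε) _).symm
  obtain ⟨C, hC⟩ := Λ.abs_lker_sub_le
  have hev : ∀ᶠ ε : ℝ in 𝓝[>] 0, 0 < ε ∧ ε < 1 := Ioo_mem_nhdsGT one_pos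
  have t2 : Tendsto (fun ε => 2 * deriv γ₀ x * (lker (-ε) (rise γ₀ x (-ε)) - lker ε (rise γ₀ x ε)))
      (𝓝[>] 0) (𝓝 0) := by
    have h1 : Tendsto (fun ε => C * ε) (𝓝[>] 0) (𝓝 0) := by
      have : Continuous fun ε => C * ε := by fun_prop
      simpa using (this.tendsto 0).mono_left (nhdsWithin_le_nhds)
    simpa using
      (squeeze_zero_norm' (f := fun ε => lker (-ε) (rise γ₀ x (-ε)) - lker ε (rise γ₀ x ε)) (hev.mono fun ε hε => hC x ε hε.1 hε.2) h1).const_mul (2 * deriv γ₀ x)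
  have t := t1.add t2
  rw [add_zero] at t
  refine t.congr' ?_
  filter_upwards [hev] with ε hε
  rw [Λ.normalPart_truncated hper x hε.1 (by linarith [pi_gt_three])]
  congr 1
  rw [setIntegral_indicator (hA ε)]
  congr 2
  ext y
  simp only [punct, mem_inter_iff, Set.mem_sdiff, mem_Ioo, mem_ofPred_eq,
    ← abs_lt]
  exact ⟨fun h => ⟨h.2, h.1.1⟩, fun h => ⟨⟨h.2, fun h0 => by
    rw [h0, abs_zero] at h; linarith⟩, h.1⟩⟩

end LevelFlow

end MacroIPM

end

theorem theorem3p2 (γ₀ : ℝ → ℝ) (hper : Function.Periodic γ₀ (2 * π))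
    (han : AnalyticOnNhd ℝ γ₀ univ) :
    ∃ (T C₀ : ℝ) (ρ : ℝ → ℝ × ℝ → ℝ) (v : ℝ → ℝ × ℝ → ℝ × ℝ) (γ : ℝ → ℝ × ℝ → ℝ) (s₀ : ℝ → ℝ),
      0 < T ∧ 0 < C₀ ∧
      IsWeakSolution T (twoPhase γ₀) ρ v ∧
      -- (i) continuity away from the initial interface
      ContinuousOn (fun p : ℝ × ℝ × ℝ => ρ p.1 p.2)
        ((Ico 0 T ×ˢ univ) \ {p | p.1 = 0 ∧ p.2.2 = γ₀ p.2.1}) ∧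
      ContinuousOn (fun p : ℝ × ℝ × ℝ => v p.1 p.2)
        ((Ico 0 T ×ˢ univ) \ {p | p.1 = 0 ∧ p.2.2 = γ₀ p.2.1}) ∧
      -- (ii) Lipschitz and log-Lipschitz bounds
      (∀ t ∈ Ioo 0 T,
        (∃ L : ℝ≥0, LipschitzWith L (ρ t)) ∧
        (∀ᵐ x : ℝ × ℝ, DifferentiableAt ℝ (ρ t) x ∧
          euclLen (dx1 (ρ t) x, dx2 (ρ t) x) ≤ C₀ / t) ∧
        (∀ x x' : ℝ × ℝ, euclLen (x - x') ≤ 1 →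
          euclLen (v t x - v t x') ≤
            C₀ / t * (euclLen (x - x') * (1 + |log (euclLen (x - x'))|)))) ∧
      -- (iii) the level sets
      (∀ t ∈ Ioo 0 T,
        (∀ h ∈ Icc (-1 : ℝ) 1, Function.Periodic (fun x₁ => γ t (x₁, h)) (2 * π) ∧
          AnalyticOnNhd ℝ (fun x₁ => γ t (x₁, h)) univ) ∧
        (∀ x : ℝ × ℝ, γ t (x.1, 1) ≤ x.2 → ρ t x = 1) ∧
        (∀ x : ℝ × ℝ, x.2 ≤ γ t (x.1, -1) → ρ t x = -1) ∧
        (∀ x : ℝ × ℝ, γ t (x.1, -1) < x.2 → x.2 < γ t (x.1, 1) → ρ t x ∈ Ioo (-1 : ℝ) 1) ∧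
        (∀ h ∈ Ioo (-1 : ℝ) 1, {x : ℝ × ℝ | ρ t x = h} = {x : ℝ × ℝ | x.2 = γ t (x.1, h)})) ∧
      MemC1C1 T γ ∧
      (∀ x ∈ slab, γ 0 x = γ₀ x.1) ∧
      Function.Periodic s₀ (2 * π) ∧ AnalyticOnNhd ℝ s₀ univ ∧
      Tendsto (fun t => c1Norm (fun x => t⁻¹ * (γ t x - (γ₀ x.1 + t * (2 * x.2 + s₀ x.1)))))
        (𝓝[>] 0) (𝓝 0) ∧
      -- `s₀` is the normal component of the initial velocity at the interface
      (∀ x₁ : ℝ, Tendsto (fun y => normalPart γ₀ x₁ (v 0 y))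
        (𝓝[{y : ℝ × ℝ | y.2 ≠ γ₀ y.1}] (x₁, γ₀ x₁)) (𝓝 (s₀ x₁))) ∧
      (∀ x₁ : ℝ, Tendsto (fun ε => normalPart γ₀ x₁ (truncatedSheetVelocity γ₀ x₁ ε))
        (𝓝[>] 0) (𝓝 (s₀ x₁))) ∧
      -- (iv) entropy balance with equality; in particular an entropy solution
      (∀ η : ℝ → ℝ, (∃ L : ℝ≥0, LipschitzWith L η) → ∀ φ, IsTest T φ →
        entropyForm T (twoPhase γ₀) ρ v η φ = 0) ∧
      IsEntropySolution T (twoPhase γ₀) ρ v := by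
  obtain ⟨Λ⟩ := nonempty_levelFlow hper han
  have hM := Λ.one_le_M
  refine ⟨Λ.T, 24576 * Λ.M, Λ.ρ, Λ.v, fun t x => Λ.g t x.1 x.2, Λ.s₀, Λ.T_pos, by positivity,
    Λ.isWeakSolution, Λ.continuousOn_ρ, Λ.continuousOn_v, fun t ht => ⟨Λ.lipschitz_ρ ht, ?_,
      fun x x' hle => Λ.v_logLipschitz ht x x' hle⟩, fun t ht => ⟨fun h hh => ?_, Λ.level_sets ht⟩,
    Λ.memC1C1, fun x _ => Λ.init x.1 x.2, fun x => ?_, Λ.analytic_s₀, Λ.tendsto_initial,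
    Λ.tendsto_normalPart_v, Λ.tendsto_truncated hper, fun η hη φ hφ => ?_, Λ.isEntropySolution⟩
  · filter_upwards [Λ.ae_gradient_ρ ht] with x hx
    refine ⟨hx.1, hx.2.trans ?_⟩
    have := ht.1
    gcongr
    norm_num
  · have hh2 := LevelFlow.mem_Ioo_of_Icc hh
    exact ⟨Λ.g_period (Ioo_subset_Ico_self ht) hh2, Λ.analytic t (Ioo_subset_Ico_self ht) h hh2⟩
  · have := Λ.f_periodic Λ.zero_mem x (h := 0) (by norm_num)
    simpa [Λ.f_zero] using this
  · obtain ⟨L, hL⟩ := hη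
    exact Λ.entropy_balance hL.lipschitzOnWith hφ
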